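/- **Setting.** Fix integers $d,J\ge 0$ and put $L^1=L^1(\mathbb R^d;\mathbb C^{2J})$. For every $\mathbf k\in\mathbb R^d$ let $\mathbf L(\mathbf k)$ be a Hermitian $2J\times 2J$ matrix with eigenvalues (counted with multiplicity) $\omega_{J,+}(\mathbf k)\ge\dots\ge\omega_{1,+}(\mathbf k)\ge\omega_{1,-}(\mathbf k)\ge\dots\ge\omega_{J,-}(\mathbf k)$, and write $\omega_n=\omega_{n,+}$. The set $\sigma_{bc}$ of band-crossing points consists of the $\mathbf k$ at which $\omega_{n+1,\zeta}=\omega_{n,\zeta}$ for some $n,\zeta$, or $\omega_{1,\zeta}=0$ for some $\zeta$, or $\mathbf L$ is discontinuous. Assume: $\sigma_{bc}$ is closed, nowhere dense and Lebesgue null; off $\sigma_{bc}$, $\mathbf L$ is $C^\infty$, $\omega_{n,+}\ge0\ge\omega_{n,-}$ and $\omega_{n,-\zeta}(-\mathbf k)=-\omega_{n,\zeta}(\mathbf k)$; and $\|\mathbf L(\mathbf k)\|\le C(1+|\mathbf k|^p)$ for some $C,p>0$. Let $\Pi_{n,\zeta}(\mathbf k)$ be the orthogonal projection onto the eigenspace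 of $\omega_{n,\zeta}(\mathbf k)$. Let $\mathfrak M\subset\{2,3,\dots\}$ be finite and, for $m\in\mathfrak M$, let $\chi^{(m)}(\mathbf k,\mathbf k',\dots,\mathbf k^{(m)})$ be $m$-linear maps $(\mathbb C^{2J})^m\to\mathbb C^{2J}$ that are $C^\infty$ and bounded while all arguments lie off $\sigma_{bc}$. Put $$\hat F(\hat U)(\mathbf k)=\sum_{m\in\mathfrak M}(2\pi)^{-(m-1)d}\int\chi^{(m)}(\mathbf k,\vec{\mathbf k})\,\hat U(\mathbf k')\cdots\hat U(\mathbf k^{(m)})\,d\mathbf k'\cdots d\mathbf k^{(m-1)},\qquad \mathbf k^{(m)}=\mathbf k-\mathbf k'-\dots-\mathbf k^{(m-1)} .$$ For $R>0$, $\tau_*>0$, $\varrho>0$ and $\|\hat{\mathbf h}\|_{L^1}\le R$ let $\mathcal G(\hat{\mathbf h})$ be the solution in the ball $\|\hat{\mathbf u}\|\le 2R$ of $C([0,\tau_*],L^1)$ of $$\hat{\mathbf u}(\tau)=\int_0^\tau e^{\frac{i\tau'}{\varrho}\mathbf L}\hat F\big(e^{-\frac{i\tau'}{\varrho}\mathbf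 L}\hat{\mathbf u}(\tau')\big)d\tau'+\hat{\mathbf h}.$$ **Wavepackets.** Let $\Psi\in C^\infty(\mathbb R^d)$, $\Psi\ge0$, $\Psi(\eta)=1$ for $|\eta|\le\frac12$, $\Psi(\eta)=0$ for $|\eta|\ge1$, and let $0<\epsilon<1$, $s>0$. A family $\hat{\mathbf h}(\beta,\mathbf r)\in L^1$ ($\beta>0$, $\mathbf r\in\mathbb R^d$) is a *wavepacket* with $nk$-pair $(n,\mathbf k_*)$ if there is $\beta_0>0$ such that for $0<\beta<\beta_0$, with constants independent of $\beta$ and $\mathbf r$: $\|\hat{\mathbf h}\|\le C$; $\|\hat{\mathbf h}-\hat{\mathbf h}_+-\hat{\mathbf h}_-\|\le C'\beta^s$; and $\hat{\mathbf h}_\zeta(\mathbf k)=\Psi\big((\beta^{1-\epsilon}/2)^{-1}(\mathbf k-\zeta\mathbf k_*)\big)\Pi_{n,\zeta}(\mathbf k)\hat{\mathbf h}_\zeta(\mathbf k)$ for $\zeta=\pm$ (dependence on $\mathbf r$ is allowed, not required). It is *particle-like with position* $\mathbf r$ if moreover $\int|\nabla_{\mathbf k}(e^{i\mathbf r\cdot\mathbf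 k}\hat{\mathbf h}_\zeta)|\,d\mathbf k\le C_1\beta^{-1-\epsilon}$ (weak gradient), $C_1$ independent of $\beta,\mathbf r$. **Resonances.** Let $S\subset\{1,\dots,J\}\times\mathbb R^d$ be a finite set of $nk$-pairs. A *string* of length $m$ from $S$ is $\vec\lambda=((\zeta^{(j)},(n_j,\mathbf k_{*j})))_{j\le m}$ with $\zeta^{(j)}=\pm1$, $(n_j,\mathbf k_{*j})\in S$; put $\varkappa(\vec\lambda)=\sum_j\zeta^{(j)}\mathbf k_{*j}$. Let $P(S)$ be the set of $(m,\zeta,n,\vec\lambda)$ with $m\in\mathfrak M$, $\zeta=\pm1$, $n\le J$ and $\vec\lambda$ a string of length $m$ from $S$ with $-\zeta\omega_n(\zeta\varkappa(\vec\lambda))+\sum_j\zeta^{(j)}\omega_{n_j}(\mathbf k_{*j})=0$. $S$ is *resonance invariant* if $(n,\zeta\varkappa(\vec\lambda))\in S$ for all $(m,\zeta,n,\vec\lambda)\in P(S)$. A *resonant term into* $\sigma=(n,\mathbf k_*)\in S$ is an element of $P(S)$ with this $n$, with $\zeta\varkappa(\vec\lambda)=\mathbf k_*$, and with $\Pi_{n,\zeta}(\sum_j\mathbf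 k^{(j)})\chi^{(m)}(\sum_j\mathbf k^{(j)},\vec{\mathbf k})[\Pi_{n_1,\zeta^{(1)}}(\mathbf k')\,\cdot,\dots,\Pi_{n_m,\zeta^{(m)}}(\mathbf k^{(m)})\,\cdot\,]$ not identically zero (over $\vec{\mathbf k}$ with all $\mathbf k^{(j)}$ and $\sum_j\mathbf k^{(j)}$ off $\sigma_{bc}$). The group velocity of $\sigma$ is $\nabla\omega_n(\mathbf k_*)$. $\sigma$ is *group velocity matched (GVM)* if each resonant term into $\sigma$ has at least one component $(n_j,\mathbf k_{*j})$ with the same group velocity as $\sigma$. Let $S=S_1\cup\dots\cup S_K$ with pairwise disjoint $S_p$, and let $T\subset S$ (the localized indices) be such that each resonant term into an element of $T$ either has a component in $T$ with the same group velocity as that element, or has all its components in $T$ (for example $T=S$). A string from $S$ is *cross-interacting* if it has components in two different blocks. The decomposition is *partially GVM* if (i) every $S_p$ is resonance invariant and (ii) for every $(m,\zeta,n,\vec\lambda)\in P(S)$ with cross-interacting $\vec\lambda$, $\vec\lambda$ has two components that lie in different blocks and in $T$, are both GVM (with respect to $S$), and have different group velocities. **Theorem (general superposition principle).** For every $R>0$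 there is $\tau_*>0$, depending only on $R$ and the equation (not on $\varrho,\beta,\epsilon$ or the data), such that $\mathcal G(\hat{\mathbf h})$ exists and is unique for all $\varrho>0$, $\|\hat{\mathbf h}\|\le R$, and such that the following holds. Let $\epsilon,s,\Psi,S,S_1,\dots,S_K,T$ be as above, with $S$ resonance invariant, the decomposition partially GVM, $\pm\mathbf k_*\notin\sigma_{bc}$ for $(n,\mathbf k_*)\in S$ and $\varkappa(\vec\lambda)\notin\sigma_{bc}$ for every string $\vec\lambda$ from $S$ of length $m\in\mathfrak M$. For each $\sigma\in S$ let $\hat{\mathbf h}_\sigma(\beta,\mathbf r)$ be a wavepacket with $nk$-pair $\sigma$, which is particle-like if $\sigma\in T$. For every $C_0$ there is $C$ such that for all $0<\beta\le\frac12$, $0<\varrho\le\frac12$ with $\beta^2/\varrho\le C_0$ and all positions $(\mathbf r_\sigma)_{\sigma\in S}$, if $\hat{\mathbf h}_{red,p}=\sum_{\sigma\in S_p}\hat{\mathbf h}_\sigma(\beta,\mathbf r_\sigma)$ satisfy $\|\hat{\mathbf h}_{red,p}\|\le R$ for all $p$ and $\|\sum_p\hat{\mathbf h}_{red,p}\|\le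 R$, then $$\mathcal G\Big(\sum_{p=1}^K\hat{\mathbf h}_{red,p}\Big)=\sum_{p=1}^K\mathcal G(\hat{\mathbf h}_{red,p})+\tilde{\mathbf D},\qquad \sup_{0\le\tau\le\tau_*}\|\tilde{\mathbf D}(\tau)\|_{L^1}\le C\Big(\frac{\varrho}{\beta^{1+\epsilon}}|\ln\beta|+\beta^s\Big),$$ and, if $s\ge1-\epsilon$, then $$\sup_{0\le\tau\le\tau_*}\|\tilde{\mathbf D}(\tau)\|_{L^1}\le C\,\frac{\varrho}{\beta^{1+\epsilon}}|\ln\beta| .$$ -/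

import Mathlib

open MeasureTheory
open scoped ContDiff Topology

noncomputable section

namespace Wavepacket

/-- The space of wavevectors. -/
abbrev X (d : ℕ) := EuclideanSpace ℝ (Fin d)

/-- The fibre `ℂ^{2J}` with its Euclidean norm. -/
abbrev V (J : ℕ) := EuclideanSpace ℂ (Fin (2 * J))

/-- Integrable functions of the wavevector with values in `ℂ^{2J}`. -/
abbrev L1 (d J : ℕ) := Lp (V J) 1 (volume : Measure (X d))

/-- The `nk`-pairs: a band number and a principal wavevector. -/
abbrev NK (d J : ℕ) := Fin J × X d

/-- A sign `±1` as a real number. -/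
def sgn (ζ : ℤˣ) : ℝ := ((ζ : ℤ) : ℝ)

/-- The data of a modal evolution equation: the symbol `L` of the linear part, its eigenvalues
`freq ζ n` (the bands, indexed by a sign and a band number), the finite set `M` of the degrees of
homogeneity of the nonlinearity, and for each degree the susceptibility tensor
`χ m k (k', …, k^(m))`. The standing assumptions on these data are `Admissible` below. -/
structure WaveSystem (d J : ℕ) where
  L : X d → (V J →L[ℂ] V J)
  freq : ℤˣ → Fin J → X d → ℝ
  M : Finset ℕ
  χ : (m : ℕ) → X d → (Fin m → X d) →
    ContinuousMultilinearMap ℂ (fun _ : Fin m => V J) (V J)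

namespace WaveSystem

variable {d J : ℕ} (sys : WaveSystem d J)

/-- The band-crossing points. -/
def bandCrossing : Set (X d) :=
  {k | (∃ (ζ : ℤˣ) (n n' : Fin J), n.val + 1 = n'.val ∧ sys.freq ζ n' k = sys.freq ζ n k) ∨
       ¬ ContinuousAt sys.L k ∨
       (∃ (ζ : ℤˣ) (n : Fin J), n.val = 0 ∧ sys.freq ζ n k = 0)}

/-- The standing assumptions on the linear and on the nonlinear part of the equation. -/
structure Admissible : Prop where
  /-- `L k` is Hermitian. -/
  selfAdjoint : ∀ k, IsSelfAdjoint (sys.L k)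
  /-- The `freq ζ n k` are the eigenvalues of `L k`, with multiplicities. -/
  eigenbasis : ∀ k, ∃ g : OrthonormalBasis (ℤˣ × Fin J) ℂ (V J),
    ∀ ζ n, sys.L k (g (ζ, n)) = ((sys.freq ζ n k : ℝ) : ℂ) • g (ζ, n)
  /-- The natural ordering of the eigenvalues. -/
  monotone_pos : ∀ k, Monotone fun n => sys.freq 1 n k
  antitone_neg : ∀ k, Antitone fun n => sys.freq (-1) n k
  neg_le_pos : ∀ k n n', sys.freq (-1) n k ≤ sys.freq 1 n' k
  pos_nonneg : ∀ k, k ∉ sys.bandCrossing → ∀ n, 0 ≤ sys.freq 1 n k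
  neg_nonpos : ∀ k, k ∉ sys.bandCrossing → ∀ n, sys.freq (-1) n k ≤ 0
  /-- The diagonal symmetry. -/
  symm : ∀ k, k ∉ sys.bandCrossing → ∀ ζ n, sys.freq (-ζ) n (-k) = - sys.freq ζ n k
  isClosed_bandCrossing : IsClosed sys.bandCrossing
  nowhereDense_bandCrossing : IsNowhereDense sys.bandCrossing
  volume_bandCrossing : volume sys.bandCrossing = 0
  smooth_L : ∀ k, k ∉ sys.bandCrossing → ContDiffAt ℝ ∞ sys.L k
  polynomial_bound : ∃ C > (0 : ℝ), ∃ p > (0 : ℝ), ∀ k, ‖sys.L k‖ ≤ C * (1 + ‖k‖ ^ p)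
  two_le : ∀ m ∈ sys.M, 2 ≤ m
  smooth_χ : ∀ m ∈ sys.M, ∀ (k : X d) (kk : Fin m → X d), k ∉ sys.bandCrossing →
    (∀ j, kk j ∉ sys.bandCrossing) →
    ContDiffAt ℝ ∞ (fun q : X d × (Fin m → X d) => sys.χ m q.1 q.2) (k, kk)
  bounded_χ : ∃ C : ℝ, ∀ m ∈ sys.M, ∀ (k : X d) (kk : Fin m → X d), k ∉ sys.bandCrossing →
    (∀ j, kk j ∉ sys.bandCrossing) →
    ((2 * Real.pi) ^ ((m - 1) * d))⁻¹ * ‖sys.χ m k kk‖ ≤ C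

/-- The orthogonal projection of `ℂ^{2J}` onto the eigenspace of `L k` in the band `(n, ζ)`. -/
def bandProj (ζ : ℤˣ) (n : Fin J) (k : X d) : V J →L[ℂ] V J :=
  (Module.End.eigenspace ((sys.L k : V J →L[ℂ] V J) : V J →ₗ[ℂ] V J)
    ((sys.freq ζ n k : ℝ) : ℂ)).starProjection

/-- The unitary matrix `exp(i t L(k))`. -/
def propagator (t : ℝ) (k : X d) : V J →L[ℂ] V J :=
  NormedSpace.exp (((t : ℂ) * Complex.I) • sys.L k)

end WaveSystem

/-- The element of `L¹` given by an integrable function (`0` if the function is not integrable,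
which does not occur below for an admissible system). -/
def toL1 {d J : ℕ} (f : X d → V J) : L1 d J :=
  open Classical in if h : MemLp f 1 volume then h.toLp f else 0

/-- The tuple `(k', …, k^(m))` whose first `m - 1` entries are those of `y` and whose last entry
is `k - k' - … - k^(m-1)`. -/
def convTuple {d : ℕ} (m : ℕ) (k : X d) (y : Fin (m - 1) → X d) : Fin m → X d :=
  fun j => if h : j.val < m - 1 then y ⟨j.val, h⟩ else k - ∑ i, y i

namespace WaveSystem

variable {d J : ℕ} (sys : WaveSystem d J)

/-- The polynomial nonlinearity in Fourier form: a sum of convolution operators. -/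
def nonlinearity (U : X d → V J) (k : X d) : V J :=
  ∑ m ∈ sys.M, (((2 * Real.pi) ^ ((m - 1) * d))⁻¹ : ℝ) •
    ∫ y : Fin (m - 1) → X d,
      sys.χ m k (convTuple m k y) (fun j => U (convTuple m k y j))

/-- The right-hand side `exp(iτL/ϱ) F̂(exp(-iτL/ϱ) u)` of the equation for the slow variable. -/
def slowRHS (ϱ τ : ℝ) (u : L1 d J) : L1 d J :=
  toL1 fun k => sys.propagator (τ / ϱ) k
    (sys.nonlinearity (fun k' => sys.propagator (-(τ / ϱ)) k' (u k')) k)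

/-- `u` is a solution on `[0, τs]` with datum `h` of the modal evolution equation in integral
form, `u(τ) = ∫₀^τ exp(iτ'L/ϱ) F̂(exp(-iτ'L/ϱ) u(τ')) dτ' + h`, in the ball of radius `2R` of
`C([0, τs], L¹)`. -/
def IsSolution (ϱ τs R : ℝ) (h : L1 d J) (u : ℝ → L1 d J) : Prop :=
  ContinuousOn u (Set.Icc 0 τs) ∧ (∀ τ ∈ Set.Icc 0 τs, ‖u τ‖ ≤ 2 * R) ∧
    ∀ τ ∈ Set.Icc 0 τs, u τ = (∫ s in (0 : ℝ)..τ, sys.slowRHS ϱ s (u s)) + h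

/-- The solution operator: the solution with datum `h` (`0` if there is none). -/
def solution (ϱ τs R : ℝ) (h : L1 d J) : ℝ → L1 d J :=
  open Classical in
  if hu : ∃ u, sys.IsSolution ϱ τs R h u then hu.choose else 0

end WaveSystem

/-- A smooth cutoff function. -/
structure IsCutoff {d : ℕ} (Ψ : X d → ℝ) : Prop where
  smooth : ContDiff ℝ ∞ Ψ
  nonneg : ∀ η, 0 ≤ Ψ η
  eq_one : ∀ η, ‖η‖ ≤ 1 / 2 → Ψ η = 1
  eq_zero : ∀ η, 1 ≤ ‖η‖ → Ψ η = 0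

/-- `G` is the weak gradient of `f`, and it is integrable. -/
def HasIntegrableWeakGradient {d J : ℕ} (f : X d → V J) (G : X d → (X d →L[ℝ] V J)) : Prop :=
  Integrable G ∧ ∀ φ : X d → ℝ, ContDiff ℝ ∞ φ → HasCompactSupport φ → ∀ v : X d,
    ∫ k, (fderiv ℝ φ k v) • f k = - ∫ k, φ k • G k v

namespace WaveSystem

variable {d J : ℕ} (sys : WaveSystem d J)

/-- The family `h β r`, `r ∈ ℝ^d`, is a wavepacket with `nk`-pair `σ` and degree of regularity `s`,
with constants that do not depend on `r`, and `hc ζ β r`, `ζ = ±1`, are its two components. (An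
ordinary wavepacket is a family that does not depend on `r`.) -/
def IsWavepacketWith (Ψ : X d → ℝ) (ε s : ℝ) (σ : NK d J) (h : ℝ → X d → L1 d J)
    (hc : ℤˣ → ℝ → X d → L1 d J) : Prop :=
  ∃ β₀ > (0 : ℝ),
    (∃ C : ℝ, ∀ β ∈ Set.Ioo 0 β₀, ∀ r, ‖h β r‖ ≤ C) ∧
    (∀ β ∈ Set.Ioo 0 β₀, ∀ r ζ, ∀ᵐ k ∂(volume : Measure (X d)),
      hc ζ β r k =
        Ψ ((β ^ (1 - ε) / 2)⁻¹ • (k - sgn ζ • σ.2)) • sys.bandProj ζ σ.1 k (hc ζ β r k)) ∧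
    (∃ C' : ℝ, ∀ β ∈ Set.Ioo 0 β₀, ∀ r, ‖h β r - (hc (-1) β r + hc 1 β r)‖ ≤ C' * β ^ s)

/-- Wavepackets, uniformly in the parameter `r`. -/
def IsWavepacket (Ψ : X d → ℝ) (ε s : ℝ) (σ : NK d J) (h : ℝ → X d → L1 d J) : Prop :=
  ∃ hc, sys.IsWavepacketWith Ψ ε s σ h hc

/-- Particle-like wavepackets: `h β r` has the position `r`. -/
def IsParticleLike (Ψ : X d → ℝ) (ε s : ℝ) (σ : NK d J) (h : ℝ → X d → L1 d J) : Prop :=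
  ∃ hc, sys.IsWavepacketWith Ψ ε s σ h hc ∧
    ∃ β₀ > (0 : ℝ), ∃ C₁ : ℝ, ∀ β ∈ Set.Ioo 0 β₀, ∀ r ζ, ∃ G : X d → (X d →L[ℝ] V J),
      HasIntegrableWeakGradient
        (fun k => Complex.exp (Complex.I * ((inner ℝ r k : ℝ) : ℂ)) • hc ζ β r k) G ∧
      ∫ k, ‖G k‖ ≤ C₁ * β ^ (-1 - ε)

/-- The linear combination `∑ ζ_j k_j` of the wavevectors of a string. -/
def kappa {m : ℕ} (lam : Fin m → ℤˣ × NK d J) : X d :=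
  ∑ j, sgn (lam j).1 • (lam j).2.2

/-- The interaction phase function `-ζ ω_n(k) + ∑ ζ_j ω_{n_j}(k_j)`. -/
def phase (ζ : ℤˣ) (n : Fin J) {m : ℕ} (lam : Fin m → ℤˣ × NK d J) (k : X d) : ℝ :=
  -(sgn ζ * sys.freq 1 n k) + ∑ j, sgn (lam j).1 * sys.freq 1 (lam j).2.1 (lam j).2.2

/-- `(m, ζ, n, lam)` is a solution of the resonance equation with a string from the spectrum
`S`. -/
def IsResonant (S : Set (NK d J)) (m : ℕ) (ζ : ℤˣ) (n : Fin J)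
    (lam : Fin m → ℤˣ × NK d J) : Prop :=
  m ∈ sys.M ∧ (∀ j, (lam j).2 ∈ S) ∧ sys.phase ζ n lam (sgn ζ • kappa lam) = 0

/-- The resonant output spectrum. -/
def resonantOutput (S : Set (NK d J)) : Set (NK d J) :=
  {σ | ∃ (m : ℕ) (ζ : ℤˣ) (lam : Fin m → ℤˣ × NK d J),
    sys.IsResonant S m ζ σ.1 lam ∧ σ.2 = sgn ζ • kappa lam}

/-- Resonance invariant spectra. -/
def IsResonanceInvariant (S : Set (NK d J)) : Prop :=
  S ∪ sys.resonantOutput S = S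

/-- The spectrum and its output wavevectors avoid the band-crossing points. -/
def AvoidsBandCrossing (S : Set (NK d J)) : Prop :=
  (∀ σ ∈ S, ∀ ζ : ℤˣ, sgn ζ • σ.2 ∉ sys.bandCrossing) ∧
  ∀ m ∈ sys.M, ∀ lam : Fin m → ℤˣ × NK d J, (∀ j, (lam j).2 ∈ S) → kappa lam ∉ sys.bandCrossing

/-- The group velocity at an `nk`-pair. -/
def groupVelocity (σ : NK d J) : X d := gradient (sys.freq 1 σ.1) σ.2

/-- The monomial of the nonlinearity that takes inputs in the bands `(n_j, ζ_j)` of the string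
`lam` and has its output in the band `(n, ζ)` is not identically zero. -/
def IsNonzeroTerm (ζ : ℤˣ) (n : Fin J) {m : ℕ} (lam : Fin m → ℤˣ × NK d J) : Prop :=
  ∃ kk : Fin m → X d, (∀ j, kk j ∉ sys.bandCrossing) ∧ ∑ j, kk j ∉ sys.bandCrossing ∧
    ∃ x : Fin m → V J,
      sys.bandProj ζ n (∑ j, kk j) (sys.χ m (∑ j, kk j) kk
        (fun j => sys.bandProj (lam j).1 (lam j).2.1 (kk j) (x j))) ≠ 0

/-- The string `lam` gives a nonzero resonant term, with output sign `ζ`, of the component `σ` of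
the time-averaged nonlinearity. -/
def IsResonantTermInto (S : Set (NK d J)) (σ : NK d J) (m : ℕ) (ζ : ℤˣ)
    (lam : Fin m → ℤˣ × NK d J) : Prop :=
  sys.IsResonant S m ζ σ.1 lam ∧ sgn ζ • kappa lam = σ.2 ∧ sys.IsNonzeroTerm ζ σ.1 lam

/-- `σ` is group velocity matched (GVM) with respect to the time-averaged nonlinearity. -/
def IsGVM (S : Set (NK d J)) (σ : NK d J) : Prop :=
  ∀ (m : ℕ) (ζ : ℤˣ) (lam : Fin m → ℤˣ × NK d J), sys.IsResonantTermInto S σ m ζ lam →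
    ∃ j, sys.groupVelocity σ = sys.groupVelocity (lam j).2

/-- The set `T` of localized indices is closed: each nonzero resonant term into an index of `T` has
a component in `T` with the same group velocity, unless all its components are in `T`. -/
def IsLocalizationClosed (S T : Set (NK d J)) : Prop :=
  ∀ σ ∈ T, ∀ (m : ℕ) (ζ : ℤˣ) (lam : Fin m → ℤˣ × NK d J), sys.IsResonantTermInto S σ m ζ lam →
    (∃ j, (lam j).2 ∈ T ∧ sys.groupVelocity σ = sys.groupVelocity (lam j).2) ∨
      ∀ j, (lam j).2 ∈ T

/-- The whole spectrum of a decomposition into blocks. -/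
def total {K : ℕ} (S : Fin K → Finset (NK d J)) : Set (NK d J) := {σ | ∃ p, σ ∈ S p}

/-- Cross-interacting (CI) strings. -/
def IsCrossInteracting {K m : ℕ} (S : Fin K → Finset (NK d J))
    (lam : Fin m → ℤˣ × NK d J) : Prop :=
  ∃ (i j : Fin m) (p q : Fin K), p ≠ q ∧ (lam i).2 ∈ S p ∧ (lam j).2 ∈ S q

/-- The decomposition into the blocks `S p` is partially GVM, with the pairs of group velocity
matched indices taken from the set `T` of localized indices. -/
def IsPartiallyGVM {K : ℕ} (S : Fin K → Finset (NK d J)) (T : Set (NK d J)) : Prop :=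
  (∀ p, sys.IsResonanceInvariant (S p : Set (NK d J))) ∧
  ∀ (m : ℕ) (ζ : ℤˣ) (n : Fin J) (lam : Fin m → ℤˣ × NK d J),
    sys.IsResonant (total S) m ζ n lam → IsCrossInteracting S lam →
    ∃ (i j : Fin m) (p q : Fin K), p ≠ q ∧ (lam i).2 ∈ S p ∧ (lam j).2 ∈ S q ∧
      (lam i).2 ∈ T ∧ (lam j).2 ∈ T ∧
      sys.IsGVM (total S) (lam i).2 ∧ sys.IsGVM (total S) (lam j).2 ∧
      sys.groupVelocity (lam i).2 ≠ sys.groupVelocity (lam j).2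

end WaveSystem

/-- The part of a multi-wavepacket with `nk`-pairs in the finite set `B`, for the position vector
`r`. -/
def blockData {d J : ℕ} (h : NK d J → ℝ → X d → L1 d J) (B : Finset (NK d J)) (β : ℝ)
    (r : NK d J → X d) : L1 d J :=
  ∑ σ ∈ B, h σ β (r σ)

end Wavepacket

end

noncomputable section

namespace Wavepacket

variable {d J m : ℕ}

/-! ### Push-forward of integrable functions under addition -/

lemma toL1_coe {f : X d → V J} (hf : Integrable f) : toL1 f =ᵐ[volume] f := by
  have h : MemLp f 1 volume := memLp_one_iff_integrable.2 hf
  rw [toL1, dif_pos h]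
  exact h.coeFn_toLp

lemma toL1_congr {f g : X d → V J} (h : f =ᵐ[volume] g) : toL1 f = toL1 g := by
  unfold toL1
  by_cases hf : MemLp f 1 volume
  · have hg := (memLp_congr_ae h).1 hf
    rw [dif_pos hf, dif_pos hg]
    exact MemLp.toLp_congr hf hg h
  · have hg : ¬ MemLp g 1 volume := fun hg => hf ((memLp_congr_ae h).2 hg)
    rw [dif_neg hf, dif_neg hg]

lemma norm_toL1 {f : X d → V J} (hf : Integrable f) : ‖toL1 f‖ = ∫ k, ‖f k‖ := by
  rw [L1.norm_eq_integral_norm]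
  exact integral_congr_ae ((toL1_coe hf).fun_comp norm)

lemma integrable_coe (f : L1 d J) : Integrable (f : X d → V J) := L1.integrable_coeFn f

lemma sum_convTuple (hm : 0 < m) (k : X d) (y : Fin (m - 1) → X d) :
    ∑ j, convTuple m k y j = k := by
  obtain ⟨n, rfl⟩ : ∃ n, m = n + 1 := ⟨m - 1, by omega⟩
  rw [Fin.sum_univ_castSucc]
  simp [convTuple]

lemma convTuple_add (hm : 0 < m) (k : X d) (y : Fin (m - 1) → X d) (v : Fin m → X d) :
    convTuple m (k + ∑ j, v j) (y + fun i : Fin (m - 1) => v ⟨i.val, by omega⟩) = convTuple m k y + v := by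
  obtain ⟨n, rfl⟩ : ∃ n, m = n + 1 := ⟨m - 1, by omega⟩
  funext j
  refine Fin.lastCases ?_ (fun j => ?_) j
  · simp only [convTuple, Fin.val_last, add_tsub_cancel_right, lt_irrefl, dite_false, Pi.add_apply]
    rw [Fin.sum_univ_castSucc, Finset.sum_add_distrib]
    have : ∑ x : Fin (n + 1 - 1), v ⟨x, by omega⟩ = ∑ x : Fin n, v x.castSucc := rfl
    rw [this]
    abel
  · simp [convTuple]
    rfl

lemma measurePreserving_convTuple (hm : 0 < m) :
    MeasurePreserving (fun q : X d × (Fin (m - 1) → X d) => convTuple m q.1 q.2)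
      (volume.prod volume) volume := by
  obtain ⟨n, rfl⟩ : ∃ n, m = n + 1 := ⟨m - 1, by omega⟩
  have h1 : MeasurePreserving (fun q : (Fin n → X d) × X d => (q.1, q.2 - ∑ i, q.1 i))
      (volume.prod volume) (volume.prod volume) := by
    refine MeasurePreserving.skew_product (f := id)
      (g := fun (y : Fin n → X d) (k : X d) => k - ∑ i, y i) (MeasurePreserving.id _) ?_ ?_
    · fun_prop
    · exact Filter.Eventually.of_forall fun y => (measurePreserving_sub_right volume _).map_eq
  have h2 : MeasurePreserving (fun q : X d × (Fin n → X d) => (q.1 - ∑ i, q.2 i, q.2))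
      (volume.prod volume) (volume.prod volume) :=
    (Measure.measurePreserving_swap.comp h1).comp Measure.measurePreserving_swap
  have h3 := (volume_preserving_piFinSuccAbove (fun _ : Fin (n + 1) => X d) (Fin.last n)).symm
  have h4 := h3.comp h2
  suffices h : (fun q : X d × (Fin n → X d) => convTuple (n + 1) q.1 q.2) =
      (MeasurableEquiv.piFinSuccAbove (fun _ : Fin (n + 1) => X d) (Fin.last n)).symm ∘
        fun q => (q.1 - ∑ i, q.2 i, q.2) from h ▸ h4
  funext q
  funext j
  refine Fin.lastCases ?_ (fun j => ?_) j
  · simp [convTuple, MeasurableEquiv.piFinSuccAbove_symm_apply, Fin.insertNthEquiv]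
  · have := Fin.insertNth_apply_succAbove (α := fun _ : Fin (n+1) => X d) (Fin.last n)
      (q.1 - ∑ i, q.2 i) q.2 j
    rw [Fin.succAbove_last] at this
    simp [convTuple, MeasurableEquiv.piFinSuccAbove_symm_apply, Fin.insertNthEquiv]

/-- Integration over the fibres of the sum map. -/
def pushFun (G : (Fin m → X d) → V J) (k : X d) : V J := ∫ y, G (convTuple m k y)

lemma integrable_comp_convTuple {E : Type*} [NormedAddCommGroup E]
    (hm : 0 < m) {G : (Fin m → X d) → E} (hG : Integrable G) :
    Integrable (fun q : X d × (Fin (m - 1) → X d) => G (convTuple m q.1 q.2))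
      (volume.prod volume) :=
  ((measurePreserving_convTuple hm).integrable_comp hG.aestronglyMeasurable).2 hG

lemma integrable_pushFun (hm : 0 < m) {G : (Fin m → X d) → V J} (hG : Integrable G) :
    Integrable (pushFun G) :=
  (integrable_comp_convTuple hm hG).integral_prod_left

lemma ae_convTuple (hm : 0 < m) {p : (Fin m → X d) → Prop} (h : ∀ᵐ kk, p kk) :
    ∀ᵐ k : X d, ∀ᵐ y, p (convTuple m k y) :=
  Measure.ae_ae_of_ae_prod ((measurePreserving_convTuple hm).quasiMeasurePreserving.ae h)

lemma pushFun_congr (hm : 0 < m) {G G' : (Fin m → X d) → V J} (h : G =ᵐ[volume] G') :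
    pushFun G =ᵐ[volume] pushFun G' := by
  filter_upwards [ae_convTuple hm h] with k hk
  exact integral_congr_ae hk

lemma integral_norm_pushFun_le (hm : 0 < m) {G : (Fin m → X d) → V J} (hG : Integrable G) :
    ∫ k, ‖pushFun G k‖ ≤ ∫ kk, ‖G kk‖ := by
  have h1 := integrable_comp_convTuple hm hG.norm
  have h2 : ∫ kk, ‖G kk‖ = ∫ k, ∫ y, ‖G (convTuple m k y)‖ := by
    rw [← (measurePreserving_convTuple hm).map_eq, integral_map
      (measurePreserving_convTuple hm).measurable.aemeasurable, integral_prod _ h1]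
    rw [(measurePreserving_convTuple hm).map_eq]
    exact hG.norm.aestronglyMeasurable
  rw [h2]
  refine integral_mono (integrable_pushFun hm hG).norm h1.integral_prod_left fun k => ?_
  exact norm_integral_le_integral_norm _

/-- The push-forward as an element of `L¹`. -/
def push (G : (Fin m → X d) → V J) : L1 d J := toL1 (pushFun G)

lemma push_congr (hm : 0 < m) {G G' : (Fin m → X d) → V J} (h : G =ᵐ[volume] G') :
    push G = push G' := toL1_congr (pushFun_congr hm h)

lemma push_coe (hm : 0 < m) {G : (Fin m → X d) → V J} (hG : Integrable G) :
    push G =ᵐ[volume] pushFun G := toL1_coe (integrable_pushFun hm hG)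

lemma norm_push_le (hm : 0 < m) {G : (Fin m → X d) → V J} (hG : Integrable G) :
    ‖push G‖ ≤ ∫ kk, ‖G kk‖ := by
  rw [push, norm_toL1 (integrable_pushFun hm hG)]
  exact integral_norm_pushFun_le hm hG

lemma push_add (hm : 0 < m) {G G' : (Fin m → X d) → V J} (hG : Integrable G)
    (hG' : Integrable G') : push (fun kk => G kk + G' kk) = push G + push G' := by
  apply Lp.ext
  have h1 : ∀ᵐ k : X d, pushFun (fun kk => G kk + G' kk) k = pushFun G k + pushFun G' k := by
    filter_upwards [(integrable_comp_convTuple hm hG).prod_right_ae,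
      (integrable_comp_convTuple hm hG').prod_right_ae] with k h1 h2
    exact integral_add h1 h2
  filter_upwards [push_coe hm (hG.add hG'), push_coe hm hG, push_coe hm hG',
    Lp.coeFn_add (push G) (push G'), h1] with k h2 h3 h4 h5 h6
  rw [h5, Pi.add_apply, h3, h4, ← h6]
  exact h2

lemma push_smul (hm : 0 < m) {G : (Fin m → X d) → V J} (hG : Integrable G) (c : ℂ) :
    push (fun kk => c • G kk) = c • push G := by
  apply Lp.ext
  filter_upwards [push_coe hm (hG.smul c), push_coe hm hG, Lp.coeFn_smul c (push G)]
    with k h2 h3 h5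
  rw [h5, Pi.smul_apply, h3]
  exact h2.trans (integral_smul c _)

/-! ### Multipliers and translations -/

/-- Bounded strongly measurable functions. -/
def IsBddMeas {α E : Type*} [MeasureSpace α] [NormedAddCommGroup E] (K : α → E) : Prop :=
  AEStronglyMeasurable K volume ∧ ∃ C : ℝ, ∀ᵐ k, ‖K k‖ ≤ C

lemma integrable_mul {a : X d → (V J →L[ℂ] V J)} (ha : IsBddMeas a) (f : L1 d J) :
    Integrable fun k => a k (f k) := by
  obtain ⟨h1, C, h2⟩ := ha
  refine Integrable.mono' ((integrable_coe f).norm.const_mul C) ?_ ?_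
  · exact (ContinuousLinearMap.flip (ContinuousLinearMap.apply ℂ (V J))).continuous₂.comp_aestronglyMeasurable₂ h1
      (integrable_coe f).aestronglyMeasurable
  · filter_upwards [h2] with k hk
    exact (a k).le_of_opNorm_le hk _


lemma toL1_add {f g : X d → V J} (hf : Integrable f) (hg : Integrable g) :
    toL1 (fun k => f k + g k) = toL1 f + toL1 g := by
  apply Lp.ext
  filter_upwards [toL1_coe hf, toL1_coe hg, toL1_coe (hf.add hg),
    Lp.coeFn_add (toL1 f) (toL1 g)] with k h1 h2 h3 h4
  rw [h4, Pi.add_apply, h1, h2]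
  exact h3

lemma toL1_smul {f : X d → V J} (hf : Integrable f) (c : ℂ) :
    toL1 (fun k => c • f k) = c • toL1 f := by
  apply Lp.ext
  filter_upwards [toL1_coe hf, toL1_coe (hf.smul c), Lp.coeFn_smul c (toL1 f)] with k h1 h3 h4
  rw [h4, Pi.smul_apply, h1]
  exact h3

lemma norm_toL1_apply_le {a : X d → (V J →L[ℂ] V J)} (ha : IsBddMeas a) {C : ℝ}
    (hC : ∀ᵐ k, ‖a k‖ ≤ C) (f : L1 d J) : ‖toL1 fun k => a k (f k)‖ ≤ C * ‖f‖ := by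
  rw [norm_toL1 (integrable_mul ha f), L1.norm_eq_integral_norm, ← integral_const_mul]
  refine integral_mono_ae (integrable_mul ha f).norm ((integrable_coe f).norm.const_mul C) ?_
  filter_upwards [hC] with k hk
  exact (a k).le_of_opNorm_le hk _

/-- Multiplication by a bounded measurable function. -/
def mul (a : X d → (V J →L[ℂ] V J)) : L1 d J →L[ℂ] L1 d J :=
  open Classical in
  if h : IsBddMeas a then
    LinearMap.mkContinuous
      { toFun := fun f => toL1 fun k => a k (f k)
        map_add' := fun f g => by
          rw [← toL1_add (integrable_mul h f) (integrable_mul h g)]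
          refine toL1_congr ?_
          filter_upwards [Lp.coeFn_add f g] with k hk
          rw [hk, Pi.add_apply, map_add]
        map_smul' := fun c f => by
          rw [RingHom.id_apply, ← toL1_smul (integrable_mul h f)]
          refine toL1_congr ?_
          filter_upwards [Lp.coeFn_smul c f] with k hk
          rw [hk, Pi.smul_apply, map_smul] }
      h.2.choose fun f => norm_toL1_apply_le h h.2.choose_spec f
  else 0

lemma mul_apply {a : X d → (V J →L[ℂ] V J)} (ha : IsBddMeas a) (f : L1 d J) :
    mul a f = toL1 fun k => a k (f k) := by
  rw [mul, dif_pos ha]; rfl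

lemma mul_coe {a : X d → (V J →L[ℂ] V J)} (ha : IsBddMeas a) (f : L1 d J) :
    mul a f =ᵐ[volume] fun k => a k (f k) := by
  rw [mul_apply ha]
  exact toL1_coe (integrable_mul ha f)

lemma norm_mul_le {a : X d → (V J →L[ℂ] V J)} (ha : IsBddMeas a) {C : ℝ}
    (hC : ∀ᵐ k, ‖a k‖ ≤ C) (f : L1 d J) : ‖mul a f‖ ≤ C * ‖f‖ := by
  rw [mul_apply ha]
  exact norm_toL1_apply_le ha hC f

lemma norm_mul_eq {a : X d → (V J →L[ℂ] V J)} (ha : IsBddMeas a) (f : L1 d J) :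
    ‖mul a f‖ = ∫ k, ‖a k (f k)‖ := by
  rw [mul_apply ha, norm_toL1 (integrable_mul ha f)]

/-- Translation of an integrable function. -/
def translate (h : X d) : L1 d J →ₗᵢ[ℂ] L1 d J :=
  Lp.compMeasurePreservingₗᵢ ℂ (fun k => k + h) (measurePreserving_add_right volume h)

lemma translate_coe (h : X d) (f : L1 d J) :
    translate h f =ᵐ[volume] fun k => f (k + h) :=
  Lp.coeFn_compMeasurePreserving f (measurePreserving_add_right volume h)

/-! ### Multilinear convolution operators -/

/-- The values of multilinear kernels. -/
abbrev Mult (J m : ℕ) := ContinuousMultilinearMap ℂ (fun _ : Fin m => V J) (V J)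

lemma ae_coord {p : X d → Prop} (h : ∀ᵐ k, p k) (j : Fin m) :
    ∀ᵐ kk : Fin m → X d, p (kk j) :=
  (Measure.quasiMeasurePreserving_eval (fun _ : Fin m => (volume : Measure (X d))) j).ae h

lemma ae_forall_coord {p : Fin m → X d → Prop} (h : ∀ j, ∀ᵐ k, p j k) :
    ∀ᵐ kk : Fin m → X d, ∀ j, p j (kk j) :=
  ae_all_iff.2 fun j => ae_coord (h j) j

lemma quasiMeasurePreserving_sum (hm : 0 < m) :
    Measure.QuasiMeasurePreserving (fun kk : Fin m → X d => ∑ j, kk j) volume volume := by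
  have hS : Measurable (fun kk : Fin m → X d => ∑ j, kk j) := by fun_prop
  refine ⟨hS, ?_⟩
  rw [← (measurePreserving_convTuple hm).map_eq,
    Measure.map_map hS (measurePreserving_convTuple hm).measurable]
  have : ((fun kk : Fin m → X d => ∑ j, kk j) ∘
      fun q : X d × (Fin (m - 1) → X d) => convTuple m q.1 q.2) = Prod.fst := by
    funext q
    exact sum_convTuple hm q.1 q.2
  rw [this]
  exact Measure.quasiMeasurePreserving_fst.absolutelyContinuous

lemma ae_sum (hm : 0 < m) {p : X d → Prop} (h : ∀ᵐ k, p k) :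
    ∀ᵐ kk : Fin m → X d, p (∑ j, kk j) := (quasiMeasurePreserving_sum hm).ae h

/-- The integrand of a multilinear convolution. -/
def tens (K : (Fin m → X d) → Mult J m) (f : Fin m → L1 d J) (kk : Fin m → X d) : V J :=
  K kk fun j => f j (kk j)

lemma integrable_prod_norm (f : Fin m → L1 d J) :
    Integrable fun kk : Fin m → X d => ∏ j, ‖f j (kk j)‖ :=
  Integrable.fintype_prod (f := fun j (k : X d) => ‖f j k‖) fun j => (integrable_coe (f j)).norm

lemma integral_prod_norm (f : Fin m → L1 d J) :
    ∫ kk : Fin m → X d, ∏ j, ‖f j (kk j)‖ = ∏ j, ‖f j‖ := by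
  rw [integral_fintype_prod_volume_eq_prod (fun j (k : X d) => ‖f j k‖)]
  simp_rw [L1.norm_eq_integral_norm]

lemma aestronglyMeasurable_tens {K : (Fin m → X d) → Mult J m} (hK : AEStronglyMeasurable K volume)
    (f : Fin m → L1 d J) : AEStronglyMeasurable (tens K f) volume := by
  have h2 : AEStronglyMeasurable (fun (kk : Fin m → X d) (j : Fin m) => f j (kk j)) volume := by
    refine Measurable.aestronglyMeasurable (measurable_pi_lambda _ fun j => ?_)
    exact (Lp.stronglyMeasurable (f j)).measurable.comp (measurable_pi_apply j)
  exact (continuous_eval (F := Mult J m)).comp_aestronglyMeasurable (hK.prodMk h2)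

lemma norm_tens_le {K : (Fin m → X d) → Mult J m} {C : ℝ} {kk : Fin m → X d} (h : ‖K kk‖ ≤ C)
    (f : Fin m → L1 d J) : ‖tens K f kk‖ ≤ C * ∏ j, ‖f j (kk j)‖ :=
  (K kk).le_of_opNorm_le h _

lemma integrable_tens {K : (Fin m → X d) → Mult J m} (hK : IsBddMeas K)
    (f : Fin m → L1 d J) : Integrable (tens K f) := by
  obtain ⟨h1, C, h2⟩ := hK
  refine Integrable.mono' ((integrable_prod_norm f).const_mul C) (aestronglyMeasurable_tens h1 f) ?_
  filter_upwards [h2] with kk hk using norm_tens_le hk f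

lemma norm_push_tens_le (hm : 0 < m) {K : (Fin m → X d) → Mult J m} (hK : IsBddMeas K) {C : ℝ}
    (hC : ∀ᵐ kk, ‖K kk‖ ≤ C) (f : Fin m → L1 d J) : ‖push (tens K f)‖ ≤ C * ∏ j, ‖f j‖ := by
  refine (norm_push_le hm (integrable_tens hK f)).trans ?_
  rw [← integral_prod_norm, ← integral_const_mul]
  refine integral_mono_ae (integrable_tens hK f).norm ((integrable_prod_norm f).const_mul C) ?_
  filter_upwards [hC] with kk hk using norm_tens_le hk f

/-- The multilinear convolution operator with the kernel `K`. -/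
def op (K : (Fin m → X d) → Mult J m) : ContinuousMultilinearMap ℂ (fun _ : Fin m => L1 d J)
    (L1 d J) :=
  open Classical in
  if h : IsBddMeas K ∧ 0 < m then
    MultilinearMap.mkContinuous
      { toFun := fun f => push (tens K f)
        map_update_add' := fun f j x y => by
          rw [← push_add h.2 (integrable_tens h.1 _) (integrable_tens h.1 _)]
          refine push_congr h.2 ?_
          filter_upwards [ae_coord (Lp.coeFn_add x y) j] with kk hk
          simp only [tens]
          have hu : ∀ z : L1 d J, (fun i => (Function.update f j z i : X d → V J) (kk i)) =
              Function.update (fun i => f i (kk i)) j (z (kk j)) := by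
            intro z
            funext i
            by_cases hi : i = j
            · subst hi; simp
            · simp [hi]
          rw [hu, hu, hu, hk, Pi.add_apply, (K kk).map_update_add]
        map_update_smul' := fun f j c x => by
          rw [← push_smul h.2 (integrable_tens h.1 _)]
          refine push_congr h.2 ?_
          filter_upwards [ae_coord (Lp.coeFn_smul c x) j] with kk hk
          simp only [tens]
          have hu : ∀ z : L1 d J, (fun i => (Function.update f j z i : X d → V J) (kk i)) =
              Function.update (fun i => f i (kk i)) j (z (kk j)) := by
            intro z
            funext i
            by_cases hi : i = j
            · subst hi; simp
            · simp [hi]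
          rw [hu, hu, hk, Pi.smul_apply, (K kk).map_update_smul] }
      h.1.2.choose fun f => norm_push_tens_le h.2 h.1 h.1.2.choose_spec f
  else 0

lemma op_apply (hm : 0 < m) {K : (Fin m → X d) → Mult J m} (hK : IsBddMeas K)
    (f : Fin m → L1 d J) : op K f = push (tens K f) := by
  rw [op, dif_pos ⟨hK, hm⟩]; rfl

lemma norm_op_le (hm : 0 < m) {K : (Fin m → X d) → Mult J m} (hK : IsBddMeas K) {C : ℝ}
    (hC : ∀ᵐ kk, ‖K kk‖ ≤ C) (f : Fin m → L1 d J) : ‖op K f‖ ≤ C * ∏ j, ‖f j‖ := by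
  rw [op_apply hm hK]
  exact norm_push_tens_le hm hK hC f

lemma opNorm_op_le (hm : 0 < m) {K : (Fin m → X d) → Mult J m} (hK : IsBddMeas K) {C : ℝ}
    (hC0 : 0 ≤ C) (hC : ∀ᵐ kk, ‖K kk‖ ≤ C) : ‖op K‖ ≤ C :=
  ContinuousMultilinearMap.opNorm_le_bound hC0 (norm_op_le hm hK hC)

lemma op_congr (hm : 0 < m) {K K' : (Fin m → X d) → Mult J m} (hK : IsBddMeas K)
    (hK' : IsBddMeas K') {f f' : Fin m → L1 d J}
    (h : ∀ᵐ kk, K kk (fun j => f j (kk j)) = K' kk (fun j => f' j (kk j))) :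
    op K f = op K' f' := by
  rw [op_apply hm hK, op_apply hm hK']
  exact push_congr hm h

lemma IsBddMeas.add {α E : Type*} [MeasureSpace α] [NormedAddCommGroup E] {K K' : α → E}
    (hK : IsBddMeas K) (hK' : IsBddMeas K') : IsBddMeas fun k => K k + K' k := by
  obtain ⟨h1, C, h2⟩ := hK
  obtain ⟨h1', C', h2'⟩ := hK'
  refine ⟨h1.add h1', C + C', ?_⟩
  filter_upwards [h2, h2'] with k h h' using norm_add_le_of_le h h'

lemma IsBddMeas.sub {α E : Type*} [MeasureSpace α] [NormedAddCommGroup E] {K K' : α → E}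
    (hK : IsBddMeas K) (hK' : IsBddMeas K') : IsBddMeas fun k => K k - K' k := by
  obtain ⟨h1, C, h2⟩ := hK
  obtain ⟨h1', C', h2'⟩ := hK'
  refine ⟨h1.sub h1', C + C', ?_⟩
  filter_upwards [h2, h2'] with k h h' using norm_sub_le_of_le h h'

lemma IsBddMeas.sum {α E ι : Type*} [MeasureSpace α] [NormedAddCommGroup E] {K : ι → α → E}
    (s : Finset ι) (hK : ∀ i ∈ s, IsBddMeas (K i)) : IsBddMeas fun k => ∑ i ∈ s, K i k := by
  classical
  induction s using Finset.induction_on with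
  | empty => simpa using ⟨aestronglyMeasurable_const, 0, by simp⟩
  | insert a s ha ih =>
    simp only [Finset.sum_insert ha]
    exact (hK a (by simp)).add (ih fun i hi => hK i (by simp [hi]))

lemma IsBddMeas.of_continuous {α E : Type*} [TopologicalSpace α] [MeasureSpace α]
    [OpensMeasurableSpace α] [SecondCountableTopology α] [TopologicalSpace.PseudoMetrizableSpace α]
    [NormedAddCommGroup E] {K : α → E}
    (hK : Continuous K) {C : ℝ} (hC : ∀ k, ‖K k‖ ≤ C) : IsBddMeas K :=
  ⟨hK.aestronglyMeasurable, C, Filter.Eventually.of_forall hC⟩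

lemma op_add (hm : 0 < m) {K K' : (Fin m → X d) → Mult J m} (hK : IsBddMeas K)
    (hK' : IsBddMeas K') (f : Fin m → L1 d J) :
    op (fun kk => K kk + K' kk) f = op K f + op K' f := by
  rw [op_apply hm hK, op_apply hm hK', op_apply hm (hK.add hK'),
    ← push_add hm (integrable_tens hK f) (integrable_tens hK' f)]
  rfl

lemma op_sub (hm : 0 < m) {K K' : (Fin m → X d) → Mult J m} (hK : IsBddMeas K)
    (hK' : IsBddMeas K') (f : Fin m → L1 d J) :
    op (fun kk => K kk - K' kk) f = op K f - op K' f := by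
  have := op_add hm (hK.sub hK') hK' f
  simp only [sub_add_cancel] at this
  rw [this, add_sub_cancel_right]

lemma op_sum (hm : 0 < m) {ι : Type*} (s : Finset ι) {K : ι → (Fin m → X d) → Mult J m}
    (hK : ∀ i ∈ s, IsBddMeas (K i)) (f : Fin m → L1 d J) :
    op (fun kk => ∑ i ∈ s, K i kk) f = ∑ i ∈ s, op (K i) f := by
  classical
  induction s using Finset.induction_on with
  | empty =>
    simp only [Finset.sum_empty]
    have h := norm_op_le (d := d) (J := J) hm (K := fun _ => 0)
      ⟨aestronglyMeasurable_const, 0, by simp⟩ (C := 0) (by simp) f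
    rw [zero_mul] at h
    exact norm_le_zero_iff.1 h
  | insert a s ha ih =>
    simp only [Finset.sum_insert ha]
    rw [op_add hm (hK a (by simp)) (IsBddMeas.sum s fun i hi => hK i (by simp [hi])),
      ih fun i hi => hK i (by simp [hi])]

attribute [irreducible] op mul translate

end Wavepacket

namespace Wavepacket

variable {d J m : ℕ}

lemma prod_le_pow_card_of_nonneg {ι : Type*} (s : Finset ι) {f : ι → ℝ} {B : ℝ}
    (h0 : ∀ i, 0 ≤ f i) (hB : ∀ i, f i ≤ B) : ∏ i ∈ s, f i ≤ B ^ s.card := by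
  rw [← Finset.prod_const]
  exact Finset.prod_le_prod (fun i _ => h0 i) fun i _ => hB i

/-- The truncated distance to a centre. -/
def dist1 (c k : X d) : ℝ := min ‖k - c‖ 1

lemma dist1_nonneg (c k : X d) : 0 ≤ dist1 c k := le_min (norm_nonneg _) zero_le_one

lemma dist1_le_one (c k : X d) : dist1 c k ≤ 1 := min_le_right _ _

lemma dist1_le (c k : X d) : dist1 c k ≤ ‖k - c‖ := min_le_left _ _

lemma continuous_dist1 (c : X d) : Continuous (dist1 c) := by unfold dist1; fun_prop

lemma dist1_sum_le (c kk : Fin m → X d) :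
    dist1 (∑ j, c j) (∑ j, kk j) ≤ ∑ j, dist1 (c j) (kk j) := by
  by_cases h : ∃ j, 1 ≤ ‖kk j - c j‖
  · obtain ⟨j, hj⟩ := h
    refine (dist1_le_one _ _).trans ?_
    have : dist1 (c j) (kk j) = 1 := min_eq_right hj
    rw [← this]
    exact Finset.single_le_sum (f := fun j => dist1 (c j) (kk j))
      (fun i _ => dist1_nonneg _ _) (Finset.mem_univ j)
  · push Not at h
    refine (dist1_le _ _).trans ?_
    rw [← Finset.sum_sub_distrib]
    refine (norm_sum_le _ _).trans (Finset.sum_le_sum fun j _ => ?_)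
    exact (min_eq_left (h j).le).ge

/-- The first moment about `c`, truncated at distance one. -/
def wnorm (c : X d) (f : L1 d J) : ℝ := ∫ k, dist1 c k * ‖f k‖

lemma integrable_dist1_mul (c : X d) (f : L1 d J) : Integrable fun k => dist1 c k * ‖f k‖ := by
  refine (integrable_coe f).norm.bdd_mul (c := 1) (continuous_dist1 c).aestronglyMeasurable ?_
  refine Filter.Eventually.of_forall fun k => ?_
  rw [Real.norm_of_nonneg (dist1_nonneg _ _)]
  exact dist1_le_one _ _

lemma wnorm_nonneg (c : X d) (f : L1 d J) : 0 ≤ wnorm c f :=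
  integral_nonneg fun _ => mul_nonneg (dist1_nonneg _ _) (norm_nonneg _)

lemma wnorm_le_norm (c : X d) (f : L1 d J) : wnorm c f ≤ ‖f‖ := by
  rw [L1.norm_eq_integral_norm]
  refine integral_mono (integrable_dist1_mul c f) (integrable_coe f).norm fun k => ?_
  exact mul_le_of_le_one_left (norm_nonneg _) (dist1_le_one _ _)

/-- Multiplication by a scalar function, as an operator-valued function. -/
def scal (g : X d → ℂ) (k : X d) : V J →L[ℂ] V J := g k • ContinuousLinearMap.id ℂ (V J)

@[simp] lemma scal_apply (g : X d → ℂ) (k : X d) (x : V J) : scal g k x = g k • x := rfl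

lemma norm_scal_le (g : X d → ℂ) (k : X d) : ‖(scal g k : V J →L[ℂ] V J)‖ ≤ ‖g k‖ := by
  unfold scal
  rw [norm_smul]
  exact mul_le_of_le_one_right (norm_nonneg _) ContinuousLinearMap.norm_id_le

lemma isBddMeas_scal {g : X d → ℂ} (hg : Continuous g) {C : ℝ} (hC : ∀ k, ‖g k‖ ≤ C) :
    IsBddMeas (scal g : X d → (V J →L[ℂ] V J)) :=
  .of_continuous (by unfold scal; fun_prop) fun k => (norm_scal_le g k).trans (hC k)

/-- The truncated distance as a multiplier. -/
def wmul (c : X d) : X d → (V J →L[ℂ] V J) := scal fun k => (dist1 c k : ℂ)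

lemma isBddMeas_wmul (c : X d) : IsBddMeas (wmul c : X d → (V J →L[ℂ] V J)) := by
  refine isBddMeas_scal (C := 1) ?_ fun k => ?_
  · have := continuous_dist1 c
    fun_prop
  · rw [Complex.norm_real, Real.norm_of_nonneg (dist1_nonneg _ _)]
    exact dist1_le_one _ _

lemma norm_wmul_le (c k : X d) : ‖(wmul c k : V J →L[ℂ] V J)‖ ≤ dist1 c k := by
  refine (norm_scal_le _ _).trans ?_
  rw [Complex.norm_real, Real.norm_of_nonneg (dist1_nonneg _ _)]

lemma wnorm_eq (c : X d) (f : L1 d J) : wnorm c f = ‖mul (wmul c) f‖ := by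
  rw [norm_mul_eq (isBddMeas_wmul c), wnorm]
  refine integral_congr_ae (Filter.Eventually.of_forall fun k => ?_)
  simp only [wmul, scal_apply, norm_smul, Complex.norm_real]
  rw [Real.norm_of_nonneg (dist1_nonneg _ _)]

lemma wnorm_add_le (c : X d) (f g : L1 d J) : wnorm c (f + g) ≤ wnorm c f + wnorm c g := by
  simp only [wnorm_eq, map_add]
  exact norm_add_le _ _

lemma continuous_wnorm (c : X d) : Continuous (wnorm c : L1 d J → ℝ) := by
  have : (wnorm c : L1 d J → ℝ) = fun f => ‖mul (wmul c) f‖ := funext fun f => wnorm_eq c f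
  rw [this]
  fun_prop

lemma integral_dist1_mul_prod_le (c : X d) (j : Fin m) (f : Fin m → L1 d J) {B : ℝ}
    (hB : ∀ l, ‖f l‖ ≤ B) :
    Integrable (fun kk : Fin m → X d => dist1 c (kk j) * ∏ l, ‖f l (kk l)‖) ∧
    ∫ kk : Fin m → X d, dist1 c (kk j) * ∏ l, ‖f l (kk l)‖ ≤ wnorm c (f j) * B ^ (m - 1) := by
  classical
  set g : Fin m → X d → ℝ := fun l k => (if l = j then dist1 c k else 1) * ‖f l k‖ with hg
  have h1 : (fun kk : Fin m → X d => dist1 c (kk j) * ∏ l, ‖f l (kk l)‖) =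
      fun kk => ∏ l, g l (kk l) := by
    funext kk
    simp only [hg, Finset.prod_mul_distrib]
    rw [Finset.prod_ite_eq' Finset.univ j (fun l => dist1 c (kk l))]
    simp
  have h2 : ∀ l, Integrable (g l) := by
    intro l
    by_cases h : l = j
    · simpa [hg, h] using integrable_dist1_mul c (f j)
    · simpa [hg, h] using (integrable_coe (f l)).norm
  refine ⟨by rw [h1]; exact Integrable.fintype_prod h2, ?_⟩
  have h4 : ∀ l, l ≠ j → ∫ k, g l k = ‖f l‖ := by
    intro l h
    simp [hg, h, L1.norm_eq_integral_norm]
  have h5 : ∫ k, g j k = wnorm c (f j) := by simp [hg, wnorm]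
  have h3 : ∫ kk : Fin m → X d, ∏ l, g l (kk l) = ∏ l, ∫ k, g l k :=
    integral_fintype_prod_volume_eq_prod (𝕜 := ℝ) g
  rw [h1, h3, ← Finset.mul_prod_erase Finset.univ _ (Finset.mem_univ j), h5]
  refine mul_le_mul_of_nonneg_left ?_ (wnorm_nonneg _ _)
  rw [Finset.prod_congr rfl fun l hl => h4 l (Finset.ne_of_mem_erase hl)]
  refine (prod_le_pow_card_of_nonneg _ (fun l => norm_nonneg (f l)) hB).trans ?_
  rw [Finset.card_erase_of_mem (Finset.mem_univ j), Finset.card_univ, Fintype.card_fin]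

lemma norm_op_le_weight (hm : 0 < m) {K : (Fin m → X d) → Mult J m} (hK : IsBddMeas K) {A C : ℝ}
    (hA0 : 0 ≤ A) (hC0 : 0 ≤ C) (c : Fin m → X d)
    (hC : ∀ᵐ kk : Fin m → X d, ‖K kk‖ ≤ A + C * ∑ j, dist1 (c j) (kk j))
    (f : Fin m → L1 d J) {B : ℝ} (hB : ∀ l, ‖f l‖ ≤ B) :
    ‖op K f‖ ≤ A * B ^ m + C * (∑ j, wnorm (c j) (f j)) * B ^ (m - 1) := by
  rw [op_apply hm hK]
  refine (norm_push_le hm (integrable_tens hK f)).trans ?_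
  have hi := fun j => integral_dist1_mul_prod_le (c j) j f hB
  have hs : Integrable fun kk : Fin m → X d => ∑ j, dist1 (c j) (kk j) * ∏ l, ‖f l (kk l)‖ :=
    integrable_finsetSum _ fun j _ => (hi j).1
  calc ∫ kk, ‖tens K f kk‖
      ≤ ∫ kk : Fin m → X d, (A * ∏ l, ‖f l (kk l)‖ +
          C * ∑ j, dist1 (c j) (kk j) * ∏ l, ‖f l (kk l)‖) := by
        refine integral_mono_ae (integrable_tens hK f).norm
          (((integrable_prod_norm f).const_mul A).add (hs.const_mul C)) ?_
        filter_upwards [hC] with kk hk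
        refine (norm_tens_le hk f).trans (le_of_eq ?_)
        rw [← Finset.sum_mul]
        ring
    _ = A * ∏ l, ‖f l‖ +
          C * ∑ j, ∫ kk : Fin m → X d, dist1 (c j) (kk j) * ∏ l, ‖f l (kk l)‖ := by
        rw [integral_add ((integrable_prod_norm f).const_mul A) (hs.const_mul C),
          integral_const_mul, integral_const_mul, integral_prod_norm,
          integral_finsetSum _ fun j _ => (hi j).1]
    _ ≤ _ := by
        refine add_le_add (mul_le_mul_of_nonneg_left ?_ hA0) ?_
        · refine (prod_le_pow_card_of_nonneg _ (fun l => norm_nonneg (f l)) hB).trans ?_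
          simp
        · rw [mul_assoc, Finset.sum_mul]
          exact mul_le_mul_of_nonneg_left (Finset.sum_le_sum fun j _ => (hi j).2) hC0

/-! ### Algebra of kernels -/

/-- Multiplication of the output of a kernel. -/
def outMul (a : X d → (V J →L[ℂ] V J)) (K : (Fin m → X d) → Mult J m) (kk : Fin m → X d) :
    Mult J m := (a (∑ j, kk j)).compContinuousMultilinearMap (K kk)

lemma norm_outMul_le (a : X d → (V J →L[ℂ] V J)) (K : (Fin m → X d) → Mult J m)
    (kk : Fin m → X d) : ‖outMul a K kk‖ ≤ ‖a (∑ j, kk j)‖ * ‖K kk‖ :=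
  (a _).norm_compContinuousMultilinearMap_le _

lemma isBddMeas_outMul (hm : 0 < m) {a : X d → (V J →L[ℂ] V J)} (ha : IsBddMeas a)
    {K : (Fin m → X d) → Mult J m} (hK : IsBddMeas K) : IsBddMeas (outMul a K) := by
  obtain ⟨h1, C, h2⟩ := ha
  obtain ⟨h1', C', h2'⟩ := hK
  refine ⟨?_, C * C', ?_⟩
  · exact (ContinuousLinearMap.compContinuousMultilinearMapL ℂ (fun _ : Fin m => V J) (V J)
      (V J)).continuous₂.comp_aestronglyMeasurable₂
      (h1.comp_quasiMeasurePreserving (quasiMeasurePreserving_sum hm)) h1'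
  · filter_upwards [ae_sum hm h2, h2'] with kk h h'
    exact (norm_outMul_le a K kk).trans
      (mul_le_mul h h' (norm_nonneg _) ((norm_nonneg _).trans h))

lemma mul_op (hm : 0 < m) {a : X d → (V J →L[ℂ] V J)} (ha : IsBddMeas a)
    {K : (Fin m → X d) → Mult J m} (hK : IsBddMeas K) (f : Fin m → L1 d J) :
    mul a (op K f) = op (outMul a K) f := by
  rw [mul_apply ha, op_apply hm hK, op_apply hm (isBddMeas_outMul hm ha hK)]
  refine toL1_congr ?_
  filter_upwards [push_coe hm (integrable_tens hK f),
    (integrable_comp_convTuple hm (integrable_tens hK f)).prod_right_ae] with k h1 h2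
  rw [h1, pushFun, pushFun, ← ContinuousLinearMap.integral_comp_comm _ h2]
  refine integral_congr_ae (Filter.Eventually.of_forall fun y => ?_)
  simp only [tens, outMul, sum_convTuple hm]
  rfl

lemma wnorm_op_le (hm : 0 < m) {K : (Fin m → X d) → Mult J m} (hK : IsBddMeas K) {C : ℝ}
    (hC0 : 0 ≤ C) (c : Fin m → X d) (hC : ∀ᵐ kk : Fin m → X d, ‖K kk‖ ≤ C)
    (f : Fin m → L1 d J) {B : ℝ} (hB : ∀ l, ‖f l‖ ≤ B) :
    wnorm (∑ j, c j) (op K f) ≤ C * (∑ j, wnorm (c j) (f j)) * B ^ (m - 1) := by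
  rw [wnorm_eq, mul_op hm (isBddMeas_wmul _) hK]
  refine (norm_op_le_weight hm (isBddMeas_outMul hm (isBddMeas_wmul _) hK) le_rfl hC0 c ?_ f
    hB).trans (le_of_eq (by ring))
  filter_upwards [hC] with kk hk
  refine (norm_outMul_le _ _ _).trans (le_trans (mul_le_mul (b := ∑ j, dist1 (c j) (kk j)) ?_ hk
    (norm_nonneg _) ?_) (by rw [zero_add, mul_comm]))
  · exact (norm_wmul_le _ _).trans (dist1_sum_le _ _)
  · exact Finset.sum_nonneg fun j _ => dist1_nonneg _ _

lemma IsBddMeas.shift {E : Type*} [NormedAddCommGroup E] {K : (Fin m → X d) → E}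
    (hK : IsBddMeas K) (v : Fin m → X d) : IsBddMeas fun kk => K (kk + v) := by
  obtain ⟨h1, C, h2⟩ := hK
  have hq := (measurePreserving_add_right (volume : Measure (Fin m → X d)) v).quasiMeasurePreserving
  exact ⟨h1.comp_quasiMeasurePreserving hq, C, hq.ae h2⟩

lemma translate_op (hm : 0 < m) {K : (Fin m → X d) → Mult J m} (hK : IsBddMeas K)
    (v : Fin m → X d) (f : Fin m → L1 d J) :
    translate (∑ j, v j) (op K f) =
      op (fun kk => K (kk + v)) fun j => translate (v j) (f j) := by
  rw [op_apply hm hK, op_apply hm (hK.shift v)]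
  have h0 : tens (fun kk => K (kk + v)) (fun j => translate (v j) (f j)) =ᵐ[volume]
      fun kk => tens K f (kk + v) := by
    filter_upwards [ae_forall_coord fun j => translate_coe (v j) (f j)] with kk hk
    simp only [tens, Pi.add_apply]
    congr 1
    funext j
    exact hk j
  rw [push_congr hm h0]
  have hi : Integrable fun kk => tens K f (kk + v) := (integrable_tens hK f).comp_add_right v
  apply Lp.ext
  have hq := (measurePreserving_add_right (volume : Measure (X d))
    (∑ j, v j)).quasiMeasurePreserving
  filter_upwards [translate_coe (∑ j, v j) (push (tens K f)),
    hq.ae (push_coe hm (integrable_tens hK f)), push_coe hm hi] with k h1 h2 h3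
  rw [h1, h2, h3, pushFun, pushFun]
  simp only [← convTuple_add hm]
  exact (integral_add_right_eq_self (μ := (volume : Measure (Fin (m - 1) → X d)))
    (fun y => tens K f (convTuple m (k + ∑ j, v j) y)) _).symm

/-! ### Dependence on a parameter -/

lemma continuous_op_apply (hm : 0 < m) {K : ℝ → (Fin m → X d) → Mult J m}
    (hK : ∀ t, IsBddMeas (K t)) {C : ℝ} (hC : ∀ t, ∀ᵐ kk, ‖K t kk‖ ≤ C)
    (hcont : ∀ᵐ kk, Continuous fun t => K t kk) (f : Fin m → L1 d J) :
    Continuous fun t => op (K t) f := by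
  rw [continuous_iff_continuousAt]
  intro t₀
  rw [ContinuousAt, tendsto_iff_norm_sub_tendsto_zero]
  have h1 : ∀ t, ‖op (K t) f - op (K t₀) f‖ ≤
      ∫ kk, ‖tens (fun kk => K t kk - K t₀ kk) f kk‖ := by
    intro t
    rw [← op_sub hm (hK t) (hK t₀), op_apply hm ((hK t).sub (hK t₀))]
    exact norm_push_le hm (integrable_tens ((hK t).sub (hK t₀)) f)
  refine squeeze_zero (fun t => norm_nonneg _) h1 ?_
  have h0 : (0 : ℝ) = ∫ _ : Fin m → X d, (0 : ℝ) := by simp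
  rw [h0]
  have hm1 : ∀ᶠ t in 𝓝 t₀, AEStronglyMeasurable
      (fun kk => ‖tens (fun kk => K t kk - K t₀ kk) f kk‖) volume :=
    Filter.Eventually.of_forall fun t =>
      (integrable_tens ((hK t).sub (hK t₀)) f).norm.aestronglyMeasurable
  have hm2 : ∀ᶠ t in 𝓝 t₀, ∀ᵐ kk : Fin m → X d,
      ‖‖tens (fun kk => K t kk - K t₀ kk) f kk‖‖ ≤ (C + C) * ∏ j, ‖f j (kk j)‖ := by
    refine Filter.Eventually.of_forall fun t => ?_
    filter_upwards [hC t, hC t₀] with kk h h'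
    rw [norm_norm]
    exact norm_tens_le (K := fun kk => K t kk - K t₀ kk) (norm_sub_le_of_le h h') f
  refine tendsto_integral_filter_of_dominated_convergence _ hm1 hm2
    ((integrable_prod_norm f).const_mul (C + C)) ?_
  · filter_upwards [hcont] with kk hk
    have h2 : Continuous fun t => ‖(K t kk - K t₀ kk) fun j => f j (kk j)‖ := by
      have h3 : Continuous fun t => K t kk - K t₀ kk := hk.sub continuous_const
      exact ((continuous_eval_const (F := Mult J m) fun j => f j (kk j)).comp h3).norm
    have h4 := h2.tendsto t₀
    simpa [tens] using h4

lemma norm_op_sub_op_le (hm : 0 < m) {K : (Fin m → X d) → Mult J m} (hK : IsBddMeas K) {C : ℝ}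
    (hC0 : 0 ≤ C) (hC : ∀ᵐ kk, ‖K kk‖ ≤ C) (f g : Fin m → L1 d J) {B : ℝ} (hB0 : 0 ≤ B)
    (hf : ∀ j, ‖f j‖ ≤ B) (hg : ∀ j, ‖g j‖ ≤ B) :
    ‖op K f - op K g‖ ≤ C * m * B ^ (m - 1) * ‖f - g‖ := by
  refine ((op K).norm_image_sub_le f g).trans ?_
  rw [Fintype.card_fin]
  have hfg : max ‖f‖ ‖g‖ ≤ B :=
    max_le ((pi_norm_le_iff_of_nonneg hB0).2 hf) ((pi_norm_le_iff_of_nonneg hB0).2 hg)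
  gcongr
  exact opNorm_op_le hm hK hC0 hC

lemma continuous_op (hm : 0 < m) {K : ℝ → (Fin m → X d) → Mult J m}
    (hK : ∀ t, IsBddMeas (K t)) {C : ℝ} (hC : ∀ t, ∀ᵐ kk, ‖K t kk‖ ≤ C)
    (hcont : ∀ᵐ kk, Continuous fun t => K t kk) :
    Continuous fun q : ℝ × (Fin m → L1 d J) => op (K q.1) q.2 := by
  have hC0 : ∀ t, ‖op (K t)‖ ≤ |C| := fun t => opNorm_op_le hm (hK t) (abs_nonneg C) (by
    filter_upwards [hC t] with kk h using h.trans (le_abs_self C))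
  rw [continuous_iff_continuousAt]
  rintro ⟨t₀, f₀⟩
  have h1 : Filter.Tendsto (fun q : ℝ × (Fin m → L1 d J) => op (K q.1) q.2 - op (K q.1) f₀)
      (𝓝 (t₀, f₀)) (𝓝 0) := by
    refine squeeze_zero_norm (a := fun q => |C| * m * max ‖q.2‖ ‖f₀‖ ^ (m - 1) * ‖q.2 - f₀‖)
      (fun q => ?_) ?_
    · refine ((op (K q.1)).norm_image_sub_le q.2 f₀).trans ?_
      rw [Fintype.card_fin]
      gcongr
      exact hC0 _
    · have h : Continuous fun q : ℝ × (Fin m → L1 d J) =>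
        |C| * m * max ‖q.2‖ ‖f₀‖ ^ (m - 1) * ‖q.2 - f₀‖ := by fun_prop
      simpa using h.tendsto (t₀, f₀)
  have h2 : Filter.Tendsto (fun q : ℝ × (Fin m → L1 d J) => op (K q.1) f₀) (𝓝 (t₀, f₀))
      (𝓝 (op (K t₀) f₀)) :=
    ((continuous_op_apply hm hK hC hcont f₀).comp continuous_fst).tendsto (t₀, f₀)
  have h3 := h1.add h2
  simpa [ContinuousAt] using h3

end Wavepacket

namespace Wavepacket

namespace WaveSystem

variable {d J : ℕ} {sys : WaveSystem d J}

/-- The position of a band in the ordering of the eigenvalues. -/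
def bandKey (i : ℤˣ × Fin J) : ℤ := (i.1 : ℤ) * ((i.2 : ℤ) + 1)

lemma bandKey_injective : Function.Injective (bandKey : ℤˣ × Fin J → ℤ) := by
  rintro ⟨ζ, n⟩ ⟨ζ', n'⟩ h
  simp only [bandKey] at h
  rcases Int.units_eq_one_or ζ with rfl | rfl <;> rcases Int.units_eq_one_or ζ' with rfl | rfl
  · simp only [Units.val_one, one_mul] at h
    have : n = n' := Fin.ext (by omega)
    rw [this]
  · simp at h; omega
  · simp at h; omega
  · simp only [Units.val_neg, Units.val_one, neg_mul, one_mul] at h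
    have : n = n' := Fin.ext (by omega)
    rw [this]

lemma Admissible.freq_mono (hsys : sys.Admissible) (k : X d) {i j : ℤˣ × Fin J}
    (h : bandKey i ≤ bandKey j) : sys.freq i.1 i.2 k ≤ sys.freq j.1 j.2 k := by
  obtain ⟨ζ, n⟩ := i
  obtain ⟨ζ', n'⟩ := j
  simp only [bandKey] at h
  rcases Int.units_eq_one_or ζ with rfl | rfl <;> rcases Int.units_eq_one_or ζ' with rfl | rfl
  · simp only [Units.val_one, one_mul] at h
    exact hsys.monotone_pos k (Fin.le_def.2 (by dsimp only at h ⊢; omega))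
  · simp at h; omega
  · exact hsys.neg_le_pos k n n'
  · simp only [Units.val_neg, Units.val_one, neg_mul, one_mul] at h
    exact hsys.antitone_neg k (Fin.le_def.2 (by dsimp only at h ⊢; omega))

lemma card_key (i : ℤˣ × Fin J) :
    Fintype.card {j : ℤˣ × Fin J // bandKey i ≤ bandKey j} +
      Fintype.card {j : ℤˣ × Fin J // bandKey j ≤ bandKey i} =
      Fintype.card (ℤˣ × Fin J) + 1 := by
  rw [Fintype.card_subtype, Fintype.card_subtype, ← Finset.card_union_add_card_inter]
  congr 1
  · rw [← Finset.card_univ]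
    congr 1
    ext j
    simp [le_total]
  · rw [Finset.card_eq_one]
    refine ⟨i, ?_⟩
    ext j
    simp only [Finset.mem_inter, Finset.mem_filter, Finset.mem_univ, true_and,
      Finset.mem_singleton]
    exact ⟨fun h => bandKey_injective (le_antisymm h.2 h.1), fun h => by simp [h]⟩

lemma inner_apply_eq_sum {ι : Type*} [Fintype ι] (g : OrthonormalBasis ι ℂ (V J))
    (A : V J →L[ℂ] V J) (a : ι → ℝ) (hA : ∀ i, A (g i) = ((a i : ℝ) : ℂ) • g i) (x : V J) :
    (inner ℂ x (A x)).re = ∑ i, a i * ‖inner ℂ (g i) x‖ ^ 2 := by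
  have h1 : A x = ∑ i, (inner ℂ (g i) x * a i) • g i := by
    conv_lhs => rw [← g.sum_repr' x]
    rw [map_sum]
    refine Finset.sum_congr rfl fun i _ => ?_
    rw [map_smul, hA, smul_smul]
  rw [h1, inner_sum, Complex.re_sum]
  refine Finset.sum_congr rfl fun i _ => ?_
  rw [inner_smul_right, ← inner_conj_symm x (g i), mul_right_comm, Complex.mul_conj,
    Complex.normSq_eq_norm_sq, ← Complex.ofReal_mul, Complex.ofReal_re]
  ring

lemma norm_sq_eq_sum {ι : Type*} [Fintype ι] (g : OrthonormalBasis ι ℂ (V J)) (x : V J) :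
    ‖x‖ ^ 2 = ∑ i, ‖inner ℂ (g i) x‖ ^ 2 := (g.sum_sq_norm_inner_right x).symm

lemma inner_eq_zero_of_mem_span {ι : Type*} [Fintype ι] (g : OrthonormalBasis ι ℂ (V J))
    (p : ι → Prop) {x : V J} (hx : x ∈ Submodule.span ℂ (Set.range fun j : {j // p j} => g j.1))
    {i : ι} (hi : ¬ p i) : inner ℂ (g i) x = 0 := by
  induction hx using Submodule.span_induction with
  | mem x hx =>
    obtain ⟨j, rfl⟩ := hx
    exact g.orthonormal.2 fun h => hi (h ▸ j.2)
  | zero => simp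
  | add x y _ _ hx hy => rw [inner_add_right, hx, hy, add_zero]
  | smul c x _ hx => rw [inner_smul_right, hx, mul_zero]

lemma Admissible.freq_sub_le (hsys : sys.Admissible) (k k' : X d) (ζ : ℤˣ) (n : Fin J) :
    sys.freq ζ n k - sys.freq ζ n k' ≤ ‖sys.L k - sys.L k'‖ := by
  classical
  obtain ⟨g, hg⟩ := hsys.eigenbasis k
  obtain ⟨g', hg'⟩ := hsys.eigenbasis k'
  set i : ℤˣ × Fin J := (ζ, n)
  set U := Submodule.span ℂ (Set.range fun j : {j // bandKey i ≤ bandKey j} => g j.1)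
  set W := Submodule.span ℂ (Set.range fun j : {j // bandKey j ≤ bandKey i} => g' j.1)
  have hU : Module.finrank ℂ U = Fintype.card {j // bandKey i ≤ bandKey j} :=
    finrank_span_eq_card (g.orthonormal.linearIndependent.comp _ Subtype.val_injective)
  have hW : Module.finrank ℂ W = Fintype.card {j // bandKey j ≤ bandKey i} :=
    finrank_span_eq_card (g'.orthonormal.linearIndependent.comp _ Subtype.val_injective)
  have hV : Module.finrank ℂ (V J) = Fintype.card (ℤˣ × Fin J) :=
    Module.finrank_eq_card_basis g.toBasis
  have hnd : ¬ Disjoint U W := by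
    intro h
    have := Submodule.finrank_add_finrank_le_of_disjoint h
    have hc := card_key i
    omega
  rw [Submodule.disjoint_def] at hnd
  push Not at hnd
  obtain ⟨x, hxU, hxW, hx⟩ := hnd
  have hx0 : 0 < ‖x‖ ^ 2 := by positivity
  have h1 : sys.freq ζ n k * ‖x‖ ^ 2 ≤ (inner ℂ x (sys.L k x)).re := by
    rw [inner_apply_eq_sum g _ (fun j => sys.freq j.1 j.2 k) (fun j => hg j.1 j.2),
      norm_sq_eq_sum g, Finset.mul_sum]
    refine Finset.sum_le_sum fun j _ => ?_
    by_cases hj : bandKey i ≤ bandKey j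
    · exact mul_le_mul_of_nonneg_right (hsys.freq_mono k hj) (by positivity)
    · rw [inner_eq_zero_of_mem_span g _ hxU hj]; simp
  have h2 : (inner ℂ x (sys.L k' x)).re ≤ sys.freq ζ n k' * ‖x‖ ^ 2 := by
    rw [inner_apply_eq_sum g' _ (fun j => sys.freq j.1 j.2 k') (fun j => hg' j.1 j.2),
      norm_sq_eq_sum g', Finset.mul_sum]
    refine Finset.sum_le_sum fun j _ => ?_
    by_cases hj : bandKey j ≤ bandKey i
    · exact mul_le_mul_of_nonneg_right (hsys.freq_mono k' hj) (by positivity)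
    · rw [inner_eq_zero_of_mem_span g' _ hxW hj]; simp
  have h3 : (inner ℂ x (sys.L k x)).re - (inner ℂ x (sys.L k' x)).re ≤
      ‖sys.L k - sys.L k'‖ * ‖x‖ ^ 2 := by
    rw [← Complex.sub_re, ← inner_sub_right, ← sub_apply]
    refine (Complex.re_le_norm _).trans ((norm_inner_le_norm _ _).trans ?_)
    nlinarith [(sys.L k - sys.L k').le_opNorm x, norm_nonneg x]
  have h4 : (sys.freq ζ n k - sys.freq ζ n k') * ‖x‖ ^ 2 ≤ ‖sys.L k - sys.L k'‖ * ‖x‖ ^ 2 := by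
    linarith
  exact le_of_mul_le_mul_right h4 hx0

lemma continuousAt_L {k : X d} (hk : k ∉ sys.bandCrossing) : ContinuousAt sys.L k := by
  by_contra h
  exact hk (Or.inr (Or.inl h))

lemma Admissible.continuousAt_freq (hsys : sys.Admissible) {k : X d} (hk : k ∉ sys.bandCrossing)
    (ζ : ℤˣ) (n : Fin J) : ContinuousAt (sys.freq ζ n) k := by
  rw [ContinuousAt, tendsto_iff_dist_tendsto_zero]
  have h := continuousAt_L hk
  rw [ContinuousAt, tendsto_iff_norm_sub_tendsto_zero] at h
  refine squeeze_zero (fun _ => dist_nonneg) (fun k' => ?_) h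
  rw [Real.dist_eq, abs_le]
  have h1 := hsys.freq_sub_le k k' ζ n
  have h2 := hsys.freq_sub_le k' k ζ n
  rw [norm_sub_rev] at h1
  constructor <;> linarith

lemma Admissible.freq_injective (hsys : sys.Admissible) {k : X d} (hk : k ∉ sys.bandCrossing) :
    Function.Injective fun i : ℤˣ × Fin J => sys.freq i.1 i.2 k := by
  have hne : ∀ ζ (n n' : Fin J), n < n' → sys.freq ζ n k ≠ sys.freq ζ n' k := by
    intro ζ n n' hn h
    set l : Fin J := ⟨n + 1, by omega⟩
    refine hk (Or.inl ⟨ζ, n, l, rfl, ?_⟩)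
    have h1 : n ≤ l := Fin.le_def.2 (by simp [l])
    have h2 : l ≤ n' := Fin.le_def.2 (by simp only [l]; omega)
    rcases Int.units_eq_one_or ζ with rfl | rfl
    · have h3 := hsys.monotone_pos k h1
      have h4 := hsys.monotone_pos k h2
      simp only at h3 h4
      linarith
    · have h3 := hsys.antitone_neg k h1
      have h4 := hsys.antitone_neg k h2
      simp only at h3 h4
      linarith
  have hpm : ∀ n n' : Fin J, sys.freq 1 n k ≠ sys.freq (-1) n' k := by
    intro n n' h
    have h1 := hsys.pos_nonneg k hk n
    have h2 := hsys.neg_nonpos k hk n'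
    refine hk (Or.inr (Or.inr ⟨1, ⟨0, n.pos⟩, rfl, ?_⟩))
    have h3 := hsys.pos_nonneg k hk ⟨0, n.pos⟩
    have h4 := hsys.monotone_pos k (show (⟨0, n.pos⟩ : Fin J) ≤ n from Fin.le_def.2 (by simp))
    simp only at h4
    linarith
  have hs : ∀ ζ (n n' : Fin J), sys.freq ζ n k = sys.freq ζ n' k → n = n' := by
    intro ζ n n' h
    rcases lt_trichotomy n n' with h' | h' | h'
    · exact absurd h (hne ζ n n' h')
    · exact h'
    · exact absurd h.symm (hne ζ n' n h')
  rintro ⟨ζ, n⟩ ⟨ζ', n'⟩ h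
  simp only at h
  rcases Int.units_eq_one_or ζ with rfl | rfl <;> rcases Int.units_eq_one_or ζ' with rfl | rfl
  · rw [hs _ _ _ h]
  · exact absurd h (hpm _ _)
  · exact absurd h.symm (hpm _ _)
  · rw [hs _ _ _ h]

/-! ### Spectral projections -/

lemma bandProj_idem (ζ : ℤˣ) (n : Fin J) (k : X d) (x : V J) :
    sys.bandProj ζ n k (sys.bandProj ζ n k x) = sys.bandProj ζ n k x :=
  Submodule.starProjection_eq_self_iff.2 (Submodule.starProjection_apply_mem _ x)

lemma norm_bandProj_le (ζ : ℤˣ) (n : Fin J) (k : X d) : ‖sys.bandProj ζ n k‖ ≤ 1 :=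
  Submodule.starProjection_norm_le _

lemma L_bandProj (ζ : ℤˣ) (n : Fin J) (k : X d) (x : V J) :
    sys.L k (sys.bandProj ζ n k x) = ((sys.freq ζ n k : ℝ) : ℂ) • sys.bandProj ζ n k x :=
  Module.End.mem_eigenspace_iff.1 (Submodule.starProjection_apply_mem _ x)

lemma Admissible.bandProj_basis (hsys : sys.Admissible) {k : X d} (hk : k ∉ sys.bandCrossing)
    (g : OrthonormalBasis (ℤˣ × Fin J) ℂ (V J))
    (hg : ∀ ζ n, sys.L k (g (ζ, n)) = ((sys.freq ζ n k : ℝ) : ℂ) • g (ζ, n))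
    (i j : ℤˣ × Fin J) :
    sys.bandProj i.1 i.2 k (g j) = if i = j then g j else 0 := by
  split_ifs with h
  · subst h
    exact Submodule.starProjection_eq_self_iff.2 (Module.End.mem_eigenspace_iff.2 (hg i.1 i.2))
  · have hsym : ((sys.L k : V J →L[ℂ] V J) : V J →ₗ[ℂ] V J).IsSymmetric :=
      ContinuousLinearMap.isSelfAdjoint_iff_isSymmetric.1 (hsys.selfAdjoint k)
    refine (Submodule.starProjection_apply_eq_zero_iff _).2 fun y hy => ?_
    have hne : ((sys.freq i.1 i.2 k : ℝ) : ℂ) ≠ ((sys.freq j.1 j.2 k : ℝ) : ℂ) := fun h' =>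
      h (hsys.freq_injective hk (Complex.ofReal_injective h'))
    exact hsym.orthogonalFamily_eigenspaces hne ⟨y, hy⟩
      ⟨g j, Module.End.mem_eigenspace_iff.2 (hg j.1 j.2)⟩

lemma Admissible.sum_bandProj (hsys : sys.Admissible) {k : X d} (hk : k ∉ sys.bandCrossing)
    (x : V J) : ∑ i : ℤˣ × Fin J, sys.bandProj i.1 i.2 k x = x := by
  obtain ⟨g, hg⟩ := hsys.eigenbasis k
  have h : (∑ i : ℤˣ × Fin J, (sys.bandProj i.1 i.2 k : V J →ₗ[ℂ] V J)) = LinearMap.id := by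
    refine g.toBasis.ext fun j => ?_
    simp [hsys.bandProj_basis hk g hg]
  have := LinearMap.congr_fun h x
  simpa using this

lemma Admissible.bandProj_comp (hsys : sys.Admissible) {k : X d} (hk : k ∉ sys.bandCrossing)
    {i j : ℤˣ × Fin J} (hij : i ≠ j) (x : V J) :
    sys.bandProj i.1 i.2 k (sys.bandProj j.1 j.2 k x) = 0 := by
  obtain ⟨g, hg⟩ := hsys.eigenbasis k
  have h : (sys.bandProj i.1 i.2 k : V J →ₗ[ℂ] V J) ∘ₗ (sys.bandProj j.1 j.2 k : V J →ₗ[ℂ] V J)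
      = 0 := by
    refine g.toBasis.ext fun l => ?_
    simp only [OrthonormalBasis.coe_toBasis, LinearMap.comp_apply, ContinuousLinearMap.coe_coe,
      hsys.bandProj_basis hk g hg, LinearMap.zero_apply]
    split_ifs with h1
    · subst h1
      rw [hsys.bandProj_basis hk g hg, if_neg hij]
    · simp
  simpa using LinearMap.congr_fun h x

/-! ### The propagator -/

lemma exp_apply_eigenvector (A : V J →L[ℂ] V J) {a : ℂ} {x : V J} (h : A x = a • x) :
    NormedSpace.exp A x = Complex.exp a • x := by
  have h1 : ∀ n : ℕ, (A ^ n) x = a ^ n • x := by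
    intro n
    induction n with
    | zero => simp
    | succ n ih =>
      rw [pow_succ, mul_apply_eq_comp, h, map_smul, ih, smul_smul, pow_succ, mul_comm a]
  have h2 := NormedSpace.exp_series_hasSum_exp' (𝕂 := ℂ) A
  have h3 := (ContinuousLinearMap.apply ℂ (V J) x).hasSum h2
  have h4 := NormedSpace.exp_series_hasSum_exp' (𝕂 := ℂ) a
  have h5 := h4.smul_const x
  rw [← Complex.exp_eq_exp_ℂ] at h5
  have h6 : (fun n : ℕ => ((n.factorial : ℂ)⁻¹ • a ^ n) • x) = fun n : ℕ =>
      (ContinuousLinearMap.apply ℂ (V J) x) ((n.factorial : ℂ)⁻¹ • A ^ n) := by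
    funext n
    simp [h1, smul_smul]
  rw [h6] at h5
  exact h3.unique h5

lemma propagator_bandProj (t : ℝ) (ζ : ℤˣ) (n : Fin J) (k : X d) (x : V J) :
    sys.propagator t k (sys.bandProj ζ n k x) =
      Complex.exp (((t * sys.freq ζ n k : ℝ) : ℂ) * Complex.I) • sys.bandProj ζ n k x := by
  refine (exp_apply_eigenvector _ (a := ((t * sys.freq ζ n k : ℝ) : ℂ) * Complex.I) ?_)
  rw [smul_apply, L_bandProj, smul_smul]
  congr 1
  push_cast
  ring

lemma Admissible.norm_propagator_le (hsys : sys.Admissible) (t : ℝ) (k : X d) :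
    ‖sys.propagator t k‖ ≤ 1 := by
  refine ContinuousLinearMap.opNorm_le_bound _ zero_le_one fun x => ?_
  obtain ⟨g, hg⟩ := hsys.eigenbasis k
  rw [one_mul]
  have h1 : ∀ i, sys.propagator t k (g i) =
      Complex.exp (((t * sys.freq i.1 i.2 k : ℝ) : ℂ) * Complex.I) • g i := by
    intro i
    refine (exp_apply_eigenvector _ ?_)
    rw [smul_apply, hg i.1 i.2, smul_smul]
    congr 1
    push_cast
    ring
  have h2 : ∀ i, inner ℂ (g i) (sys.propagator t k x) =
      Complex.exp (((t * sys.freq i.1 i.2 k : ℝ) : ℂ) * Complex.I) * inner ℂ (g i) x := by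
    intro i
    conv_lhs => rw [← g.sum_repr' x]
    rw [map_sum, inner_sum, Finset.sum_eq_single i]
    · rw [map_smul, h1, inner_smul_right, inner_smul_right, inner_self_eq_norm_sq_to_K,
        g.orthonormal.1]
      simp [mul_comm]
    · intro j _ hj
      rw [map_smul, h1, inner_smul_right, inner_smul_right, g.orthonormal.2 hj.symm]
      ring
    · simp
  refine le_of_eq ((sq_eq_sq₀ (norm_nonneg _) (norm_nonneg _)).1 ?_)
  rw [norm_sq_eq_sum g, norm_sq_eq_sum g]
  refine Finset.sum_congr rfl fun i _ => ?_
  rw [h2, norm_mul, Complex.norm_exp_ofReal_mul_I, one_mul]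

lemma continuous_propagator (k : X d) : Continuous fun t => sys.propagator t k := by
  let _ : NormedAlgebra ℚ (V J →L[ℂ] V J) := NormedAlgebra.restrictScalars ℚ ℂ _
  unfold propagator
  exact NormedSpace.exp_continuous.comp (by fun_prop)

lemma continuousAt_propagator (t : ℝ) {k : X d} (hk : k ∉ sys.bandCrossing) :
    ContinuousAt (sys.propagator t) k := by
  let _ : NormedAlgebra ℚ (V J →L[ℂ] V J) := NormedAlgebra.restrictScalars ℚ ℂ _
  unfold propagator
  have h : ContinuousAt (fun k => ((t : ℂ) * Complex.I) • sys.L k) k :=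
    ContinuousAt.comp (g := fun A : V J →L[ℂ] V J => ((t : ℂ) * Complex.I) • A)
      (continuous_const_smul _).continuousAt (continuousAt_L hk)
  exact ContinuousAt.comp (g := NormedSpace.exp) NormedSpace.exp_continuous.continuousAt h

end WaveSystem

end Wavepacket

namespace Wavepacket

namespace WaveSystem

variable {d J : ℕ} {sys : WaveSystem d J}

/-! ### Smoothness of the eigenvalues and of the spectral projections -/

lemma Admissible.det_eq (hsys : sys.Admissible) (k : X d) (t : ℝ) :
    (Matrix.of fun a b => (((t : ℝ) : ℂ) • EuclideanSpace.single b (1 : ℂ) -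
      sys.L k (EuclideanSpace.single b (1 : ℂ)) : V J) a).det =
    ((∏ i : ℤˣ × Fin J, (t - sys.freq i.1 i.2 k) : ℝ) : ℂ) := by
  obtain ⟨g, hg⟩ := hsys.eigenbasis k
  set A : V J →ₗ[ℂ] V J := ((t : ℝ) : ℂ) • LinearMap.id - (sys.L k : V J →ₗ[ℂ] V J) with hA
  set b := (EuclideanSpace.basisFun (Fin (2 * J)) ℂ).toBasis
  have h1 : Matrix.of (fun a b => (((t : ℝ) : ℂ) • EuclideanSpace.single b (1 : ℂ) -
      sys.L k (EuclideanSpace.single b (1 : ℂ)) : V J) a) = LinearMap.toMatrix b b A := by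
    ext i j
    simp [LinearMap.toMatrix_apply, b, hA]
  have h2 : LinearMap.toMatrix g.toBasis g.toBasis A =
      Matrix.diagonal fun i => (((t - sys.freq i.1 i.2 k : ℝ)) : ℂ) := by
    ext i j
    rw [LinearMap.toMatrix_apply]
    have : A (g j) = (((t - sys.freq j.1 j.2 k : ℝ)) : ℂ) • g j := by
      simp [hA, hg j.1 j.2, sub_smul]
    rw [OrthonormalBasis.coe_toBasis, this, map_smul, Finsupp.smul_apply,
      ← OrthonormalBasis.coe_toBasis, Module.Basis.repr_self, Matrix.diagonal_apply]
    by_cases h : i = j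
    · subst h; simp
    · simp [h]
  rw [h1, LinearMap.det_toMatrix, ← LinearMap.det_toMatrix g.toBasis, h2, Matrix.det_diagonal]
  push_cast
  rfl

lemma Admissible.contDiffAt_charpoly (hsys : sys.Admissible) {k : X d}
    (hk : k ∉ sys.bandCrossing) (t : ℝ) :
    ContDiffAt ℝ ∞ (fun q : X d × ℝ => ∏ i : ℤˣ × Fin J, (q.2 - sys.freq i.1 i.2 q.1)) (k, t) := by
  have hL : ContDiffAt ℝ ∞ (fun q : X d × ℝ => sys.L q.1) (k, t) :=
    (hsys.smooth_L k hk).comp (k, t) contDiffAt_fst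
  have h1 : ∀ a b : Fin (2 * J), ContDiffAt ℝ ∞ (fun q : X d × ℝ =>
      (((q.2 : ℝ) : ℂ) • EuclideanSpace.single b (1 : ℂ) -
        sys.L q.1 (EuclideanSpace.single b (1 : ℂ)) : V J) a) (k, t) := by
    intro a b
    have h2 : ContDiffAt ℝ ∞ (fun q : X d × ℝ => ((q.2 : ℝ) : ℂ)) (k, t) :=
      Complex.ofRealCLM.contDiff.contDiffAt.comp _ contDiffAt_snd
    have h3 : ContDiffAt ℝ ∞ (fun q : X d × ℝ => sys.L q.1 (EuclideanSpace.single b (1 : ℂ)))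
        (k, t) :=
      ((ContinuousLinearMap.apply ℂ (V J)
        (EuclideanSpace.single b (1 : ℂ))).restrictScalars ℝ).contDiff.contDiffAt.comp _ hL
    have h4 := (h2.smul (contDiffAt_const (c := EuclideanSpace.single b (1 : ℂ)))).sub h3
    exact ((EuclideanSpace.proj (𝕜 := ℂ) a).restrictScalars ℝ).contDiff.contDiffAt.comp _ h4
  have h5 : (fun q : X d × ℝ => ∏ i : ℤˣ × Fin J, (q.2 - sys.freq i.1 i.2 q.1)) =
      fun q => (Matrix.of fun a b => (((q.2 : ℝ) : ℂ) • EuclideanSpace.single b (1 : ℂ) -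
      sys.L q.1 (EuclideanSpace.single b (1 : ℂ)) : V J) a).det.re := by
    funext q
    rw [hsys.det_eq, Complex.ofReal_re]
  rw [h5]
  refine Complex.reCLM.contDiff.contDiffAt.comp _ ?_
  simp only [Matrix.det_apply, Matrix.of_apply]
  refine ContDiffAt.sum fun σ _ => ?_
  refine ContDiffAt.const_smul _ (contDiffAt_prod fun i _ => ?_)
  exact h1 _ _

lemma isInvertible_of_apply_one_ne_zero {A : ℝ →L[ℝ] ℝ} (h : A 1 ≠ 0) : A.IsInvertible := by
  refine ContinuousLinearMap.IsInvertible.of_inverse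
    (g := (A 1)⁻¹ • ContinuousLinearMap.id ℝ ℝ) ?_ ?_
  · ext; simp [h]
  · ext; simp [h]

lemma Admissible.contDiffAt_freq (hsys : sys.Admissible) {k : X d}
    (hk : k ∉ sys.bandCrossing) (ζ : ℤˣ) (n : Fin J) : ContDiffAt ℝ ∞ (sys.freq ζ n) k := by
  classical
  set f : X d × ℝ → ℝ := fun q => ∏ i : ℤˣ × Fin J, (q.2 - sys.freq i.1 i.2 q.1) with hf
  set u : X d × ℝ := (k, sys.freq ζ n k)
  have cdf : ContDiffAt ℝ ∞ f u := hsys.contDiffAt_charpoly hk _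
  have hfu : ∀ k', f (k', sys.freq ζ n k') = 0 := fun k' =>
    Finset.prod_eq_zero (Finset.mem_univ (ζ, n)) (sub_self _)
  have hd : HasDerivAt (fun t => f (k, t))
      (∏ i ∈ Finset.univ.erase ((ζ, n) : ℤˣ × Fin J), (sys.freq ζ n k - sys.freq i.1 i.2 k))
      (sys.freq ζ n k) := by
    have h1 := HasDerivAt.fun_finsetProd (u := (Finset.univ : Finset (ℤˣ × Fin J)))
      (f := fun i t => t - sys.freq i.1 i.2 k) (f' := fun _ => (1 : ℝ)) (x := sys.freq ζ n k)
      fun i _ => (hasDerivAt_id _).sub_const _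
    have h2 : ∑ i : ℤˣ × Fin J, (∏ j ∈ Finset.univ.erase i, (sys.freq ζ n k - sys.freq j.1 j.2 k)) • (1 : ℝ) =
        ∏ i ∈ Finset.univ.erase ((ζ, n) : ℤˣ × Fin J),
          (sys.freq ζ n k - sys.freq i.1 i.2 k) := ?_
    · rw [h2] at h1
      exact h1
    rw [Finset.sum_eq_single (ζ, n)]
    · simp
    · intro j _ hj
      rw [smul_eq_mul, mul_one]
      exact Finset.prod_eq_zero (Finset.mem_erase.2 ⟨hj.symm, Finset.mem_univ (ζ, n)⟩) (sub_self _)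
    · simp
  have hval : (fderiv ℝ f u ∘L .inr ℝ (X d) ℝ) 1 =
      ∏ i ∈ Finset.univ.erase ((ζ, n) : ℤˣ × Fin J),
        (sys.freq ζ n k - sys.freq i.1 i.2 k) := by
    have h1 : HasFDerivAt f (fderiv ℝ f u) u :=
      (cdf.differentiableAt (by simp)).hasFDerivAt
    have h2 : HasFDerivAt (fun t : ℝ => ((k, t) : X d × ℝ)) (.inr ℝ (X d) ℝ) (sys.freq ζ n k) :=
      hasFDerivAt_prodMk_right k _
    exact (HasFDerivAt.comp (g := f) _ h1 h2).hasDerivAt.unique hd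
  have hinv : (fderiv ℝ f u ∘L .inr ℝ (X d) ℝ).IsInvertible := by
    refine isInvertible_of_apply_one_ne_zero ?_
    rw [hval, Finset.prod_ne_zero_iff]
    intro i hi h
    exact Finset.ne_of_mem_erase hi (hsys.freq_injective hk (sub_eq_zero.1 h).symm)
  have hn : (∞ : WithTop ℕ∞) ≠ 0 := by simp
  have h3 := cdf.eventually_apply_eq_iff_implicitFunction hn hinv
  have h4 : Filter.Tendsto (fun k' => ((k', sys.freq ζ n k') : X d × ℝ)) (𝓝 k) (𝓝 u) :=
    (continuousAt_id.prodMk (hsys.continuousAt_freq hk ζ n))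
  refine (cdf.contDiffAt_implicitFunction hn hinv).congr_of_eventuallyEq ?_
  filter_upwards [h4.eventually h3] with k' hk'
  exact (hk'.1 ((hfu k').trans (hfu k).symm)).symm

/-- The Lagrange interpolation formula for a spectral projection. -/
def lagrangeProd (sys : WaveSystem d J) (i : ℤˣ × Fin J) (l : List (ℤˣ × Fin J)) (k : X d) :
    V J →L[ℂ] V J :=
  (l.map fun j => (((sys.freq i.1 i.2 k - sys.freq j.1 j.2 k)⁻¹ : ℝ) : ℂ) •
    (sys.L k - ((sys.freq j.1 j.2 k : ℝ) : ℂ) • ContinuousLinearMap.id ℂ (V J))).prod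

lemma Admissible.contDiffAt_lagrangeProd (hsys : sys.Admissible) {k : X d}
    (hk : k ∉ sys.bandCrossing) (i : ℤˣ × Fin J) (l : List (ℤˣ × Fin J)) (hl : i ∉ l) :
    ContDiffAt ℝ ∞ (lagrangeProd sys i l) k := by
  induction l with
  | nil => exact contDiffAt_const
  | cons j l ih =>
    rw [List.mem_cons, not_or] at hl
    have hc : ∀ {g : X d → ℝ}, ContDiffAt ℝ ∞ g k →
        ContDiffAt ℝ ∞ (fun k => ((g k : ℝ) : ℂ)) k := fun hg =>
      Complex.ofRealCLM.contDiff.contDiffAt.comp k hg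
    have h1 := hc (((hsys.contDiffAt_freq hk i.1 i.2).sub (hsys.contDiffAt_freq hk j.1 j.2)).inv
      (sub_ne_zero.2 fun h => hl.1 (hsys.freq_injective hk h)))
    have h2 := (hc (hsys.contDiffAt_freq hk j.1 j.2)).smul
      (contDiffAt_const (c := ContinuousLinearMap.id ℂ (V J)))
    have h3 := (h1.smul ((hsys.smooth_L k hk).sub h2)).mul (ih hl.2)
    refine h3.congr_of_eventuallyEq (Filter.Eventually.of_forall fun k' => ?_)
    simp only [lagrangeProd, List.map_cons, List.prod_cons]
    rfl

lemma lagrangeProd_basis {k : X d} (g : OrthonormalBasis (ℤˣ × Fin J) ℂ (V J))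
    (hg : ∀ ζ n, sys.L k (g (ζ, n)) = ((sys.freq ζ n k : ℝ) : ℂ) • g (ζ, n))
    (i : ℤˣ × Fin J) (l : List (ℤˣ × Fin J)) (a : ℤˣ × Fin J) :
    lagrangeProd sys i l k (g a) = (((l.map fun j => (sys.freq i.1 i.2 k - sys.freq j.1 j.2 k)⁻¹ *
      (sys.freq a.1 a.2 k - sys.freq j.1 j.2 k)).prod : ℝ) : ℂ) • g a := by
  induction l with
  | nil => simp [lagrangeProd]
  | cons j l ih =>
    simp only [lagrangeProd, List.map_cons, List.prod_cons, mul_apply_eq_comp] at ih ⊢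
    rw [ih, map_smul, smul_apply, sub_apply, smul_apply, hg a.1 a.2]
    simp only [ContinuousLinearMap.id_apply, ← sub_smul, smul_smul]
    congr 1
    push_cast
    ring

lemma Admissible.bandProj_eq_lagrangeProd (hsys : sys.Admissible) {k : X d}
    (hk : k ∉ sys.bandCrossing) (i : ℤˣ × Fin J) :
    sys.bandProj i.1 i.2 k = lagrangeProd sys i (Finset.univ.erase i).toList k := by
  obtain ⟨g, hg⟩ := hsys.eigenbasis k
  have h : (sys.bandProj i.1 i.2 k : V J →ₗ[ℂ] V J) =
      (lagrangeProd sys i (Finset.univ.erase i).toList k : V J →ₗ[ℂ] V J) := by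
    refine g.toBasis.ext fun a => ?_
    simp only [OrthonormalBasis.coe_toBasis, ContinuousLinearMap.coe_coe]
    rw [hsys.bandProj_basis hk g hg, lagrangeProd_basis g hg]
    split_ifs with h
    · subst h
      rw [List.prod_eq_one]
      · simp
      · intro x hx
        obtain ⟨j, hj, rfl⟩ := List.mem_map.1 hx
        refine inv_mul_cancel₀ (sub_ne_zero.2 fun h => ?_)
        exact Finset.ne_of_mem_erase (Finset.mem_toList.1 hj) (hsys.freq_injective hk h).symm
    · rw [List.prod_eq_zero]
      · simp
      · exact List.mem_map.2 ⟨a, by simp [Ne.symm h], by simp⟩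
  exact ContinuousLinearMap.coe_inj.1 h

lemma Admissible.eventually_notMem (hsys : sys.Admissible) {k : X d}
    (hk : k ∉ sys.bandCrossing) : ∀ᶠ k' in 𝓝 k, k' ∉ sys.bandCrossing :=
  hsys.isClosed_bandCrossing.isOpen_compl.mem_nhds hk

lemma Admissible.contDiffAt_bandProj (hsys : sys.Admissible) {k : X d}
    (hk : k ∉ sys.bandCrossing) (ζ : ℤˣ) (n : Fin J) : ContDiffAt ℝ ∞ (sys.bandProj ζ n) k := by
  refine (hsys.contDiffAt_lagrangeProd hk (ζ, n) (Finset.univ.erase (ζ, n)).toList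
    (by simp)).congr_of_eventuallyEq ?_
  filter_upwards [hsys.eventually_notMem hk] with k' hk'
  exact hsys.bandProj_eq_lagrangeProd hk' (ζ, n)

end WaveSystem

end Wavepacket

namespace Wavepacket

variable {d J m : ℕ}

lemma aestronglyMeasurable_of_ae_continuousAt {α E : Type*} [TopologicalSpace α]
    [MeasurableSpace α] [OpensMeasurableSpace α] [SecondCountableTopology α]
    [NormedAddCommGroup E] {μ : Measure α} {f : α → E} (h : ∀ᵐ x ∂μ, ContinuousAt f x) :
    AEStronglyMeasurable f μ := by
  have h1 : MeasurableSet {x | ContinuousAt f x} :=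
    (IsGδ.setOfPred_continuousAt f).measurableSet
  have h2 : ContinuousOn f {x | ContinuousAt f x} := fun x hx => hx.continuousWithinAt
  have h3 := h2.aestronglyMeasurable (μ := μ) h1
  rwa [Measure.restrict_eq_self_of_ae_mem (s := {x | ContinuousAt f x}) h] at h3

/-! ### Grönwall's inequality in integral form -/

lemma gronwall_integral {a : ℝ → ℝ} (ha : Continuous a) {A C T : ℝ} (hC : 0 ≤ C)
    (h : ∀ τ ∈ Set.Icc 0 T, a τ ≤ A + C * ∫ s in (0 : ℝ)..τ, a s) {τ : ℝ}
    (hτ : τ ∈ Set.Icc 0 T) : a τ ≤ A * Real.exp (C * τ) := by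
  set b : ℝ → ℝ := fun τ => ∫ s in (0 : ℝ)..τ, a s with hb
  have hbd : ∀ t, HasDerivAt b (a t) t := fun t =>
    intervalIntegral.integral_hasDerivAt_right (ha.intervalIntegrable _ _)
      (ha.stronglyMeasurableAtFilter _ _) ha.continuousAt
  set g : ℝ → ℝ := fun t => Real.exp (-(C * t)) * (A + C * b t) with hg
  have hgd : ∀ t, HasDerivAt g (Real.exp (-(C * t)) * (C * (a t - (A + C * b t)))) t := by
    intro t
    have h1 : HasDerivAt (fun t => Real.exp (-(C * t))) (Real.exp (-(C * t)) * (-(C * 1))) t :=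
      ((hasDerivAt_id t).const_mul C).neg.exp
    have h2 := h1.mul (((hbd t).const_mul C).const_add A)
    exact h2.congr_deriv (by ring)
  have hanti : AntitoneOn g (Set.Icc 0 T) := by
    refine antitoneOn_of_deriv_nonpos (convex_Icc _ _)
      (fun t _ => (hgd t).continuousAt.continuousWithinAt)
      (fun t _ => (hgd t).differentiableAt.differentiableWithinAt) fun t ht => ?_
    rw [(hgd t).deriv]
    have h1 := h t (interior_subset ht)
    refine mul_nonpos_of_nonneg_of_nonpos (Real.exp_pos _).le
      (mul_nonpos_of_nonneg_of_nonpos hC ?_)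
    simp only [hb]
    linarith
  have h0 : g 0 = A := by simp [hg, hb]
  have h1 := hanti (Set.left_mem_Icc.2 (hτ.1.trans hτ.2)) hτ hτ.1
  rw [h0] at h1
  have h2 : a τ ≤ A + C * b τ := h τ hτ
  have h3 : A + C * b τ = g τ * Real.exp (C * τ) := by
    simp only [hg]
    rw [mul_right_comm, ← Real.exp_add]
    simp
  rw [h3] at h2
  exact h2.trans (mul_le_mul_of_nonneg_right h1 (Real.exp_pos _).le)

namespace WaveSystem

variable {sys : WaveSystem d J}

/-! ### The nonlinearity as a sum of convolution operators -/

/-- The kernel of a monomial of the nonlinearity, before the output propagator. -/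
def innerKernel (sys : WaveSystem d J) (m : ℕ) (t : ℝ) (kk : Fin m → X d) : Mult J m :=
  ((((2 * Real.pi) ^ ((m - 1) * d))⁻¹ : ℝ) : ℂ) •
    (sys.χ m (∑ j, kk j) kk).compContinuousLinearMap fun j => sys.propagator (-t) (kk j)

/-- The kernel of a monomial of the nonlinearity for the slow variable. -/
def slowKernel (sys : WaveSystem d J) (m : ℕ) (t : ℝ) : (Fin m → X d) → Mult J m :=
  outMul (sys.propagator t) (sys.innerKernel m t)

lemma Admissible.ae_off (hsys : sys.Admissible) : ∀ᵐ k : X d, k ∉ sys.bandCrossing :=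
  measure_eq_zero_iff_ae_notMem.1 hsys.volume_bandCrossing

lemma Admissible.ae_off_args (hsys : sys.Admissible) (hm : 0 < m) :
    ∀ᵐ kk : Fin m → X d, (∑ j, kk j) ∉ sys.bandCrossing ∧ ∀ j, kk j ∉ sys.bandCrossing :=
  (ae_sum hm hsys.ae_off).and (ae_forall_coord fun _ => hsys.ae_off)

lemma Admissible.isBddMeas_propagator (hsys : sys.Admissible) (t : ℝ) :
    IsBddMeas (sys.propagator t) := by
  refine ⟨aestronglyMeasurable_of_ae_continuousAt ?_, 1,
    Filter.Eventually.of_forall fun k => hsys.norm_propagator_le t k⟩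
  filter_upwards [hsys.ae_off] with k hk using continuousAt_propagator t hk

lemma Admissible.norm_innerKernel_le (hsys : sys.Admissible) :
    ∃ C : ℝ, 0 ≤ C ∧ ∀ m ∈ sys.M, ∀ t, ∀ kk : Fin m → X d, (∑ j, kk j) ∉ sys.bandCrossing →
      (∀ j, kk j ∉ sys.bandCrossing) → ‖sys.innerKernel m t kk‖ ≤ C := by
  obtain ⟨C, hC⟩ := hsys.bounded_χ
  refine ⟨|C|, abs_nonneg C, fun m hm t kk h1 h2 => ?_⟩
  refine le_trans ?_ ((hC m hm _ kk h1 h2).trans (le_abs_self C))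
  have hp : (0 : ℝ) ≤ ((2 * Real.pi) ^ ((m - 1) * d))⁻¹ := by positivity
  rw [innerKernel, norm_smul, Complex.norm_real, Real.norm_of_nonneg hp]
  refine mul_le_mul_of_nonneg_left ?_ hp
  refine (ContinuousMultilinearMap.norm_compContinuousLinearMap_le _ _).trans ?_
  refine mul_le_of_le_one_right (norm_nonneg _) ?_
  exact Finset.prod_le_one (fun _ _ => norm_nonneg _) fun j _ => hsys.norm_propagator_le _ _

lemma Admissible.continuousAt_innerKernel (hsys : sys.Admissible) (hm : m ∈ sys.M) (t : ℝ)
    {kk : Fin m → X d} (h1 : (∑ j, kk j) ∉ sys.bandCrossing)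
    (h2 : ∀ j, kk j ∉ sys.bandCrossing) : ContinuousAt (sys.innerKernel m t) kk := by
  have hχ : ContinuousAt (fun kk : Fin m → X d => sys.χ m (∑ j, kk j) kk) kk := by
    have h3 : ContinuousAt (fun kk : Fin m → X d => (∑ j, kk j, kk)) kk := by fun_prop
    exact ContinuousAt.comp (g := fun q : X d × (Fin m → X d) => sys.χ m q.1 q.2)
      (f := fun kk : Fin m → X d => (∑ j, kk j, kk)) (hsys.smooth_χ m hm _ kk h1 h2).continuousAt h3
  have hp : ContinuousAt (fun (kk : Fin m → X d) (j : Fin m) =>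
      sys.propagator (-t) (kk j)) kk := by
    refine continuousAt_pi.2 fun j => ?_
    exact ContinuousAt.comp (g := sys.propagator (-t)) (f := fun kk : Fin m → X d => kk j)
      (continuousAt_propagator (-t) (h2 j)) (continuous_apply j).continuousAt
  have hc := ((ContinuousMultilinearMap.compContinuousLinearMapContinuousMultilinear ℂ
    (fun _ : Fin m => V J) (fun _ : Fin m => V J) (V J)).cont.continuousAt.comp hp).clm_apply hχ
  exact ContinuousAt.comp (g := fun A : Mult J m =>
    ((((2 * Real.pi) ^ ((m - 1) * d))⁻¹ : ℝ) : ℂ) • A) (continuous_const_smul _).continuousAt hc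

lemma continuous_innerKernel (kk : Fin m → X d) :
    Continuous fun t => sys.innerKernel m t kk := by
  have hp : Continuous fun (t : ℝ) (j : Fin m) => sys.propagator (-t) (kk j) :=
    continuous_pi fun j => (continuous_propagator (kk j)).comp continuous_neg
  have hc := ((ContinuousMultilinearMap.compContinuousLinearMapContinuousMultilinear ℂ
    (fun _ : Fin m => V J) (fun _ : Fin m => V J) (V J)).cont.comp hp).clm_apply
      (continuous_const (y := sys.χ m (∑ j, kk j) kk))
  exact Continuous.comp (g := fun A : Mult J m =>
    ((((2 * Real.pi) ^ ((m - 1) * d))⁻¹ : ℝ) : ℂ) • A) (continuous_const_smul _) hc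

lemma Admissible.pos_of_mem (hsys : sys.Admissible) (hm : m ∈ sys.M) : 0 < m :=
  lt_of_lt_of_le two_pos (hsys.two_le m hm)

lemma Admissible.isBddMeas_innerKernel (hsys : sys.Admissible) (hm : m ∈ sys.M) (t : ℝ) :
    IsBddMeas (sys.innerKernel m t) := by
  obtain ⟨C, _, hC⟩ := hsys.norm_innerKernel_le
  refine ⟨aestronglyMeasurable_of_ae_continuousAt ?_, C, ?_⟩
  · filter_upwards [hsys.ae_off_args (hsys.pos_of_mem hm)] with kk hk
    exact hsys.continuousAt_innerKernel hm t hk.1 hk.2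
  · filter_upwards [hsys.ae_off_args (hsys.pos_of_mem hm)] with kk hk
    exact hC m hm t kk hk.1 hk.2

lemma Admissible.isBddMeas_slowKernel (hsys : sys.Admissible) (hm : m ∈ sys.M) (t : ℝ) :
    IsBddMeas (sys.slowKernel m t) :=
  isBddMeas_outMul (hsys.pos_of_mem hm) (hsys.isBddMeas_propagator t)
    (hsys.isBddMeas_innerKernel hm t)

lemma Admissible.norm_slowKernel_le (hsys : sys.Admissible) :
    ∃ C : ℝ, 0 ≤ C ∧ ∀ m ∈ sys.M, ∀ t, ∀ᵐ kk : Fin m → X d, ‖sys.slowKernel m t kk‖ ≤ C := by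
  obtain ⟨C, h0, hC⟩ := hsys.norm_innerKernel_le
  refine ⟨C, h0, fun m hm t => ?_⟩
  filter_upwards [hsys.ae_off_args (hsys.pos_of_mem hm)] with kk hk
  refine (norm_outMul_le _ _ _).trans ?_
  rw [← one_mul C]
  exact mul_le_mul (hsys.norm_propagator_le _ _) (hC m hm t kk hk.1 hk.2) (norm_nonneg _)
    zero_le_one

lemma continuous_slowKernel (kk : Fin m → X d) : Continuous fun t => sys.slowKernel m t kk :=
  (ContinuousLinearMap.compContinuousMultilinearMapL ℂ (fun _ : Fin m => V J) (V J)
    (V J)).continuous₂.comp₂ (continuous_propagator _) (continuous_innerKernel kk)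

/-- The right-hand side of the equation, with `t` the fast time. -/
def rhs (sys : WaveSystem d J) (t : ℝ) (u : L1 d J) : L1 d J :=
  ∑ m ∈ sys.M, op (sys.slowKernel m t) fun _ => u

lemma Admissible.nonlinearity_eq (hsys : sys.Admissible) (t : ℝ) (u : L1 d J) :
    sys.nonlinearity (fun k' => sys.propagator (-t) k' (u k')) =
      fun k => ∑ m ∈ sys.M, pushFun (tens (sys.innerKernel m t) fun _ => u) k := by
  funext k
  refine Finset.sum_congr rfl fun m hm => ?_
  rw [pushFun, ← integral_smul]
  refine integral_congr_ae (Filter.Eventually.of_forall fun y => ?_)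
  simp only [tens, innerKernel, sum_convTuple (hsys.pos_of_mem hm)]
  rfl

lemma toL1_sum {ι : Type*} (s : Finset ι) {f : ι → X d → V J} (hf : ∀ i ∈ s, Integrable (f i)) :
    toL1 (fun k => ∑ i ∈ s, f i k) = ∑ i ∈ s, toL1 (f i) := by
  classical
  induction s using Finset.induction_on with
  | empty =>
    simp only [Finset.sum_empty]
    have h : Integrable fun _ : X d => (0 : V J) := integrable_zero _ _ _
    have := norm_toL1 h
    simp only [norm_zero, integral_zero] at this
    exact norm_eq_zero.1 this
  | insert a s ha ih =>
    simp only [Finset.sum_insert ha]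
    rw [toL1_add (hf a (by simp)) (integrable_finsetSum _ fun i hi => hf i (by simp [hi])),
      ih fun i hi => hf i (by simp [hi])]

lemma Admissible.slowRHS_eq (hsys : sys.Admissible) (ϱ τ : ℝ) (u : L1 d J) :
    sys.slowRHS ϱ τ u = sys.rhs (τ / ϱ) u := by
  have h1 : ∀ m ∈ sys.M, Integrable (pushFun (tens (sys.innerKernel m (τ / ϱ)) fun _ => u)) :=
    fun m hm => integrable_pushFun (hsys.pos_of_mem hm)
      (integrable_tens (hsys.isBddMeas_innerKernel hm _) _)
  have h2 : sys.slowRHS ϱ τ u = mul (sys.propagator (τ / ϱ))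
      (∑ m ∈ sys.M, op (sys.innerKernel m (τ / ϱ)) fun _ => u) := by
    rw [slowRHS, hsys.nonlinearity_eq, mul_apply (hsys.isBddMeas_propagator _)]
    refine toL1_congr ?_
    have h3 : ∑ m ∈ sys.M, op (sys.innerKernel m (τ / ϱ)) (fun _ => u) =
        toL1 fun k => ∑ m ∈ sys.M, pushFun (tens (sys.innerKernel m (τ / ϱ)) fun _ => u) k := by
      rw [toL1_sum _ h1]
      exact Finset.sum_congr rfl fun m hm =>
        op_apply (hsys.pos_of_mem hm) (hsys.isBddMeas_innerKernel hm _) _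
    rw [h3]
    filter_upwards [toL1_coe (integrable_finsetSum _ h1)] with k hk
    rw [hk]
  rw [h2, map_sum]
  exact Finset.sum_congr rfl fun m hm => mul_op (hsys.pos_of_mem hm)
    (hsys.isBddMeas_propagator _) (hsys.isBddMeas_innerKernel hm _) _

lemma Admissible.continuous_op_slowKernel (hsys : sys.Admissible) (hm : m ∈ sys.M) :
    Continuous fun q : ℝ × (Fin m → L1 d J) => op (sys.slowKernel m q.1) q.2 := by
  obtain ⟨C, _, hC⟩ := hsys.norm_slowKernel_le
  have h1 : ∀ᵐ kk : Fin m → X d, Continuous fun t => sys.slowKernel m t kk :=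
    Filter.Eventually.of_forall fun kk => continuous_slowKernel kk
  exact continuous_op (K := fun t => sys.slowKernel m t) (C := C) (hsys.pos_of_mem hm)
    (fun t => hsys.isBddMeas_slowKernel hm t) (fun t => hC m hm t) h1

lemma continuous_op_diag {K : ℝ → (Fin m → X d) → Mult J m}
    (h : Continuous fun q : ℝ × (Fin m → L1 d J) => op (K q.1) q.2) :
    Continuous fun q : ℝ × L1 d J => op (K q.1) fun _ => q.2 := by
  have h2 : Continuous fun q : ℝ × L1 d J => ((q.1, fun _ => q.2) : ℝ × (Fin m → L1 d J)) :=
    continuous_fst.prodMk (continuous_pi fun _ => continuous_snd)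
  exact h.comp h2

attribute [irreducible] slowKernel

lemma Admissible.continuous_rhs (hsys : sys.Admissible) :
    Continuous fun q : ℝ × L1 d J => sys.rhs q.1 q.2 := by
  simp only [rhs]
  exact continuous_finsetSum _ fun m hm => continuous_op_diag (hsys.continuous_op_slowKernel hm)

/-- Bounds for the right-hand side on balls. -/
lemma Admissible.exists_rhs_bound (hsys : sys.Admissible) (B : ℝ) (hB : 0 ≤ B) :
    ∃ C : ℝ, 0 ≤ C ∧ (∀ t, ∀ u : L1 d J, ‖u‖ ≤ B → ‖sys.rhs t u‖ ≤ C) ∧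
      ∀ t, ∀ u v : L1 d J, ‖u‖ ≤ B → ‖v‖ ≤ B → ‖sys.rhs t u - sys.rhs t v‖ ≤ C * ‖u - v‖ := by
  obtain ⟨C, hC0, hC⟩ := hsys.norm_slowKernel_le
  refine ⟨∑ m ∈ sys.M, (C * B ^ m + C * m * B ^ (m - 1)), Finset.sum_nonneg fun m _ => by
    positivity, fun t u hu => ?_, fun t u v hu hv => ?_⟩
  · refine norm_sum_le_of_le _ fun m hm => ?_
    refine (norm_op_le (hsys.pos_of_mem hm) (hsys.isBddMeas_slowKernel hm t) (hC m hm t) _).trans ?_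
    refine le_add_of_le_of_nonneg ?_ (by positivity)
    rw [Finset.prod_const, Finset.card_univ, Fintype.card_fin]
    gcongr
  · rw [rhs, rhs, ← Finset.sum_sub_distrib, Finset.sum_mul]
    refine norm_sum_le_of_le _ fun m hm => ?_
    refine (norm_op_sub_op_le (hsys.pos_of_mem hm) (hsys.isBddMeas_slowKernel hm t) hC0
      (hC m hm t) _ _ hB (fun _ => hu) fun _ => hv).trans ?_
    have h1 : ‖(fun _ : Fin m => u) - fun _ => v‖ ≤ ‖u - v‖ :=
      (pi_norm_le_iff_of_nonneg (norm_nonneg _)).2 fun _ => le_rfl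
    refine mul_le_mul ?_ h1 (norm_nonneg _) (by positivity)
    exact le_add_of_nonneg_left (by positivity)

lemma Admissible.continuous_rhs_comp (hsys : sys.Admissible) (ϱ : ℝ) {u : ℝ → L1 d J}
    (hu : Continuous u) : Continuous fun s => sys.rhs (s / ϱ) (u s) :=
  Continuous.comp (g := fun q : ℝ × L1 d J => sys.rhs q.1 q.2) (f := fun s => (s / ϱ, u s))
    hsys.continuous_rhs ((continuous_id.div_const ϱ).prodMk hu)

/-! ### Well-posedness -/

lemma Admissible.exists_isSolution (hsys : sys.Admissible) {ϱ τs R C : ℝ} (hR : 0 < R)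
    (hτ : 0 < τs)
    (hC0 : 0 ≤ C) (hC1 : ∀ t, ∀ u : L1 d J, ‖u‖ ≤ 2 * R → ‖sys.rhs t u‖ ≤ C)
    (hC2 : ∀ t, ∀ u v : L1 d J, ‖u‖ ≤ 2 * R → ‖v‖ ≤ 2 * R →
      ‖sys.rhs t u - sys.rhs t v‖ ≤ C * ‖u - v‖) (hτC : C * τs ≤ R) (h : L1 d J)
    (hh : ‖h‖ ≤ R) : ∃ u, sys.IsSolution ϱ τs R h u := by
  obtain ⟨C, rfl⟩ : ∃ c : NNReal, (c : ℝ) = C := ⟨C.toNNReal, Real.coe_toNNReal _ hC0⟩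
  obtain ⟨R, rfl⟩ : ∃ c : NNReal, (c : ℝ) = R := ⟨R.toNNReal, Real.coe_toNNReal _ hR.le⟩
  have hball : ∀ u ∈ Metric.closedBall h R, ‖u‖ ≤ 2 * R := by
    intro u hu
    rw [mem_closedBall_iff_norm] at hu
    calc ‖u‖ = ‖(u - h) + h‖ := by rw [sub_add_cancel]
      _ ≤ ‖u - h‖ + ‖h‖ := norm_add_le _ _
      _ ≤ 2 * R := by linarith
  set t₀ : Set.Icc (0 : ℝ) τs := ⟨0, Set.left_mem_Icc.2 hτ.le⟩
  have hPL : IsPicardLindelof (fun s u => sys.rhs (s / ϱ) u) t₀ h R 0 C C := by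
    refine ⟨fun t _ => ?_, fun x _ => ?_, fun t _ x hx => hC1 _ x (hball x hx), ?_⟩
    · refine LipschitzOnWith.of_dist_le_mul fun u hu v hv => ?_
      rw [dist_eq_norm, dist_eq_norm]
      exact hC2 _ u v (hball u hu) (hball v hv)
    · exact (hsys.continuous_rhs_comp ϱ (continuous_const (y := x))).continuousOn
    · change (C : ℝ) * max (τs - 0) (0 - 0) ≤ R - 0
      rw [sub_zero, sub_zero, sub_zero, max_eq_left hτ.le]
      exact hτC
  obtain ⟨α, hα⟩ := ODE.FunSpace.exists_isFixedPt_next hPL (Metric.mem_closedBall_self le_rfl)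
  refine ⟨α.compProj, α.continuous_compProj.continuousOn, fun τ _ =>
    hball _ (α.compProj_mem_closedBall hPL.mul_max_le), fun τ hτ' => ?_⟩
  have h1 : α.compProj τ = ODE.picard (fun s u => sys.rhs (s / ϱ) u) t₀ h α.compProj τ := by
    conv_lhs => rw [← hα]
    rw [ODE.FunSpace.compProj_apply, ODE.FunSpace.next_apply, Set.projIcc_of_mem _ hτ']
  rw [h1, ODE.picard_apply, add_comm]
  simp_rw [hsys.slowRHS_eq]
  rfl

/-- Solutions extended from `[0, T]` to the line by constants. -/
structure IsGlobalSol (sys : WaveSystem d J) (ϱ T B C : ℝ) (h : L1 d J) (u : ℝ → L1 d J) :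
    Prop where
  continuous : Continuous u
  bound : ∀ τ, ‖u τ‖ ≤ B
  eq : ∀ τ ∈ Set.Icc 0 T, u τ = (∫ s in (0 : ℝ)..τ, sys.rhs (s / ϱ) (u s)) + h
  lip : ∀ s t, ‖u s - u t‖ ≤ C * |s - t|

lemma Admissible.exists_isGlobalSol (hsys : sys.Admissible) {ϱ T R C : ℝ} (hT : 0 ≤ T)
    (hC1 : ∀ t, ∀ u : L1 d J, ‖u‖ ≤ 2 * R → ‖sys.rhs t u‖ ≤ C) {h : L1 d J} {u : ℝ → L1 d J}
    (hu : sys.IsSolution ϱ T R h u) :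
    ∃ v, sys.IsGlobalSol ϱ T (2 * R) C h v ∧ Set.EqOn u v (Set.Icc 0 T) := by
  obtain ⟨h1, h2, h3⟩ := hu
  set v : ℝ → L1 d J := fun τ => u (Set.projIcc 0 T hT τ) with hv
  have heq : Set.EqOn u v (Set.Icc 0 T) := fun τ hτ => by
    simp only [hv, Set.projIcc_of_mem hT hτ]
  have hc : Continuous v := by
    have := h1.domRestrict.comp (continuous_projIcc (h := hT))
    exact this
  have hvb : ∀ τ, ‖v τ‖ ≤ 2 * R := fun τ => h2 _ (Set.projIcc 0 T hT τ).2
  have hve : ∀ τ ∈ Set.Icc 0 T, v τ = (∫ s in (0 : ℝ)..τ, sys.rhs (s / ϱ) (v s)) + h := by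
    intro τ hτ
    rw [← heq hτ, h3 τ hτ]
    congr 1
    refine intervalIntegral.integral_congr fun s hs => ?_
    rw [Set.uIcc_of_le hτ.1] at hs
    simp only [hsys.slowRHS_eq]
    rw [heq ⟨hs.1, hs.2.trans hτ.2⟩]
  refine ⟨v, ⟨hc, hvb, hve, fun s t => ?_⟩, heq⟩
  have hp : ∀ τ, v τ = v (Set.projIcc 0 T hT τ) := fun τ => by simp [hv]
  rw [hp s, hp t, hve _ (Set.projIcc 0 T hT s).2, hve _ (Set.projIcc 0 T hT t).2,
    add_sub_add_right_eq_sub]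
  have hi := hsys.continuous_rhs_comp ϱ hc
  rw [intervalIntegral.integral_interval_sub_left (hi.intervalIntegrable _ _)
    (hi.intervalIntegrable _ _)]
  refine (intervalIntegral.norm_integral_le_of_norm_le_const fun x _ => hC1 _ _ (hvb x)).trans ?_
  have hC0 : 0 ≤ C := (norm_nonneg _).trans (hC1 0 _ (hvb 0))
  refine mul_le_mul_of_nonneg_left ?_ hC0
  exact Set.abs_projIcc_sub_projIcc hT

/-- Stability of solutions under perturbations of the equation and of the data. -/
lemma Admissible.norm_sub_le_of_approx (hsys : sys.Admissible) {ϱ T B C δ : ℝ} (hC0 : 0 ≤ C)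
    (hC2 : ∀ t, ∀ u v : L1 d J, ‖u‖ ≤ B → ‖v‖ ≤ B →
      ‖sys.rhs t u - sys.rhs t v‖ ≤ C * ‖u - v‖) {u v : ℝ → L1 d J} (hu : Continuous u)
    (hv : Continuous v) (hub : ∀ τ, ‖u τ‖ ≤ B) (hvb : ∀ τ, ‖v τ‖ ≤ B)
    (h : ∀ τ ∈ Set.Icc 0 T, ‖(u τ - v τ) - ∫ s in (0 : ℝ)..τ,
      (sys.rhs (s / ϱ) (u s) - sys.rhs (s / ϱ) (v s))‖ ≤ δ) {τ : ℝ} (hτ : τ ∈ Set.Icc 0 T) :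
    ‖u τ - v τ‖ ≤ δ * Real.exp (C * τ) := by
  refine gronwall_integral (a := fun τ => ‖u τ - v τ‖) (hu.sub hv).norm hC0 (fun τ hτ => ?_) hτ
  have h1 := h τ hτ
  have hi := (hsys.continuous_rhs_comp ϱ hu).sub (hsys.continuous_rhs_comp ϱ hv)
  have h2 : ‖∫ s in (0 : ℝ)..τ, (sys.rhs (s / ϱ) (u s) - sys.rhs (s / ϱ) (v s))‖ ≤
      C * ∫ s in (0 : ℝ)..τ, ‖u s - v s‖ := by
    rw [← intervalIntegral.integral_const_mul]
    refine (intervalIntegral.norm_integral_le_integral_norm hτ.1).trans ?_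
    refine intervalIntegral.integral_mono_on hτ.1 (hi.norm.intervalIntegrable _ _)
      (((hu.sub hv).norm.const_mul C).intervalIntegrable _ _) fun s _ => ?_
    exact hC2 _ _ _ (hub s) (hvb s)
  calc ‖u τ - v τ‖ ≤ ‖(u τ - v τ) - ∫ s in (0 : ℝ)..τ,
        (sys.rhs (s / ϱ) (u s) - sys.rhs (s / ϱ) (v s))‖ + ‖∫ s in (0 : ℝ)..τ,
        (sys.rhs (s / ϱ) (u s) - sys.rhs (s / ϱ) (v s))‖ := by
        rw [add_comm]; exact norm_le_norm_add_norm_sub' _ _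
    _ ≤ _ := add_le_add h1 h2

lemma Admissible.stability (hsys : sys.Admissible) {ϱ T B C : ℝ} (hC0 : 0 ≤ C)
    (hC2 : ∀ t, ∀ u v : L1 d J, ‖u‖ ≤ B → ‖v‖ ≤ B →
      ‖sys.rhs t u - sys.rhs t v‖ ≤ C * ‖u - v‖) {B' B'' C' C'' : ℝ} {h h' : L1 d J}
    {u v : ℝ → L1 d J} (hu : sys.IsGlobalSol ϱ T B' C' h u)
    (hv : sys.IsGlobalSol ϱ T B'' C'' h' v) (hB' : B' ≤ B) (hB'' : B'' ≤ B) {τ : ℝ}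
    (hτ : τ ∈ Set.Icc 0 T) : ‖u τ - v τ‖ ≤ ‖h - h'‖ * Real.exp (C * τ) := by
  refine hsys.norm_sub_le_of_approx (ϱ := ϱ) hC0 hC2 hu.continuous hv.continuous
    (fun τ => (hu.bound τ).trans hB') (fun τ => (hv.bound τ).trans hB'') (fun τ hτ => ?_) hτ
  rw [intervalIntegral.integral_sub
    ((hsys.continuous_rhs_comp ϱ hu.continuous).intervalIntegrable _ _)
    ((hsys.continuous_rhs_comp ϱ hv.continuous).intervalIntegrable _ _), hu.eq τ hτ, hv.eq τ hτ]
  exact le_of_eq (congrArg norm (by abel))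

end WaveSystem

end Wavepacket

namespace Wavepacket

variable {d J m : ℕ}

section Abstract

variable {E F : Type*} [NormedAddCommGroup E] [NormedSpace ℂ E]
  [NormedAddCommGroup F] [NormedSpace ℂ F]

/-! ### Oscillating integrals in time -/

lemma norm_integral_osc_le {g : ℝ → E} (hg : Continuous g) {B μ : ℝ} (hμ : μ ≠ 0)
    (hB : ∀ s, ‖g s‖ ≤ B) {τ : ℝ} (hτ : 0 ≤ τ) :
    ‖∫ s in (0 : ℝ)..τ, Complex.exp (((s * μ : ℝ) : ℂ) * Complex.I) • g s‖ ≤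
      Real.pi / |μ| * B + ∫ s in (0 : ℝ)..τ, ‖g s - g (s - Real.pi / |μ|)‖ := by
  set δ := Real.pi / |μ| with hδ
  have hδ0 : 0 < δ := div_pos Real.pi_pos (abs_pos.2 hμ)
  set e : ℝ → ℂ := fun s => Complex.exp (((s * μ : ℝ) : ℂ) * Complex.I) with he
  have he1 : ∀ s, ‖e s‖ = 1 := fun s => Complex.norm_exp_ofReal_mul_I _
  have hec : Continuous e := by simp only [he]; fun_prop
  have hes : ∀ s, e (s - δ) = -e s := by
    intro s
    have h1 : (((s - δ) * μ : ℝ) : ℂ) * Complex.I =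
        ((s * μ : ℝ) : ℂ) * Complex.I - ((δ * μ : ℝ) : ℂ) * Complex.I := by push_cast; ring
    simp only [he]
    rw [h1, Complex.exp_sub]
    rcases lt_or_gt_of_ne hμ with h | h
    · have : δ * μ = -Real.pi := by
        rw [hδ, abs_of_neg h]; field_simp
      rw [this]
      simp [Complex.exp_neg, div_neg]
    · have : δ * μ = Real.pi := by
        rw [hδ, abs_of_pos h]; field_simp
      rw [this]
      simp [div_neg]
  set f : ℝ → E := fun s => e s • g s with hf
  have hfc : Continuous f := hec.smul hg
  have hfB : ∀ s, ‖f s‖ ≤ B := fun s => by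
    simp only [hf, norm_smul, he1, one_mul]; exact hB s
  have hi : ∀ a b, IntervalIntegrable f volume a b := fun a b => hfc.intervalIntegrable a b
  have h1 : ∫ s in (0 : ℝ)..τ, e s • (g s - g (s - δ)) =
      (∫ s in (0 : ℝ)..τ, f s) + ∫ s in (0 : ℝ)..τ, f (s - δ) := by
    have hfc2 : Continuous fun s => f (s - δ) := hfc.comp (continuous_sub_right δ)
    rw [← intervalIntegral.integral_add (hi _ _) (hfc2.intervalIntegrable _ _)]
    refine intervalIntegral.integral_congr fun s _ => ?_
    simp only [hf, hes, smul_sub, neg_smul]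
    rw [sub_eq_add_neg]
  rw [intervalIntegral.integral_comp_sub_right f δ] at h1
  have h2 : ∫ s in (0 - δ)..(τ - δ), f s = (∫ s in (0 - δ)..0, f s) +
      (∫ s in (0 : ℝ)..τ, f s) - ∫ s in (τ - δ)..τ, f s := by
    rw [intervalIntegral.integral_add_adjacent_intervals (hi _ _) (hi _ _),
      ← intervalIntegral.integral_add_adjacent_intervals (hi (0 - δ) (τ - δ)) (hi (τ - δ) τ)]
    abel
  have h3 : (2 : ℝ) • ∫ s in (0 : ℝ)..τ, f s = (∫ s in (0 : ℝ)..τ, e s • (g s - g (s - δ))) -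
      (∫ s in (0 - δ)..0, f s) + ∫ s in (τ - δ)..τ, f s := by
    rw [h1, h2, two_smul]
    abel
  have h4 : ∀ a, ‖∫ s in (a - δ)..a, f s‖ ≤ B * δ := by
    intro a
    refine (intervalIntegral.norm_integral_le_of_norm_le_const fun s _ => hfB s).trans ?_
    rw [sub_sub_cancel, abs_of_pos hδ0]
  have h5 : ‖∫ s in (0 : ℝ)..τ, e s • (g s - g (s - δ))‖ ≤
      ∫ s in (0 : ℝ)..τ, ‖g s - g (s - δ)‖ := by
    refine (intervalIntegral.norm_integral_le_integral_norm hτ).trans (le_of_eq ?_)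
    refine intervalIntegral.integral_congr fun s _ => ?_
    simp only [norm_smul, he1, one_mul]
  have h6 : 0 ≤ ∫ s in (0 : ℝ)..τ, ‖g s - g (s - δ)‖ :=
    intervalIntegral.integral_nonneg hτ fun s _ => norm_nonneg _
  have h7 : 2 * ‖∫ s in (0 : ℝ)..τ, f s‖ ≤
      (∫ s in (0 : ℝ)..τ, ‖g s - g (s - δ)‖) + B * δ + B * δ := by
    have : ‖(2 : ℝ) • ∫ s in (0 : ℝ)..τ, f s‖ = 2 * ‖∫ s in (0 : ℝ)..τ, f s‖ := by
      rw [norm_smul]; norm_num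
    rw [← this, h3]
    refine (norm_add_le _ _).trans (add_le_add ((norm_sub_le _ _).trans (add_le_add h5 ?_)) (h4 τ))
    exact h4 0
  change ‖∫ s in (0 : ℝ)..τ, f s‖ ≤ _
  rw [mul_comm δ B]
  linarith

/-! ### Duhamel superpositions -/

lemma integral_norm_duhamel_le [CompleteSpace E] [CompleteSpace F]
    {Λ : ℝ → E →L[ℂ] F} (hΛ : Continuous fun q : ℝ × E => Λ q.1 q.2)
    {C : ℝ} (hC0 : 0 ≤ C) (hC : ∀ τ f, ‖Λ τ f‖ ≤ C * ‖f‖) {w b : ℝ → E} (hw : Continuous w)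
    (hb : Continuous b) {h : E} {T ε Q : ℝ} (hT : 0 ≤ T)
    (he : ∀ τ ∈ Set.Icc 0 T, ‖w τ - (h + ∫ s in (0 : ℝ)..τ, b s)‖ ≤ ε)
    (hh : ∫ τ in (0 : ℝ)..T, ‖Λ τ h‖ ≤ Q)
    (hQ : ∀ s ∈ Set.Icc 0 T, ∫ τ in (0 : ℝ)..T, ‖Λ τ (b s)‖ ≤ Q) :
    ∫ τ in (0 : ℝ)..T, ‖Λ τ (w τ)‖ ≤ Q + T * Q + T * (C * ε) := by
  have hcF : Continuous (Function.uncurry fun τ s => ‖Λ τ (b s)‖) :=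
    (hΛ.comp (continuous_fst.prodMk (hb.comp continuous_snd))).norm
  have hc1 : ∀ f, Continuous fun τ => Λ τ f := fun f =>
    hΛ.comp (continuous_id.prodMk continuous_const)
  have hc2 : Continuous fun τ => ∫ s in (0 : ℝ)..T, ‖Λ τ (b s)‖ :=
    intervalIntegral.continuous_parametric_intervalIntegral_of_continuous' hcF 0 T
  have hpt : ∀ τ ∈ Set.Icc 0 T, ‖Λ τ (w τ)‖ ≤
      ‖Λ τ h‖ + (∫ s in (0 : ℝ)..T, ‖Λ τ (b s)‖) + C * ε := by
    intro τ hτ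
    have h1 : w τ = h + (∫ s in (0 : ℝ)..τ, b s) + (w τ - (h + ∫ s in (0 : ℝ)..τ, b s)) := by abel
    have hcb : Continuous fun s => ‖Λ τ (b s)‖ := ((Λ τ).continuous.comp hb).norm
    have h2 : ‖Λ τ (∫ s in (0 : ℝ)..τ, b s)‖ ≤ ∫ s in (0 : ℝ)..T, ‖Λ τ (b s)‖ := by
      rw [← ContinuousLinearMap.intervalIntegral_comp_comm _ (hb.intervalIntegrable _ _)]
      refine (intervalIntegral.norm_integral_le_integral_norm hτ.1).trans ?_
      refine intervalIntegral.integral_mono_interval le_rfl hτ.1 hτ.2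
        (Filter.Eventually.of_forall fun s => norm_nonneg _) (hcb.intervalIntegrable _ _)
    have h3 : ‖Λ τ (w τ - (h + ∫ s in (0 : ℝ)..τ, b s))‖ ≤ C * ε := by
      exact (hC _ _).trans (mul_le_mul_of_nonneg_left (he τ hτ) hC0)
    have h4 := congrArg (Λ τ) h1
    rw [map_add, map_add] at h4
    rw [h4]
    refine (norm_add_le _ _).trans (add_le_add ((norm_add_le _ _).trans (add_le_add le_rfl h2)) ?_)
    exact h3
  calc ∫ τ in (0 : ℝ)..T, ‖Λ τ (w τ)‖
      ≤ ∫ τ in (0 : ℝ)..T, (‖Λ τ h‖ + (∫ s in (0 : ℝ)..T, ‖Λ τ (b s)‖) + C * ε) := by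
        refine intervalIntegral.integral_mono_on hT ?_ ?_ hpt
        · exact (hΛ.comp (continuous_id.prodMk hw)).norm.intervalIntegrable _ _
        · exact (((hc1 h).norm.add hc2).add continuous_const).intervalIntegrable _ _
    _ = (∫ τ in (0 : ℝ)..T, ‖Λ τ h‖) +
          (∫ s in (0 : ℝ)..T, ∫ τ in (0 : ℝ)..T, ‖Λ τ (b s)‖) + T * (C * ε) := by
        have hcn : Continuous fun τ => ‖Λ τ h‖ := (hc1 h).norm
        have hcs : Continuous fun τ => ‖Λ τ h‖ + ∫ s in (0 : ℝ)..T, ‖Λ τ (b s)‖ := hcn.add hc2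
        have hio : IntegrableOn (Function.uncurry fun τ s => ‖Λ τ (b s)‖)
            (Set.uIoc 0 T ×ˢ Set.uIoc 0 T) :=
          (hcF.continuousOn.integrableOn_compact (isCompact_uIcc.prod isCompact_uIcc)).mono_set
            (Set.prod_mono Set.uIoc_subset_uIcc Set.uIoc_subset_uIcc)
        rw [intervalIntegral.integral_add (hcs.intervalIntegrable _ _)
          (continuous_const.intervalIntegrable _ _),
          intervalIntegral.integral_add (hcn.intervalIntegrable _ _)
          (hc2.intervalIntegrable _ _), intervalIntegral.integral_const,
          intervalIntegral_intervalIntegral_swap hio]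
        simp
    _ ≤ Q + T * Q + T * (C * ε) := by
        refine add_le_add (add_le_add hh ?_) le_rfl
        have : ∫ s in (0 : ℝ)..T, ∫ τ in (0 : ℝ)..T, ‖Λ τ (b s)‖ ≤ ∫ s in (0 : ℝ)..T, Q := by
          refine intervalIntegral.integral_mono_on hT ?_ (continuous_const.intervalIntegrable _ _) hQ
          refine Continuous.intervalIntegrable ?_ _ _
          exact intervalIntegral.continuous_parametric_intervalIntegral_of_continuous'
            (f := fun s τ => ‖Λ τ (b s)‖) (hcF.comp continuous_swap) 0 T
        refine this.trans (le_of_eq ?_)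
        simp

/-! ### Atomic seminorms -/

/-- The seminorms that are at most `1` on the atoms and at most `‖·‖ / η`. -/
def atomTests (A : Set E) (η : ℝ) : Set (Seminorm ℂ E) :=
  {q | (∀ f, q f ≤ ‖f‖ / η) ∧ ∀ a ∈ A, q a ≤ 1}

/-- The largest seminorm that is at most `1` on the atoms and at most `‖·‖ / η`. -/
def atomNorm (A : Set E) (η : ℝ) : Seminorm ℂ E := sSup (atomTests A η)

lemma bddAbove_atomTests (A : Set E) (η : ℝ) : BddAbove (atomTests A η) := by
  rw [Seminorm.bddAbove_iff]
  refine ⟨fun f => ‖f‖ / η, ?_⟩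
  rintro _ ⟨q, hq, rfl⟩
  exact hq.1

lemma le_atomNorm {A : Set E} {η : ℝ} {q : Seminorm ℂ E} (hq : q ∈ atomTests A η) (f : E) :
    q f ≤ atomNorm A η f := (le_csSup (bddAbove_atomTests A η) hq) f

lemma atomNorm_le_of_forall {A : Set E} {η : ℝ} (hη : 0 ≤ η) {f : E} {c : ℝ}
    (h : ∀ q ∈ atomTests A η, q f ≤ c) : atomNorm A η f ≤ c := by
  rw [atomNorm, Seminorm.sSup_apply (bddAbove_atomTests A η)]
  have h0 : (0 : Seminorm ℂ E) ∈ atomTests A η :=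
    ⟨fun f => div_nonneg (norm_nonneg _) hη, fun a _ => zero_le_one⟩
  have : Nonempty (atomTests A η) := ⟨⟨0, h0⟩⟩
  exact ciSup_le fun q => h q.1 q.2

lemma atomNorm_le_norm {A : Set E} {η : ℝ} (hη : 0 ≤ η) (f : E) : atomNorm A η f ≤ ‖f‖ / η :=
  atomNorm_le_of_forall hη fun _ hq => hq.1 f

lemma atomNorm_le_one {A : Set E} {η : ℝ} (hη : 0 ≤ η) {a : E} (ha : a ∈ A) :
    atomNorm A η a ≤ 1 := atomNorm_le_of_forall hη fun _ hq => hq.2 a ha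

lemma continuous_atomNorm {A : Set E} {η : ℝ} (hη : 0 < η) :
    Continuous (atomNorm A η : E → ℝ) := by
  have h1 : ∀ f g, |atomNorm A η f - atomNorm A η g| ≤ η⁻¹ * ‖f - g‖ := fun f g =>
    (abs_sub_map_le_sub _ f g).trans ((atomNorm_le_norm hη.le _).trans
      (le_of_eq (by rw [div_eq_inv_mul])))
  refine (LipschitzWith.of_dist_le_mul (K := ⟨η⁻¹, by positivity⟩) fun f g => ?_).continuous
  rw [Real.dist_eq, dist_eq_norm]
  exact h1 f g

/-- A seminorm with the bounds `C` on atoms and `C / η` overall is at most `C` times the atomic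
seminorm. -/
lemma seminorm_le_atomNorm {A : Set E} {η C : ℝ} (hC : 0 < C) (q : Seminorm ℂ E)
    (h1 : ∀ f, q f ≤ C * (‖f‖ / η)) (h2 : ∀ a ∈ A, q a ≤ C) (f : E) :
    q f ≤ C * atomNorm A η f := by
  set c : NNReal := ⟨C⁻¹, by positivity⟩
  have hq : c • q ∈ atomTests A η := by
    refine ⟨fun f => ?_, fun a ha => ?_⟩
    · change C⁻¹ * q f ≤ _
      rw [inv_mul_le_iff₀ hC]
      exact h1 f
    · change C⁻¹ * q a ≤ _
      rw [inv_mul_le_iff₀ hC, mul_one]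
      exact h2 a ha
  have h3 : C⁻¹ * q f ≤ atomNorm A η f := le_atomNorm hq f
  rwa [inv_mul_le_iff₀ hC] at h3

lemma atomNorm_integral_le [CompleteSpace E] {A : Set E} {η : ℝ} (hη : 0 < η) {b : ℝ → E}
    (hb : Continuous b) {τ : ℝ} (hτ : 0 ≤ τ) :
    atomNorm A η (∫ s in (0 : ℝ)..τ, b s) ≤ ∫ s in (0 : ℝ)..τ, atomNorm A η (b s) := by
  rcases hτ.eq_or_lt with rfl | hτ
  · simp
  have hN := continuous_atomNorm (A := A) hη
  have hv : volume (Set.Ioc 0 τ) = ENNReal.ofReal τ := by rw [Real.volume_Ioc, sub_zero]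
  have h := (atomNorm A η).convexOn.map_set_average_le (μ := volume) (t := Set.Ioc 0 τ) (f := b)
    hN.continuousOn isClosed_univ (by rw [hv]; simpa using hτ) (by rw [hv]; simp) (by simp)
    (hb.integrableOn_Ioc) ((hN.comp hb).integrableOn_Ioc)
  have hv2 : (volume : Measure ℝ).real (Set.Ioc 0 τ) = τ := by
    rw [Measure.real, hv, ENNReal.toReal_ofReal hτ.le]
  rw [setAverage_eq, setAverage_eq, hv2, ← intervalIntegral.integral_of_le hτ.le,
    ← intervalIntegral.integral_of_le hτ.le, smul_eq_mul] at h
  have h2 : atomNorm A η (τ⁻¹ • ∫ s in (0 : ℝ)..τ, b s) =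
      τ⁻¹ * atomNorm A η (∫ s in (0 : ℝ)..τ, b s) := by
    have : (τ⁻¹ • ∫ s in (0 : ℝ)..τ, b s) = ((τ⁻¹ : ℝ) : ℂ) • ∫ s in (0 : ℝ)..τ, b s :=
      (Complex.coe_smul _ _).symm
    rw [this, map_smul_eq_mul, Complex.norm_real, Real.norm_of_nonneg (inv_nonneg.2 hτ.le)]
  rw [h2] at h
  exact le_of_mul_le_mul_left h (inv_pos.2 hτ)

end Abstract

/-! ### The logarithmic integral -/

lemma integral_div_add_abs_le {A T : ℝ} (hA : 0 < A) (hT : 0 ≤ T) (s₀ : ℝ) :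
    ∫ s in (0 : ℝ)..T, A / (A + |s - s₀|) ≤ 2 * A * Real.log (1 + T / A) := by
  set s₁ := max 0 (min s₀ T) with hs₁
  have h01 : 0 ≤ s₁ := le_max_left _ _
  have h1T : s₁ ≤ T := max_le hT (min_le_right _ _)
  have hc : Continuous fun s => A / (A + |s - s₁|) := by
    refine continuous_const.div (by fun_prop) fun s => ?_
    positivity
  have hc0 : Continuous fun s => A / (A + |s - s₀|) := by
    refine continuous_const.div (by fun_prop) fun s => ?_
    positivity
  have hle : ∀ s ∈ Set.Icc 0 T, A / (A + |s - s₀|) ≤ A / (A + |s - s₁|) := by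
    intro s hs
    refine div_le_div_of_nonneg_left hA.le (by positivity) (add_le_add le_rfl ?_)
    rcases le_total s₀ 0 with h | h
    · have : s₁ = 0 := by rw [hs₁, min_eq_left (h.trans hT), max_eq_left h]
      rw [this, abs_of_nonneg (by linarith [hs.1]), abs_of_nonneg (by linarith [hs.1])]
      linarith
    · rcases le_total s₀ T with h' | h'
      · have : s₁ = s₀ := by rw [hs₁, min_eq_left h', max_eq_right h]
        rw [this]
      · have : s₁ = T := by rw [hs₁, min_eq_right h', max_eq_right hT]
        rw [this, abs_of_nonpos (by linarith [hs.2]), abs_of_nonpos (by linarith [hs.2])]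
        linarith
  have hlog : ∀ r, 0 ≤ r → r ≤ T → ∫ x in (0 : ℝ)..r, A / (A + x) ≤ A * Real.log (1 + T / A) := by
    intro r hr hrT
    have h1 : ∫ x in (0 : ℝ)..r, A / (A + x) = A * ∫ x in (0 : ℝ)..r, (x + A)⁻¹ := by
      rw [← intervalIntegral.integral_const_mul]
      refine intervalIntegral.integral_congr fun x _ => ?_
      simp only [div_eq_mul_inv, add_comm]
    rw [h1, intervalIntegral.integral_comp_add_right (fun x => x⁻¹) A, zero_add,
      integral_inv_of_pos hA (by linarith)]
    refine mul_le_mul_of_nonneg_left (Real.log_le_log (by positivity) ?_) hA.le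
    rw [add_div, div_self hA.ne', add_comm]
    gcongr
  calc ∫ s in (0 : ℝ)..T, A / (A + |s - s₀|)
      ≤ ∫ s in (0 : ℝ)..T, A / (A + |s - s₁|) :=
        intervalIntegral.integral_mono_on hT (hc0.intervalIntegrable _ _)
          (hc.intervalIntegrable _ _) hle
    _ = (∫ s in (0 : ℝ)..s₁, A / (A + |s - s₁|)) + ∫ s in s₁..T, A / (A + |s - s₁|) :=
        (intervalIntegral.integral_add_adjacent_intervals (hc.intervalIntegrable _ _)
          (hc.intervalIntegrable _ _)).symm
    _ ≤ A * Real.log (1 + T / A) + A * Real.log (1 + T / A) := by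
        refine add_le_add ?_ ?_
        · refine le_trans (le_of_eq ?_) (hlog s₁ h01 h1T)
          have h := intervalIntegral.integral_comp_sub_left
            (fun x => A / (A + x)) s₁ (a := 0) (b := s₁)
          rw [sub_self, sub_zero] at h
          rw [← h]
          refine intervalIntegral.integral_congr fun s hs => ?_
          rw [Set.uIcc_of_le h01] at hs
          rw [abs_of_nonpos (by linarith [hs.2]), neg_sub]
        · refine le_trans (le_of_eq ?_) (hlog (T - s₁) (by linarith) (by linarith))
          have h := intervalIntegral.integral_comp_sub_right
            (fun x => A / (A + x)) s₁ (a := s₁) (b := T)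
          rw [sub_self] at h
          rw [← h]
          refine intervalIntegral.integral_congr fun s hs => ?_
          rw [Set.uIcc_of_le h1T] at hs
          rw [abs_of_nonneg (by linarith [hs.1])]
    _ = _ := by ring

/-! ### Weak gradients -/

lemma sub_eq_integral_of_weakGradient {u : X d → V J} (hu : Integrable u)
    {g : X d → (X d →L[ℝ] V J)} (hgm : StronglyMeasurable g)
    (hG : HasIntegrableWeakGradient u g) (h : X d) :
    Integrable (fun q : X d × ℝ => g (q.1 + q.2 • h) h)
      (volume.prod (volume.restrict (Set.Ioc 0 1))) ∧
    (∀ᵐ k, u (k + h) - u k = ∫ t in Set.Ioc (0 : ℝ) 1, g (k + t • h) h) := by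
  have hcont : Continuous fun q : X d × ℝ => q.1 + q.2 • h := by fun_prop
  have hm1 : StronglyMeasurable fun q : X d × ℝ => g (q.1 + q.2 • h) h :=
    (ContinuousLinearMap.apply ℝ (V J) h).continuous.comp_stronglyMeasurable
      (hgm.comp_measurable hcont.measurable)
  have hgh : Integrable fun k => g k h := (ContinuousLinearMap.apply ℝ (V J) h).integrable_comp hG.1
  have hint : Integrable (fun q : X d × ℝ => g (q.1 + q.2 • h) h)
      (volume.prod (volume.restrict (Set.Ioc 0 1))) := by
    rw [integrable_prod_iff' hm1.aestronglyMeasurable]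
    refine ⟨Filter.Eventually.of_forall fun t => hgh.comp_add_right (t • h), ?_⟩
    have : (fun t : ℝ => ∫ k : X d, ‖g (k + t • h) h‖) = fun _ => ∫ k, ‖g k h‖ :=
      funext fun t => integral_add_right_eq_self (fun k => ‖g k h‖) (t • h)
    simp only [this]
    exact integrable_const _
  refine ⟨hint, ?_⟩
  have hL : Integrable fun k => u (k + h) - u k := (hu.comp_add_right h).sub hu
  refine ae_eq_of_integral_contDiff_smul_eq hL.locallyIntegrable
    (hint.integral_prod_left).locallyIntegrable fun φ hφ hφc => ?_
  obtain ⟨B, hB⟩ := hφc.exists_bound_of_continuous hφ.continuous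
  have hφ' : Continuous (fderiv ℝ φ) := hφ.continuous_fderiv (by simp)
  obtain ⟨B', hB'⟩ := (hφc.fderiv ℝ).exists_bound_of_continuous hφ'
  have hφm : ∀ {v : X d → V J}, Integrable v → ∀ a, Integrable fun k => φ (k - a) • v k := by
    intro v hv a
    refine hv.bdd_smul (φ := fun k => φ (k - a)) B ?_ ?_
    · exact (hφ.continuous.comp (continuous_sub_right a)).aestronglyMeasurable
    · exact Filter.Eventually.of_forall fun k => hB _
  have e1 : ∫ k, φ k • (u (k + h) - u k) = ∫ k, (φ (k - h) - φ k) • u k := by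
    have h1 : ∫ k, φ k • u (k + h) = ∫ k, φ (k - h) • u k := by
      rw [← integral_add_right_eq_self (fun k => φ (k - h) • u k) h]
      simp
    have h2 : Integrable fun k => φ k • u k := by simpa using hφm hu 0
    have h3 : Integrable fun k => φ k • u (k + h) := by
      simpa using hφm (hu.comp_add_right h) 0
    simp only [smul_sub, sub_smul]
    rw [integral_sub h3 h2, integral_sub (hφm hu h) h2, h1]
  have e2 : ∀ k, φ (k - h) - φ k = -∫ t in Set.Ioc (0 : ℝ) 1, fderiv ℝ φ (k - t • h) h := by
    intro k
    rw [← intervalIntegral.integral_of_le zero_le_one]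
    have hd : ∀ t ∈ Set.uIcc (0 : ℝ) 1, HasDerivAt (fun t : ℝ => φ (k - t • h))
        (-(fderiv ℝ φ (k - t • h) h)) t := by
      intro t _
      have h1 : HasFDerivAt φ (fderiv ℝ φ (k - t • h)) (k - t • h) :=
        (hφ.differentiable (by simp) _).hasFDerivAt
      have h2 : HasDerivAt (fun t : ℝ => k - t • h) (-h) t := by
        simpa using ((hasDerivAt_id t).smul_const h).const_sub k
      have h4 := h1.comp_hasDerivAt t h2
      rw [map_neg] at h4
      exact h4
    have hc : Continuous fun t : ℝ => fderiv ℝ φ (k - t • h) h := by fun_prop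
    have h3 := intervalIntegral.integral_eq_sub_of_hasDerivAt hd (hc.neg.intervalIntegrable _ _)
    rw [intervalIntegral.integral_neg] at h3
    simpa using h3.symm
  have i2 : Integrable (fun q : X d × ℝ => (fderiv ℝ φ (q.1 - q.2 • h) h) • u q.1)
      (volume.prod (volume.restrict (Set.Ioc 0 1))) := by
    refine (hu.comp_fst _).bdd_smul
      (φ := fun q : X d × ℝ => fderiv ℝ φ (q.1 - q.2 • h) h) (B' * ‖h‖) ?_ ?_
    · exact Continuous.aestronglyMeasurable (by fun_prop)
    · exact Filter.Eventually.of_forall fun q =>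
        (ContinuousLinearMap.le_opNorm _ _).trans (by gcongr; exact hB' _)
  have i3 : Integrable (fun q : X d × ℝ => φ q.1 • g (q.1 + q.2 • h) h)
      (volume.prod (volume.restrict (Set.Ioc 0 1))) := by
    refine hint.bdd_smul (φ := fun q : X d × ℝ => φ q.1) B ?_ (Filter.Eventually.of_forall fun q => hB _)
    exact (hφ.continuous.comp continuous_fst).aestronglyMeasurable
  have e3 : ∀ t : ℝ, ∫ k, (fderiv ℝ φ (k - t • h) h) • u k = -∫ k, φ k • g (k + t • h) h := by
    intro t
    have hcs : HasCompactSupport fun k => φ (k - t • h) :=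
      hφc.comp_homeomorph (Homeomorph.subRight (t • h))
    have h1 := hG.2 (fun k => φ (k - t • h)) (hφ.comp (contDiff_id.sub contDiff_const)) hcs h
    have h2 : ∫ k, φ (k - t • h) • g k h = ∫ k, φ k • g (k + t • h) h := by
      rw [← integral_add_right_eq_self (fun k => φ (k - t • h) • g k h) (t • h)]
      simp
    rw [h2] at h1
    rw [← h1]
    simp only [fderiv_comp_sub]
  calc ∫ k, φ k • (u (k + h) - u k)
      = -∫ k, ∫ t in Set.Ioc (0 : ℝ) 1, (fderiv ℝ φ (k - t • h) h) • u k := by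
        rw [e1, ← integral_neg]
        refine integral_congr_ae (Filter.Eventually.of_forall fun k => ?_)
        simp only [e2, neg_smul]
        rw [integral_smul_const]
    _ = -∫ t in Set.Ioc (0 : ℝ) 1, ∫ k, (fderiv ℝ φ (k - t • h) h) • u k := by
        rw [integral_integral_swap i2]
    _ = ∫ t in Set.Ioc (0 : ℝ) 1, ∫ k, φ k • g (k + t • h) h := by
        simp only [e3]
        rw [integral_neg, neg_neg]
    _ = ∫ k, ∫ t in Set.Ioc (0 : ℝ) 1, φ k • g (k + t • h) h := (integral_integral_swap i3).symm
    _ = _ := by simp only [integral_smul]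

lemma norm_translate_sub_le_of_weakGradient {f : L1 d J} {u : X d → V J} (hu : f =ᵐ[volume] u)
    {G : X d → (X d →L[ℝ] V J)} (hG : HasIntegrableWeakGradient u G) (h : X d) :
    ‖translate h f - f‖ ≤ ‖h‖ * ∫ k, ‖G k‖ := by
  set g := hG.1.1.mk G with hg
  have hgG : G =ᵐ[volume] g := hG.1.1.ae_eq_mk
  have hG' : HasIntegrableWeakGradient u g := by
    refine ⟨hG.1.congr hgG, fun φ hφ hφc v => ?_⟩
    rw [hG.2 φ hφ hφc v]
    congr 1
    refine integral_congr_ae ?_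
    filter_upwards [hgG] with k hk
    rw [hk]
  obtain ⟨h1, h2⟩ := sub_eq_integral_of_weakGradient ((integrable_coe f).congr hu)
    hG.1.1.stronglyMeasurable_mk hG' h
  have hsh : ∀ᵐ k, f (k + h) = u (k + h) :=
    (measurePreserving_add_right volume h).quasiMeasurePreserving.ae hu
  have e : ‖translate h f - f‖ = ∫ k, ‖∫ t in Set.Ioc (0 : ℝ) 1, g (k + t • h) h‖ := by
    rw [L1.norm_eq_integral_norm]
    refine integral_congr_ae ?_
    filter_upwards [Lp.coeFn_sub (translate h f) f, translate_coe h f, hsh, hu, h2]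
      with k a1 a2 a3 a4 a5
    rw [a1, Pi.sub_apply, a2, a3, a4, a5]
  calc ‖translate h f - f‖
      ≤ ∫ k, ∫ t in Set.Ioc (0 : ℝ) 1, ‖g (k + t • h) h‖ := by
        rw [e]
        exact integral_mono h1.integral_prod_left.norm h1.norm.integral_prod_left fun k =>
          norm_integral_le_integral_norm _
    _ = ∫ t in Set.Ioc (0 : ℝ) 1, ∫ k, ‖g (k + t • h) h‖ := integral_integral_swap h1.norm
    _ = ∫ k, ‖g k h‖ := by
        have : ∀ t : ℝ, ∫ k, ‖g (k + t • h) h‖ = ∫ k, ‖g k h‖ := fun t =>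
          integral_add_right_eq_self (fun k => ‖g k h‖) (t • h)
        simp [this]
    _ ≤ ∫ k, ‖h‖ * ‖g k‖ := by
        refine integral_mono ?_ (hG'.1.norm.const_mul _) fun k => ?_
        · exact ((ContinuousLinearMap.apply ℝ (V J) h).integrable_comp hG'.1).norm
        · exact ((g k).le_opNorm h).trans (le_of_eq (mul_comm _ _))
    _ = ‖h‖ * ∫ k, ‖G k‖ := by
        rw [integral_const_mul]
        congr 1
        refine integral_congr_ae ?_
        filter_upwards [hgG] with k hk
        rw [hk]

end Wavepacket

namespace Wavepacket

variable {d J m : ℕ}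

/-! ### Oscillating kernels -/

/-- The unimodular number `exp(i x)`. -/
def cis (x : ℝ) : ℂ := Complex.exp ((x : ℂ) * Complex.I)

lemma norm_cis (x : ℝ) : ‖cis x‖ = 1 := Complex.norm_exp_ofReal_mul_I x

lemma cis_zero : cis 0 = 1 := by simp [cis]

lemma cis_pi : cis Real.pi = -1 := Complex.exp_pi_mul_I

lemma cis_add (x y : ℝ) : cis (x + y) = cis x * cis y := by
  rw [cis, cis, cis, ← Complex.exp_add]; push_cast; ring_nf

lemma continuous_cis : Continuous cis := by unfold cis; fun_prop

lemma norm_cis_sub_le (x y : ℝ) : ‖cis x - cis y‖ ≤ |x - y| := by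
  have h : cis x - cis y = cis y * (cis (x - y) - 1) := by
    rw [mul_sub, ← cis_add, mul_one, add_sub_cancel]
  rw [h, norm_mul, norm_cis, one_mul]
  have := Real.norm_exp_I_mul_ofReal_sub_one_le (x := x - y)
  rw [mul_comm, Real.norm_eq_abs] at this
  exact this

/-- Multiplication of a kernel by `exp(i θ)`. -/
def osc (θ : (Fin m → X d) → ℝ) (K : (Fin m → X d) → Mult J m) (kk : Fin m → X d) : Mult J m :=
  cis (θ kk) • K kk

lemma norm_osc (θ : (Fin m → X d) → ℝ) (K : (Fin m → X d) → Mult J m) (kk : Fin m → X d) :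
    ‖osc θ K kk‖ = ‖K kk‖ := by rw [osc, norm_smul, norm_cis, one_mul]

lemma continuous_osc {θ : (Fin m → X d) → ℝ} (hθ : Continuous θ)
    {K : (Fin m → X d) → Mult J m} (hK : Continuous K) : Continuous (osc θ K) :=
  (continuous_cis.comp hθ).smul hK

lemma op_smul (hm : 0 < m) {K : (Fin m → X d) → Mult J m} (hK : IsBddMeas K) (z : ℂ)
    (f : Fin m → L1 d J) : op (fun kk => z • K kk) f = z • op K f := by
  have hz : IsBddMeas (scal (fun _ => z) : X d → (V J →L[ℂ] V J)) :=
    isBddMeas_scal continuous_const fun _ => le_rfl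
  have h : mul (scal fun _ : X d => z) (op K f) = z • op K f := by
    refine Lp.ext ?_
    filter_upwards [mul_coe hz (op K f), Lp.coeFn_smul z (op K f)] with k h1 h2
    rw [h1, h2]
    rfl
  rw [← h, mul_op hm hz hK]
  rfl

/-- The modulation `exp(i⟨y, k⟩)`. -/
def modul (y : X d) : X d → (V J →L[ℂ] V J) := scal fun k => cis (inner ℝ y k)

lemma isBddMeas_modul (y : X d) : IsBddMeas (modul y : X d → (V J →L[ℂ] V J)) := by
  refine isBddMeas_scal (C := 1) ?_ fun k => (norm_cis _).le
  exact continuous_cis.comp (continuous_const.inner continuous_id)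

lemma modul_apply (y k : X d) (x : V J) : modul y k x = cis (inner ℝ y k) • x := rfl

lemma norm_mul_modul (y : X d) (f : L1 d J) : ‖mul (modul y) f‖ = ‖f‖ := by
  rw [norm_mul_eq (isBddMeas_modul y), L1.norm_eq_integral_norm]
  refine integral_congr_ae (Filter.Eventually.of_forall fun k => ?_)
  simp only [modul_apply, norm_smul, norm_cis, one_mul]

lemma wnorm_modul (c y : X d) (f : L1 d J) : wnorm c (mul (modul y) f) = wnorm c f := by
  refine integral_congr_ae ?_
  filter_upwards [mul_coe (isBddMeas_modul y) f] with k hk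
  rw [hk, modul_apply, norm_smul, norm_cis, one_mul]

lemma mul_modul_zero (f : L1 d J) : mul (modul 0) f = f := by
  refine Lp.ext ?_
  filter_upwards [mul_coe (isBddMeas_modul 0) f] with k hk
  rw [hk, modul_apply, inner_zero_left, cis_zero, one_smul]

lemma mul_modul_op (hm : 0 < m) {θ : (Fin m → X d) → ℝ} (hθ : Continuous θ)
    {K : (Fin m → X d) → Mult J m} (hK : Continuous K) {B : ℝ} (hB : ∀ kk, ‖K kk‖ ≤ B)
    (y' : X d) (y : Fin m → X d) (f : Fin m → L1 d J) :
    mul (modul y') (op (osc θ K) f) =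
      op (osc (fun kk => θ kk + (inner ℝ y' (∑ j, kk j) - ∑ j, inner ℝ (y j) (kk j))) K)
        fun j => mul (modul (y j)) (f j) := by
  have h1 : IsBddMeas (osc θ K) :=
    IsBddMeas.of_continuous (continuous_osc hθ hK) fun kk => (norm_osc θ K kk).le.trans (hB kk)
  have hθ' : Continuous fun kk : Fin m → X d =>
      θ kk + (inner ℝ y' (∑ j, kk j) - ∑ j, inner ℝ (y j) (kk j)) := by fun_prop
  have h2 : IsBddMeas (osc (fun kk => θ kk +
      (inner ℝ y' (∑ j, kk j) - ∑ j, inner ℝ (y j) (kk j))) K) :=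
    IsBddMeas.of_continuous (continuous_osc hθ' hK) fun kk => (norm_osc _ K kk).le.trans (hB kk)
  rw [mul_op hm (isBddMeas_modul y') h1]
  refine op_congr hm (isBddMeas_outMul hm (isBddMeas_modul y') h1) h2 ?_
  filter_upwards [ae_forall_coord fun j => mul_coe (isBddMeas_modul (y j)) (f j)] with kk hkk
  simp only [hkk, modul_apply]
  rw [ContinuousMultilinearMap.map_smul_univ]
  simp only [outMul, osc, ContinuousLinearMap.compContinuousMultilinearMap_coe,
    Function.comp_apply, smul_apply, modul_apply, smul_smul]
  congr 1
  have h3 : ∏ j, cis (inner ℝ (y j) (kk j)) = cis (∑ j, inner ℝ (y j) (kk j)) := by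
    simp only [cis, ← Complex.exp_sum]
    push_cast
    rw [Finset.sum_mul]
  rw [h3, ← cis_add, ← cis_add]
  congr 1
  ring

/-- A monomial of the interaction system with a global symbol for each of the frequencies: the
kernel `K` with the phase `Ωo(∑ k_j) - ∑ Ω_j(k_j)`, together with the regularity bounds near the
centres `c_j`. -/
structure PhaseMono (d J m : ℕ) where
  K : (Fin m → X d) → Mult J m
  c : Fin m → X d
  Ωo : X d → ℝ
  Ω : Fin m → X d → ℝ
  vo : X d
  v : Fin m → X d
  B : ℝ
  pos : 0 < m
  one_le : 1 ≤ B
  norm_K_le : ∀ kk, ‖K kk‖ ≤ B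
  lip_K : ∀ kk kk', ‖K kk - K kk'‖ ≤ B * ‖kk - kk'‖
  cont_o : Continuous Ωo
  cont : ∀ j, Continuous (Ω j)
  near_o : ∀ k, |Ωo k - Ωo (∑ j, c j)| ≤ B * dist1 (∑ j, c j) k
  near : ∀ j k, |Ω j k - Ω j (c j)| ≤ B * dist1 (c j) k
  taylor_o : ∀ k h, |Ωo (k + h) - Ωo k - inner ℝ vo h| ≤ B * ‖h‖ * (dist1 (∑ j, c j) k + ‖h‖)
  taylor : ∀ j k h, |Ω j (k + h) - Ω j k - inner ℝ (v j) h| ≤ B * ‖h‖ * (dist1 (c j) k + ‖h‖)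

namespace PhaseMono

variable (P : PhaseMono d J m)

/-- The interaction phase. -/
def phi (kk : Fin m → X d) : ℝ := P.Ωo (∑ j, kk j) - ∑ j, P.Ω j (kk j)

/-- The kernel at the fast time `t`. -/
def ker (t : ℝ) : (Fin m → X d) → Mult J m := osc (fun kk => t * P.phi kk) P.K

lemma continuous_K : Continuous P.K := by
  refine (LipschitzWith.of_dist_le_mul (K := ⟨P.B, zero_le_one.trans P.one_le⟩)
    fun kk kk' => ?_).continuous
  rw [dist_eq_norm, dist_eq_norm]
  exact P.lip_K kk kk'

lemma continuous_phi : Continuous P.phi := by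
  have h1 := P.cont_o
  have h2 := P.cont
  unfold phi
  fun_prop

lemma norm_osc_le (θ : (Fin m → X d) → ℝ) (kk : Fin m → X d) : ‖osc θ P.K kk‖ ≤ P.B :=
  (norm_osc θ P.K kk).le.trans (P.norm_K_le kk)

lemma isBddMeas_osc {θ : (Fin m → X d) → ℝ} (hθ : Continuous θ) : IsBddMeas (osc θ P.K) :=
  IsBddMeas.of_continuous (continuous_osc hθ P.continuous_K) (P.norm_osc_le θ)

lemma isBddMeas_ker (t : ℝ) : IsBddMeas (P.ker t) :=
  P.isBddMeas_osc (continuous_const.mul P.continuous_phi)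

lemma norm_ker_le (t : ℝ) (kk : Fin m → X d) : ‖P.ker t kk‖ ≤ P.B := P.norm_osc_le _ kk

lemma B_nonneg : 0 ≤ P.B := zero_le_one.trans P.one_le

lemma norm_op_le (t : ℝ) (f : Fin m → L1 d J) : ‖op (P.ker t) f‖ ≤ P.B * ∏ j, ‖f j‖ :=
  Wavepacket.norm_op_le P.pos (P.isBddMeas_ker t)
    (Filter.Eventually.of_forall (P.norm_ker_le t)) f

lemma norm_op_le_pow (t : ℝ) {f : Fin m → L1 d J} {b : ℝ} (hf : ∀ j, ‖f j‖ ≤ b) :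
    ‖op (P.ker t) f‖ ≤ P.B * b ^ m := by
  refine (P.norm_op_le t f).trans (mul_le_mul_of_nonneg_left ?_ P.B_nonneg)
  have := prod_le_pow_card_of_nonneg Finset.univ (fun j => norm_nonneg (f j)) hf
  rwa [Finset.card_univ, Fintype.card_fin] at this

lemma continuous_op : Continuous fun q : ℝ × (Fin m → L1 d J) => op (P.ker q.1) q.2 := by
  refine Wavepacket.continuous_op P.pos P.isBddMeas_ker
    (fun t => Filter.Eventually.of_forall (P.norm_ker_le t))
    (Filter.Eventually.of_forall fun kk => ?_)
  exact (continuous_cis.comp (continuous_id.mul continuous_const)).smul continuous_const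

lemma abs_phi_sub_le (kk : Fin m → X d) :
    |P.phi kk - P.phi P.c| ≤ 2 * P.B * ∑ j, dist1 (P.c j) (kk j) := by
  have h1 : P.phi kk - P.phi P.c = (P.Ωo (∑ j, kk j) - P.Ωo (∑ j, P.c j)) -
      ∑ j, (P.Ω j (kk j) - P.Ω j (P.c j)) := by
    simp only [phi, Finset.sum_sub_distrib]; ring
  have h2 : |∑ j, (P.Ω j (kk j) - P.Ω j (P.c j))| ≤ P.B * ∑ j, dist1 (P.c j) (kk j) := by
    refine (Finset.abs_sum_le_sum_abs _ _).trans ?_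
    rw [Finset.mul_sum]
    exact Finset.sum_le_sum fun j _ => P.near j (kk j)
  have h3 := (P.near_o (∑ j, kk j)).trans
    (mul_le_mul_of_nonneg_left (dist1_sum_le P.c kk) P.B_nonneg)
  rw [h1]
  refine (abs_sub _ _).trans ?_
  linarith

/-- The phase after the modulations `y'` of the output and `y j` of the inputs. -/
def theta (t : ℝ) (y' : X d) (y : Fin m → X d) (kk : Fin m → X d) : ℝ :=
  t * P.phi kk + (inner ℝ y' (∑ j, kk j) - ∑ j, inner ℝ (y j) (kk j))

lemma continuous_theta (t : ℝ) (y' : X d) (y : Fin m → X d) : Continuous (P.theta t y' y) := by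
  have := P.continuous_phi
  unfold theta
  fun_prop

/-- The linear part of the change of the phase under the shift `u`. -/
def shiftPhase (t : ℝ) (y' : X d) (y u : Fin m → X d) : ℝ :=
  t * (inner ℝ P.vo (∑ j, u j) - ∑ j, inner ℝ (P.v j) (u j)) +
    (inner ℝ y' (∑ j, u j) - ∑ j, inner ℝ (y j) (u j))

lemma abs_theta_shift_le (t : ℝ) (y' : X d) (y u kk : Fin m → X d) {ν : ℝ} (hν : 0 ≤ ν)
    (hu : ∀ j, ‖u j‖ ≤ ν) :
    |P.theta t y' y (kk + u) - P.theta t y' y kk - P.shiftPhase t y' y u| ≤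
      |t| * (2 * P.B * m ^ 2 * ν) * (ν + ∑ j, dist1 (P.c j) (kk j)) := by
  set D := ∑ j, dist1 (P.c j) (kk j) with hD
  have hD0 : 0 ≤ D := Finset.sum_nonneg fun j _ => dist1_nonneg _ _
  have hB := P.B_nonneg
  have hm1 : (1 : ℝ) ≤ m := by exact_mod_cast P.pos
  have hsum : ‖∑ j, u j‖ ≤ m * ν := by
    refine (norm_sum_le _ _).trans ((Finset.sum_le_sum fun j _ => hu j).trans (le_of_eq ?_))
    simp
  have e1 : P.theta t y' y (kk + u) - P.theta t y' y kk - P.shiftPhase t y' y u =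
      t * ((P.Ωo (∑ j, kk j + ∑ j, u j) - P.Ωo (∑ j, kk j) - inner ℝ P.vo (∑ j, u j)) -
        ∑ j, (P.Ω j (kk j + u j) - P.Ω j (kk j) - inner ℝ (P.v j) (u j))) := by
    simp only [theta, shiftPhase, phi, Pi.add_apply, Finset.sum_add_distrib, inner_add_right,
      Finset.sum_sub_distrib]
    ring
  have h1 : |P.Ωo (∑ j, kk j + ∑ j, u j) - P.Ωo (∑ j, kk j) - inner ℝ P.vo (∑ j, u j)| ≤
      P.B * (m * ν) * (D + m * ν) := by
    refine (P.taylor_o _ _).trans ?_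
    have hd := dist1_nonneg (∑ j, P.c j) (∑ j, kk j)
    have hd' := dist1_sum_le P.c kk
    gcongr
  have h2 : |∑ j, (P.Ω j (kk j + u j) - P.Ω j (kk j) - inner ℝ (P.v j) (u j))| ≤
      P.B * ν * (D + m * ν) := by
    refine (Finset.abs_sum_le_sum_abs _ _).trans ?_
    calc _ ≤ ∑ j, P.B * ν * (dist1 (P.c j) (kk j) + ν) := by
          refine Finset.sum_le_sum fun j _ => (P.taylor j _ _).trans ?_
          have := dist1_nonneg (P.c j) (kk j)
          gcongr <;> exact hu j
      _ = _ := by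
          rw [← Finset.mul_sum, Finset.sum_add_distrib, hD]
          simp
  rw [e1, abs_mul, mul_assoc]
  refine mul_le_mul_of_nonneg_left ((abs_sub _ _).trans ((add_le_add h1 h2).trans ?_))
    (abs_nonneg t)
  have h3 : D + m * ν ≤ m * (ν + D) := by nlinarith
  have h4 : P.B * ν ≤ P.B * (m * ν) := by
    refine mul_le_mul_of_nonneg_left ?_ hB
    nlinarith
  have h5 : 0 ≤ m * (ν + D) := by positivity
  calc P.B * (m * ν) * (D + m * ν) + P.B * ν * (D + m * ν)
      ≤ P.B * (m * ν) * (m * (ν + D)) + P.B * (m * ν) * (m * (ν + D)) := by gcongr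
    _ = _ := by ring

lemma norm_osc_shift_le (t : ℝ) (y' : X d) (y u kk : Fin m → X d) {ν : ℝ} (hν : 0 ≤ ν)
    (hu : ∀ j, ‖u j‖ ≤ ν) :
    ‖osc (P.theta t y' y) P.K (kk + u) -
        cis (P.shiftPhase t y' y u) • osc (P.theta t y' y) P.K kk‖ ≤
      (P.B * ν + P.B * (|t| * (2 * P.B * m ^ 2 * ν) * ν)) +
        P.B * (|t| * (2 * P.B * m ^ 2 * ν)) * ∑ j, dist1 (P.c j) (kk j) := by
  set θ := P.theta t y' y
  set α := P.shiftPhase t y' y u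
  have e : osc θ P.K (kk + u) - cis α • osc θ P.K kk =
      cis (θ (kk + u)) • (P.K (kk + u) - P.K kk) +
        (cis (θ (kk + u)) - cis (α + θ kk)) • P.K kk := by
    rw [osc, osc, smul_smul, ← cis_add]
    module
  rw [e]
  refine (norm_add_le _ _).trans ?_
  rw [norm_smul, norm_smul, norm_cis, one_mul]
  have h1 : ‖P.K (kk + u) - P.K kk‖ ≤ P.B * ν := by
    refine (P.lip_K _ _).trans (mul_le_mul_of_nonneg_left ?_ P.B_nonneg)
    rw [add_sub_cancel_left]
    exact (pi_norm_le_iff_of_nonneg hν).2 hu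
  have h2 : ‖cis (θ (kk + u)) - cis (α + θ kk)‖ ≤ _ :=
    (norm_cis_sub_le _ _).trans ((le_of_eq (by congr 1; ring)).trans
      (P.abs_theta_shift_le t y' y u kk hν hu))
  have h3 := mul_le_mul h2 (P.norm_K_le kk) (norm_nonneg _) ((norm_nonneg _).trans h2)
  refine (add_le_add h1 h3).trans (le_of_eq ?_)
  ring

lemma shift_bound {B M p q ν a t w S : ℝ} (hB : 1 ≤ B) (hM : 1 ≤ M) (hq : 0 ≤ q) (hqp : q ≤ p)
    (hν : 0 ≤ ν) (ha : 0 ≤ a) (ht : 0 ≤ t) (hw : 0 ≤ w) (hS : S ≤ M * w) :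
    B * M * q * (ν * a) + ((B * ν + B * (t * (2 * B * M ^ 2 * ν) * ν)) * p +
      B * (t * (2 * B * M ^ 2 * ν)) * S * q) ≤
      4 * B ^ 2 * M ^ 3 * p * (ν * (a + 1 + t * (ν + w))) := by
  have hp : 0 ≤ p := hq.trans hqp
  have hB0 : 0 ≤ B := zero_le_one.trans hB
  have hM0 : 0 ≤ M := zero_le_one.trans hM
  have hBB : B ≤ B ^ 2 := le_self_pow₀ hB (by norm_num)
  have hm3 : M ≤ M ^ 3 := le_self_pow₀ hM (by norm_num)
  have hm23 : M ^ 2 ≤ M ^ 3 := pow_le_pow_right₀ hM (by norm_num)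
  have hm03 : 1 ≤ M ^ 3 := one_le_pow₀ hM
  have k1 : B * M * q * (ν * a) ≤ B ^ 2 * M ^ 3 * p * (ν * a) := by gcongr
  have i1 : B * ν * p ≤ B ^ 2 * M ^ 3 * p * ν := by
    calc B * ν * p = B * 1 * p * ν := by ring
      _ ≤ _ := by gcongr
  have i2 : B * (t * (2 * B * M ^ 2 * ν) * ν) * p ≤ 2 * (B ^ 2 * M ^ 3 * p) * (ν * (t * ν)) := by
    calc _ = 2 * (B ^ 2 * M ^ 2 * p) * (ν * (t * ν)) := by ring
      _ ≤ _ := by gcongr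
  have k3 : B * (t * (2 * B * M ^ 2 * ν)) * S * q ≤ 2 * (B ^ 2 * M ^ 3 * p) * (ν * (t * w)) := by
    calc _ ≤ B * (t * (2 * B * M ^ 2 * ν)) * (M * w) * p := by gcongr
      _ = _ := by ring
  have hnn : 0 ≤ B ^ 2 * M ^ 3 * p := by positivity
  have hx : 0 ≤ ν * a := by positivity
  have hy : 0 ≤ ν * (t * ν) := by positivity
  have hz : 0 ≤ ν * (t * w) := by positivity
  have j1 := mul_nonneg hnn hx
  have j2 := mul_nonneg hnn hν
  have j3 := mul_nonneg hnn hy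
  have j4 := mul_nonneg hnn hz
  linarith

/-- The effect of a shift of the inputs on a modulated monomial. -/
lemma norm_translate_sub_le (t : ℝ) (y' : X d) (y u : Fin m → X d) {ν : ℝ} (hν : 0 ≤ ν)
    (hu : ∀ j, ‖u j‖ ≤ ν) {f : Fin m → L1 d J} {b w a : ℝ} (hb : 1 ≤ b) (ha : 0 ≤ a)
    (hf : ∀ j, ‖f j‖ ≤ b) (hw : ∀ j, wnorm (P.c j) (f j) ≤ w)
    (hfa : ∀ j, ‖translate (u j) (mul (modul (y j)) (f j)) - mul (modul (y j)) (f j)‖ ≤ ν * a) :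
    ‖translate (∑ j, u j) (mul (modul y') (op (P.ker t) f)) -
        cis (P.shiftPhase t y' y u) • mul (modul y') (op (P.ker t) f)‖ ≤
      4 * P.B ^ 2 * m ^ 3 * b ^ m * (ν * (a + 1 + |t| * (ν + w))) := by
  set θ := P.theta t y' y
  set α := P.shiftPhase t y' y u
  set g : Fin m → L1 d J := fun j => mul (modul (y j)) (f j) with hg
  have hb0 : 0 ≤ b := zero_le_one.trans hb
  have hB := P.B_nonneg
  have hB1 := P.one_le
  have hm1 : (1 : ℝ) ≤ m := by exact_mod_cast P.pos
  have hθ : IsBddMeas (osc θ P.K) := P.isBddMeas_osc (P.continuous_theta t y' y)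
  have e0 : mul (modul y') (op (P.ker t) f) = op (osc θ P.K) g :=
    mul_modul_op P.pos (continuous_const.mul P.continuous_phi) P.continuous_K P.norm_K_le y' y f
  have hsm : IsBddMeas fun kk => cis α • osc θ P.K kk :=
    IsBddMeas.of_continuous (C := P.B) ((continuous_osc
      (P.continuous_theta t y' y) P.continuous_K).const_smul (cis α)) fun kk => by
        rw [norm_smul, norm_cis, one_mul]; exact P.norm_osc_le θ kk
  have e1 : op (fun kk => cis α • osc θ P.K kk) g = cis α • op (osc θ P.K) g :=
    op_smul P.pos hθ (cis α) g
  have hgb : ∀ j, ‖g j‖ ≤ b := fun j => (norm_mul_modul _ _).le.trans (hf j)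
  have e2 : translate (∑ j, u j) (op (osc θ P.K) g) - cis α • op (osc θ P.K) g =
      (op (fun kk => osc θ P.K (kk + u)) (fun j => translate (u j) (g j)) -
        op (fun kk => osc θ P.K (kk + u)) g) +
      op (fun kk => osc θ P.K (kk + u) - cis α • osc θ P.K kk) g := by
    rw [translate_op P.pos hθ, op_sub P.pos (hθ.shift u) hsm, e1]
    abel
  have h1 : ‖op (fun kk => osc θ P.K (kk + u)) (fun j => translate (u j) (g j)) -
      op (fun kk => osc θ P.K (kk + u)) g‖ ≤ P.B * m * b ^ (m - 1) * (ν * a) := by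
    refine (norm_op_sub_op_le P.pos (hθ.shift u) hB
      (Filter.Eventually.of_forall fun kk => P.norm_osc_le θ _) _ _ hb0
      (fun j => ?_) hgb).trans ?_
    · rw [LinearIsometry.norm_map]; exact hgb j
    · refine mul_le_mul_of_nonneg_left ?_ (by positivity)
      exact (pi_norm_le_iff_of_nonneg (by positivity)).2 hfa
  have h2 := norm_op_le_weight P.pos ((hθ.shift u).sub hsm) (A := P.B * ν +
      P.B * (|t| * (2 * P.B * m ^ 2 * ν) * ν)) (C := P.B * (|t| * (2 * P.B * m ^ 2 * ν)))
    (by positivity) (by positivity) P.c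
    (Filter.Eventually.of_forall fun kk => P.norm_osc_shift_le t y' y u kk hν hu) g hgb
  have h3 : ∑ j, wnorm (P.c j) (g j) ≤ m * w := by
    have : ∀ j ∈ Finset.univ, wnorm (P.c j) (g j) ≤ w := fun j _ => by
      rw [hg]; simp only [wnorm_modul]; exact hw j
    refine (Finset.sum_le_sum this).trans (le_of_eq (by simp))
  have hw0 : 0 ≤ w := (wnorm_nonneg _ _).trans (hw ⟨0, P.pos⟩)
  have hbm : b ^ (m - 1) ≤ b ^ m := pow_le_pow_right₀ hb (Nat.sub_le m 1)
  rw [e0, e2]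
  refine (norm_add_le _ _).trans ((add_le_add h1 h2).trans ?_)
  exact shift_bound hB1 hm1 (pow_nonneg hb0 _) hbm hν ha (abs_nonneg t) hw0 h3

end PhaseMono

end Wavepacket

namespace Wavepacket

variable {d J m : ℕ}

/-! ### The scales -/

/-- The admissible range of the two small parameters. -/
structure Scale (C₀ ε β ϱ : ℝ) : Prop where
  ε_pos : 0 < ε
  β_pos : 0 < β
  β_le : β ≤ 1 / 2
  ϱ_pos : 0 < ϱ
  le : β ^ 2 ≤ C₀ * ϱ

/-- The size of the supports. -/
def widthScale (ε β : ℝ) : ℝ := β ^ (1 - ε)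

/-- The size of the gradients. -/
def gradScale (ε β : ℝ) : ℝ := β ^ (-1 - ε)

/-- The size of the error. -/
def errScale (ε β ϱ : ℝ) : ℝ := ϱ * gradScale ε β * |Real.log β|

namespace Scale

variable {C₀ ε β ϱ : ℝ}

lemma C₀_nonneg (S : Scale C₀ ε β ϱ) : 0 ≤ C₀ := by
  by_contra h
  push Not at h
  have := S.le
  have h1 := mul_neg_of_neg_of_pos h S.ϱ_pos
  have h2 := sq_nonneg β
  linarith

lemma width_pos (S : Scale C₀ ε β ϱ) : 0 < widthScale ε β := Real.rpow_pos_of_pos S.β_pos _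

lemma grad_pos (S : Scale C₀ ε β ϱ) : 0 < gradScale ε β := Real.rpow_pos_of_pos S.β_pos _

lemma one_le_grad (S : Scale C₀ ε β ϱ) : 1 ≤ gradScale ε β :=
  Real.one_le_rpow_of_pos_of_le_one_of_nonpos S.β_pos (by linarith [S.β_le])
    (by linarith [S.ε_pos])

lemma one_le_width_mul_grad (S : Scale C₀ ε β ϱ) : 1 ≤ widthScale ε β * gradScale ε β := by
  rw [widthScale, gradScale, ← Real.rpow_add S.β_pos]
  exact Real.one_le_rpow_of_pos_of_le_one_of_nonpos S.β_pos (by linarith [S.β_le])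
    (by linarith [S.ε_pos])

lemma width_le (S : Scale C₀ ε β ϱ) : widthScale ε β ≤ C₀ * ϱ * gradScale ε β := by
  have h : widthScale ε β = β ^ 2 * gradScale ε β := by
    rw [widthScale, gradScale, ← Real.rpow_natCast, ← Real.rpow_add S.β_pos]
    congr 1
    push_cast
    ring
  rw [h]
  exact mul_le_mul_of_nonneg_right S.le S.grad_pos.le

lemma log_two_le (S : Scale C₀ ε β ϱ) : Real.log 2 ≤ |Real.log β| := by
  have h1 : Real.log β ≤ Real.log (1 / 2) := Real.log_le_log S.β_pos S.β_le
  rw [one_div, Real.log_inv] at h1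
  have h2 : 0 < Real.log 2 := Real.log_pos (by norm_num)
  rw [abs_of_neg (by linarith)]
  linarith

lemma log_two_pos : 0 < Real.log 2 := Real.log_pos (by norm_num)

lemma err_pos (S : Scale C₀ ε β ϱ) : 0 < errScale ε β ϱ :=
  mul_pos (mul_pos S.ϱ_pos S.grad_pos) (log_two_pos.trans_le S.log_two_le)

lemma grad_le_err (S : Scale C₀ ε β ϱ) : ϱ * gradScale ε β ≤ (Real.log 2)⁻¹ * errScale ε β ϱ := by
  rw [inv_mul_eq_div, le_div_iff₀ log_two_pos]
  exact mul_le_mul_of_nonneg_left S.log_two_le (mul_pos S.ϱ_pos S.grad_pos).le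

lemma ϱ_le_err (S : Scale C₀ ε β ϱ) : ϱ ≤ (Real.log 2)⁻¹ * errScale ε β ϱ :=
  (le_mul_of_one_le_right S.ϱ_pos.le S.one_le_grad).trans S.grad_le_err

lemma width_le_err (S : Scale C₀ ε β ϱ) :
    widthScale ε β ≤ C₀ * (Real.log 2)⁻¹ * errScale ε β ϱ := by
  refine S.width_le.trans ?_
  rw [mul_assoc, mul_assoc]
  exact mul_le_mul_of_nonneg_left S.grad_le_err S.C₀_nonneg

lemma time_le (S : Scale C₀ ε β ϱ) {T s : ℝ} (hs : s ∈ Set.Icc 0 T) :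
    |s / ϱ| * widthScale ε β ≤ T * C₀ * gradScale ε β := by
  rw [abs_of_nonneg (div_nonneg hs.1 S.ϱ_pos.le), div_mul_eq_mul_div, div_le_iff₀ S.ϱ_pos]
  calc s * widthScale ε β ≤ T * (C₀ * ϱ * gradScale ε β) :=
        mul_le_mul hs.2 S.width_le S.width_pos.le (hs.1.trans hs.2)
    _ = _ := by ring

lemma log_le (S : Scale C₀ ε β ϱ) {T w : ℝ} (hT : 0 ≤ T) (hw : 0 < w) :
    2 * (ϱ * gradScale ε β / w) * Real.log (1 + T / (ϱ * gradScale ε β / w)) ≤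
      2 / w * (Real.log (1 + T * w * C₀) / Real.log 2 + 1) * errScale ε β ϱ := by
  have hg := S.grad_pos
  have hϱ := S.ϱ_pos
  have hC := S.C₀_nonneg
  have hβ := S.β_pos
  have hβ1 : 1 ≤ β⁻¹ := (one_le_inv₀ hβ).2 (by linarith [S.β_le])
  have h1 : T / (ϱ * gradScale ε β / w) ≤ T * w * C₀ * β⁻¹ := by
    rw [div_div_eq_mul_div, div_le_iff₀ (mul_pos hϱ hg)]
    have h2 : 1 ≤ C₀ * β⁻¹ * (ϱ * gradScale ε β) := by
      have h3 : β * gradScale ε β * β = widthScale ε β := by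
        rw [widthScale, gradScale]
        nth_rewrite 1 [← Real.rpow_one β]
        nth_rewrite 3 [← Real.rpow_one β]
        rw [← Real.rpow_add hβ, ← Real.rpow_add hβ]
        congr 1; ring
      have h4 : 1 ≤ β * gradScale ε β := by
        rw [gradScale]
        nth_rewrite 1 [← Real.rpow_one β]
        rw [← Real.rpow_add hβ]
        exact Real.one_le_rpow_of_pos_of_le_one_of_nonpos hβ (by linarith [S.β_le])
          (by linarith [S.ε_pos])
      have h5 := S.width_le
      rw [← h3] at h5
      rw [show C₀ * β⁻¹ * (ϱ * gradScale ε β) = C₀ * ϱ * gradScale ε β / β by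
        rw [div_eq_mul_inv]; ring, le_div_iff₀ hβ]
      nlinarith
    calc T * w = T * w * 1 := (mul_one _).symm
      _ ≤ T * w * (C₀ * β⁻¹ * (ϱ * gradScale ε β)) := by gcongr
      _ = _ := by ring
  have h6 : Real.log (1 + T / (ϱ * gradScale ε β / w)) ≤
      Real.log (1 + T * w * C₀) + |Real.log β| := by
    have h7 : 1 + T / (ϱ * gradScale ε β / w) ≤ (1 + T * w * C₀) * β⁻¹ := by
      rw [add_mul, one_mul]
      exact add_le_add hβ1 h1
    refine (Real.log_le_log (by positivity) h7).trans ?_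
    rw [Real.log_mul (by positivity) (by positivity), Real.log_inv]
    exact add_le_add le_rfl (neg_le_abs _)
  have h8 : Real.log (1 + T * w * C₀) ≤ Real.log (1 + T * w * C₀) / Real.log 2 * |Real.log β| := by
    have h9 : 0 ≤ Real.log (1 + T * w * C₀) :=
      Real.log_nonneg (by have : 0 ≤ T * w * C₀ := by positivity
                          linarith)
    rw [div_mul_eq_mul_div, le_div_iff₀ log_two_pos]
    exact mul_le_mul_of_nonneg_left S.log_two_le h9
  calc _ ≤ 2 * (ϱ * gradScale ε β / w) *
        ((Real.log (1 + T * w * C₀) / Real.log 2 + 1) * |Real.log β|) := by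
        refine mul_le_mul_of_nonneg_left ?_ (by positivity)
        rw [add_mul, one_mul]
        exact h6.trans (add_le_add h8 le_rfl)
    _ = _ := by rw [errScale]; ring

end Scale

/-! ### Atoms -/

/-- Functions of norm at most `1` that are concentrated near `c` at the scale `a₁`, and localized
near some position at the scale `a₂`. -/
def atoms (c : X d) (a₁ a₂ : ℝ) : Set (L1 d J) :=
  {f | ‖f‖ ≤ 1 ∧ wnorm c f ≤ a₁ ∧
    ∃ y, ∀ h, ‖translate h (mul (modul y) f) - mul (modul y) f‖ ≤ ‖h‖ * a₂}

lemma wnorm_smul (c : X d) (z : ℂ) (f : L1 d J) : wnorm c (z • f) = ‖z‖ * wnorm c f := by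
  rw [wnorm_eq, wnorm_eq, map_smul, norm_smul]

lemma atomNorm_atoms_le {c : X d} {a₁ a₂ η C : ℝ} (hη : 0 ≤ η) (hC : 0 < C) {f : L1 d J}
    (h1 : ‖f‖ ≤ C) (h2 : wnorm c f ≤ C * a₁) (y : X d)
    (h3 : ∀ h, ‖translate h (mul (modul y) f) - mul (modul y) f‖ ≤ ‖h‖ * (C * a₂)) :
    atomNorm (atoms c a₁ a₂) η f ≤ C := by
  have hn : ‖((C⁻¹ : ℝ) : ℂ)‖ = C⁻¹ := by
    rw [Complex.norm_real, Real.norm_of_nonneg (inv_nonneg.2 hC.le)]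
  have ha : ((C⁻¹ : ℝ) : ℂ) • f ∈ atoms c a₁ a₂ := by
    refine ⟨?_, ?_, y, fun h => ?_⟩
    · rw [norm_smul, hn, inv_mul_le_iff₀ hC, mul_one]; exact h1
    · rw [wnorm_smul, hn, inv_mul_le_iff₀ hC]; exact h2
    · rw [map_smul, map_smul, ← smul_sub, norm_smul, hn, inv_mul_le_iff₀ hC]
      refine (h3 h).trans (le_of_eq (by ring))
  have h4 := atomNorm_le_one (η := η) hη ha
  rw [map_smul_eq_mul, hn, inv_mul_le_iff₀ hC, mul_one] at h4
  exact h4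

namespace PhaseMono

variable (P : PhaseMono d J m)

/-- The constant in the bounds for localized inputs. -/
def locConst (b Ct : ℝ) : ℝ := 4 * P.B ^ 2 * m ^ 3 * b ^ m * (2 + Ct * (1 + b))

lemma le_locConst {b Ct : ℝ} (hb : 1 ≤ b) (hCt : 0 ≤ Ct) :
    2 * (P.B * m * b ^ m) ≤ P.locConst b Ct := by
  have hm1 : (1 : ℝ) ≤ m := by exact_mod_cast P.pos
  have hB := P.one_le
  have hb0 : 0 ≤ b := zero_le_one.trans hb
  have hB0 := P.B_nonneg
  have hBB : P.B ≤ P.B ^ 2 := le_self_pow₀ hB (by norm_num)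
  have hm3 : (m : ℝ) ≤ m ^ 3 := le_self_pow₀ hm1 (by norm_num)
  have h1 : 1 ≤ 2 + Ct * (1 + b) := by nlinarith [mul_nonneg hCt hb0]
  have h0 : 0 ≤ 2 + Ct * (1 + b) := zero_le_one.trans h1
  have h2 : P.B * m * b ^ m ≤ P.B ^ 2 * m ^ 3 * b ^ m := by gcongr
  have h3 : 0 ≤ P.B ^ 2 * m ^ 3 * b ^ m := by positivity
  rw [locConst]
  nlinarith

lemma le_locConst' {b Ct : ℝ} (hb : 1 ≤ b) (hCt : 0 ≤ Ct) :
    2 * (P.B * b ^ m) ≤ P.locConst b Ct := by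
  refine le_trans ?_ (P.le_locConst hb hCt)
  have hm1 : (1 : ℝ) ≤ m := by exact_mod_cast P.pos
  have hB := P.B_nonneg
  have hb0 : 0 ≤ b := zero_le_one.trans hb
  have : P.B * 1 * b ^ m ≤ P.B * m * b ^ m := by gcongr
  linarith

lemma locConst_pos {b Ct : ℝ} (hb : 1 ≤ b) (hCt : 0 ≤ Ct) : 0 < P.locConst b Ct := by
  refine lt_of_lt_of_le ?_ (P.le_locConst' hb hCt)
  have hB : 0 < P.B := zero_lt_one.trans_le P.one_le
  have hb0 : 0 < b := zero_lt_one.trans_le hb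
  positivity

lemma norm_translate_sub_le_locConst {t b Ct a₁ a₂ : ℝ} (hb : 1 ≤ b) (hCt : 0 ≤ Ct)
    (ha2 : 1 ≤ a₂) (ha12 : 1 ≤ a₁ * a₂) (ht : |t| * a₁ ≤ Ct * a₂)
    (y' : X d) (y u : Fin m → X d) {ν : ℝ} (hν : 0 ≤ ν)
    (hu : ∀ j, ‖u j‖ ≤ ν) {f : Fin m → L1 d J}
    (hf : ∀ j, ‖f j‖ ≤ b) (hw : ∀ j, wnorm (P.c j) (f j) ≤ b * a₁)
    (hfa : ∀ j, ‖translate (u j) (mul (modul (y j)) (f j)) - mul (modul (y j)) (f j)‖ ≤ ν * a₂) :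
    ‖translate (∑ j, u j) (mul (modul y') (op (P.ker t) f)) -
        cis (P.shiftPhase t y' y u) • mul (modul y') (op (P.ker t) f)‖ ≤
      ν * (P.locConst b Ct * a₂) := by
  have ha20 : 0 < a₂ := zero_lt_one.trans_le ha2
  have hb0 : 0 ≤ b := zero_le_one.trans hb
  have ha10 : 0 ≤ a₁ := by
    by_contra h
    push Not at h
    nlinarith [mul_neg_of_neg_of_pos h ha20]
  rcases le_total (ν * a₂) 1 with h | h
  · have hν1 : ν ≤ a₁ := by nlinarith
    refine (P.norm_translate_sub_le t y' y u hν hu hb ha20.le hf hw hfa).trans ?_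
    have h1 : |t| * (ν + b * a₁) ≤ Ct * (1 + b) * a₂ := by
      calc |t| * (ν + b * a₁) ≤ |t| * (a₁ + b * a₁) := by gcongr
        _ = (1 + b) * (|t| * a₁) := by ring
        _ ≤ (1 + b) * (Ct * a₂) := by gcongr
        _ = _ := by ring
    have h2 : a₂ + 1 + |t| * (ν + b * a₁) ≤ (2 + Ct * (1 + b)) * a₂ := by linarith
    have hB := P.B_nonneg
    calc _ ≤ 4 * P.B ^ 2 * m ^ 3 * b ^ m * (ν * ((2 + Ct * (1 + b)) * a₂)) := by gcongr
      _ = _ := by rw [locConst]; ring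
  · have h1 : ‖mul (modul y') (op (P.ker t) f)‖ ≤ P.B * b ^ m := by
      rw [norm_mul_modul]; exact P.norm_op_le_pow t hf
    refine (_root_.norm_sub_le _ _).trans ?_
    rw [LinearIsometry.norm_map, norm_smul, norm_cis, one_mul]
    have h2 := P.le_locConst' hb hCt
    have h3 := P.locConst_pos hb hCt
    calc _ ≤ P.locConst b Ct * 1 := by linarith
      _ ≤ P.locConst b Ct * (ν * a₂) := by gcongr
      _ = _ := by ring

lemma atomNorm_op_le_of_atom {t b Ct a₁ a₂ η : ℝ} (hη : 0 ≤ η) (hb : 1 ≤ b) (hCt : 0 ≤ Ct)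
    (ha2 : 1 ≤ a₂) (ha12 : 1 ≤ a₁ * a₂) (ht : |t| * a₁ ≤ Ct * a₂)
    {f : Fin m → L1 d J} (hf : ∀ j, ‖f j‖ ≤ b) (hw : ∀ j, wnorm (P.c j) (f j) ≤ b * a₁)
    (a : Fin m) (hfa : f a ∈ atoms (P.c a) a₁ a₂) :
    atomNorm (atoms (∑ j, P.c j) a₁ a₂) η (op (P.ker t) f) ≤ P.locConst b Ct := by
  obtain ⟨-, -, y, hy⟩ := hfa
  have hb0 : 0 ≤ b := zero_le_one.trans hb
  have hB := P.B_nonneg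
  have ha20 : 0 < a₂ := zero_lt_one.trans_le ha2
  have hL := P.locConst_pos hb hCt
  have hL1 := P.le_locConst' hb hCt
  have hL2 := P.le_locConst hb hCt
  have ha10 : 0 ≤ a₁ := by
    by_contra h
    push Not at h
    nlinarith [mul_neg_of_neg_of_pos h ha20]
  refine atomNorm_atoms_le hη hL ?_ ?_ (y - t • (P.vo - P.v a)) fun h => ?_
  · refine (P.norm_op_le_pow t hf).trans ?_
    have : 0 ≤ P.B * b ^ m := by positivity
    linarith
  · refine (wnorm_op_le P.pos (P.isBddMeas_ker t) hB P.c
      (Filter.Eventually.of_forall (P.norm_ker_le t)) f hf).trans ?_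
    have h1 : ∑ j, wnorm (P.c j) (f j) ≤ m * (b * a₁) :=
      (Finset.sum_le_sum fun j _ => hw j).trans (le_of_eq (by simp))
    have hbm : b ^ m = b * b ^ (m - 1) := by
      rw [← pow_succ', Nat.sub_add_cancel P.pos]
    calc P.B * (∑ j, wnorm (P.c j) (f j)) * b ^ (m - 1)
        ≤ P.B * (m * (b * a₁)) * b ^ (m - 1) := by gcongr
      _ = P.B * m * b ^ m * a₁ := by rw [hbm]; ring
      _ ≤ P.locConst b Ct * a₁ := by
        refine mul_le_mul_of_nonneg_right ?_ ha10
        have : 0 ≤ P.B * m * b ^ m := by positivity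
        linarith
  · have key := P.norm_translate_sub_le_locConst hb hCt ha2 ha12 ht
      (y - t • (P.vo - P.v a)) (Pi.single a y) (Pi.single a h) (norm_nonneg h) (fun j => ?_) hf hw
      (fun j => ?_)
    · have e1 : ∑ j, (Pi.single a h : Fin m → X d) j = h := by simp
      have e2 : P.shiftPhase t (y - t • (P.vo - P.v a)) (Pi.single a y) (Pi.single a h) = 0 := by
        have h1 : ∑ j, inner ℝ (P.v j) ((Pi.single a h : Fin m → X d) j) = inner ℝ (P.v a) h := by
          rw [Finset.sum_eq_single a]
          · simp
          · intro j _ hj; simp [hj]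
          · simp
        have h2 : ∑ j, inner ℝ ((Pi.single a y : Fin m → X d) j)
            ((Pi.single a h : Fin m → X d) j) = inner ℝ y h := by
          rw [Finset.sum_eq_single a]
          · simp
          · intro j _ hj; simp [hj]
          · simp
        rw [shiftPhase, e1, h1, h2, inner_sub_left, inner_smul_left, inner_sub_left]
        simp
      rw [e1, e2, cis_zero, one_smul] at key
      exact key
    · by_cases hj : j = a
      · subst hj; simp
      · simp [hj]
    · by_cases hj : j = a
      · subst hj
        simpa using hy h
      · have h0 : translate (0 : X d) (mul (modul 0) (f j)) = mul (modul 0) (f j) := by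
          refine Lp.ext ?_
          filter_upwards [translate_coe 0 (mul (modul 0) (f j))] with k hk
          rw [hk, add_zero]
        rw [Pi.single_eq_of_ne hj, Pi.single_eq_of_ne hj, h0, sub_self, norm_zero]
        positivity

end PhaseMono

end Wavepacket

namespace Wavepacket

variable {d J m : ℕ}

lemma translate_zero (f : L1 d J) : translate 0 f = f := by
  refine Lp.ext ?_
  filter_upwards [translate_coe 0 f] with k hk
  rw [hk, add_zero]

namespace PhaseMono

variable (P : PhaseMono d J m)

lemma norm_op_update_le (t : ℝ) {b : ℝ} (hb : 1 ≤ b) {f : Fin m → L1 d J} {a : Fin m}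
    (hf : ∀ j ≠ a, ‖f j‖ ≤ b) (g : L1 d J) :
    ‖op (P.ker t) (Function.update f a g)‖ ≤ P.B * b ^ m * ‖g‖ := by
  refine (P.norm_op_le t _).trans ?_
  rw [mul_assoc]
  refine mul_le_mul_of_nonneg_left ?_ P.B_nonneg
  rw [← Finset.mul_prod_erase _ _ (Finset.mem_univ a), Function.update_self, mul_comm]
  refine mul_le_mul_of_nonneg_right ?_ (norm_nonneg g)
  calc ∏ j ∈ Finset.univ.erase a, ‖Function.update f a g j‖ ≤ ∏ j ∈ Finset.univ.erase a, b := by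
        refine Finset.prod_le_prod (fun j _ => norm_nonneg _) fun j hj => ?_
        rw [Function.update_of_ne (Finset.ne_of_mem_erase hj)]
        exact hf j (Finset.ne_of_mem_erase hj)
    _ = b ^ (m - 1) := by simp
    _ ≤ b ^ m := pow_le_pow_right₀ hb (Nat.sub_le m 1)

/-- The dependence of a monomial on one of its inputs. -/
def slot (t : ℝ) (f : Fin m → L1 d J) (a : Fin m) : L1 d J →L[ℂ] L1 d J :=
  (op (P.ker t)).toContinuousLinearMap f a

lemma slot_apply (t : ℝ) (f : Fin m → L1 d J) (a : Fin m) (g : L1 d J) :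
    P.slot t f a g = op (P.ker t) (Function.update f a g) := rfl

/-- A monomial with one localized input is localized. -/
lemma atomNorm_op_le {t b Ct a₁ a₂ η : ℝ} (hη : 0 < η) (hb : 1 ≤ b) (hCt : 0 ≤ Ct)
    (ha2 : 1 ≤ a₂) (ha12 : 1 ≤ a₁ * a₂) (ht : |t| * a₁ ≤ Ct * a₂)
    {f : Fin m → L1 d J} (hf : ∀ j, ‖f j‖ ≤ b) (hw : ∀ j, wnorm (P.c j) (f j) ≤ b * a₁)
    (a : Fin m) :
    atomNorm (atoms (∑ j, P.c j) a₁ a₂) η (op (P.ker t) f) ≤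
      P.locConst b Ct * atomNorm (atoms (P.c a) a₁ a₂) η (f a) := by
  have hL := P.locConst_pos hb hCt
  have hb0 : 0 ≤ b := zero_le_one.trans hb
  have ha10 : 0 ≤ a₁ := by
    by_contra h
    push Not at h
    nlinarith [mul_neg_of_neg_of_pos h (zero_lt_one.trans_le ha2)]
  have key := seminorm_le_atomNorm (A := atoms (P.c a) a₁ a₂) (η := η) hL
    ((atomNorm (atoms (∑ j, P.c j) a₁ a₂) η).comp
      ((P.slot t f a : L1 d J →L[ℂ] L1 d J) : L1 d J →ₗ[ℂ] L1 d J)) (fun g => ?_)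
    (fun g hg => ?_) (f a)
  · rw [Seminorm.comp_apply, ContinuousLinearMap.coe_coe, slot_apply, Function.update_eq_self] at key
    exact key
  · rw [Seminorm.comp_apply, ContinuousLinearMap.coe_coe, slot_apply]
    refine (atomNorm_le_norm hη.le _).trans ?_
    rw [← mul_div_assoc]
    refine div_le_div_of_nonneg_right ?_ hη.le
    refine (P.norm_op_update_le t hb (fun j _ => hf j) g).trans ?_
    refine mul_le_mul_of_nonneg_right ?_ (norm_nonneg g)
    have h1 := P.le_locConst' hb hCt
    have h2 : 0 ≤ P.B * b ^ m := mul_nonneg P.B_nonneg (pow_nonneg hb0 m)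
    linarith
  · rw [Seminorm.comp_apply, ContinuousLinearMap.coe_coe, slot_apply]
    refine P.atomNorm_op_le_of_atom hη.le hb hCt ha2 ha12 ht (fun j => ?_) (fun j => ?_) a ?_
    · by_cases hj : j = a
      · subst hj; rw [Function.update_self]; exact hg.1.trans hb
      · rw [Function.update_of_ne hj]; exact hf j
    · by_cases hj : j = a
      · subst hj; rw [Function.update_self]
        exact hg.2.1.trans (le_mul_of_one_le_left ha10 hb)
      · rw [Function.update_of_ne hj]; exact hw j
    · rw [Function.update_self]; exact hg

/-- Two localized inputs with different group velocities interact only for a short time. -/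
lemma collision_pointwise {b Ct a₁ a₂ : ℝ} (hb : 1 ≤ b) (hCt : 0 ≤ Ct) (ha2 : 1 ≤ a₂)
    (ha12 : 1 ≤ a₁ * a₂) {a a' : Fin m} (haa : a ≠ a') {g g' : L1 d J}
    (hg : g ∈ atoms (P.c a) a₁ a₂) (hg' : g' ∈ atoms (P.c a') a₁ a₂) :
    ∃ z : X d, ∀ (t : ℝ) (f : Fin m → L1 d J), |t| * a₁ ≤ Ct * a₂ → (∀ j, ‖f j‖ ≤ b) →
      (∀ j, wnorm (P.c j) (f j) ≤ b * a₁) → f a = g → f a' = g' →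
      ‖op (P.ker t) f‖ * (a₂ + ‖z + t • (P.v a' - P.v a)‖) ≤ 3 * P.locConst b Ct * a₂ := by
  obtain ⟨-, -, y₁, hy₁⟩ := hg
  obtain ⟨-, -, y₂, hy₂⟩ := hg'
  refine ⟨y₂ - y₁, fun t f ht hf hw hfa hfa' => ?_⟩
  have hb0 : 0 ≤ b := zero_le_one.trans hb
  have ha20 : 0 < a₂ := zero_lt_one.trans_le ha2
  have hL := P.locConst_pos hb hCt
  have hL1 := P.le_locConst' hb hCt
  set ξ := y₂ - y₁ + t • (P.v a' - P.v a) with hξ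
  set G := op (P.ker t) f
  have h1 : ‖G‖ * a₂ ≤ P.locConst b Ct * a₂ := by
    refine mul_le_mul_of_nonneg_right ((P.norm_op_le_pow t hf).trans ?_) ha20.le
    have h2 : 0 ≤ P.B * b ^ m := mul_nonneg P.B_nonneg (pow_nonneg hb0 m)
    linarith
  have h2 : ‖G‖ * ‖ξ‖ ≤ 2 * P.locConst b Ct * a₂ := by
    rcases eq_or_ne ξ 0 with h0 | h0
    · rw [h0, norm_zero, mul_zero]; positivity
    have hξ0 : 0 < ‖ξ‖ := norm_pos_iff.2 h0
    set h : X d := (Real.pi / ‖ξ‖ ^ 2) • ξ with hh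
    have hnh : ‖h‖ = Real.pi / ‖ξ‖ := by
      rw [hh, norm_smul, Real.norm_of_nonneg (by positivity)]
      field_simp
    set y : Fin m → X d := Function.update (Pi.single a y₁) a' y₂
    set u : Fin m → X d := Function.update (Pi.single a h) a' (-h)
    have hsum : ∀ (F : Fin m → ℝ), (∀ j, j ≠ a → j ≠ a' → F j = 0) → ∑ j, F j = F a + F a' := by
      intro F hF
      rw [← Finset.add_sum_erase _ _ (Finset.mem_univ a),
        Finset.sum_eq_single_of_mem a' (Finset.mem_erase.2 ⟨haa.symm, Finset.mem_univ _⟩)]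
      intro j hj hja'
      exact hF j (Finset.ne_of_mem_erase hj) hja'
    have hua : u a = h := by simp [u, Function.update_of_ne haa]
    have hua' : u a' = -h := by simp [u]
    have hya : y a = y₁ := by simp [y, Function.update_of_ne haa]
    have hya' : y a' = y₂ := by simp [y]
    have hu0 : ∀ j, j ≠ a → j ≠ a' → u j = 0 := fun j h1 h2 => by simp [u, h1, h2]
    have hy0 : ∀ j, j ≠ a → j ≠ a' → y j = 0 := fun j h1 h2 => by simp [y, h1, h2]
    have hsu : ∑ j, u j = 0 := by
      rw [← Finset.add_sum_erase _ _ (Finset.mem_univ a),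
        Finset.sum_eq_single_of_mem a' (Finset.mem_erase.2 ⟨haa.symm, Finset.mem_univ _⟩), hua,
        hua', add_neg_cancel]
      intro j hj hja'
      exact hu0 j (Finset.ne_of_mem_erase hj) hja'
    have hphase : P.shiftPhase t 0 y u = Real.pi := by
      have e1 : ∑ j, inner ℝ (P.v j) (u j) = inner ℝ (P.v a) h - inner ℝ (P.v a') h := by
        rw [hsum _ fun j h1 h2 => by rw [hu0 j h1 h2, inner_zero_right], hua, hua', inner_neg_right]
        ring
      have e2 : ∑ j, inner ℝ (y j) (u j) = inner ℝ y₁ h - inner ℝ y₂ h := by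
        rw [hsum _ fun j h1 h2 => by rw [hu0 j h1 h2, inner_zero_right], hua, hua', inner_neg_right,
          hya, hya']
        ring
      have e3 : inner ℝ ξ h = Real.pi := by
        rw [hh, inner_smul_right, real_inner_self_eq_norm_sq]
        field_simp
      rw [shiftPhase, hsu, e1, e2, inner_zero_right, inner_zero_right, ← e3, hξ, inner_add_left,
        inner_sub_left, inner_smul_left, inner_sub_left]
      simp
      ring
    have key := P.norm_translate_sub_le_locConst hb hCt ha2 ha12 ht 0 y u (norm_nonneg h)
      (fun j => ?_) hf hw (fun j => ?_)
    · rw [hsu, hphase, translate_zero, cis_pi, mul_modul_zero, neg_one_smul, sub_neg_eq_add,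
        ← two_smul ℝ, norm_smul, Real.norm_ofNat, hnh] at key
      have h3 : ‖G‖ * ‖ξ‖ ≤ Real.pi / 2 * (P.locConst b Ct * a₂) := by
        rw [div_mul_eq_mul_div, le_div_iff₀ hξ0] at key
        linarith
      refine h3.trans ?_
      have h4 : 0 < P.locConst b Ct * a₂ := mul_pos hL ha20
      nlinarith [Real.pi_le_four]
    · by_cases h1 : j = a'
      · subst h1; rw [hua', norm_neg]
      · by_cases h2 : j = a
        · subst h2; rw [hua]
        · rw [hu0 j h2 h1, norm_zero]; exact norm_nonneg _
    · by_cases h1 : j = a'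
      · subst h1
        rw [hua', hya', hfa', ← norm_neg h]
        exact hy₂ _
      · by_cases h2 : j = a
        · subst h2
          rw [hua, hya, hfa]
          exact hy₁ _
        · rw [hu0 j h2 h1, translate_zero, sub_self, norm_zero]
          positivity
  rw [mul_add]
  linarith

/-- The time integral of a collision of localized inputs. -/
lemma collision_integral {b C₀ T : ℝ} (hb : 1 ≤ b) (hC₀ : 0 ≤ C₀) (hT : 0 ≤ T) {a a' : Fin m}
    (haa : a ≠ a') (hv : P.v a ≠ P.v a') :
    ∃ C : ℝ, 0 < C ∧ ∀ ε β ϱ, Scale C₀ ε β ϱ → ∀ g ∈ atoms (P.c a) (widthScale ε β) (gradScale ε β),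
      ∀ g' ∈ atoms (P.c a') (widthScale ε β) (gradScale ε β), ∀ f : ℝ → Fin m → L1 d J,
      Continuous f → (∀ s j, ‖f s j‖ ≤ b) →
      (∀ s ∈ Set.Icc 0 T, ∀ j, wnorm (P.c j) (f s j) ≤ b * widthScale ε β) →
      (∀ s, f s a = g) → (∀ s, f s a' = g') →
      ∫ s in (0 : ℝ)..T, ‖op (P.ker (s / ϱ)) (f s)‖ ≤ C * errScale ε β ϱ := by
  set q := ‖P.v a' - P.v a‖ with hq
  have hq0 : 0 < q := norm_pos_iff.2 (sub_ne_zero.2 hv.symm)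
  have hCt : 0 ≤ T * C₀ := mul_nonneg hT hC₀
  have hL := P.locConst_pos hb hCt
  have hlog : 0 ≤ Real.log (1 + T * q * C₀) / Real.log 2 :=
    div_nonneg (Real.log_nonneg (by have : 0 ≤ T * q * C₀ := by positivity
                                    linarith)) Scale.log_two_pos.le
  refine ⟨3 * P.locConst b (T * C₀) * (2 / q * (Real.log (1 + T * q * C₀) / Real.log 2 + 1)),
    by positivity, ?_⟩
  intro ε β ϱ S g hg g' hg' f hfc hf hw hfa hfa'
  obtain ⟨z, hz⟩ := P.collision_pointwise hb hCt S.one_le_grad S.one_le_width_mul_grad haa hg hg'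
  have ha2 := S.grad_pos
  have hϱ := S.ϱ_pos
  set A := ϱ * gradScale ε β / q with hA
  have hA0 : 0 < A := by positivity
  set s₀ := -(ϱ * inner ℝ z (P.v a' - P.v a) / q ^ 2) with hs₀
  have hpt : ∀ s ∈ Set.Icc 0 T, ‖op (P.ker (s / ϱ)) (f s)‖ ≤
      3 * P.locConst b (T * C₀) * (A / (A + |s - s₀|)) := by
    intro s hs
    have h1 := hz (s / ϱ) (f s) (S.time_le hs) (hf s) (hw s hs) (hfa s) (hfa' s)
    have h2 : q / ϱ * |s - s₀| ≤ ‖z + (s / ϱ) • (P.v a' - P.v a)‖ := by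
      have h3 := abs_real_inner_le_norm (z + (s / ϱ) • (P.v a' - P.v a)) (P.v a' - P.v a)
      rw [← hq] at h3
      have h4 : inner ℝ (z + (s / ϱ) • (P.v a' - P.v a)) (P.v a' - P.v a) =
          q ^ 2 / ϱ * (s - s₀) := by
        rw [inner_add_left, inner_smul_left, real_inner_self_eq_norm_sq, ← hq, hs₀]
        simp only [conj_trivial]
        field_simp
        ring
      rw [h4, abs_mul, abs_of_pos (by positivity)] at h3
      rw [← mul_le_mul_iff_left₀ hq0]
      refine le_trans (le_of_eq ?_) h3
      ring
    have h5 : ‖op (P.ker (s / ϱ)) (f s)‖ * (q / ϱ * (A + |s - s₀|)) ≤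
        3 * P.locConst b (T * C₀) * (q / ϱ * A) := by
      have h6 : q / ϱ * A = gradScale ε β := by rw [hA]; field_simp
      rw [mul_add, h6]
      exact (mul_le_mul_of_nonneg_left (add_le_add le_rfl h2) (norm_nonneg _)).trans h1
    have h7 : 0 < A + |s - s₀| := by positivity
    rw [← mul_div_assoc, le_div_iff₀ h7]
    have h8 : 0 < q / ϱ := by positivity
    rw [← mul_le_mul_iff_right₀ h8]
    calc q / ϱ * (‖op (P.ker (s / ϱ)) (f s)‖ * (A + |s - s₀|)) =
        ‖op (P.ker (s / ϱ)) (f s)‖ * (q / ϱ * (A + |s - s₀|)) := by ring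
      _ ≤ _ := h5
      _ = _ := by ring
  have hc1 : Continuous fun s => ‖op (P.ker (s / ϱ)) (f s)‖ :=
    (P.continuous_op.comp ((continuous_id.div_const ϱ).prodMk hfc)).norm
  have hc2 : Continuous fun s => 3 * P.locConst b (T * C₀) * (A / (A + |s - s₀|)) := by
    refine continuous_const.mul (continuous_const.div (by fun_prop) fun s => ?_)
    positivity
  calc ∫ s in (0 : ℝ)..T, ‖op (P.ker (s / ϱ)) (f s)‖
      ≤ ∫ s in (0 : ℝ)..T, 3 * P.locConst b (T * C₀) * (A / (A + |s - s₀|)) :=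
        intervalIntegral.integral_mono_on hT (hc1.intervalIntegrable _ _)
          (hc2.intervalIntegrable _ _) hpt
    _ = 3 * P.locConst b (T * C₀) * ∫ s in (0 : ℝ)..T, A / (A + |s - s₀|) :=
        intervalIntegral.integral_const_mul _ _
    _ ≤ 3 * P.locConst b (T * C₀) * (2 * A * Real.log (1 + T / A)) := by
        gcongr
        exact integral_div_add_abs_le hA0 hT s₀
    _ ≤ 3 * P.locConst b (T * C₀) * (2 / q * (Real.log (1 + T * q * C₀) / Real.log 2 + 1) *
          errScale ε β ϱ) := by
        exact mul_le_mul_of_nonneg_left (S.log_le hT hq0) (by positivity)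
    _ = _ := by ring

end PhaseMono

end Wavepacket

namespace Wavepacket

variable {d J m : ℕ}

section Abstract

variable {E F : Type*} [NormedAddCommGroup E] [NormedSpace ℂ E]
  [NormedAddCommGroup F] [NormedSpace ℂ F]

/-- The time integral of `‖Λ τ f‖` as a seminorm. -/
def integralSeminorm (Λ : ℝ → E →L[ℂ] F) (hΛ : Continuous fun q : ℝ × E => Λ q.1 q.2) {T : ℝ}
    (hT : 0 ≤ T) : Seminorm ℂ E :=
  Seminorm.of (fun f => ∫ τ in (0 : ℝ)..T, ‖Λ τ f‖)
    (fun f g => by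
      have hc : ∀ f, Continuous fun τ => ‖Λ τ f‖ := fun f =>
        (hΛ.comp (continuous_id.prodMk continuous_const)).norm
      rw [← intervalIntegral.integral_add ((hc f).intervalIntegrable _ _)
        ((hc g).intervalIntegrable _ _)]
      refine intervalIntegral.integral_mono_on hT ((hc _).intervalIntegrable _ _)
        (((hc f).add (hc g)).intervalIntegrable _ _) fun τ _ => ?_
      rw [map_add]
      exact norm_add_le _ _)
    (fun a f => by
      simp only [map_smul, norm_smul]
      exact intervalIntegral.integral_const_mul _ _)

lemma integral_norm_le_of_atoms [CompleteSpace E] [CompleteSpace F] {A : Set E}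
    {Λ : ℝ → E →L[ℂ] F} (hΛ : Continuous fun q : ℝ × E => Λ q.1 q.2)
    {C : ℝ} (hC0 : 0 ≤ C) (hC : ∀ τ f, ‖Λ τ f‖ ≤ C * ‖f‖) {w b : ℝ → E} (hw : Continuous w)
    (hb : Continuous b) {h : E} {T n Q η : ℝ} (hT : 0 ≤ T) (hη : 0 < η) (hQ0 : 0 < Q)
    (hn : 0 ≤ n)
    (hTC : T * C * η ≤ Q) (hA : ∀ f ∈ A, ∫ τ in (0 : ℝ)..T, ‖Λ τ f‖ ≤ Q)
    (he : ∀ τ ∈ Set.Icc 0 T, ‖w τ - (h + ∫ s in (0 : ℝ)..τ, b s)‖ ≤ n * η)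
    (hh : atomNorm A η h ≤ n) (hbn : ∀ s ∈ Set.Icc 0 T, atomNorm A η (b s) ≤ n) :
    ∫ τ in (0 : ℝ)..T, ‖Λ τ (w τ)‖ ≤ Q * (n * (2 + T)) := by
  have hc : ∀ f, Continuous fun τ => ‖Λ τ f‖ := fun f =>
    (hΛ.comp (continuous_id.prodMk continuous_const)).norm
  have key : ∀ f, ∫ τ in (0 : ℝ)..T, ‖Λ τ f‖ ≤ Q * atomNorm A η f := by
    refine seminorm_le_atomNorm hQ0 (integralSeminorm Λ hΛ hT) (fun f => ?_) hA
    change ∫ τ in (0 : ℝ)..T, ‖Λ τ f‖ ≤ _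
    have h1 : ∫ τ in (0 : ℝ)..T, ‖Λ τ f‖ ≤ ∫ τ in (0 : ℝ)..T, C * ‖f‖ :=
      intervalIntegral.integral_mono_on hT ((hc f).intervalIntegrable _ _)
        (continuous_const.intervalIntegrable _ _) fun τ _ => hC τ f
    rw [intervalIntegral.integral_const, sub_zero, smul_eq_mul] at h1
    refine h1.trans ?_
    rw [mul_div_assoc', le_div_iff₀ hη]
    calc T * (C * ‖f‖) * η = T * C * η * ‖f‖ := by ring
      _ ≤ _ := by gcongr
  have h1 := integral_norm_duhamel_le hΛ hC0 hC hw hb hT he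
    ((key h).trans (mul_le_mul_of_nonneg_left hh hQ0.le))
    fun s hs => (key (b s)).trans (mul_le_mul_of_nonneg_left (hbn s hs) hQ0.le)
  refine h1.trans ?_
  have h2 : T * (C * (n * η)) ≤ Q * n := by
    calc T * (C * (n * η)) = T * C * η * n := by ring
      _ ≤ _ := by gcongr
  linarith

end Abstract

/-- A path that is, up to an error of size `n η`, a superposition of localized functions. -/
def IsLocalizedPath (A : Set (L1 d J)) (T η n : ℝ) (w : ℝ → L1 d J) : Prop :=
  ∃ (h : L1 d J) (b : ℝ → L1 d J), Continuous b ∧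
    (∀ τ ∈ Set.Icc 0 T, ‖w τ - (h + ∫ s in (0 : ℝ)..τ, b s)‖ ≤ n * η) ∧
    atomNorm A η h ≤ n ∧ ∀ s ∈ Set.Icc 0 T, atomNorm A η (b s) ≤ n

namespace PhaseMono

variable (P : PhaseMono d J m)

lemma continuous_slot (ϱ : ℝ) {f : ℝ → Fin m → L1 d J} (hf : Continuous f) (a : Fin m) :
    Continuous fun q : ℝ × L1 d J => P.slot (q.1 / ϱ) (f q.1) a q.2 := by
  refine P.continuous_op.comp ((continuous_fst.div_const ϱ).prodMk ?_)
  exact (hf.comp continuous_fst).update a continuous_snd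

/-- Two paths of localized functions with different group velocities have a small interaction. -/
lemma collision {b C₀ T : ℝ} (hb : 1 ≤ b) (hC₀ : 0 ≤ C₀) (hT : 0 ≤ T) {a a' : Fin m}
    (haa : a ≠ a') (hv : P.v a ≠ P.v a') :
    ∃ C : ℝ, 0 < C ∧ ∀ ε β ϱ, Scale C₀ ε β ϱ → ∀ w : ℝ → Fin m → L1 d J,
      Continuous w → (∀ s j, ‖w s j‖ ≤ b) →
      (∀ s ∈ Set.Icc 0 T, ∀ j, wnorm (P.c j) (w s j) ≤ b * widthScale ε β) →
      IsLocalizedPath (atoms (P.c a) (widthScale ε β) (gradScale ε β)) T (errScale ε β ϱ) b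
        (fun s => w s a) →
      IsLocalizedPath (atoms (P.c a') (widthScale ε β) (gradScale ε β)) T (errScale ε β ϱ) b
        (fun s => w s a') →
      ∫ s in (0 : ℝ)..T, ‖op (P.ker (s / ϱ)) (w s)‖ ≤ C * errScale ε β ϱ := by
  obtain ⟨C₁, hC₁, h1⟩ := P.collision_integral hb hC₀ hT haa hv
  have hb0 : 0 ≤ b := zero_le_one.trans hb
  have hM : 0 ≤ P.B * b ^ m := mul_nonneg P.B_nonneg (pow_nonneg hb0 m)
  set C₂ := C₁ + T * (P.B * b ^ m) with hC₂
  have hC₂0 : 0 < C₂ := by positivity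
  set r := b * (2 + T) with hr
  have hr1 : 1 ≤ r := by nlinarith
  refine ⟨C₂ * r * r, by positivity, ?_⟩
  intro ε β ϱ S w hwc hwb hww hla hla'
  have hη := S.err_pos
  set η := errScale ε β ϱ
  have ha1 := S.width_pos
  obtain ⟨h, v, hvc, hve, hvh, hvb⟩ := hla
  obtain ⟨h', v', hvc', hve', hvh', hvb'⟩ := hla'
  have hwa : Continuous fun s => w s a := (continuous_apply a).comp hwc
  have hwa' : Continuous fun s => w s a' := (continuous_apply a').comp hwc
  have hup : ∀ (g' : L1 d J), g' ∈ atoms (P.c a') (widthScale ε β) (gradScale ε β) →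
      ∫ s in (0 : ℝ)..T, ‖P.slot (s / ϱ) (w s) a' g'‖ ≤ C₂ * η * r := by
    intro g' hg'
    have hfc : Continuous fun s => Function.update (w s) a' g' := hwc.update a' continuous_const
    have hfb : ∀ s j, ‖Function.update (w s) a' g' j‖ ≤ b := by
      intro s j
      by_cases hj : j = a'
      · subst hj; rw [Function.update_self]; exact hg'.1.trans hb
      · rw [Function.update_of_ne hj]; exact hwb s j
    have key := integral_norm_le_of_atoms (A := atoms (P.c a) (widthScale ε β) (gradScale ε β))
      (Λ := fun s => P.slot (s / ϱ) (Function.update (w s) a' g') a)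
      (P.continuous_slot ϱ hfc a) hM
      (fun s f => P.norm_op_update_le (s / ϱ) hb (fun j _ => hfb s j) f) hwa hvc (n := b)
      (Q := C₂ * η) hT hη (by positivity) hb0 ?_ (fun g hg => ?_) hve hvh hvb
    · refine le_trans (le_of_eq ?_) key
      refine intervalIntegral.integral_congr fun s _ => ?_
      simp only [slot_apply]
      rw [Function.update_comm haa.symm, Function.update_eq_self]
    · have : 0 ≤ C₁ * η := by positivity
      rw [hC₂, add_mul]
      linarith
    · refine (h1 ε β ϱ S g hg g' hg'
        (fun s => Function.update (Function.update (w s) a' g') a g)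
        (hfc.update a continuous_const) (fun s j => ?_) (fun s hs j => ?_) (fun s => ?_)
        (fun s => ?_)).trans ?_
      · by_cases hj : j = a
        · subst hj; rw [Function.update_self]; exact hg.1.trans hb
        · rw [Function.update_of_ne hj]; exact hfb s j
      · by_cases hj : j = a
        · subst hj; rw [Function.update_self]
          exact hg.2.1.trans (le_mul_of_one_le_left ha1.le hb)
        · rw [Function.update_of_ne hj]
          by_cases hj' : j = a'
          · subst hj'; rw [Function.update_self]
            exact hg'.2.1.trans (le_mul_of_one_le_left ha1.le hb)
          · rw [Function.update_of_ne hj']; exact hww s hs j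
      · rw [Function.update_self]
      · rw [Function.update_of_ne haa.symm, Function.update_self]
      · refine mul_le_mul_of_nonneg_right ?_ hη.le
        have : 0 ≤ T * (P.B * b ^ m) := by positivity
        linarith
  have key := integral_norm_le_of_atoms (A := atoms (P.c a') (widthScale ε β) (gradScale ε β))
    (Λ := fun s => P.slot (s / ϱ) (w s) a')
    (P.continuous_slot ϱ hwc a') hM
    (fun s f => P.norm_op_update_le (s / ϱ) hb (fun j _ => hwb s j) f) hwa' hvc' (n := b)
    (Q := C₂ * η * r) hT hη (by positivity) hb0 ?_ hup hve' hvh' hvb'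
  · refine le_trans (le_of_eq ?_) (key.trans (le_of_eq (by ring)))
    refine intervalIntegral.integral_congr fun s _ => ?_
    simp only [slot_apply]
    rw [Function.update_eq_self]
  · calc T * (P.B * b ^ m) * η ≤ C₂ * η * 1 := by
          rw [mul_one]
          refine mul_le_mul_of_nonneg_right ?_ hη.le
          linarith
      _ ≤ _ := by gcongr

lemma ker_eq_smul (t : ℝ) : P.ker t = fun kk => cis (t * P.phi P.c) •
    osc (fun kk => t * (P.phi kk - P.phi P.c)) P.K kk := by
  funext kk
  rw [ker, osc, osc, smul_smul, ← cis_add]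
  congr 2
  ring

lemma continuous_op_centered : Continuous fun q : ℝ × (Fin m → L1 d J) =>
    op (osc (fun kk => q.1 * (P.phi kk - P.phi P.c)) P.K) q.2 := by
  have h0 : ∀ t, IsBddMeas (osc (fun kk => t * (P.phi kk - P.phi P.c)) P.K) := fun t =>
    P.isBddMeas_osc (continuous_const.mul (P.continuous_phi.sub continuous_const))
  refine Wavepacket.continuous_op P.pos h0
    (fun t => Filter.Eventually.of_forall (P.norm_osc_le _))
    (Filter.Eventually.of_forall fun kk => ?_)
  exact (continuous_cis.comp (continuous_id.mul continuous_const)).smul continuous_const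

lemma osc_bound {q ϱ M Z T τ D I : ℝ} (hq : 0 ≤ q) (hϱ : 0 ≤ ϱ) (hM : 0 ≤ M) (hZ : 0 ≤ Z)
    (hT : 0 ≤ T) (hτ : τ ≤ T) (hD : 0 ≤ D) (hI : 0 ≤ I) :
    q * ϱ * M + (τ * (Z * ϱ) + D * I) ≤ (q * M + T * Z + D + 1) * (ϱ + I) := by
  have h1 : τ * (Z * ϱ) ≤ T * (Z * ϱ) := mul_le_mul_of_nonneg_right hτ (by positivity)
  have h2 : 0 ≤ (q * M + T * Z + 1) * I + (D + 1) * ϱ := by positivity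
  linarith

/-- The oscillation of a nonresonant monomial. -/
lemma nonresonant {b Λ T : ℝ} (hb : 1 ≤ b) (hΛ : 0 ≤ Λ) (hT : 0 ≤ T)
    (hphi : P.phi P.c ≠ 0) :
    ∃ C : ℝ, 0 < C ∧ ∀ ϱ, 0 < ϱ → ∀ w : ℝ → Fin m → L1 d J, Continuous w →
      (∀ s j, ‖w s j‖ ≤ b) → (∀ s s' j, ‖w s j - w s' j‖ ≤ Λ * |s - s'|) →
      ∀ τ ∈ Set.Icc 0 T, ‖∫ s in (0 : ℝ)..τ, op (P.ker (s / ϱ)) (w s)‖ ≤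
        C * (ϱ + ∫ s in (0 : ℝ)..τ, ∑ j, wnorm (P.c j) (w s j)) := by
  set q := Real.pi / |P.phi P.c| with hq
  have hq0 : 0 < q := div_pos Real.pi_pos (abs_pos.2 hphi)
  have hb0 : 0 ≤ b := zero_le_one.trans hb
  have hB := P.B_nonneg
  have hbm : 0 ≤ b ^ (m - 1) := pow_nonneg hb0 _
  set D := P.B * (2 * P.B) * q * b ^ (m - 1) with hD
  have hD0 : 0 ≤ D := by positivity
  set N := q * (P.B * b ^ m) + T * (P.B * m * b ^ (m - 1) * (Λ * q) + D * (m * (Λ * q))) with hN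
  have hN0 : 0 ≤ N := by positivity
  refine ⟨N + D + 1, by positivity, ?_⟩
  intro ϱ hϱ w hwc hwb hwl τ hτ
  set μ := P.phi P.c / ϱ with hμ
  have hμ0 : μ ≠ 0 := div_ne_zero hphi hϱ.ne'
  have hδ : Real.pi / |μ| = q * ϱ := by
    rw [hμ, abs_div, abs_of_pos hϱ, hq]; field_simp
  set θ : ℝ → (Fin m → X d) → ℝ := fun s kk => s / ϱ * (P.phi kk - P.phi P.c) with hθ
  have hθc : ∀ s, Continuous (θ s) := fun s =>
    continuous_const.mul (P.continuous_phi.sub continuous_const)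
  set g : ℝ → L1 d J := fun s => op (osc (θ s) P.K) (w s) with hg
  have hgc : Continuous g := by
    have h2 : Continuous fun s : ℝ => (s / ϱ, w s) := (continuous_id.div_const ϱ).prodMk hwc
    exact P.continuous_op_centered.comp h2
  have hop : ∀ s, op (P.ker (s / ϱ)) (w s) =
      Complex.exp (((s * μ : ℝ) : ℂ) * Complex.I) • g s := fun s => by
    have h0 : s / ϱ * P.phi P.c = s * μ := by rw [hμ]; ring
    rw [P.ker_eq_smul (s / ϱ), op_smul P.pos (P.isBddMeas_osc (hθc s)), h0]
    rfl
  have hgb : ∀ s, ‖g s‖ ≤ P.B * b ^ m := by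
    intro s
    refine (Wavepacket.norm_op_le P.pos (P.isBddMeas_osc (hθc s))
      (Filter.Eventually.of_forall (P.norm_osc_le _)) _).trans
      (mul_le_mul_of_nonneg_left ?_ hB)
    have := prod_le_pow_card_of_nonneg Finset.univ (fun j => norm_nonneg (w s j)) (hwb s)
    rwa [Finset.card_univ, Fintype.card_fin] at this
  have hws : Continuous fun s => ∑ j, wnorm (P.c j) (w s j) :=
    continuous_finsetSum _ fun j _ =>
      (continuous_wnorm (P.c j)).comp ((continuous_apply j).comp hwc)
  have hdiff : ∀ s, ‖g s - g (s - q * ϱ)‖ ≤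
      (P.B * m * b ^ (m - 1) * (Λ * q) + D * (m * (Λ * q))) * ϱ +
        D * ∑ j, wnorm (P.c j) (w s j) := by
    intro s
    set s' := s - q * ϱ with hs'
    have hss : |s - s'| = q * ϱ := by
      rw [hs', sub_sub_cancel, abs_of_pos (by positivity)]
    have e : g s - g s' = (op (osc (θ s) P.K) (w s) - op (osc (θ s) P.K) (w s')) +
        op (fun kk => osc (θ s) P.K kk - osc (θ s') P.K kk) (w s') := by
      rw [op_sub P.pos (P.isBddMeas_osc (hθc s)) (P.isBddMeas_osc (hθc s'))]
      simp only [hg]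
      abel
    have e1 : ‖op (osc (θ s) P.K) (w s) - op (osc (θ s) P.K) (w s')‖ ≤
        P.B * m * b ^ (m - 1) * (Λ * (q * ϱ)) := by
      refine (norm_op_sub_op_le P.pos (P.isBddMeas_osc (hθc s)) hB
        (Filter.Eventually.of_forall (P.norm_osc_le _)) _ _ hb0 (hwb s) (hwb s')).trans ?_
      refine mul_le_mul_of_nonneg_left ?_ (by positivity)
      refine (pi_norm_le_iff_of_nonneg (by positivity)).2 fun j => ?_
      rw [← hss]
      exact hwl s s' j
    have e2 : ‖op (fun kk => osc (θ s) P.K kk - osc (θ s') P.K kk) (w s')‖ ≤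
        D * ∑ j, wnorm (P.c j) (w s' j) := by
      refine (norm_op_le_weight P.pos ((P.isBddMeas_osc (hθc s)).sub (P.isBddMeas_osc (hθc s')))
        (A := 0) (C := P.B * (2 * P.B) * q) le_rfl (by positivity) P.c
        (Filter.Eventually.of_forall fun kk => ?_) _ (hwb s')).trans (le_of_eq ?_)
      · have h1 : osc (θ s) P.K kk - osc (θ s') P.K kk =
            (cis (θ s kk) - cis (θ s' kk)) • P.K kk := by
          rw [osc, osc]; module
        have h2 : |θ s kk - θ s' kk| ≤ q * (2 * P.B * ∑ j, dist1 (P.c j) (kk j)) := by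
          have : θ s kk - θ s' kk = q * (P.phi kk - P.phi P.c) := by
            rw [hθ, hs']; field_simp; ring
          rw [this, abs_mul, abs_of_pos hq0]
          exact mul_le_mul_of_nonneg_left (P.abs_phi_sub_le kk) hq0.le
        rw [h1, norm_smul, zero_add]
        refine (mul_le_mul ((norm_cis_sub_le _ _).trans h2) (P.norm_K_le kk) (norm_nonneg _)
          ((abs_nonneg _).trans h2)).trans (le_of_eq (by ring))
      · rw [hD]; ring
    have e3 : ∑ j, wnorm (P.c j) (w s' j) ≤
        (∑ j, wnorm (P.c j) (w s j)) + m * (Λ * (q * ϱ)) := by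
      have h1 : ∀ j ∈ Finset.univ, wnorm (P.c j) (w s' j) ≤
          wnorm (P.c j) (w s j) + Λ * (q * ϱ) := by
        intro j _
        have h2 := wnorm_add_le (P.c j) (w s j) (w s' j - w s j)
        rw [add_sub_cancel] at h2
        have h3 := (wnorm_le_norm (P.c j) (w s' j - w s j)).trans (hwl s' s j)
        rw [abs_sub_comm, hss] at h3
        linarith
      refine (Finset.sum_le_sum h1).trans (le_of_eq ?_)
      rw [Finset.sum_add_distrib]
      simp
    rw [e]
    refine (norm_add_le _ _).trans ((add_le_add e1
      (e2.trans (mul_le_mul_of_nonneg_left e3 hD0))).trans (le_of_eq (by ring)))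
  have hmain := norm_integral_osc_le hgc hμ0 hgb hτ.1
  rw [hδ] at hmain
  have hint : ∫ s in (0 : ℝ)..τ, ‖g s - g (s - q * ϱ)‖ ≤
      τ * ((P.B * m * b ^ (m - 1) * (Λ * q) + D * (m * (Λ * q))) * ϱ) +
        D * ∫ s in (0 : ℝ)..τ, ∑ j, wnorm (P.c j) (w s j) := by
    have hc1 : Continuous fun s => ‖g s - g (s - q * ϱ)‖ :=
      (hgc.sub (hgc.comp (continuous_sub_right _))).norm
    have hc2 : Continuous fun s => (P.B * m * b ^ (m - 1) * (Λ * q) + D * (m * (Λ * q))) * ϱ +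
        D * ∑ j, wnorm (P.c j) (w s j) := continuous_const.add (hws.const_mul D)
    refine (intervalIntegral.integral_mono_on hτ.1 (hc1.intervalIntegrable _ _)
      (hc2.intervalIntegrable _ _) fun s _ => hdiff s).trans (le_of_eq ?_)
    rw [intervalIntegral.integral_add (continuous_const.intervalIntegrable _ _)
      ((hws.const_mul D).intervalIntegrable _ _), intervalIntegral.integral_const,
      intervalIntegral.integral_const_mul, sub_zero, smul_eq_mul]
  have hI : 0 ≤ ∫ s in (0 : ℝ)..τ, ∑ j, wnorm (P.c j) (w s j) :=
    intervalIntegral.integral_nonneg hτ.1 fun s _ =>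
      Finset.sum_nonneg fun j _ => wnorm_nonneg _ _
  simp only [hop]
  refine hmain.trans ((add_le_add le_rfl hint).trans ?_)
  exact osc_bound hq0.le hϱ.le (by positivity) (by positivity) hT hτ.2 hD0 hI

end PhaseMono

end Wavepacket

namespace Wavepacket

variable {d J m : ℕ}

/-! ### Cutoffs and extensions -/

section Cutoff

variable {E F : Type*} [NormedAddCommGroup E] [NormedSpace ℝ E] [FiniteDimensional ℝ E]
  [NormedAddCommGroup F] [NormedSpace ℝ F]

/-- A smooth function equal to `1` on the ball of radius `r / 2` about `c` and to `0` off the ball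
of radius `r`. -/
def cut (c : E) (r : ℝ) : E → ℝ :=
  open Classical in
  if h : 0 < r then (⟨r / 2, r, half_pos h, half_lt_self h⟩ : ContDiffBump c) else 0

lemma cut_eq_one {c : E} {r : ℝ} (hr : 0 < r) {k : E} (hk : ‖k - c‖ ≤ r / 2) : cut c r k = 1 := by
  rw [cut, dif_pos hr]
  exact ContDiffBump.one_of_mem_closedBall _ (by rwa [Metric.mem_closedBall, dist_eq_norm])

lemma cut_eq_zero {c : E} {r : ℝ} {k : E} (hk : r ≤ ‖k - c‖) : cut c r k = 0 := by
  rw [cut]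
  split_ifs with hr
  · exact ContDiffBump.zero_of_le_dist _ (by rwa [dist_eq_norm])
  · rfl

lemma abs_cut_le (c : E) (r : ℝ) (k : E) : |cut c r k| ≤ 1 := by
  rw [cut]
  split_ifs with hr
  · rw [abs_of_nonneg (ContDiffBump.nonneg _)]
    exact ContDiffBump.le_one _
  · simp

lemma contDiff_cut (c : E) (r : ℝ) : ContDiff ℝ ∞ (cut c r) := by
  rw [cut]
  split_ifs with hr
  · exact ContDiffBump.contDiff _
  · exact contDiff_const

lemma hasCompactSupport_cut (c : E) (r : ℝ) : HasCompactSupport (cut c r) := by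
  rw [cut]
  split_ifs with hr
  · exact ContDiffBump.hasCompactSupport _
  · exact HasCompactSupport.zero

lemma contDiff_cut_smul {f : E → F} {c : E} {r : ℝ}
    (hf : ∀ k, ‖k - c‖ ≤ r → ContDiffAt ℝ ∞ f k) : ContDiff ℝ ∞ fun k => cut c r k • f k := by
  rw [contDiff_iff_contDiffAt]
  intro k
  rcases le_or_gt ‖k - c‖ r with h | h
  · exact (contDiff_cut c r).contDiffAt.smul (hf k h)
  · have h1 : ∀ᶠ k' in 𝓝 k, cut c r k' • f k' = 0 := by
      have h2 : ContinuousAt (fun k' => ‖k' - c‖) k := by fun_prop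
      filter_upwards [h2.eventually (lt_mem_nhds h)] with k' hk'
      rw [cut_eq_zero hk'.le, zero_smul]
    exact contDiffAt_const.congr_of_eventuallyEq h1

lemma exists_bound_cut_smul {f : E → F} {c : E} {r : ℝ}
    (hf : ∀ k, ‖k - c‖ ≤ r → ContDiffAt ℝ ∞ f k) :
    ∃ B : ℝ, 0 ≤ B ∧ (∀ k, ‖cut c r k • f k‖ ≤ B) ∧
      ∀ k k', ‖cut c r k • f k - cut c r k' • f k'‖ ≤ B * ‖k - k'‖ := by
  have h1 := contDiff_cut_smul hf
  have h2 : HasCompactSupport fun k => cut c r k • f k := (hasCompactSupport_cut c r).smul_right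
  obtain ⟨B, hB⟩ := h2.exists_bound_of_continuous h1.continuous
  obtain ⟨L, hL⟩ := h1.lipschitzWith_of_hasCompactSupport h2 (by simp)
  refine ⟨max B L, le_max_of_le_right L.2, fun k => (hB k).trans (le_max_left _ _),
    fun k k' => ?_⟩
  rw [← dist_eq_norm, ← dist_eq_norm]
  exact (hL.dist_le_mul k k').trans (mul_le_mul_of_nonneg_right (le_max_right _ _) dist_nonneg)

end Cutoff

lemma exists_taylor_cut_smul {f : X d → ℝ} {c : X d} {r : ℝ} (hr : 0 < r)
    (hf : ∀ k, ‖k - c‖ ≤ r → ContDiffAt ℝ ∞ f k) :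
    ∃ B : ℝ, 0 ≤ B ∧ (∀ k, |cut c r k • f k - cut c r c • f c| ≤ B * dist1 c k) ∧
      ∀ k h, |cut c r (k + h) • f (k + h) - cut c r k • f k - inner ℝ (gradient f c) h| ≤
        B * ‖h‖ * (dist1 c k + ‖h‖) := by
  obtain ⟨B₀, hB₀, hb, hl⟩ := exists_bound_cut_smul hf
  have h1 := contDiff_cut_smul hf
  set Ω : X d → ℝ := fun k => cut c r k • f k with hΩ
  have h2 : HasCompactSupport Ω := (hasCompactSupport_cut c r).smul_right
  have h3 : ContDiff ℝ ∞ (fderiv ℝ Ω) := h1.fderiv_right (by simp)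
  obtain ⟨B₁, hB₁⟩ := (h2.fderiv ℝ).exists_bound_of_continuous h3.continuous
  obtain ⟨L, hL⟩ := h3.lipschitzWith_of_hasCompactSupport (h2.fderiv ℝ) (by simp)
  have hgr : ∀ h, inner ℝ (gradient f c) h = fderiv ℝ Ω c h := by
    intro h
    have : f =ᶠ[𝓝 c] Ω := by
      have h4 : ContinuousAt (fun k' => ‖k' - c‖) c := by fun_prop
      have h5 : ‖c - c‖ < r / 2 := by rw [sub_self, norm_zero]; exact half_pos hr
      filter_upwards [h4.eventually (eventually_lt_nhds h5)] with k' hk'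
      rw [hΩ]
      simp only
      rw [cut_eq_one hr hk'.le, one_smul]
    rw [inner_gradient_left, this.fderiv_eq]
  have hB₁0 : 0 ≤ B₁ := (norm_nonneg _).trans (hB₁ 0)
  have hd : ∀ (B A : ℝ) (k : X d), 0 ≤ B → 0 ≤ A → ∀ x, x ≤ B * ‖k - c‖ → x ≤ A →
      x ≤ (B + A) * dist1 c k := by
    intro B A k hB hA x h1 h2
    rcases le_total ‖k - c‖ 1 with h | h
    · rw [dist1, min_eq_left h]; nlinarith [norm_nonneg (k - c)]
    · rw [dist1, min_eq_right h]; linarith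
  refine ⟨B₀ + 2 * B₀ + (L + 2 * B₁), by positivity, fun k => ?_, fun k h => ?_⟩
  · have h5 := hd B₀ (2 * B₀) k hB₀ (by positivity) |Ω k - Ω c| (hl k c) (by
      refine (abs_sub _ _).trans ?_
      have := hb k
      have := hb c
      rw [Real.norm_eq_abs] at *
      linarith)
    refine h5.trans (mul_le_mul_of_nonneg_right ?_ (dist1_nonneg _ _))
    have := L.2
    linarith [L.coe_nonneg]
  · rw [hgr]
    have hLc := L.coe_nonneg
    have key : ∀ z ∈ segment ℝ k (k + h), ‖fderiv ℝ Ω z - fderiv ℝ Ω c‖ ≤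
        (L + 2 * B₁) * (dist1 c k + ‖h‖) := by
      intro z hz
      have hzk : ‖z - k‖ ≤ ‖h‖ := by
        obtain ⟨t, ht, rfl⟩ := segment_eq_image' ℝ k (k + h) ▸ hz
        simp only [add_sub_cancel_left]
        rw [norm_smul, Real.norm_of_nonneg ht.1]
        exact mul_le_of_le_one_left (norm_nonneg _) ht.2
      have h6 : ‖fderiv ℝ Ω z - fderiv ℝ Ω k‖ ≤ L * ‖h‖ := by
        have := hL.dist_le_mul z k
        rw [dist_eq_norm, dist_eq_norm] at this
        exact this.trans (mul_le_mul_of_nonneg_left hzk hLc)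
      have h7 : ‖fderiv ℝ Ω k - fderiv ℝ Ω c‖ ≤ (L + 2 * B₁) * dist1 c k := by
        refine hd L (2 * B₁) k hLc (by positivity) _ ?_ ?_
        · have := hL.dist_le_mul k c
          rwa [dist_eq_norm, dist_eq_norm] at this
        · refine (norm_sub_le _ _).trans ?_
          linarith [hB₁ k, hB₁ c]
      have h8 := norm_sub_le_norm_sub_add_norm_sub (fderiv ℝ Ω z) (fderiv ℝ Ω k) (fderiv ℝ Ω c)
      have h9 : 0 ≤ 2 * B₁ * ‖h‖ := by positivity
      linarith
    have h10 := (convex_segment k (k + h)).norm_image_sub_le_of_norm_fderiv_le'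
      (fun z _ => h1.differentiable (by simp) z) key (left_mem_segment ℝ _ _)
      (right_mem_segment ℝ _ _)
    rw [add_sub_cancel_left, Real.norm_eq_abs] at h10
    refine h10.trans ?_
    have h11 : 0 ≤ dist1 c k + ‖h‖ := add_nonneg (dist1_nonneg _ _) (norm_nonneg _)
    calc (L + 2 * B₁) * (dist1 c k + ‖h‖) * ‖h‖ = (L + 2 * B₁) * (‖h‖ * (dist1 c k + ‖h‖)) := by
          ring
      _ ≤ (B₀ + 2 * B₀ + (L + 2 * B₁)) * (‖h‖ * (dist1 c k + ‖h‖)) := by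
          refine mul_le_mul_of_nonneg_right (by linarith) (by positivity)
      _ = _ := by ring

namespace WaveSystem

variable {sys : WaveSystem d J}

/-! ### The frame of a spectrum -/

/-- The wavevector of the component `ζ` of a wavepacket. -/
def centre (i : ℤˣ × NK d J) : X d := sgn i.1 • i.2.2

/-- The indices of the components of a multi-wavepacket with the spectrum `S`. -/
def idx (S : Finset (NK d J)) : Finset (ℤˣ × NK d J) := Finset.univ ×ˢ S

lemma mem_idx {S : Finset (NK d J)} {i : ℤˣ × NK d J} : i ∈ idx S ↔ i.2 ∈ S := by
  rw [idx, Finset.mem_product, and_iff_right (Finset.mem_univ _)]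

/-- `ρ` is a radius for which the relevant wavevectors of the spectrum `S` are separated from each
other and from the band-crossing points. -/
structure IsRadius (sys : WaveSystem d J) (S : Finset (NK d J)) (ρ : ℝ) : Prop where
  pos : 0 < ρ
  off : ∀ i ∈ idx S, ∀ k, ‖k - centre i‖ ≤ 8 * ρ → k ∉ sys.bandCrossing
  off_out : ∀ m ∈ sys.M, ∀ lam : Fin m → ℤˣ × NK d J, (∀ j, lam j ∈ idx S) →
    ∀ k, ‖k - kappa lam‖ ≤ 8 * m * ρ → k ∉ sys.bandCrossing
  sep : ∀ i ∈ idx S, ∀ i' ∈ idx S, centre i' ≠ centre i → 2 * ρ ≤ ‖centre i' - centre i‖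
  sep_out : ∀ i ∈ idx S, ∀ m ∈ sys.M, ∀ lam : Fin m → ℤˣ × NK d J, (∀ j, lam j ∈ idx S) →
    kappa lam ≠ centre i → 2 * ρ ≤ ‖kappa lam - centre i‖

lemma exists_radius_finset {P : Finset (X d)} {Z : Set (X d)} (hZ : IsClosed Z)
    (hP : ∀ c ∈ P, c ∉ Z) : ∃ r > 0, (∀ c ∈ P, ∀ k, ‖k - c‖ ≤ r → k ∉ Z) ∧
      ∀ c ∈ P, ∀ c' ∈ P, c' ≠ c → r ≤ ‖c' - c‖ := by
  have h1 : ∀ c ∈ P, ∃ r > 0, ∀ k, ‖k - c‖ ≤ r → k ∉ Z := by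
    intro c hc
    obtain ⟨r, hr, h⟩ := Metric.isOpen_iff.1 hZ.isOpen_compl c (hP c hc)
    refine ⟨r / 2, half_pos hr, fun k hk => h ?_⟩
    rw [Metric.mem_ball, dist_eq_norm]
    linarith
  have h2 : ∃ r > 0, ∀ c ∈ P, ∀ k, ‖k - c‖ ≤ r → k ∉ Z := by
    choose! r hr h using h1
    rcases P.eq_empty_or_nonempty with rfl | hne
    · exact ⟨1, one_pos, by simp⟩
    · refine ⟨P.inf' hne r, (Finset.lt_inf'_iff hne).2 hr, fun c hc k hk => h c hc k ?_⟩
      exact hk.trans (Finset.inf'_le r hc)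
  have h3 : ∃ r > 0, ∀ q ∈ P ×ˢ P, q.2 ≠ q.1 → r ≤ ‖q.2 - q.1‖ := by
    rcases (P ×ˢ P).eq_empty_or_nonempty with he | hne
    · exact ⟨1, one_pos, by simp [he]⟩
    · refine ⟨(P ×ˢ P).inf' hne fun q => if q.2 = q.1 then 1 else ‖q.2 - q.1‖, ?_,
        fun q hq h => (Finset.inf'_le _ hq).trans (by simp [h])⟩
      rw [gt_iff_lt, Finset.lt_inf'_iff]
      intro q _
      split_ifs with h
      · exact one_pos
      · exact norm_pos_iff.2 (sub_ne_zero.2 h)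
  obtain ⟨r, hr, h⟩ := h2
  obtain ⟨r', hr', h'⟩ := h3
  refine ⟨min r r', lt_min hr hr', fun c hc k hk => h c hc k (hk.trans (min_le_left _ _)),
    fun c hc c' hc' hne => (min_le_right _ _).trans
      (h' (c, c') (Finset.mk_mem_product hc hc') hne)⟩

lemma Admissible.exists_isRadius (hsys : sys.Admissible) {S : Finset (NK d J)}
    (hS : sys.AvoidsBandCrossing (S : Set (NK d J))) : ∃ ρ, sys.IsRadius S ρ := by
  classical
  set P : Finset (X d) := (idx S).image centre ∪
    sys.M.biUnion fun m => (Fintype.piFinset fun _ : Fin m => idx S).image kappa with hP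
  have hc : ∀ i ∈ idx S, centre i ∈ P := fun i hi =>
    Finset.mem_union_left _ (Finset.mem_image_of_mem _ hi)
  have hk : ∀ m ∈ sys.M, ∀ lam : Fin m → ℤˣ × NK d J, (∀ j, lam j ∈ idx S) → kappa lam ∈ P :=
    fun m hm lam hl => Finset.mem_union_right _ (Finset.mem_biUnion.2
      ⟨m, hm, Finset.mem_image_of_mem _ (Fintype.mem_piFinset.2 hl)⟩)
  have hoff : ∀ c ∈ P, c ∉ sys.bandCrossing := by
    intro c hc
    rcases Finset.mem_union.1 hc with h | h
    · obtain ⟨i, hi, rfl⟩ := Finset.mem_image.1 h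
      exact hS.1 i.2 (mem_idx.1 hi) i.1
    · obtain ⟨m, hm, h⟩ := Finset.mem_biUnion.1 h
      obtain ⟨lam, hl, rfl⟩ := Finset.mem_image.1 h
      exact hS.2 m hm lam fun j => mem_idx.1 (Fintype.mem_piFinset.1 hl j)
  obtain ⟨r, hr, h1, h2⟩ := exists_radius_finset hsys.isClosed_bandCrossing hoff
  set N : ℝ := ((sys.M.sup id : ℕ) : ℝ) + 1 with hN
  have hN1 : 1 ≤ N := by rw [hN]; linarith [Nat.cast_nonneg (α := ℝ) (sys.M.sup id)]
  have hNm : ∀ m ∈ sys.M, (m : ℝ) ≤ N := fun m hm => by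
    have : m ≤ sys.M.sup id := Finset.le_sup (f := id) hm
    rw [hN]
    have : (m : ℝ) ≤ (sys.M.sup id : ℕ) := by exact_mod_cast this
    linarith
  have hN0 : 0 < N := by linarith
  have hNr : 8 * N * (r / (8 * N)) = r := by field_simp
  have hρ : 0 < r / (8 * N) := by positivity
  have hle : 8 * (r / (8 * N)) ≤ r := by
    calc 8 * (r / (8 * N)) ≤ 8 * N * (r / (8 * N)) := by
          refine mul_le_mul_of_nonneg_right ?_ hρ.le
          linarith
      _ = r := hNr
  refine ⟨r / (8 * N), hρ, fun i hi k hk' => h1 _ (hc i hi) k (hk'.trans hle),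
    fun m hm lam hl k hk' => h1 _ (hk m hm lam hl) k (hk'.trans ?_),
    fun i hi i' hi' hne => le_trans ?_ (h2 _ (hc i hi) _ (hc i' hi') hne),
    fun i hi m hm lam hl hne => le_trans ?_ (h2 _ (hc i hi) _ (hk m hm lam hl) hne)⟩
  · calc 8 * m * (r / (8 * N)) ≤ 8 * N * (r / (8 * N)) := by
          have := hNm m hm
          gcongr
      _ = r := hNr
  · linarith
  · linarith

end WaveSystem

end Wavepacket

namespace Wavepacket

variable {d J m : ℕ}

namespace WaveSystem

variable {sys : WaveSystem d J} {S : Finset (NK d J)} {ρ : ℝ}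

/-! ### The interaction monomials -/

/-- The susceptibility with its output projected to the band `o`. -/
def bandKernel (sys : WaveSystem d J) (m : ℕ) (o : ℤˣ × Fin J) (kk : Fin m → X d) : Mult J m :=
  ((((2 * Real.pi) ^ ((m - 1) * d))⁻¹ : ℝ) : ℂ) •
    outMul (sys.bandProj o.1 o.2) (fun kk => sys.χ m (∑ j, kk j) kk) kk

/-- The global symbol of the band `(ζ, n)`, cut off at the distance `r` from `c`. -/
def cutFreq (sys : WaveSystem d J) (o : ℤˣ × Fin J) (c : X d) (r : ℝ) (k : X d) : ℝ :=
  cut c r k • sys.freq o.1 o.2 k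

/-- The cut off kernel of the monomial with the inputs `lam` and its output in the band `o`. -/
def monoKernel (sys : WaveSystem d J) (ρ : ℝ) (lam : Fin m → ℤˣ × NK d J) (o : ℤˣ × Fin J)
    (kk : Fin m → X d) : Mult J m :=
  cut (fun j => centre (lam j)) (4 * ρ) kk • sys.bandKernel m o kk

lemma norm_sum_sub_le {kk c : Fin m → X d} {r : ℝ} (h : ‖kk - c‖ ≤ r) :
    ‖∑ j, kk j - ∑ j, c j‖ ≤ m * r := by
  rw [← Finset.sum_sub_distrib]
  refine (norm_sum_le _ _).trans ((Finset.sum_le_sum fun j _ =>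
    ((norm_le_pi_norm (kk - c) j).trans h)).trans (le_of_eq ?_))
  simp

lemma IsRadius.off_args (hr : sys.IsRadius S ρ) (hm : m ∈ sys.M) {lam : Fin m → ℤˣ × NK d J}
    (hl : ∀ j, lam j ∈ idx S) {kk : Fin m → X d}
    (hk : ‖kk - fun j => centre (lam j)‖ ≤ 4 * ρ) :
    (∑ j, kk j) ∉ sys.bandCrossing ∧ ∀ j, kk j ∉ sys.bandCrossing := by
  have hρ := hr.pos
  constructor
  · refine hr.off_out m hm lam hl _ ((norm_sum_sub_le hk).trans ?_)
    have : (0 : ℝ) ≤ m := Nat.cast_nonneg m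
    nlinarith
  · intro j
    refine hr.off (lam j) (hl j) _ (((norm_le_pi_norm (kk - _) j).trans hk).trans ?_)
    linarith

lemma Admissible.contDiffAt_bandKernel (hsys : sys.Admissible) (hm : m ∈ sys.M)
    (o : ℤˣ × Fin J) {kk : Fin m → X d} (h1 : (∑ j, kk j) ∉ sys.bandCrossing)
    (h2 : ∀ j, kk j ∉ sys.bandCrossing) : ContDiffAt ℝ ∞ (sys.bandKernel m o) kk := by
  have hsum : ContDiff ℝ ∞ fun kk : Fin m → X d => ∑ j, kk j :=
    ContDiff.sum fun j _ => contDiff_apply ℝ (X d) j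
  have hb : ContDiffAt ℝ ∞ (fun kk : Fin m → X d => sys.bandProj o.1 o.2 (∑ j, kk j)) kk :=
    ContDiffAt.comp kk (g := sys.bandProj o.1 o.2) (f := fun kk : Fin m → X d => ∑ j, kk j)
      (hsys.contDiffAt_bandProj h1 o.1 o.2) hsum.contDiffAt
  have hχ : ContDiffAt ℝ ∞ (fun kk : Fin m → X d => sys.χ m (∑ j, kk j) kk) kk :=
    ContDiffAt.comp kk (g := fun q : X d × (Fin m → X d) => sys.χ m q.1 q.2)
      (f := fun kk : Fin m → X d => (∑ j, kk j, kk))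
      (hsys.smooth_χ m hm _ _ h1 h2) (hsum.contDiffAt.prodMk contDiffAt_id)
  set L := ContinuousLinearMap.compContinuousMultilinearMapL ℂ (fun _ : Fin m => V J) (V J) (V J)
  have hL : IsBoundedBilinearMap ℝ fun q : (V J →L[ℂ] V J) × Mult J m => L q.1 q.2 :=
    { add_left := fun x y z => by simp
      smul_left := fun c x z => by
        rw [← Complex.coe_smul, map_smul, ← Complex.coe_smul]; rfl
      add_right := fun x y z => by simp
      smul_right := fun c x z => by
        rw [← Complex.coe_smul, map_smul, ← Complex.coe_smul]
      bound := ⟨1, one_pos, fun x y => by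
        rw [one_mul]
        exact ContinuousLinearMap.norm_compContinuousMultilinearMap_le x y⟩ }
  have h3 : ContDiffAt ℝ ∞ (fun kk : Fin m → X d => L (sys.bandProj o.1 o.2 (∑ j, kk j))
      (sys.χ m (∑ j, kk j) kk)) kk :=
    ContDiffAt.comp kk (g := fun q : (V J →L[ℂ] V J) × Mult J m => L q.1 q.2)
      (f := fun kk : Fin m → X d => (sys.bandProj o.1 o.2 (∑ j, kk j), sys.χ m (∑ j, kk j) kk))
      hL.contDiff.contDiffAt (hb.prodMk hχ)
  exact h3.const_smul ((((2 * Real.pi) ^ ((m - 1) * d))⁻¹ : ℝ) : ℂ)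

lemma IsRadius.exists_phaseMono (hsys : sys.Admissible) (hr : sys.IsRadius S ρ) (hm : m ∈ sys.M)
    {lam : Fin m → ℤˣ × NK d J} (hl : ∀ j, lam j ∈ idx S) (o : ℤˣ × Fin J) :
    ∃ P : PhaseMono d J m, P.K = sys.monoKernel ρ lam o ∧ P.c = (fun j => centre (lam j)) ∧
      P.Ωo = sys.cutFreq o (kappa lam) (8 * m * ρ) ∧
      P.Ω = (fun j => sys.cutFreq ((lam j).1, (lam j).2.1) (centre (lam j)) (8 * ρ)) ∧
      P.vo = gradient (sys.freq o.1 o.2) (kappa lam) ∧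
      P.v = fun j => gradient (sys.freq (lam j).1 (lam j).2.1) (centre (lam j)) := by
  have hρ := hr.pos
  have hm0 : 0 < m := hsys.pos_of_mem hm
  have hmR : (0 : ℝ) < m := by exact_mod_cast hm0
  have hK : ∀ kk, ‖kk - fun j => centre (lam j)‖ ≤ 4 * ρ →
      ContDiffAt ℝ ∞ (sys.bandKernel m o) kk := fun kk hk =>
    hsys.contDiffAt_bandKernel hm o (hr.off_args hm hl hk).1 (hr.off_args hm hl hk).2
  obtain ⟨B₁, hB₁, hK1, hK2⟩ := exists_bound_cut_smul hK
  have hfo : ∀ k, ‖k - kappa lam‖ ≤ 8 * m * ρ → ContDiffAt ℝ ∞ (sys.freq o.1 o.2) k :=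
    fun k hk => hsys.contDiffAt_freq (hr.off_out m hm lam hl k hk) _ _
  have hf : ∀ j k, ‖k - centre (lam j)‖ ≤ 8 * ρ →
      ContDiffAt ℝ ∞ (sys.freq (lam j).1 (lam j).2.1) k :=
    fun j k hk => hsys.contDiffAt_freq (hr.off (lam j) (hl j) k hk) _ _
  obtain ⟨B₂, hB₂, ho1, ho2⟩ := exists_taylor_cut_smul (by positivity) hfo
  choose B₃ hB₃ h1 h2 using fun j => exists_taylor_cut_smul (by positivity) (hf j)
  set B := 1 + B₁ + B₂ + ∑ j, B₃ j with hB
  have hs : 0 ≤ ∑ j, B₃ j := Finset.sum_nonneg fun j _ => hB₃ j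
  have hBj : ∀ j, B₃ j ≤ B := fun j => by
    have := Finset.single_le_sum (fun j _ => hB₃ j) (Finset.mem_univ j)
    linarith
  have hB1 : B₁ ≤ B := by linarith
  have hB2 : B₂ ≤ B := by linarith
  have hd : ∀ c k h : X d, 0 ≤ dist1 c k + ‖h‖ := fun c k h =>
    add_nonneg (dist1_nonneg _ _) (norm_nonneg _)
  refine ⟨
    { K := sys.monoKernel ρ lam o
      c := fun j => centre (lam j)
      Ωo := sys.cutFreq o (kappa lam) (8 * m * ρ)
      Ω := fun j => sys.cutFreq ((lam j).1, (lam j).2.1) (centre (lam j)) (8 * ρ)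
      vo := gradient (sys.freq o.1 o.2) (kappa lam)
      v := fun j => gradient (sys.freq (lam j).1 (lam j).2.1) (centre (lam j))
      B := B
      pos := hm0
      one_le := by linarith
      norm_K_le := fun kk => (hK1 kk).trans hB1
      lip_K := fun kk kk' => (hK2 kk kk').trans
        (mul_le_mul_of_nonneg_right hB1 (norm_nonneg _))
      cont_o := (contDiff_cut_smul hfo).continuous
      cont := fun j => (contDiff_cut_smul (hf j)).continuous
      near_o := fun k => (ho1 k).trans (mul_le_mul_of_nonneg_right hB2 (dist1_nonneg _ _))
      near := fun j k => (h1 j k).trans (mul_le_mul_of_nonneg_right (hBj j) (dist1_nonneg _ _))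
      taylor_o := fun k h => (ho2 k h).trans (mul_le_mul_of_nonneg_right
        (mul_le_mul_of_nonneg_right hB2 (norm_nonneg _)) (hd _ _ _))
      taylor := fun j k h => (h2 j k h).trans (mul_le_mul_of_nonneg_right
        (mul_le_mul_of_nonneg_right (hBj j) (norm_nonneg _)) (hd _ _ _)) },
    rfl, rfl, rfl, rfl, rfl, rfl⟩

/-! ### Frequencies and velocities at the centres -/

lemma sgn_smul_sgn_smul (ζ : ℤˣ) (k : X d) : sgn ζ • sgn ζ • k = k := by
  rcases Int.units_eq_one_or ζ with rfl | rfl <;> simp [sgn]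

lemma Admissible.freq_sgn_smul (hsys : sys.Admissible) {k : X d} (ζ : ℤˣ)
    (hk : sgn ζ • k ∉ sys.bandCrossing) (n : Fin J) :
    sys.freq ζ n (sgn ζ • k) = sgn ζ * sys.freq 1 n k := by
  rcases Int.units_eq_one_or ζ with rfl | rfl
  · simp [sgn]
  · have h := hsys.symm _ hk (-1) n
    simp [sgn] at h ⊢
    linarith

lemma Admissible.gradient_freq (hsys : sys.Admissible) {k : X d} (ζ : ℤˣ)
    (hk : k ∉ sys.bandCrossing) (hk' : sgn ζ • k ∉ sys.bandCrossing) (n : Fin J) :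
    gradient (sys.freq ζ n) (sgn ζ • k) = gradient (sys.freq 1 n) k := by
  rcases Int.units_eq_one_or ζ with rfl | rfl
  · simp [sgn]
  · have e : sgn (-1) • k = -k := by simp [sgn]
    rw [e] at hk' ⊢
    have h1 : sys.freq (-1) n =ᶠ[𝓝 (-k)] fun k' => -sys.freq 1 n (-k') := by
      filter_upwards [hsys.eventually_notMem hk'] with k' h
      have := hsys.symm k' h (-1) n
      rw [neg_neg] at this
      rw [this, neg_neg]
    have h2 : HasFDerivAt (sys.freq 1 n) (fderiv ℝ (sys.freq 1 n) k) (- -k) := by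
      rw [neg_neg]
      exact ((hsys.contDiffAt_freq hk 1 n).differentiableAt (by simp)).hasFDerivAt
    have h3 : HasFDerivAt (fun k' => -sys.freq 1 n (-k')) (fderiv ℝ (sys.freq 1 n) k) (-k) := by
      have h4 := (h2.comp (-k) (hasFDerivAt_id (𝕜 := ℝ) (-k)).neg).neg
      have h5 : -(fderiv ℝ (sys.freq 1 n) k).comp (-ContinuousLinearMap.id ℝ (X d)) =
          fderiv ℝ (sys.freq 1 n) k := by ext; simp
      rw [h5] at h4
      exact h4
    rw [gradient, gradient, h1.fderiv_eq, h3.fderiv]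

end WaveSystem

end Wavepacket

namespace Wavepacket

variable {d J m : ℕ}

open WaveSystem

/-- A wave system with a finite spectrum and a separation radius for it. -/
structure Frame (d J : ℕ) where
  sys : WaveSystem d J
  adm : sys.Admissible
  S : Finset (NK d J)
  ρ : ℝ
  rad : sys.IsRadius S ρ

namespace Frame

variable (A : Frame d J)

/-- The indices of the components. -/
abbrev I := {i : ℤˣ × NK d J // i ∈ idx A.S}

variable {A}

/-- The wavevector of a component. -/
def c (i : A.I) : X d := centre i.1

/-- The band of a component. -/
def band (i : A.I) : ℤˣ × Fin J := (i.1.1, i.1.2.1)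

/-- The string of a tuple of components. -/
def str (lam : Fin m → A.I) : Fin m → ℤˣ × NK d J := fun j => (lam j).1

lemma kappa_str (lam : Fin m → A.I) : kappa (str lam) = ∑ j, c (lam j) := rfl

/-- The monomial with the inputs `lam` and its output in the band `o`. -/
def mono (hm : m ∈ A.sys.M) (lam : Fin m → A.I) (o : ℤˣ × Fin J) : PhaseMono d J m :=
  (A.rad.exists_phaseMono A.adm hm (lam := str lam) (fun j => (lam j).2) o).choose

lemma mono_spec (hm : m ∈ A.sys.M) (lam : Fin m → A.I) (o : ℤˣ × Fin J) :
    (mono hm lam o).K = A.sys.monoKernel A.ρ (str lam) o ∧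
      (mono hm lam o).c = (fun j => c (lam j)) ∧
      (mono hm lam o).Ωo = A.sys.cutFreq o (kappa (str lam)) (8 * m * A.ρ) ∧
      (mono hm lam o).Ω = (fun j => A.sys.cutFreq (band (lam j)) (c (lam j)) (8 * A.ρ)) ∧
      (mono hm lam o).vo = gradient (A.sys.freq o.1 o.2) (kappa (str lam)) ∧
      (mono hm lam o).v = fun j => gradient (A.sys.freq (lam j).1.1 (lam j).1.2.1) (c (lam j)) :=
  (A.rad.exists_phaseMono A.adm hm (lam := str lam) (fun j => (lam j).2) o).choose_spec

lemma mono_c (hm : m ∈ A.sys.M) (lam : Fin m → A.I) (o : ℤˣ × Fin J) (j : Fin m) :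
    (mono hm lam o).c j = c (lam j) := by rw [(mono_spec hm lam o).2.1]

/-! ### Filters -/

/-- The symbol of the filter of the component `i`. -/
def filt (i : A.I) (k : X d) : V J →L[ℂ] V J :=
  (cut (c i) (2 * A.ρ) k : ℂ) • A.sys.bandProj (band i).1 (band i).2 k

/-- The filter of the component `i`. -/
def Q (i : A.I) : L1 d J →L[ℂ] L1 d J := mul (filt i)

lemma norm_filt_le (i : A.I) (k : X d) : ‖filt i k‖ ≤ 1 := by
  rw [filt, norm_smul, Complex.norm_real, Real.norm_eq_abs]
  exact mul_le_one₀ (abs_cut_le _ _ _) (norm_nonneg _) (norm_bandProj_le _ _ _)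

lemma isBddMeas_filt (i : A.I) : IsBddMeas (filt i) := by
  refine ⟨?_, 1, Filter.Eventually.of_forall (norm_filt_le i)⟩
  refine aestronglyMeasurable_of_ae_continuousAt ?_
  filter_upwards [A.adm.ae_off] with k hk
  exact (Complex.continuous_ofReal.comp
    (contDiff_cut (c i) (2 * A.ρ)).continuous).continuousAt.smul
    (A.adm.contDiffAt_bandProj hk _ _).continuousAt

lemma norm_Q_le (i : A.I) (f : L1 d J) : ‖Q i f‖ ≤ ‖f‖ := by
  have := norm_mul_le (isBddMeas_filt i) (Filter.Eventually.of_forall (norm_filt_le i)) f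
  rwa [one_mul] at this

/-- The functions in the range of the filter `i`. -/
def IsFiltered (i : A.I) (f : L1 d J) : Prop :=
  ∀ᵐ k, (2 * A.ρ < ‖k - c i‖ → f k = 0) ∧
    A.sys.bandProj (band i).1 (band i).2 k (f k) = f k

lemma isFiltered_Q (i : A.I) (f : L1 d J) : IsFiltered i (Q i f) := by
  filter_upwards [mul_coe (isBddMeas_filt i) f] with k hk
  rw [Q, hk, filt, smul_apply]
  refine ⟨fun h => ?_, ?_⟩
  · rw [cut_eq_zero h.le, Complex.ofReal_zero, zero_smul]
  · rw [map_smul, bandProj_idem]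

/-! ### Decomposition of the nonlinearity on filtered inputs -/

lemma monoKernel_eq {lam : Fin m → A.I} {o : ℤˣ × Fin J} {kk : Fin m → X d}
    (h : ∀ j, ‖kk j - c (lam j)‖ ≤ 2 * A.ρ) :
    A.sys.monoKernel A.ρ (str lam) o kk = A.sys.bandKernel m o kk := by
  have hρ := A.rad.pos
  rw [monoKernel, cut_eq_one (by positivity), one_smul]
  refine (pi_norm_le_iff_of_nonneg (by positivity)).2 fun j => ?_
  have := h j
  rw [Pi.sub_apply]
  refine this.trans (le_of_eq (by ring))

lemma phi_mono (hm : m ∈ A.sys.M) {lam : Fin m → A.I} {o : ℤˣ × Fin J} {kk : Fin m → X d}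
    (h : ∀ j, ‖kk j - c (lam j)‖ ≤ 2 * A.ρ) :
    (mono hm lam o).phi kk = A.sys.freq o.1 o.2 (∑ j, kk j) -
      ∑ j, A.sys.freq (band (lam j)).1 (band (lam j)).2 (kk j) := by
  have hρ := A.rad.pos
  have hm0 : (0 : ℝ) < m := by exact_mod_cast A.adm.pos_of_mem hm
  obtain ⟨-, -, h3, h4, -, -⟩ := mono_spec hm lam o
  rw [PhaseMono.phi, h3, h4]
  congr 1
  · rw [cutFreq, cut_eq_one (by positivity), one_smul]
    have h5 : ‖kk - fun j => c (lam j)‖ ≤ 2 * A.ρ :=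
      (pi_norm_le_iff_of_nonneg (by positivity)).2 h
    refine (norm_sum_sub_le h5).trans ?_
    have : 0 < m * A.ρ := by positivity
    linarith
  · refine Finset.sum_congr rfl fun j _ => ?_
    change A.sys.cutFreq (band (lam j)) (c (lam j)) (8 * A.ρ) (kk j) = _
    rw [cutFreq, cut_eq_one (by positivity), one_smul]
    linarith [h j]

lemma bandKernel_apply (sys : WaveSystem d J) (o : ℤˣ × Fin J) (kk : Fin m → X d)
    (x : Fin m → V J) : sys.bandKernel m o kk x =
      ((((2 * Real.pi) ^ ((m - 1) * d))⁻¹ : ℝ) : ℂ) •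
        sys.bandProj o.1 o.2 (∑ j, kk j) (sys.χ m (∑ j, kk j) kk x) := rfl

lemma slowKernel_apply_of_eigen {kk : Fin m → X d} (h1 : (∑ j, kk j) ∉ A.sys.bandCrossing)
    (b : Fin m → ℤˣ × Fin J) {x : Fin m → V J}
    (hx : ∀ j, A.sys.bandProj (b j).1 (b j).2 (kk j) (x j) = x j) (t : ℝ) :
    A.sys.slowKernel m t kk x = ∑ o : ℤˣ × Fin J,
      cis (t * (A.sys.freq o.1 o.2 (∑ j, kk j) - ∑ j, A.sys.freq (b j).1 (b j).2 (kk j))) •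
        A.sys.bandKernel m o kk x := by
  have h2 : (fun j => A.sys.propagator (-t) (kk j) (x j)) =
      fun j => cis (-t * A.sys.freq (b j).1 (b j).2 (kk j)) • x j := by
    funext j
    have := propagator_bandProj (sys := A.sys) (-t) (b j).1 (b j).2 (kk j) (x j)
    rw [hx j] at this
    exact this
  have h3 : A.sys.slowKernel m t kk x = A.sys.propagator t (∑ j, kk j)
      (((((2 * Real.pi) ^ ((m - 1) * d))⁻¹ : ℝ) : ℂ) •
        A.sys.χ m (∑ j, kk j) kk fun j => A.sys.propagator (-t) (kk j) (x j)) := by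
    rw [slowKernel]; rfl
  have h4 : ∏ j, cis (-t * A.sys.freq (b j).1 (b j).2 (kk j)) =
      cis (-t * ∑ j, A.sys.freq (b j).1 (b j).2 (kk j)) := by
    simp only [cis, ← Complex.exp_sum]
    push_cast
    rw [Finset.mul_sum, Finset.sum_mul]
  rw [h3, h2, ContinuousMultilinearMap.map_smul_univ, h4]
  set y := A.sys.χ m (∑ j, kk j) kk x
  conv_lhs => rw [← A.adm.sum_bandProj h1 y]
  rw [Finset.smul_sum, Finset.smul_sum, map_sum]
  refine Finset.sum_congr rfl fun o _ => ?_
  rw [map_smul, map_smul, propagator_bandProj, bandKernel_apply]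
  change _ • _ • cis (t * A.sys.freq o.1 o.2 (∑ j, kk j)) • _ = _
  rw [smul_smul, smul_smul, smul_smul, mul_sub, sub_eq_add_neg, ← neg_mul, cis_add]
  congr 1
  ring

lemma op_slowKernel_eq (hm : m ∈ A.sys.M) (lam : Fin m → A.I) {w : Fin m → L1 d J}
    (hw : ∀ j, IsFiltered (lam j) (w j)) (t : ℝ) :
    op (A.sys.slowKernel m t) w = ∑ o : ℤˣ × Fin J, op ((mono hm lam o).ker t) w := by
  have hm0 := A.adm.pos_of_mem hm
  rw [← op_sum hm0 _ fun o _ => (mono hm lam o).isBddMeas_ker t]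
  refine op_congr hm0 (A.adm.isBddMeas_slowKernel hm t)
    (IsBddMeas.sum _ fun o _ => (mono hm lam o).isBddMeas_ker t) ?_
  filter_upwards [A.adm.ae_off_args hm0, ae_forall_coord hw] with kk hkk hwk
  by_cases h0 : ∃ j, w j (kk j) = 0
  · obtain ⟨j, hj⟩ := h0
    rw [ContinuousMultilinearMap.map_coord_zero _ j hj,
      ContinuousMultilinearMap.map_coord_zero _ j hj]
  · push Not at h0
    have hnear : ∀ j, ‖kk j - c (lam j)‖ ≤ 2 * A.ρ := fun j => by
      by_contra h
      push Not at h
      exact h0 j ((hwk j).1 h)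
    rw [slowKernel_apply_of_eigen hkk.1 (fun j => band (lam j)) (fun j => (hwk j).2) t,
      sum_apply]
    refine Finset.sum_congr rfl fun o _ => ?_
    rw [PhaseMono.ker, osc, smul_apply, phi_mono hm hnear, (mono_spec hm lam o).1,
      monoKernel_eq hnear]

/-- Vanishing monomials. -/
lemma op_mono_eq_zero (hm : m ∈ A.sys.M) (lam : Fin m → A.I) (o : ℤˣ × Fin J)
    (hz : ¬ A.sys.IsNonzeroTerm o.1 o.2 (str lam)) {w : Fin m → L1 d J}
    (hw : ∀ j, IsFiltered (lam j) (w j)) (t : ℝ) : op ((mono hm lam o).ker t) w = 0 := by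
  have hm0 := A.adm.pos_of_mem hm
  have h0 : IsBddMeas fun _ : Fin m → X d => (0 : Mult J m) :=
    IsBddMeas.of_continuous (C := 0) continuous_const fun _ => by simp
  have h1 : op ((mono hm lam o).ker t) w = op (fun _ : Fin m → X d => (0 : Mult J m)) w := by
    refine op_congr hm0 ((mono hm lam o).isBddMeas_ker t) h0 ?_
    filter_upwards [A.adm.ae_off_args hm0, ae_forall_coord hw] with kk hkk hwk
    have h2 : A.sys.bandProj o.1 o.2 (∑ j, kk j) (A.sys.χ m (∑ j, kk j) kk
        fun j => w j (kk j)) = 0 := by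
      by_contra h
      refine hz ⟨kk, hkk.2, hkk.1, fun j => w j (kk j), ?_⟩
      have h3 : (fun j => A.sys.bandProj (str lam j).1 (str lam j).2.1 (kk j) (w j (kk j))) =
          fun j => w j (kk j) := funext fun j => (hwk j).2
      rw [h3]
      exact h
    rw [PhaseMono.ker, osc, (mono_spec hm lam o).1, monoKernel, smul_apply, smul_apply,
      bandKernel_apply, h2, smul_zero, smul_zero, smul_zero, zero_apply]
  rw [h1]
  have h2 := norm_op_le hm0 h0 (C := 0) (Filter.Eventually.of_forall fun _ => by simp) w
  rw [zero_mul] at h2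
  exact norm_le_zero_iff.1 h2

/-! ### Phases and velocities at the centres -/

lemma c_off (i : A.I) : c i ∉ A.sys.bandCrossing :=
  A.rad.off i.1 i.2 _ (by rw [c, sub_self, norm_zero]; linarith [A.rad.pos])

lemma wave_off (i : A.I) : i.1.2.2 ∉ A.sys.bandCrossing := by
  have h : ((1 : ℤˣ), i.1.2) ∈ idx A.S := mem_idx.2 ((mem_idx (i := i.1)).1 i.2)
  have := c_off (A := A) ⟨_, h⟩
  simpa [c, centre, sgn] using this

lemma kappa_off (hm : m ∈ A.sys.M) (lam : Fin m → A.I) : kappa (str lam) ∉ A.sys.bandCrossing :=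
  A.rad.off_out m hm (str lam) (fun j => (lam j).2) _ (by
    rw [sub_self, norm_zero]
    have := A.rad.pos
    positivity)

lemma phi_centre (hm : m ∈ A.sys.M) (lam : Fin m → A.I) (o : ℤˣ × Fin J) :
    (mono hm lam o).phi (mono hm lam o).c = -A.sys.phase o.1 o.2 (str lam)
      (sgn o.1 • kappa (str lam)) := by
  have hρ := A.rad.pos
  rw [(mono_spec hm lam o).2.1, phi_mono hm (fun j => by rw [sub_self, norm_zero]; positivity),
    phase]
  have h1 : A.sys.freq o.1 o.2 (∑ j, c (lam j)) =
      sgn o.1 * A.sys.freq 1 o.2 (sgn o.1 • kappa (str lam)) := by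
    rw [← A.adm.freq_sgn_smul o.1 (by rw [sgn_smul_sgn_smul]; exact kappa_off hm lam),
      sgn_smul_sgn_smul, kappa_str]
  have h2 : ∀ j, A.sys.freq (band (lam j)).1 (band (lam j)).2 (c (lam j)) =
      sgn (str lam j).1 * A.sys.freq 1 (str lam j).2.1 (str lam j).2.2 := fun j =>
    A.adm.freq_sgn_smul _ (c_off (lam j)) _
  rw [h1, Finset.sum_congr rfl fun j _ => h2 j]
  ring

lemma v_mono (hm : m ∈ A.sys.M) (lam : Fin m → A.I) (o : ℤˣ × Fin J) (j : Fin m) :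
    (mono hm lam o).v j = A.sys.groupVelocity (lam j).1.2 := by
  rw [(mono_spec hm lam o).2.2.2.2.2]
  exact A.adm.gradient_freq _ (wave_off (lam j)) (c_off (lam j)) _

/-! ### Filters of monomials and of filtered functions -/

lemma abs_cut_sub_le (c c' : X d) {r : ℝ} {z : ℝ} (hz : cut c r c' = z) :
    ∃ C : ℝ, 0 ≤ C ∧ ∀ k, |cut c r k - z| ≤ C * dist1 c' k := by
  obtain ⟨L, hL⟩ := (contDiff_cut c r).lipschitzWith_of_hasCompactSupport
    (hasCompactSupport_cut c r) (by simp)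
  refine ⟨max L 2, le_max_of_le_right (by norm_num), fun k => ?_⟩
  rw [← hz]
  rcases le_total ‖k - c'‖ 1 with h | h
  · rw [dist1, min_eq_left h]
    have := hL.dist_le_mul k c'
    rw [Real.dist_eq, dist_eq_norm] at this
    exact this.trans (mul_le_mul_of_nonneg_right (le_max_left _ _) (norm_nonneg _))
  · rw [dist1, min_eq_right h, mul_one]
    refine le_max_of_le_right ((abs_sub _ _).trans ?_)
    linarith [abs_cut_le c r k, abs_cut_le c r c']

lemma monoKernel_proj (hm : m ∈ A.sys.M) (lam : Fin m → A.I) (i : A.I) (o : ℤˣ × Fin J)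
    (kk : Fin m → X d) (x : Fin m → V J) :
    A.sys.bandProj (band i).1 (band i).2 (∑ j, kk j) (A.sys.monoKernel A.ρ (str lam) o kk x) =
      if band i = o then A.sys.monoKernel A.ρ (str lam) o kk x else 0 := by
  by_cases hk : ‖kk - fun j => c (lam j)‖ ≤ 4 * A.ρ
  · have hoff := (A.rad.off_args hm (lam := str lam) (fun j => (lam j).2) hk).1
    have h1 : A.sys.monoKernel A.ρ (str lam) o kk x = A.sys.bandProj o.1 o.2 (∑ j, kk j)
        (A.sys.monoKernel A.ρ (str lam) o kk x) := by
      rw [monoKernel, smul_apply, bandKernel_apply, ← Complex.coe_smul, map_smul, map_smul,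
        bandProj_idem]
    split_ifs with h
    · rw [h, ← h1]
    · rw [h1, A.adm.bandProj_comp hoff h]
  · push Not at hk
    have h1 : A.sys.monoKernel A.ρ (str lam) o kk = 0 := by
      rw [monoKernel]
      change cut (fun j => c (lam j)) (4 * A.ρ) kk • _ = _
      rw [cut_eq_zero hk.le]
      exact zero_smul ℝ (A.sys.bandKernel m o kk)
    rw [h1]
    simp

lemma Q_op_mono (hm : m ∈ A.sys.M) (lam : Fin m → A.I) (i : A.I) (o : ℤˣ × Fin J) {b : ℝ}
    (hb : 0 ≤ b) :
    ∃ C : ℝ, 0 ≤ C ∧ ∀ t (w : Fin m → L1 d J), (∀ j, ‖w j‖ ≤ b) →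
      ‖Q i (op ((mono hm lam o).ker t) w) -
        (if band i = o ∧ kappa (str lam) = c i then op ((mono hm lam o).ker t) w else 0)‖ ≤
        C * ∑ j, wnorm (c (lam j)) (w j) := by
  classical
  have hm0 := A.adm.pos_of_mem hm
  have hρ := A.rad.pos
  set P := mono hm lam o with hP
  set z : ℝ := if kappa (str lam) = c i then 1 else 0 with hz
  have hcz : cut (c i) (2 * A.ρ) (kappa (str lam)) = z := by
    rw [hz]
    split_ifs with h
    · rw [h]; exact cut_eq_one (by positivity) (by rw [sub_self, norm_zero]; positivity)
    · exact cut_eq_zero (A.rad.sep_out i.1 i.2 m hm (str lam) (fun j => (lam j).2) h)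
  obtain ⟨C, hC, hcut⟩ := abs_cut_sub_le (c i) (kappa (str lam)) hcz
  have hB := P.B_nonneg
  refine ⟨C * P.B * b ^ (m - 1), by positivity, fun t w hw => ?_⟩
  set K' : (Fin m → X d) → Mult J m := fun kk =>
    (if band i = o ∧ kappa (str lam) = c i then (1 : ℂ) else 0) • P.ker t kk with hK'
  have hkb := P.isBddMeas_ker t
  have hK'b : IsBddMeas K' := by
    refine IsBddMeas.of_continuous (C := ‖(if band i = o ∧ kappa (str lam) = c i then (1 : ℂ)
      else 0)‖ * P.B) ?_ fun kk => ?_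
    · exact (continuous_osc (continuous_const.mul P.continuous_phi) P.continuous_K).const_smul
        (if band i = o ∧ kappa (str lam) = c i then (1 : ℂ) else 0)
    · rw [hK']
      simp only
      rw [norm_smul]
      exact mul_le_mul_of_nonneg_left (P.norm_ker_le t kk) (norm_nonneg _)
  have hob := isBddMeas_outMul hm0 (isBddMeas_filt i) hkb
  have e1 : (if band i = o ∧ kappa (str lam) = c i then op (P.ker t) w else 0) = op K' w := by
    rw [hK', op_smul hm0 hkb]
    split_ifs <;> simp
  rw [Q, mul_op hm0 (isBddMeas_filt i) hkb, e1, ← op_sub hm0 hob hK'b]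
  have hkey : ∀ kk, ‖outMul (filt i) (P.ker t) kk - K' kk‖ ≤
      0 + C * P.B * ∑ j, dist1 (c (lam j)) (kk j) := by
    intro kk
    have e2 : outMul (filt i) (P.ker t) kk - K' kk =
        (if band i = o then ((cut (c i) (2 * A.ρ) (∑ j, kk j) - z : ℝ) : ℂ) else 0) •
          P.ker t kk := by
      ext1 x
      have h1 : outMul (filt i) (P.ker t) kk x = (cut (c i) (2 * A.ρ) (∑ j, kk j) : ℂ) •
          cis (t * P.phi kk) • A.sys.bandProj (band i).1 (band i).2 (∑ j, kk j) (P.K kk x) := by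
        change (filt i (∑ j, kk j)) (P.ker t kk x) = _
        rw [filt, smul_apply, PhaseMono.ker, osc, smul_apply, map_smul]
      rw [sub_apply, h1, hP, (mono_spec hm lam o).1, monoKernel_proj hm lam i o kk x, hK']
      simp only [smul_apply, PhaseMono.ker, osc, (mono_spec hm lam o).1, hP]
      by_cases hbo : band i = o
      · by_cases hka : kappa (str lam) = c i
        · simp [hbo, hka, hz, sub_smul]
        · simp [hbo, hka, hz]
      · simp [hbo]
    rw [e2, norm_smul, zero_add]
    have h3 : ‖(if band i = o then ((cut (c i) (2 * A.ρ) (∑ j, kk j) - z : ℝ) : ℂ) else 0)‖ ≤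
        C * ∑ j, dist1 (c (lam j)) (kk j) := by
      have h4 : C * dist1 (kappa (str lam)) (∑ j, kk j) ≤
          C * ∑ j, dist1 (c (lam j)) (kk j) :=
        mul_le_mul_of_nonneg_left (dist1_sum_le (fun j => c (lam j)) kk) hC
      split_ifs with hbo
      · rw [Complex.norm_real, Real.norm_eq_abs]
        exact (hcut _).trans h4
      · rw [norm_zero]
        exact mul_nonneg hC (Finset.sum_nonneg fun j _ => dist1_nonneg _ _)
    calc _ ≤ (C * ∑ j, dist1 (c (lam j)) (kk j)) * P.B :=
          mul_le_mul h3 (P.norm_ker_le t kk) (norm_nonneg _) ((norm_nonneg _).trans h3)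
      _ = _ := by ring
  refine (norm_op_le_weight hm0 (hob.sub hK'b) le_rfl (by positivity) (fun j => c (lam j))
    (Filter.Eventually.of_forall hkey) w hw).trans (le_of_eq (by ring))

lemma c_band_injective {i i' : A.I} (hc : c i = c i') (hb : band i = band i') : i = i' := by
  obtain ⟨⟨ζ, n, k⟩, hi⟩ := i
  obtain ⟨⟨ζ', n', k'⟩, hi'⟩ := i'
  simp only [band, Prod.mk.injEq] at hb
  obtain ⟨rfl, rfl⟩ := hb
  have : k = k' := by
    simp only [c, centre] at hc
    rw [← sgn_smul_sgn_smul ζ k, hc, sgn_smul_sgn_smul]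
  subst this
  rfl

lemma Q_filtered (i i' : A.I) :
    ∃ C : ℝ, 0 ≤ C ∧ ∀ f : L1 d J,
      (∀ᵐ k, A.sys.bandProj (band i').1 (band i').2 k (f k) = f k) →
      ‖Q i f - (if i = i' then f else 0)‖ ≤ C * wnorm (c i') f := by
  have hρ := A.rad.pos
  set z : ℝ := if c i' = c i then 1 else 0 with hz
  have hcz : cut (c i) (2 * A.ρ) (c i') = z := by
    rw [hz]
    split_ifs with h
    · rw [h]; exact cut_eq_one (by positivity) (by rw [sub_self, norm_zero]; positivity)
    · exact cut_eq_zero (A.rad.sep i.1 i.2 i'.1 i'.2 h)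
  obtain ⟨C, hC, hcut⟩ := abs_cut_sub_le (c i) (c i') hcz
  refine ⟨C, hC, fun f hf => ?_⟩
  rw [L1.norm_eq_integral_norm, wnorm, ← integral_const_mul]
  refine integral_mono_ae (integrable_coe _).norm ((integrable_dist1_mul _ f).const_mul C) ?_
  have h0 : (if i = i' then f else 0 : L1 d J) =ᵐ[volume] fun k => if i = i' then f k else 0 := by
    split_ifs
    · rfl
    · exact Lp.coeFn_zero _ _ _
  filter_upwards [hf, A.adm.ae_off, mul_coe (isBddMeas_filt i) f, h0,
    Lp.coeFn_sub (Q i f) (if i = i' then f else 0)] with k h1 h2 h3 h4 h5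
  have h6 : (Q i f : X d → V J) k = (cut (c i) (2 * A.ρ) k : ℂ) •
      if band i = band i' then f k else 0 := by
    rw [Q, h3, filt, smul_apply]
    congr 1
    split_ifs with h
    · rw [h, h1]
    · rw [← h1, A.adm.bandProj_comp h2 h]
  have h7 : (Q i f : X d → V J) k - (if i = i' then f k else 0) =
      (if band i = band i' then ((cut (c i) (2 * A.ρ) k - z : ℝ) : ℂ) else 0) • f k := by
    rw [h6]
    by_cases hb : band i = band i'
    · by_cases hcc : c i' = c i
      · have hi : i = i' := c_band_injective hcc.symm hb
        subst hi
        simp [hz, sub_smul]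
      · have hi : i ≠ i' := fun h => hcc (by rw [h])
        simp [hz, hb, hcc, hi]
    · have hi : i ≠ i' := fun h => hb (by rw [h])
      simp [hb, hi]
  rw [h5, Pi.sub_apply, h4, h7, norm_smul, ← mul_assoc]
  refine mul_le_mul_of_nonneg_right ?_ (norm_nonneg _)
  split_ifs
  · rw [Complex.norm_real, Real.norm_eq_abs]
    exact hcut k
  · rw [norm_zero]
    exact mul_nonneg hC (dist1_nonneg _ _)

end Frame

end Wavepacket

namespace Wavepacket

variable {d J m : ℕ}

open WaveSystem

namespace Frame

variable {A : Frame d J}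

/-- The monomials of the interaction system: a degree, the inputs and the band of the output. -/
abbrev Term (A : Frame d J) := Σ m : {m // m ∈ A.sys.M}, (Fin m.1 → A.I) × (ℤˣ × Fin J)

namespace Term

variable (q : A.Term)

/-- The monomial with its phase. -/
def phaseMono : PhaseMono d J q.1.1 := mono q.1.2 q.2.1 q.2.2

/-- The wavevector of the output. -/
def kap : X d := kappa (str q.2.1)

/-- The resonance condition. -/
def Resonant : Prop := A.sys.phase q.2.2.1 q.2.2.2 (str q.2.1) (sgn q.2.2.1 • q.kap) = 0

/-- The output is in the component `i`. -/
def Matches (i : A.I) : Prop := band i = q.2.2 ∧ q.kap = c i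

/-- The nonvanishing monomials. -/
def Nonzero : Prop := A.sys.IsNonzeroTerm q.2.2.1 q.2.2.2 (str q.2.1)

/-- The value of a monomial at the fast time `t`. -/
def val (t : ℝ) (w : A.I → L1 d J) : L1 d J := op (q.phaseMono.ker t) fun j => w (q.2.1 j)

lemma phaseMono_c (j : Fin q.1.1) : q.phaseMono.c j = c (q.2.1 j) := mono_c _ _ _ j

lemma sum_c : ∑ j, q.phaseMono.c j = q.kap := by
  simp only [phaseMono_c]; rfl

lemma continuous_val {w : ℝ → A.I → L1 d J} (hw : Continuous w) (ϱ : ℝ) :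
    Continuous fun s => q.val (s / ϱ) (w s) := by
  refine q.phaseMono.continuous_op.comp ((continuous_id.div_const ϱ).prodMk ?_)
  exact continuous_pi fun j => (continuous_apply (q.2.1 j)).comp hw

end Term

/-- The monomials with all inputs in `F`. -/
def terms (F : Finset A.I) : Finset A.Term :=
  Finset.univ.sigma fun m => (Fintype.piFinset fun _ : Fin m.1 => F) ×ˢ Finset.univ

lemma mem_terms {F : Finset A.I} {q : A.Term} : q ∈ terms F ↔ ∀ j, q.2.1 j ∈ F := by
  rw [terms, Finset.mem_sigma, and_iff_right (Finset.mem_univ _), Finset.mem_product,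
    and_iff_left (Finset.mem_univ _), Fintype.mem_piFinset]

lemma rhs_sum (F : Finset A.I) {w : A.I → L1 d J} (hw : ∀ i, IsFiltered i (w i)) (t : ℝ) :
    A.sys.rhs t (∑ i ∈ F, w i) = ∑ q ∈ terms F, q.val t w := by
  have h : ∀ m : {m // m ∈ A.sys.M}, op (A.sys.slowKernel m.1 t) (fun _ => ∑ i ∈ F, w i) =
      ∑ q ∈ (Fintype.piFinset fun _ : Fin m.1 => F) ×ˢ (Finset.univ : Finset (ℤˣ × Fin J)),
        Term.val ⟨m, q⟩ t w := by
    intro m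
    rw [ContinuousMultilinearMap.map_sum_finset (op (A.sys.slowKernel m.1 t))
      (fun _ i => w i) (fun _ => F), Finset.sum_product]
    refine Finset.sum_congr rfl fun lam _ => ?_
    exact op_slowKernel_eq m.2 lam (fun j => hw (lam j)) t
  rw [rhs, ← Finset.sum_coe_sort A.sys.M fun m => op (A.sys.slowKernel m t) fun _ => ∑ i ∈ F, w i,
    terms, Finset.sum_sigma]
  exact Finset.sum_congr rfl fun m _ => h m

/-- The total weighted norm of a family of components. -/
def spread (F : Finset A.I) (w : A.I → L1 d J) : ℝ := ∑ i ∈ F, wnorm (c i) (w i)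

lemma spread_nonneg (F : Finset A.I) (w : A.I → L1 d J) : 0 ≤ spread F w :=
  Finset.sum_nonneg fun _ _ => wnorm_nonneg _ _

lemma wnorm_le_spread {F : Finset A.I} (w : A.I → L1 d J) {i : A.I} (hi : i ∈ F) :
    wnorm (c i) (w i) ≤ spread F w :=
  Finset.single_le_sum (f := fun i => wnorm (c i) (w i)) (fun _ _ => wnorm_nonneg _ _) hi

lemma continuous_spread (F : Finset A.I) {w : ℝ → A.I → L1 d J} (hw : Continuous w) :
    Continuous fun s => spread F (w s) :=
  continuous_finsetSum _ fun i _ => (continuous_wnorm (c i)).comp ((continuous_apply i).comp hw)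

lemma sum_wnorm_le_spread {F : Finset A.I} (w : A.I → L1 d J) {q : A.Term} (hq : q ∈ terms F) :
    ∑ j, wnorm (c (q.2.1 j)) (w (q.2.1 j)) ≤ q.1.1 * spread F w := by
  refine (Finset.sum_le_sum fun j _ => wnorm_le_spread w (mem_terms.1 hq j)).trans (le_of_eq ?_)
  simp

/-- The filtered components of a function. -/
def comp (u : L1 d J) (i : A.I) : L1 d J := Q i u

/-- The part of a function that is not captured by the filters of `F`. -/
def rest (F : Finset A.I) (u : L1 d J) : L1 d J := u - ∑ i ∈ F, comp u i

lemma norm_comp_le (u : L1 d J) (i : A.I) : ‖comp u i‖ ≤ ‖u‖ := norm_Q_le i u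

lemma continuous_comp {u : ℝ → L1 d J} (hu : Continuous u) :
    Continuous fun s => (comp (u s) : A.I → L1 d J) :=
  continuous_pi fun i => (Q i).continuous.comp hu

lemma continuous_rest (F : Finset A.I) {u : ℝ → L1 d J} (hu : Continuous u) :
    Continuous fun s => rest F (u s) :=
  hu.sub (continuous_finsetSum _ fun i _ => (Q i).continuous.comp hu)

lemma norm_sum_comp_le (F : Finset A.I) {u : L1 d J} {b : ℝ} (hu : ‖u‖ ≤ b) :
    ‖∑ i ∈ F, comp u i‖ ≤ F.card * b := by
  refine (norm_sum_le _ _).trans ((Finset.sum_le_sum fun i _ =>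
    (norm_comp_le u i).trans hu).trans (le_of_eq ?_))
  simp

/-- The time integral of a nonresonant monomial. -/
lemma exists_nonresonant_bound {b Λ T : ℝ} (hb : 1 ≤ b) (hΛ : 0 ≤ Λ) (hT : 0 ≤ T)
    (F : Finset A.I) : ∃ C : ℝ, 0 ≤ C ∧ ∀ q ∈ terms F, ¬ q.Resonant → ∀ ϱ, 0 < ϱ →
      ∀ w : ℝ → A.I → L1 d J, Continuous w → (∀ s i, ‖w s i‖ ≤ b) →
      (∀ s s' i, ‖w s i - w s' i‖ ≤ Λ * |s - s'|) → ∀ τ ∈ Set.Icc 0 T,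
      ‖∫ s in (0 : ℝ)..τ, q.val (s / ϱ) (w s)‖ ≤
        C * (ϱ + ∫ s in (0 : ℝ)..τ, spread F (w s)) := by
  have h : ∀ q : A.Term, ∃ C : ℝ, 0 ≤ C ∧ (q ∈ terms F → ¬ q.Resonant → ∀ ϱ, 0 < ϱ →
      ∀ w : ℝ → A.I → L1 d J, Continuous w → (∀ s i, ‖w s i‖ ≤ b) →
      (∀ s s' i, ‖w s i - w s' i‖ ≤ Λ * |s - s'|) → ∀ τ ∈ Set.Icc 0 T,
      ‖∫ s in (0 : ℝ)..τ, q.val (s / ϱ) (w s)‖ ≤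
        C * (ϱ + ∫ s in (0 : ℝ)..τ, spread F (w s))) := by
    intro q
    by_cases hr : q.Resonant
    · exact ⟨0, le_rfl, fun _ h => absurd hr h⟩
    have hphi : q.phaseMono.phi q.phaseMono.c ≠ 0 := by
      rw [Term.phaseMono, phi_centre]
      exact neg_ne_zero.2 hr
    obtain ⟨C, hC, hbound⟩ := q.phaseMono.nonresonant hb hΛ hT hphi
    refine ⟨C * (q.1.1 + 1), by positivity, fun hq _ ϱ hϱ w hwc hwb hwl τ hτ => ?_⟩
    have hwq : Continuous fun s => fun j => w s (q.2.1 j) :=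
      continuous_pi fun j => (continuous_apply (q.2.1 j)).comp hwc
    refine (hbound ϱ hϱ (fun s j => w s (q.2.1 j)) hwq (fun s j => hwb s _)
      (fun s s' j => hwl s s' _) τ hτ).trans ?_
    have hc1 : Continuous fun s => ∑ j, wnorm (q.phaseMono.c j) (w s (q.2.1 j)) :=
      continuous_finsetSum _ fun j _ =>
        (continuous_wnorm _).comp ((continuous_apply (q.2.1 j)).comp hwc)
    have hc2 := continuous_spread F hwc
    have h1 : ∫ s in (0 : ℝ)..τ, ∑ j, wnorm (q.phaseMono.c j) (w s (q.2.1 j)) ≤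
        ∫ s in (0 : ℝ)..τ, q.1.1 * spread F (w s) := by
      refine intervalIntegral.integral_mono_on hτ.1 (hc1.intervalIntegrable _ _)
        ((hc2.const_mul _).intervalIntegrable _ _) fun s _ => ?_
      simp only [Term.phaseMono_c]
      exact sum_wnorm_le_spread (w s) hq
    rw [intervalIntegral.integral_const_mul] at h1
    have h2 : 0 ≤ ∫ s in (0 : ℝ)..τ, spread F (w s) :=
      intervalIntegral.integral_nonneg hτ.1 fun s _ => spread_nonneg _ _
    rw [mul_assoc]
    refine mul_le_mul_of_nonneg_left ?_ hC.le
    have h3 : (0 : ℝ) ≤ q.1.1 := Nat.cast_nonneg _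
    nlinarith [mul_nonneg h3 hϱ.le]
  choose C hC hb using h
  refine ⟨∑ q, C q, Finset.sum_nonneg fun q _ => hC q,
    fun q hq hr ϱ hϱ w hwc hwb hwl τ hτ => (hb q hq hr ϱ hϱ w hwc hwb hwl τ hτ).trans ?_⟩
  have h2 : 0 ≤ ∫ s in (0 : ℝ)..τ, spread F (w s) :=
    intervalIntegral.integral_nonneg hτ.1 fun s _ => spread_nonneg _ _
  exact mul_le_mul_of_nonneg_right
    (Finset.single_le_sum (fun q _ => hC q) (Finset.mem_univ q)) (by positivity)

lemma exists_rhs_sub_bound (F : Finset A.I) {b : ℝ} (hb : 0 ≤ b) :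
    ∃ C : ℝ, 0 ≤ C ∧ ∀ t (u : L1 d J), ‖u‖ ≤ b →
      ‖A.sys.rhs t u - ∑ q ∈ terms F, q.val t (comp u)‖ ≤ C * ‖rest F u‖ := by
  obtain ⟨C, hC, -, hlip⟩ := A.adm.exists_rhs_bound ((F.card + 1) * b) (by positivity)
  refine ⟨C, hC, fun t u hu => ?_⟩
  have h := rhs_sum F (w := comp u) (fun i => isFiltered_Q i u) t
  rw [← h]
  refine hlip t u _ (hu.trans ?_) ((norm_sum_comp_le F hu).trans ?_)
  · have : 0 ≤ (F.card : ℝ) * b := by positivity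
    linarith
  · linarith

set_option maxHeartbeats 1000000 in
/-- The effect of a bounded operator on the time integral of the nonlinearity, up to the leading
resonant monomials. -/
lemma exists_block_bound {b Λ T : ℝ} (hb : 1 ≤ b) (hΛ : 0 ≤ Λ) (hT : 0 ≤ T) (F : Finset A.I)
    {a : ℝ} (ha : 0 ≤ a) :
    ∃ C : ℝ, 0 ≤ C ∧ ∀ ϱ, 0 < ϱ → ∀ u : ℝ → L1 d J, Continuous u → (∀ s, ‖u s‖ ≤ b) →
      (∀ s s', ‖u s - u s'‖ ≤ Λ * |s - s'|) → ∀ (L : L1 d J →L[ℂ] L1 d J)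
      (L' : A.Term → L1 d J →L[ℂ] L1 d J), (∀ f, ‖L f‖ ≤ a * ‖f‖) →
      (∀ q ∈ terms F, ¬ q.Resonant → L' q = L) →
      (∀ q ∈ terms F, q.Resonant → ∀ s, ‖L' q (q.val (s / ϱ) (comp (u s)))‖ ≤
        a * spread F (comp (u s))) → ∀ τ ∈ Set.Icc 0 T,
      ‖∫ s in (0 : ℝ)..τ, (L (A.sys.rhs (s / ϱ) (u s)) -
          ∑ q ∈ terms F, (L - L' q) (q.val (s / ϱ) (comp (u s))))‖ ≤
        C * (ϱ + ∫ s in (0 : ℝ)..τ, (‖rest F (u s)‖ + spread F (comp (u s)))) := by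
  obtain ⟨C₁, hC₁, h1⟩ := exists_rhs_sub_bound F (zero_le_one.trans hb)
  obtain ⟨C₂, hC₂, h2⟩ := exists_nonresonant_bound hb hΛ hT F
  refine ⟨a * C₁ + (terms F).card * (a * C₂ + a), by positivity, ?_⟩
  intro ϱ hϱ u huc hub hul L L' hL hL1 hL2 τ hτ
  have hcr := continuous_rest F huc
  have hcc := continuous_comp (A := A) huc
  have hcs := continuous_spread F hcc
  have hcq : ∀ q : A.Term, Continuous fun s => q.val (s / ϱ) (comp (u s)) := fun q =>
    q.continuous_val hcc ϱ
  have hcu : Continuous fun s => A.sys.rhs (s / ϱ) (u s) := A.adm.continuous_rhs_comp ϱ huc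
  set f : ℝ → L1 d J := fun s => L (A.sys.rhs (s / ϱ) (u s) -
    ∑ q ∈ terms F, q.val (s / ϱ) (comp (u s))) with hf
  have hfc : Continuous f :=
    L.continuous.comp (hcu.sub (continuous_finsetSum _ fun q _ => hcq q))
  set g : A.Term → ℝ → L1 d J := fun q s => L' q (q.val (s / ϱ) (comp (u s))) with hg
  have hgc : ∀ q, Continuous (g q) := fun q => (L' q).continuous.comp (hcq q)
  have e : ∀ s, L (A.sys.rhs (s / ϱ) (u s)) -
      ∑ q ∈ terms F, (L - L' q) (q.val (s / ϱ) (comp (u s))) = f s + ∑ q ∈ terms F, g q s := by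
    intro s
    simp only [hf, hg, map_sub, map_sum, sub_apply, Finset.sum_sub_distrib]
    abel
  simp only [e]
  have hgs : Continuous fun s => ∑ q ∈ terms F, g q s := continuous_finsetSum _ fun q _ => hgc q
  rw [intervalIntegral.integral_add (hfc.intervalIntegrable _ _) (hgs.intervalIntegrable _ _),
    intervalIntegral.integral_finsetSum fun q _ => (hgc q).intervalIntegrable _ _]
  have hI1 : 0 ≤ ∫ s in (0 : ℝ)..τ, ‖rest F (u s)‖ :=
    intervalIntegral.integral_nonneg hτ.1 fun s _ => norm_nonneg _
  have hI2 : 0 ≤ ∫ s in (0 : ℝ)..τ, spread F (comp (u s)) :=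
    intervalIntegral.integral_nonneg hτ.1 fun s _ => spread_nonneg _ _
  rw [intervalIntegral.integral_add (hcr.norm.intervalIntegrable _ _)
    (hcs.intervalIntegrable _ _)]
  set I1 := ∫ s in (0 : ℝ)..τ, ‖rest F (u s)‖
  set I2 := ∫ s in (0 : ℝ)..τ, spread F (comp (u s))
  have hb1 : ‖∫ s in (0 : ℝ)..τ, f s‖ ≤ a * C₁ * I1 := by
    refine (intervalIntegral.norm_integral_le_integral_norm hτ.1).trans ?_
    rw [← intervalIntegral.integral_const_mul]
    refine intervalIntegral.integral_mono_on hτ.1 (hfc.norm.intervalIntegrable _ _)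
      ((hcr.norm.const_mul _).intervalIntegrable _ _) fun s _ => ?_
    refine (hL _).trans ?_
    rw [mul_assoc]
    exact mul_le_mul_of_nonneg_left (h1 _ _ (hub s)) ha
  have hb2 : ∀ q ∈ terms F, ‖∫ s in (0 : ℝ)..τ, g q s‖ ≤ (a * C₂ + a) * (ϱ + I2) := by
    intro q hq
    by_cases hr : q.Resonant
    · refine (intervalIntegral.norm_integral_le_integral_norm hτ.1).trans ?_
      have h3 : ∫ s in (0 : ℝ)..τ, ‖g q s‖ ≤ ∫ s in (0 : ℝ)..τ, a * spread F (comp (u s)) :=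
        intervalIntegral.integral_mono_on hτ.1 ((hgc q).norm.intervalIntegrable _ _)
          ((hcs.const_mul _).intervalIntegrable _ _) fun s _ => hL2 q hq hr s
      rw [intervalIntegral.integral_const_mul] at h3
      refine h3.trans ?_
      change a * I2 ≤ _
      have : 0 ≤ a * C₂ * (ϱ + I2) + a * ϱ := by positivity
      linarith
    · simp only [hg, hL1 q hq hr]
      rw [ContinuousLinearMap.intervalIntegral_comp_comm _ ((hcq q).intervalIntegrable _ _)]
      refine (hL _).trans ?_
      have h3 := h2 q hq hr ϱ hϱ (fun s => comp (u s)) hcc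
        (fun s i => (norm_comp_le _ _).trans (hub s))
        (fun s s' i => by
          rw [comp, comp, ← map_sub]; exact (norm_Q_le _ _).trans (hul s s')) τ hτ
      refine (mul_le_mul_of_nonneg_left h3 ha).trans ?_
      have : 0 ≤ a * (ϱ + I2) := by positivity
      change a * (C₂ * (ϱ + I2)) ≤ _
      linarith
  have hb3 : ‖∑ q ∈ terms F, ∫ s in (0 : ℝ)..τ, g q s‖ ≤
      (terms F).card * ((a * C₂ + a) * (ϱ + I2)) := by
    refine (norm_sum_le _ _).trans ((Finset.sum_le_sum hb2).trans (le_of_eq ?_))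
    rw [Finset.sum_const, nsmul_eq_mul]
  refine (norm_add_le _ _).trans ((add_le_add hb1 hb3).trans ?_)
  have : 0 ≤ a * C₁ * (ϱ + I2) + (terms F).card * (a * C₂ + a) * I1 := by positivity
  linarith

end Frame

end Wavepacket

namespace Wavepacket

variable {d J m : ℕ}

open WaveSystem

namespace Frame

variable {A : Frame d J}

/-- The components with `nk`-pairs in `B`. -/
def blk (A : Frame d J) (B : Finset (NK d J)) : Finset A.I :=
  open Classical in Finset.univ.filter fun i => i.1.2 ∈ B

lemma mem_blk {B : Finset (NK d J)} {i : A.I} : i ∈ blk A B ↔ i.1.2 ∈ B := by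
  classical
  simp [blk]

lemma Term.Matches.unique {q : A.Term} {i i' : A.I} (h : q.Matches i) (h' : q.Matches i') :
    i = i' := c_band_injective (h.2.symm.trans h'.2) (h.1.trans h'.1.symm)

/-- Each resonant monomial with inputs in `F` has its output in `F`. -/
def ResClosed (F : Finset A.I) : Prop :=
  ∀ q ∈ terms F, q.Resonant → ∃ i ∈ F, q.Matches i

lemma resClosed_blk {B : Finset (NK d J)} (hBS : B ⊆ A.S)
    (hB : A.sys.IsResonanceInvariant (B : Set (NK d J))) : ResClosed (blk A B) := by
  intro q hq hr
  have hmem : (q.2.2.2, sgn q.2.2.1 • q.kap) ∈ (B : Set (NK d J)) := by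
    rw [← hB]
    exact Or.inr ⟨q.1.1, q.2.2.1, str q.2.1,
      ⟨q.1.2, fun j => mem_blk.1 (mem_terms.1 hq j), hr⟩, rfl⟩
  refine ⟨⟨(q.2.2.1, (q.2.2.2, sgn q.2.2.1 • q.kap)), mem_idx.2 (hBS hmem)⟩,
    mem_blk.2 hmem, rfl, ?_⟩
  exact (sgn_smul_sgn_smul _ _).symm

/-- Exact wave packets of the width `a`. -/
structure IsPacket (F : Finset A.I) (b a : ℝ) (g : A.I → L1 d J) : Prop where
  bound : ∀ i ∈ F, ‖g i‖ ≤ b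
  width : ∀ i ∈ F, wnorm (c i) (g i) ≤ b * a
  proj : ∀ i ∈ F, ∀ᵐ k, A.sys.bandProj (band i).1 (band i).2 k (g i k) = g i k

lemma exists_Q_val_bound (F : Finset A.I) {b : ℝ} (hb : 0 ≤ b) :
    ∃ C : ℝ, 0 ≤ C ∧ ∀ q ∈ terms F, ∀ (i : A.I) (t : ℝ) (w : A.I → L1 d J), (∀ i, ‖w i‖ ≤ b) →
      (q.Matches i → ‖Q i (q.val t w) - q.val t w‖ ≤ C * spread F w) ∧
      (¬ q.Matches i → ‖Q i (q.val t w)‖ ≤ C * spread F w) ∧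
      (q.Matches i → wnorm (c i) (q.val t w) ≤ C * spread F w) := by
  have h : ∀ q : A.Term, ∀ i : A.I, ∃ C : ℝ, 0 ≤ C ∧ (q ∈ terms F → ∀ (t : ℝ) (w : A.I → L1 d J),
      (∀ i, ‖w i‖ ≤ b) →
      (q.Matches i → ‖Q i (q.val t w) - q.val t w‖ ≤ C * spread F w) ∧
      (¬ q.Matches i → ‖Q i (q.val t w)‖ ≤ C * spread F w) ∧
      (q.Matches i → wnorm (c i) (q.val t w) ≤ C * spread F w)) := by
    intro q i
    obtain ⟨C, hC, h1⟩ := Q_op_mono q.1.2 q.2.1 i q.2.2 hb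
    have hB := q.phaseMono.B_nonneg
    set C' := q.phaseMono.B * b ^ (q.1.1 - 1) with hC'
    have hC'0 : 0 ≤ C' := by positivity
    refine ⟨(C + C') * q.1.1, by positivity, fun hq t w hw => ?_⟩
    have h2 := h1 t (fun j => w (q.2.1 j)) fun j => hw _
    have h3 := sum_wnorm_le_spread w hq
    have h4 := spread_nonneg F w
    have h5 : C * ∑ j, wnorm (c (q.2.1 j)) (w (q.2.1 j)) ≤ (C + C') * q.1.1 * spread F w := by
      rw [mul_assoc]
      exact mul_le_mul (by linarith) h3
        (Finset.sum_nonneg fun _ _ => wnorm_nonneg _ _) (by positivity)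
    refine ⟨fun hm => ?_, fun hm => ?_, fun hm => ?_⟩
    · have hm' : band i = q.2.2 ∧ kappa (str q.2.1) = c i := hm
      rw [if_pos hm'] at h2
      exact h2.trans h5
    · have hm' : ¬ (band i = q.2.2 ∧ kappa (str q.2.1) = c i) := hm
      rw [if_neg hm', sub_zero] at h2
      exact h2.trans h5
    · have h6 := wnorm_op_le q.phaseMono.pos (q.phaseMono.isBddMeas_ker t) hB q.phaseMono.c
        (Filter.Eventually.of_forall (q.phaseMono.norm_ker_le t)) (fun j => w (q.2.1 j))
        fun j => hw _
      rw [Term.sum_c, hm.2] at h6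
      simp only [Term.phaseMono_c] at h6
      refine h6.trans ?_
      calc _ = C' * ∑ j, wnorm (c (q.2.1 j)) (w (q.2.1 j)) := by rw [hC']; ring
        _ ≤ (C + C') * (q.1.1 * spread F w) :=
          mul_le_mul (by linarith) h3
            (Finset.sum_nonneg fun _ _ => wnorm_nonneg _ _) (by positivity)
        _ = _ := by ring
  choose C hC hb using h
  have hle : ∀ q i, C q i ≤ ∑ q, ∑ i, C q i := fun q i =>
    (Finset.single_le_sum (fun i _ => hC q i) (Finset.mem_univ i)).trans
      (Finset.single_le_sum (f := fun q => ∑ i, C q i)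
        (fun q _ => Finset.sum_nonneg fun i _ => hC q i) (Finset.mem_univ q))
  refine ⟨∑ q, ∑ i, C q i, Finset.sum_nonneg fun q _ => Finset.sum_nonneg fun i _ => hC q i,
    fun q hq i t w hw => ?_⟩
  obtain ⟨h1, h2, h3⟩ := hb q i hq t w hw
  have h4 := mul_le_mul_of_nonneg_right (hle q i) (spread_nonneg F w)
  exact ⟨fun h => (h1 h).trans h4, fun h => (h2 h).trans h4, fun h => (h3 h).trans h4⟩

lemma exists_Q_packet_bound (F : Finset A.I) {b : ℝ} (hb : 0 ≤ b) :
    ∃ C : ℝ, 0 ≤ C ∧ ∀ (a : ℝ) (g : A.I → L1 d J), 0 ≤ a → IsPacket F b a g → ∀ i ∈ F,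
      ‖Q i (∑ i' ∈ F, g i') - g i‖ ≤ C * a := by
  classical
  choose C hC h using fun i i' : A.I => Q_filtered i i'
  refine ⟨∑ i, ∑ i', C i i' * b, Finset.sum_nonneg fun i _ => Finset.sum_nonneg fun i' _ =>
    mul_nonneg (hC i i') hb, fun a g ha hg i hi => ?_⟩
  have h1 : Q i (∑ i' ∈ F, g i') - g i = ∑ i' ∈ F, (Q i (g i') - if i = i' then g i' else 0) := by
    rw [Finset.sum_sub_distrib, map_sum, Finset.sum_ite_eq, if_pos hi]
  have h2 : ∀ i' ∈ F, ‖Q i (g i') - (if i = i' then g i' else 0)‖ ≤ C i i' * b * a := by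
    intro i' hi'
    refine (h i i' (g i') (hg.proj i' hi')).trans ?_
    rw [mul_assoc]
    exact mul_le_mul_of_nonneg_left (hg.width i' hi') (hC i i')
  rw [h1]
  refine (norm_sum_le _ _).trans ((Finset.sum_le_sum h2).trans ?_)
  rw [← Finset.sum_mul]
  refine mul_le_mul_of_nonneg_right ?_ ha
  refine (Finset.sum_le_sum_of_subset_of_nonneg (Finset.subset_univ F) fun i' _ _ =>
    mul_nonneg (hC i i') hb).trans ?_
  exact Finset.single_le_sum (f := fun i => ∑ i', C i i' * b)
    (fun i _ => Finset.sum_nonneg fun i' _ => mul_nonneg (hC i i') hb) (Finset.mem_univ i)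

/-- The operator that removes the components in `F`. -/
def restL (F : Finset A.I) : L1 d J →L[ℂ] L1 d J := ContinuousLinearMap.id ℂ _ - ∑ i ∈ F, Q i

lemma restL_apply (F : Finset A.I) (u : L1 d J) : restL F u = rest F u := by
  simp [restL, rest, comp]

/-- The weighted part of the component `i`. -/
def widthL (i : A.I) : L1 d J →L[ℂ] L1 d J := (mul (wmul (c i))).comp (Q i)

lemma norm_widthL (i : A.I) (u : L1 d J) : ‖widthL i u‖ = wnorm (c i) (comp u i) :=
  (wnorm_eq _ _).symm

lemma exists_restL_bound (F : Finset A.I) (hF : ResClosed F) {b : ℝ} (hb : 0 ≤ b) :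
    ∃ a : ℝ, 0 ≤ a ∧ (∀ f : L1 d J, ‖restL F f‖ ≤ a * ‖f‖) ∧
      (∀ (i : A.I) (f : L1 d J), ‖widthL i f‖ ≤ a * ‖f‖) ∧
      ∀ q ∈ terms F, q.Resonant → ∀ (t : ℝ) (w : A.I → L1 d J), (∀ i, ‖w i‖ ≤ b) →
        ‖restL F (q.val t w)‖ ≤ a * spread F w ∧ ∀ i : A.I, ‖widthL i (q.val t w)‖ ≤ a * spread F w := by
  classical
  obtain ⟨C, hC, h⟩ := exists_Q_val_bound F hb
  refine ⟨(F.card + 2) * (C + 1), by positivity, fun f => ?_, fun i f => ?_,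
    fun q hq hr t w hw => ⟨?_, fun i => ?_⟩⟩
  · have h1 := norm_sum_comp_le F (le_refl ‖f‖)
    rw [restL_apply, rest]
    refine (norm_sub_le _ _).trans ((add_le_add le_rfl h1).trans ?_)
    have : 0 ≤ (1 + (F.card + 2) * C) * ‖f‖ := by positivity
    linarith
  · rw [norm_widthL]
    refine (wnorm_le_norm _ _).trans ((norm_comp_le f i).trans ?_)
    have : 0 ≤ (F.card + 1 + (F.card + 2) * C) * ‖f‖ := by positivity
    linarith
  · obtain ⟨i₀, hi₀, hm⟩ := hF q hq hr
    have h0 := spread_nonneg F w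
    have h1 : restL F (q.val t w) =
        ∑ i ∈ F, ((if i = i₀ then q.val t w else 0) - Q i (q.val t w)) := by
      rw [restL_apply, rest, Finset.sum_sub_distrib, Finset.sum_ite_eq', if_pos hi₀]
      rfl
    have h2 : ∀ i ∈ F, ‖(if i = i₀ then q.val t w else 0) - Q i (q.val t w)‖ ≤
        C * spread F w := by
      intro i _
      split_ifs with hi
      · subst hi
        rw [norm_sub_rev]
        exact (h q hq i t w hw).1 hm
      · rw [zero_sub, norm_neg]
        exact (h q hq i t w hw).2.1 fun hm' => hi (hm'.unique hm)
    rw [h1]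
    refine (norm_sum_le _ _).trans ((Finset.sum_le_sum h2).trans ?_)
    rw [Finset.sum_const, nsmul_eq_mul]
    have : 0 ≤ (F.card + 2 + 2 * C) * spread F w := by positivity
    linarith
  · have h0 := spread_nonneg F w
    have h3 : ‖widthL i (q.val t w)‖ ≤ 2 * C * spread F w := by
      rw [norm_widthL]
      by_cases hm : q.Matches i
      · have h1 := (h q hq i t w hw).1 hm
        have h2 := (h q hq i t w hw).2.2 hm
        have h4 := wnorm_add_le (c i) (q.val t w) (Q i (q.val t w) - q.val t w)
        rw [add_sub_cancel] at h4
        have h5 := wnorm_le_norm (c i) (Q i (q.val t w) - q.val t w)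
        change wnorm (c i) (Q i (q.val t w)) ≤ _
        linarith
      · have h1 := (h q hq i t w hw).2.1 hm
        refine (wnorm_le_norm _ _).trans (h1.trans ?_)
        have : 0 ≤ C * spread F w := by positivity
        linarith
    refine h3.trans ?_
    have : 0 ≤ (F.card + F.card * C + 2) * spread F w := by positivity
    linarith

set_option maxHeartbeats 1000000 in
/-- The components of a solution with wavepacket data stay concentrated near their centres, and
the rest stays small. -/
lemma exists_concentration (F : Finset A.I) (hF : ResClosed F) {b Λ T : ℝ} (hb : 1 ≤ b)
    (hΛ : 0 ≤ Λ) (hT : 0 ≤ T) :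
    ∃ C : ℝ, 0 ≤ C ∧ ∀ ϱ a (g : A.I → L1 d J) (u : ℝ → L1 d J), 0 < ϱ → 0 ≤ a → ϱ ≤ b * a →
      IsPacket F b a g → A.sys.IsGlobalSol ϱ T b Λ (∑ i ∈ F, g i) u → ∀ τ ∈ Set.Icc 0 T,
      ‖rest F (u τ)‖ + spread F (comp (u τ)) ≤ C * a := by
  have hb0 : 0 ≤ b := zero_le_one.trans hb
  obtain ⟨a₀, ha₀, hn1, hn2, hres⟩ := exists_restL_bound F hF hb0
  obtain ⟨C₁, hC₁, h1⟩ := exists_block_bound hb hΛ hT F ha₀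
  obtain ⟨C₂, hC₂, h2⟩ := exists_Q_packet_bound F hb0
  set n : ℝ := (F.card : ℝ) with hn
  have hn0 : 0 ≤ n := Nat.cast_nonneg _
  set D := n * C₂ + n * (b + C₂) with hD
  set E := (n + 1) * C₁ with hE
  refine ⟨(D + E * b) * Real.exp (E * T), by positivity, ?_⟩
  intro ϱ a g u hϱ ha hϱa hg hu τ hτ
  have hcr := continuous_rest F hu.continuous
  have hcc := continuous_comp (A := A) hu.continuous
  have hcs := continuous_spread F hcc
  have hcu : Continuous fun s => A.sys.rhs (s / ϱ) (u s) :=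
    A.adm.continuous_rhs_comp ϱ hu.continuous
  have key : ∀ L : L1 d J →L[ℂ] L1 d J, (∀ f, ‖L f‖ ≤ a₀ * ‖f‖) →
      (∀ q ∈ terms F, q.Resonant → ∀ s, ‖L (q.val (s / ϱ) (comp (u s)))‖ ≤
        a₀ * spread F (comp (u s))) → ∀ τ ∈ Set.Icc 0 T,
      ‖L (u τ)‖ ≤ ‖L (∑ i ∈ F, g i)‖ +
        C₁ * (ϱ + ∫ s in (0 : ℝ)..τ, (‖rest F (u s)‖ + spread F (comp (u s)))) := by
    intro L hL hLq τ hτ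
    have h3 := h1 ϱ hϱ u hu.continuous hu.bound hu.lip L (fun _ => L) hL (fun _ _ _ => rfl)
      hLq τ hτ
    simp only [sub_self, zero_apply, Finset.sum_const_zero, sub_zero] at h3
    rw [ContinuousLinearMap.intervalIntegral_comp_comm _ (hcu.intervalIntegrable _ _)] at h3
    rw [hu.eq τ hτ, map_add, add_comm]
    exact (norm_add_le _ _).trans (add_le_add le_rfl h3)
  have hw : ∀ s i, ‖comp (A := A) (u s) i‖ ≤ b := fun s i => (norm_comp_le _ _).trans (hu.bound s)
  have hA : ∀ τ ∈ Set.Icc 0 T, ‖rest F (u τ)‖ + spread F (comp (u τ)) ≤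
      (D * a + E * ϱ) + E * ∫ s in (0 : ℝ)..τ, (‖rest F (u s)‖ + spread F (comp (u s))) := by
    intro τ hτ
    set I := ∫ s in (0 : ℝ)..τ, (‖rest F (u s)‖ + spread F (comp (u s)))
    have k1 : ‖rest F (u τ)‖ ≤ n * (C₂ * a) + C₁ * (ϱ + I) := by
      rw [← restL_apply]
      refine (key _ hn1 (fun q hq hr s => (hres q hq hr _ _ (hw s)).1) τ hτ).trans
        (add_le_add ?_ le_rfl)
      have e : restL F (∑ i ∈ F, g i) = ∑ i ∈ F, (g i - Q i (∑ i ∈ F, g i)) := by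
        rw [restL_apply, rest, Finset.sum_sub_distrib]
        rfl
      rw [e]
      refine (norm_sum_le _ _).trans ((Finset.sum_le_sum fun i hi => ?_).trans
        (le_of_eq (by rw [Finset.sum_const, nsmul_eq_mul])))
      rw [norm_sub_rev]
      exact h2 a g ha hg i hi
    have k2 : ∀ i ∈ F, wnorm (c i) (comp (u τ) i) ≤ (b + C₂) * a + C₁ * (ϱ + I) := by
      intro i hi
      rw [← norm_widthL]
      refine (key _ (hn2 i) (fun q hq hr s => (hres q hq hr _ _ (hw s)).2 i) τ hτ).trans
        (add_le_add ?_ le_rfl)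
      rw [norm_widthL]
      have h4 := wnorm_add_le (c i) (g i) (Q i (∑ i ∈ F, g i) - g i)
      rw [add_sub_cancel] at h4
      have h5 := (wnorm_le_norm (c i) _).trans (h2 a g ha hg i hi)
      have h6 := hg.width i hi
      change wnorm (c i) (Q i (∑ i ∈ F, g i)) ≤ _
      linarith
    have k3 : spread F (comp (u τ)) ≤ n * ((b + C₂) * a + C₁ * (ϱ + I)) :=
      (Finset.sum_le_sum k2).trans (le_of_eq (by rw [Finset.sum_const, nsmul_eq_mul]))
    refine (add_le_add k1 k3).trans (le_of_eq ?_)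
    rw [hD, hE]
    ring
  have hG := gronwall_integral (hcr.norm.add hcs) (by positivity) hA hτ
  refine hG.trans ?_
  have h5 : D * a + E * ϱ ≤ (D + E * b) * a := by
    have hE0 : 0 ≤ E := by positivity
    have := mul_le_mul_of_nonneg_left hϱa hE0
    linarith
  have h6 : Real.exp (E * τ) ≤ Real.exp (E * T) := by
    refine Real.exp_le_exp.2 (mul_le_mul_of_nonneg_left hτ.2 (by positivity))
  calc _ ≤ (D + E * b) * a * Real.exp (E * T) := by
        refine mul_le_mul h5 h6 (Real.exp_pos _).le (by positivity)
    _ = _ := by ring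

end Frame

end Wavepacket

namespace Wavepacket

variable {d J m : ℕ}

open WaveSystem

namespace Frame

variable {A : Frame d J}

/-- The resonant monomials that drive the component `i`. -/
def drift (F : Finset A.I) (i : A.I) (t : ℝ) (w : A.I → L1 d J) : L1 d J :=
  open Classical in ∑ q ∈ terms F, if q.Resonant ∧ q.Matches i then q.val t w else 0

lemma continuous_drift (F : Finset A.I) (i : A.I) {w : ℝ → A.I → L1 d J} (hw : Continuous w)
    (ϱ : ℝ) : Continuous fun s => drift F i (s / ϱ) (w s) := by
  classical
  refine continuous_finsetSum _ fun q _ => ?_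
  by_cases h : q.Resonant ∧ q.Matches i
  · simp only [if_pos h]
    exact q.continuous_val hw ϱ
  · simp only [if_neg h]
    exact continuous_const

set_option maxHeartbeats 1000000 in
/-- The components of a solution follow the resonant monomials. -/
lemma exists_drift_bound (F : Finset A.I) (hF : ResClosed F) {b Λ T : ℝ} (hb : 1 ≤ b)
    (hΛ : 0 ≤ Λ) (hT : 0 ≤ T) :
    ∃ C : ℝ, 0 ≤ C ∧ ∀ ϱ a (g : A.I → L1 d J) (u : ℝ → L1 d J), 0 < ϱ → 0 ≤ a → ϱ ≤ b * a →
      IsPacket F b a g → A.sys.IsGlobalSol ϱ T b Λ (∑ i ∈ F, g i) u → ∀ τ ∈ Set.Icc 0 T,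
      ∀ i ∈ F, ‖comp (u τ) i -
        (g i + ∫ s in (0 : ℝ)..τ, drift F i (s / ϱ) (comp (u s)))‖ ≤ C * a := by
  classical
  have hb0 : 0 ≤ b := zero_le_one.trans hb
  obtain ⟨a₀, ha₀, h0⟩ := exists_Q_val_bound F hb0
  obtain ⟨C₁, hC₁, h1⟩ := exists_block_bound hb hΛ hT F (a := a₀ + 1) (by positivity)
  obtain ⟨C₂, hC₂, h2⟩ := exists_Q_packet_bound F hb0
  obtain ⟨C₃, hC₃, h3⟩ := exists_concentration F hF hb hΛ hT
  refine ⟨C₁ * (b + T * C₃) + C₂, by positivity, ?_⟩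
  intro ϱ a g u hϱ ha hϱa hg hu τ hτ i hi
  have hcr := continuous_rest F hu.continuous
  have hcc := continuous_comp (A := A) hu.continuous
  have hcs := continuous_spread F hcc
  have hcu : Continuous fun s => A.sys.rhs (s / ϱ) (u s) :=
    A.adm.continuous_rhs_comp ϱ hu.continuous
  have hcd := continuous_drift F i hcc ϱ
  have hw : ∀ s i, ‖comp (A := A) (u s) i‖ ≤ b := fun s i => (norm_comp_le _ _).trans (hu.bound s)
  set L' : A.Term → L1 d J →L[ℂ] L1 d J := fun q =>
    if q.Resonant ∧ q.Matches i then Q i - ContinuousLinearMap.id ℂ _ else Q i with hL'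
  have h4 := h1 ϱ hϱ u hu.continuous hu.bound hu.lip (Q i) L'
    (fun f => (norm_Q_le i f).trans (by nlinarith [norm_nonneg f, mul_nonneg ha₀ (norm_nonneg f)]))
    (fun q _ hr => by simp only [hL']; rw [if_neg fun h => hr h.1])
    (fun q hq hr s => by
      have h5 := h0 q hq i (s / ϱ) (comp (u s)) (hw s)
      have h6 := spread_nonneg F (comp (u s))
      by_cases hm : q.Matches i
      · simp only [hL', if_pos (And.intro hr hm)]
        refine (h5.1 hm).trans ?_
        linarith
      · simp only [hL', if_neg fun h : q.Resonant ∧ q.Matches i => hm h.2]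
        refine (h5.2.1 hm).trans ?_
        linarith) τ hτ
  have e : ∀ s, ∑ q ∈ terms F, (Q i - L' q) (q.val (s / ϱ) (comp (u s))) =
      drift F i (s / ϱ) (comp (u s)) := by
    intro s
    refine Finset.sum_congr rfl fun q _ => ?_
    by_cases h : q.Resonant ∧ q.Matches i
    · simp only [hL', if_pos h]
      simp
    · simp only [hL', if_neg h]
      simp
  simp only [e] at h4
  have hcQ : Continuous fun s => Q i (A.sys.rhs (s / ϱ) (u s)) := (Q i).continuous.comp hcu
  rw [intervalIntegral.integral_sub (hcQ.intervalIntegrable _ _) (hcd.intervalIntegrable _ _),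
    ContinuousLinearMap.intervalIntegral_comp_comm _ (hcu.intervalIntegrable _ _)] at h4
  have h5 : ∫ s in (0 : ℝ)..τ, (‖rest F (u s)‖ + spread F (comp (u s))) ≤ T * (C₃ * a) := by
    have h6 : ∫ s in (0 : ℝ)..τ, (‖rest F (u s)‖ + spread F (comp (u s))) ≤
        ∫ s in (0 : ℝ)..τ, C₃ * a :=
      intervalIntegral.integral_mono_on hτ.1 ((hcr.norm.add hcs).intervalIntegrable _ _)
        (continuous_const.intervalIntegrable _ _) fun s hs =>
          h3 ϱ a g u hϱ ha hϱa hg hu s ⟨hs.1, hs.2.trans hτ.2⟩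
    refine h6.trans ?_
    rw [intervalIntegral.integral_const, sub_zero, smul_eq_mul]
    exact mul_le_mul_of_nonneg_right hτ.2 (by positivity)
  have h6 := h2 a g ha hg i hi
  have h7 : comp (u τ) i - (g i + ∫ s in (0 : ℝ)..τ, drift F i (s / ϱ) (comp (u s))) =
      (Q i (∫ s in (0 : ℝ)..τ, A.sys.rhs (s / ϱ) (u s)) -
        ∫ s in (0 : ℝ)..τ, drift F i (s / ϱ) (comp (u s))) + (Q i (∑ i ∈ F, g i) - g i) := by
    have h8 : comp (u τ) i = Q i (∫ s in (0 : ℝ)..τ, A.sys.rhs (s / ϱ) (u s)) +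
        Q i (∑ i ∈ F, g i) := by
      rw [← map_add, ← hu.eq τ hτ]
      rfl
    rw [h8]
    abel
  rw [h7]
  refine (norm_add_le _ _).trans ((add_le_add h4 h6).trans ?_)
  have h8 := mul_le_mul_of_nonneg_left (add_le_add hϱa h5) hC₁
  linarith

/-- The total size of the localized components, measured by atoms. -/
def locSum (G : Finset A.I) (a₁ a₂ η : ℝ) (w : A.I → L1 d J) : ℝ :=
  ∑ i ∈ G, atomNorm (atoms (c i) a₁ a₂) η (w i)

lemma atomNorm_drift_le {F G : Finset A.I}
    (hG : ∀ i ∈ G, ∀ q ∈ terms F, q.Resonant → q.Matches i → q.Nonzero → ∃ j, q.2.1 j ∈ G)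
    {b Ct t a₁ a₂ η : ℝ} (hη : 0 < η) (hb : 1 ≤ b) (hCt : 0 ≤ Ct) (ha2 : 1 ≤ a₂)
    (ha12 : 1 ≤ a₁ * a₂) (ht : |t| * a₁ ≤ Ct * a₂) {w : A.I → L1 d J}
    (hf : ∀ i, IsFiltered i (w i)) (hw : ∀ i, ‖w i‖ ≤ b) (hw1 : ∀ i ∈ F, wnorm (c i) (w i) ≤ b * a₁)
    {i : A.I} (hi : i ∈ G) :
    atomNorm (atoms (c i) a₁ a₂) η (drift F i t w) ≤
      (∑ q : A.Term, q.phaseMono.locConst b Ct) * locSum G a₁ a₂ η w := by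
  classical
  have hL : ∀ q : A.Term, 0 ≤ q.phaseMono.locConst b Ct := fun q =>
    (q.phaseMono.locConst_pos hb hCt).le
  have hS : 0 ≤ locSum G a₁ a₂ η w := Finset.sum_nonneg fun _ _ => apply_nonneg _ _
  have h : ∀ q ∈ terms F, atomNorm (atoms (c i) a₁ a₂) η
      (if q.Resonant ∧ q.Matches i then q.val t w else 0) ≤
        q.phaseMono.locConst b Ct * locSum G a₁ a₂ η w := by
    intro q hq
    split_ifs with h
    · by_cases hz : q.Nonzero
      · obtain ⟨j, hj⟩ := hG i hi q hq h.1 h.2 hz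
        have h1 := q.phaseMono.atomNorm_op_le hη hb hCt ha2 ha12 ht
          (f := fun j => w (q.2.1 j)) (fun j => hw _)
          (fun j => by rw [Term.phaseMono_c]; exact hw1 _ (mem_terms.1 hq j)) j
        rw [Term.sum_c, h.2.2, Term.phaseMono_c] at h1
        refine h1.trans (mul_le_mul_of_nonneg_left ?_ (hL q))
        exact Finset.single_le_sum
          (f := fun i => atomNorm (atoms (c i) a₁ a₂) η (w i))
          (fun _ _ => apply_nonneg _ _) hj
      · have h1 : q.val t w = 0 :=
          op_mono_eq_zero q.1.2 q.2.1 q.2.2 hz (fun j => hf (q.2.1 j)) t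
        rw [h1, map_zero]
        exact mul_nonneg (hL q) hS
    · rw [map_zero]
      exact mul_nonneg (hL q) hS
  have h2 : atomNorm (atoms (c i) a₁ a₂) η (drift F i t w) ≤
      ∑ q ∈ terms F, q.phaseMono.locConst b Ct * locSum G a₁ a₂ η w :=
    (Finset.le_sum_of_subadditive _ (map_zero _).le (map_add_le_add _) _ _).trans (Finset.sum_le_sum h)
  refine h2.trans ?_
  rw [← Finset.sum_mul]
  exact mul_le_mul_of_nonneg_right
    (Finset.sum_le_sum_of_subset_of_nonneg (Finset.subset_univ _) fun q _ _ => hL q) hS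

set_option maxHeartbeats 1000000 in
/-- The localized components of a solution stay localized. -/
lemma exists_localization (F G : Finset A.I) (hF : ResClosed F) (hGF : G ⊆ F)
    (hG : ∀ i ∈ G, ∀ q ∈ terms F, q.Resonant → q.Matches i → q.Nonzero → ∃ j, q.2.1 j ∈ G)
    {b Λ T C₀ : ℝ} (hb : 1 ≤ b) (hΛ : 0 ≤ Λ) (hT : 0 ≤ T) (hC₀ : 0 ≤ C₀) :
    ∃ n : ℝ, 0 ≤ n ∧ ∀ ε β ϱ (g : A.I → L1 d J) (u : ℝ → L1 d J), Scale C₀ ε β ϱ →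
      ϱ ≤ b * widthScale ε β → IsPacket F b (widthScale ε β) g →
      (∀ i ∈ G, atomNorm (atoms (c i) (widthScale ε β) (gradScale ε β)) (errScale ε β ϱ) (g i) ≤
        b) →
      A.sys.IsGlobalSol ϱ T b Λ (∑ i ∈ F, g i) u → ∀ i ∈ G, ∀ n' ≥ n,
      IsLocalizedPath (atoms (c i) (widthScale ε β) (gradScale ε β)) T (errScale ε β ϱ) n'
        (fun s => comp (u s) i) := by
  have hb0 : 0 ≤ b := zero_le_one.trans hb
  obtain ⟨C₁, hC₁, h1⟩ := exists_drift_bound F hF hb hΛ hT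
  obtain ⟨C₂, hC₂, h2⟩ := exists_concentration F hF hb hΛ hT
  set b' := b + C₂ with hb'
  have hb'1 : 1 ≤ b' := by linarith
  set L := ∑ q : A.Term, q.phaseMono.locConst b' (T * C₀) with hL
  have hL0 : 0 ≤ L := Finset.sum_nonneg fun q _ =>
    (q.phaseMono.locConst_pos hb'1 (by positivity)).le
  have hlog : 0 ≤ (Real.log 2)⁻¹ := inv_nonneg.2 (Real.log_nonneg (by norm_num))
  set N := C₁ * (C₀ * (Real.log 2)⁻¹) with hN
  have hN0 : 0 ≤ N := by positivity
  set Y := G.card * (N + b) * Real.exp (G.card * L * T) with hY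
  have hY0 : 0 ≤ Y := by positivity
  refine ⟨N + b + L * Y, by positivity, ?_⟩
  intro ε β ϱ g u hS hϱ hg hgG hu
  set a₁ := widthScale ε β
  set a₂ := gradScale ε β
  set η := errScale ε β ϱ
  have hη : 0 < η := hS.err_pos
  have ha1 : 0 ≤ a₁ := hS.width_pos.le
  have hcc := continuous_comp (A := A) hu.continuous
  have hcd := fun i => continuous_drift F i hcc ϱ
  have hLs : Continuous fun s => locSum G a₁ a₂ η (comp (u s)) :=
    continuous_finsetSum _ fun i _ =>
      (continuous_atomNorm hη).comp ((continuous_apply i).comp hcc)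
  have he : ∀ τ ∈ Set.Icc 0 T, ∀ i ∈ G, ‖comp (u τ) i -
      (g i + ∫ s in (0 : ℝ)..τ, drift F i (s / ϱ) (comp (u s)))‖ ≤ N * η := by
    intro τ hτ i hi
    refine (h1 ϱ a₁ g u hS.ϱ_pos ha1 hϱ hg hu τ hτ i (hGF hi)).trans ?_
    rw [hN, mul_assoc]
    exact mul_le_mul_of_nonneg_left hS.width_le_err hC₁
  have hd : ∀ s ∈ Set.Icc 0 T, ∀ i ∈ G, atomNorm (atoms (c i) a₁ a₂) η
      (drift F i (s / ϱ) (comp (u s))) ≤ L * locSum G a₁ a₂ η (comp (u s)) := by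
    intro s hs i hi
    refine atomNorm_drift_le hG hη hb'1 (by positivity) hS.one_le_grad
      hS.one_le_width_mul_grad (hS.time_le hs) (fun i => isFiltered_Q i _)
      (fun i => (norm_comp_le _ _).trans ((hu.bound s).trans (by linarith))) (fun i hi => ?_) hi
    have h3 := h2 ϱ a₁ g u hS.ϱ_pos ha1 hϱ hg hu s hs
    have h4 := wnorm_le_spread (comp (u s)) hi
    have h5 := norm_nonneg (rest F (u s))
    have h6 := mul_nonneg hb0 ha1
    change wnorm (c i) (comp (u s) i) ≤ b' * a₁
    rw [hb', add_mul]
    linarith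
  have hsum : ∀ τ ∈ Set.Icc 0 T, locSum G a₁ a₂ η (comp (u τ)) ≤
      G.card * (N + b) + G.card * L * ∫ s in (0 : ℝ)..τ, locSum G a₁ a₂ η (comp (u s)) := by
    intro τ hτ
    have h3 : ∀ i ∈ G, atomNorm (atoms (c i) a₁ a₂) η (comp (u τ) i) ≤
        (N + b) + L * ∫ s in (0 : ℝ)..τ, locSum G a₁ a₂ η (comp (u s)) := by
      intro i hi
      set N' := atomNorm (atoms (c i) a₁ a₂) η with hN'
      set I := ∫ s in (0 : ℝ)..τ, drift F i (s / ϱ) (comp (u s)) with hI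
      have e : comp (u τ) i = (comp (u τ) i - (g i + I)) + (g i + I) := by abel
      have h4 : N' (comp (u τ) i - (g i + I)) ≤ N := by
        refine (atomNorm_le_norm hη.le _).trans ?_
        rw [div_le_iff₀ hη]
        exact he τ hτ i hi
      have h5 : N' I ≤ ∫ s in (0 : ℝ)..τ, L * locSum G a₁ a₂ η (comp (u s)) := by
        refine (atomNorm_integral_le hη (hcd i) hτ.1).trans ?_
        refine intervalIntegral.integral_mono_on hτ.1
          (((continuous_atomNorm hη).comp (hcd i)).intervalIntegrable _ _)
          ((hLs.const_mul _).intervalIntegrable _ _) fun s hs => hd s ⟨hs.1, hs.2.trans hτ.2⟩ i hi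
      rw [intervalIntegral.integral_const_mul] at h5
      have h6 := map_add_le_add N' (comp (u τ) i - (g i + I)) (g i + I)
      have h7 := map_add_le_add N' (g i) I
      have h8 := hgG i hi
      rw [← e] at h6
      linarith
    refine (Finset.sum_le_sum h3).trans (le_of_eq ?_)
    rw [Finset.sum_const, nsmul_eq_mul]
    ring
  have hYb : ∀ τ ∈ Set.Icc 0 T, locSum G a₁ a₂ η (comp (u τ)) ≤ Y := by
    intro τ hτ
    refine (gronwall_integral hLs (by positivity) hsum hτ).trans ?_
    refine mul_le_mul_of_nonneg_left (Real.exp_le_exp.2 ?_) (by positivity)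
    exact mul_le_mul_of_nonneg_left hτ.2 (by positivity)
  intro i hi n' hn'
  have hLY : 0 ≤ L * Y := by positivity
  refine ⟨g i, fun s => drift F i (s / ϱ) (comp (u s)), hcd i, fun τ hτ =>
    (he τ hτ i hi).trans (mul_le_mul_of_nonneg_right (by linarith) hη.le),
    (hgG i hi).trans (by linarith), fun s hs => (hd s hs i hi).trans ?_⟩
  exact (mul_le_mul_of_nonneg_left (hYb s hs) hL0).trans (by linarith)

end Frame

end Wavepacket

namespace Wavepacket

variable {d J m : ℕ}

open WaveSystem

namespace Frame

variable {A : Frame d J} {K : ℕ} {S : Fin K → Finset (NK d J)} {T : Set (NK d J)}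

/-- Decompositions of the spectrum as in the superposition principle. -/
structure IsSplit (A : Frame d J) (S : Fin K → Finset (NK d J)) (T : Set (NK d J)) : Prop where
  total_eq : (A.S : Set (NK d J)) = total S
  disj : ∀ p q, p ≠ q → Disjoint (S p) (S q)
  loc : A.sys.IsLocalizationClosed (total S) T
  gvm : A.sys.IsPartiallyGVM S T

namespace IsSplit

variable (hS : A.IsSplit S T)

include hS

lemma subset (p : Fin K) : S p ⊆ A.S := fun σ hσ => by
  have : σ ∈ (A.S : Set (NK d J)) := by rw [hS.total_eq]; exact ⟨p, hσ⟩
  exact this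

lemma exists_block (i : A.I) : ∃ p, i ∈ blk A (S p) := by
  have : i.1.2 ∈ (A.S : Set (NK d J)) := mem_idx.1 i.2
  rw [hS.total_eq] at this
  obtain ⟨p, hp⟩ := this
  exact ⟨p, mem_blk.2 hp⟩

/-- The block of a component. -/
def block (i : A.I) : Fin K := (hS.exists_block i).choose

lemma mem_block (i : A.I) : i ∈ blk A (S (hS.block i)) := (hS.exists_block i).choose_spec

lemma mem_blk_iff {i : A.I} {p : Fin K} : i ∈ blk A (S p) ↔ hS.block i = p := by
  refine ⟨fun h => ?_, fun h => h ▸ hS.mem_block i⟩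
  by_contra hne
  exact Finset.disjoint_left.1 (hS.disj _ _ hne) (mem_blk.1 (hS.mem_block i)) (mem_blk.1 h)

lemma sum_blk {E : Type*} [AddCommMonoid E] (f : A.I → E) :
    ∑ p, ∑ i ∈ blk A (S p), f i = ∑ i, f i := by
  classical
  have h : ∀ p, blk A (S p) = Finset.univ.filter fun i => hS.block i = p := fun p => by
    ext i
    simp [hS.mem_blk_iff]
  simp only [h]
  exact Finset.sum_fiberwise _ _ _

lemma resClosed (p : Fin K) : ResClosed (blk A (S p)) :=
  resClosed_blk (hS.subset p) (hS.gvm.1 p)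

/-- The components of a family of functions, one for each block. -/
def comps (u : Fin K → L1 d J) (i : A.I) : L1 d J := comp (u (hS.block i)) i

lemma val_comps {q : A.Term} {p : Fin K} (hq : q ∈ terms (blk A (S p))) (t : ℝ)
    (u : Fin K → L1 d J) : q.val t (hS.comps u) = q.val t (comp (u p)) := by
  simp only [Term.val]
  congr 1
  funext j
  rw [comps, hS.mem_blk_iff.1 (mem_terms.1 hq j)]

lemma continuous_comps {u : Fin K → ℝ → L1 d J} (hu : ∀ p, Continuous (u p)) :
    Continuous fun s => hS.comps fun p => u p s :=
  continuous_pi fun i => (Q i).continuous.comp (hu (hS.block i))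

lemma sum_sub_sum_comps (u : Fin K → L1 d J) :
    ∑ p, u p - ∑ i, hS.comps u i = ∑ p, rest (blk A (S p)) (u p) := by
  rw [← hS.sum_blk, ← Finset.sum_sub_distrib]
  refine Finset.sum_congr rfl fun p _ => ?_
  rw [rest]
  congr 1
  exact Finset.sum_congr rfl fun i hi => by rw [comps, hS.mem_blk_iff.1 hi]

omit hS in
/-- The monomials with inputs in different blocks. -/
def Cross (S : Fin K → Finset (NK d J)) (q : A.Term) : Prop := ∀ p, q ∉ terms (blk A (S p))

lemma val_sub_sum (q : A.Term) (t : ℝ) (u : Fin K → L1 d J) :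
    open Classical in
    q.val t (hS.comps u) - ∑ p, (if q ∈ terms (blk A (S p)) then q.val t (comp (u p)) else 0) =
      if Cross S q then q.val t (hS.comps u) else 0 := by
  classical
  by_cases h : Cross S q
  · rw [if_pos h, Finset.sum_eq_zero fun p _ => if_neg (h p), sub_zero]
  · rw [if_neg h]
    simp only [Cross, not_forall, not_not] at h
    obtain ⟨p, hp⟩ := h
    have hm : 0 < q.1.1 := zero_lt_two.trans_le (A.adm.two_le _ q.1.2)
    rw [Finset.sum_eq_single p, if_pos hp, hS.val_comps hp, sub_self]
    · intro p' _ hp'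
      refine if_neg fun hq => hp' ?_
      rw [← hS.mem_blk_iff.1 (mem_terms.1 hq ⟨0, hm⟩), hS.mem_blk_iff.1 (mem_terms.1 hp ⟨0, hm⟩)]
    · intro h
      exact absurd (Finset.mem_univ p) h

lemma isCrossInteracting {q : A.Term} (hq : Cross S q) : IsCrossInteracting S (str q.2.1) := by
  have hm : 0 < q.1.1 := zero_lt_two.trans_le (A.adm.two_le _ q.1.2)
  have h := hq (hS.block (q.2.1 ⟨0, hm⟩))
  rw [mem_terms] at h
  push Not at h
  obtain ⟨j, hj⟩ := h
  exact ⟨⟨0, hm⟩, j, hS.block (q.2.1 ⟨0, hm⟩), hS.block (q.2.1 j),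
    fun h => hj (hS.mem_blk_iff.2 h.symm), mem_blk.1 (hS.mem_block _),
    mem_blk.1 (hS.mem_block _)⟩

lemma isResonant {q : A.Term} (hq : q.Resonant) :
    A.sys.IsResonant (total S) q.1.1 q.2.2.1 q.2.2.2 (str q.2.1) := by
  refine ⟨q.1.2, fun j => ?_, hq⟩
  rw [← hS.total_eq]
  exact mem_idx.1 (q.2.1 j).2

lemma exists_slots {q : A.Term} (hq : Cross S q) (hr : q.Resonant) :
    ∃ a a' : Fin q.1.1, a ≠ a' ∧ q.phaseMono.v a ≠ q.phaseMono.v a' ∧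
      (q.2.1 a).1.2 ∈ T ∧ (q.2.1 a').1.2 ∈ T := by
  obtain ⟨a, a', p, p', -, -, -, h1, h2, -, -, h3⟩ :=
    hS.gvm.2 _ _ _ _ (hS.isResonant hr) (hS.isCrossInteracting hq)
  refine ⟨a, a', fun h => h3 (by rw [h]), ?_, h1, h2⟩
  rw [Term.phaseMono, v_mono, v_mono]
  exact h3

lemma exists_localized_slot (p : Fin K) :
    open Classical in
    ∀ i ∈ (blk A (S p)).filter (fun i => i.1.2 ∈ T), ∀ q ∈ terms (blk A (S p)), q.Resonant →
      q.Matches i → q.Nonzero → ∃ j, q.2.1 j ∈ (blk A (S p)).filter (fun i => i.1.2 ∈ T) := by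
  classical
  intro i hi q hq hr hm hz
  have hi' := (Finset.mem_filter.1 hi).2
  have hb1 : i.1.1 = q.2.2.1 := congrArg Prod.fst hm.1
  have hb2 : i.1.2.1 = q.2.2.2 := congrArg Prod.snd hm.1
  have hres := hS.isResonant hr
  rw [← hb2] at hres
  have hzz : A.sys.IsNonzeroTerm q.2.2.1 i.1.2.1 (str q.2.1) := by rw [hb2]; exact hz
  have hkap : sgn q.2.2.1 • kappa (str q.2.1) = i.1.2.2 := by
    have h1 : kappa (str q.2.1) = sgn i.1.1 • i.1.2.2 := hm.2
    rw [h1, ← hb1, sgn_smul_sgn_smul]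
  have h0 : 0 < q.1.1 := zero_lt_two.trans_le (A.adm.two_le _ q.1.2)
  rcases hS.loc i.1.2 hi' q.1.1 q.2.2.1 (str q.2.1) ⟨hres, hkap, hzz⟩ with ⟨j, hj, -⟩ | h
  · exact ⟨j, Finset.mem_filter.2 ⟨mem_terms.1 hq j, hj⟩⟩
  · exact ⟨⟨0, h0⟩, Finset.mem_filter.2 ⟨mem_terms.1 hq _, h _⟩⟩

end IsSplit

/-- The assumptions on the data and on the solutions in the blocks. -/
structure IsFamily (A : Frame d J) (S : Fin K → Finset (NK d J)) (T : Set (NK d J))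
    (b Λ τs ε β ϱ : ℝ) (g : A.I → L1 d J) (u : Fin K → ℝ → L1 d J) : Prop where
  ϱ_le : ϱ ≤ b * widthScale ε β
  packet : IsPacket Finset.univ b (widthScale ε β) g
  localized : ∀ i : A.I, i.1.2 ∈ T →
    atomNorm (atoms (c i) (widthScale ε β) (gradScale ε β)) (errScale ε β ϱ) (g i) ≤ b
  sol : ∀ p, A.sys.IsGlobalSol ϱ τs b Λ (∑ i ∈ blk A (S p), g i) (u p)

namespace IsSplit

variable (hS : A.IsSplit S T)

include hS

lemma exists_block_estimates {b Λ τs C₀ : ℝ} (hb : 1 ≤ b) (hΛ : 0 ≤ Λ) (hτs : 0 ≤ τs)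
    (hC₀ : 0 ≤ C₀) :
    ∃ n : ℝ, 1 ≤ n ∧ ∀ ε β ϱ (g : A.I → L1 d J) (u : Fin K → ℝ → L1 d J), Scale C₀ ε β ϱ →
      A.IsFamily S T b Λ τs ε β ϱ g u →
      (∀ p, ∀ τ ∈ Set.Icc 0 τs, ‖rest (blk A (S p)) (u p τ)‖ ≤ n * widthScale ε β) ∧
      (∀ i, ∀ τ ∈ Set.Icc 0 τs,
        wnorm (c i) (hS.comps (fun p => u p τ) i) ≤ n * widthScale ε β) ∧
      ∀ i : A.I, i.1.2 ∈ T →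
        IsLocalizedPath (atoms (c i) (widthScale ε β) (gradScale ε β)) τs (errScale ε β ϱ) n
          (fun s => hS.comps (fun p => u p s) i) := by
  classical
  choose C hC h1 using fun p => exists_concentration (blk A (S p)) (hS.resClosed p) hb hΛ hτs
  choose n hn h2 using fun p => exists_localization (blk A (S p))
    ((blk A (S p)).filter fun i => i.1.2 ∈ T) (hS.resClosed p) (Finset.filter_subset _ _)
    (hS.exists_localized_slot p) hb hΛ hτs hC₀
  have hCs : ∀ p, C p ≤ ∑ p, C p := fun p =>
    Finset.single_le_sum (fun p _ => hC p) (Finset.mem_univ p)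
  have hns : ∀ p, n p ≤ ∑ p, n p := fun p =>
    Finset.single_le_sum (fun p _ => hn p) (Finset.mem_univ p)
  have hC0 : 0 ≤ ∑ p, C p := Finset.sum_nonneg fun p _ => hC p
  have hn0 : 0 ≤ ∑ p, n p := Finset.sum_nonneg fun p _ => hn p
  refine ⟨1 + ∑ p, C p + ∑ p, n p, by linarith, fun ε β ϱ g u hSc hf => ?_⟩
  have hw := hSc.width_pos.le
  have hpk : ∀ p, IsPacket (blk A (S p)) b (widthScale ε β) g := fun p =>
    ⟨fun i _ => hf.packet.bound i (Finset.mem_univ i),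
      fun i _ => hf.packet.width i (Finset.mem_univ i),
      fun i _ => hf.packet.proj i (Finset.mem_univ i)⟩
  have h3 : ∀ p, ∀ τ ∈ Set.Icc 0 τs, ‖rest (blk A (S p)) (u p τ)‖ +
      spread (blk A (S p)) (comp (u p τ)) ≤ (1 + ∑ p, C p + ∑ p, n p) * widthScale ε β :=
    fun p τ hτ => (h1 p ϱ _ g (u p) hSc.ϱ_pos hw hf.ϱ_le (hpk p) (hf.sol p) τ hτ).trans
      (mul_le_mul_of_nonneg_right (by linarith [hCs p]) hw)
  refine ⟨fun p τ hτ => ?_, fun i τ hτ => ?_, fun i hi => ?_⟩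
  · linarith [h3 p τ hτ, spread_nonneg (blk A (S p)) (comp (u p τ))]
  · have h4 := wnorm_le_spread (comp (u (hS.block i) τ)) (hS.mem_block i)
    have h5 := norm_nonneg (rest (blk A (S (hS.block i))) (u (hS.block i) τ))
    have h6 := h3 (hS.block i) τ hτ
    change wnorm (c i) (comp (u (hS.block i) τ) i) ≤ _
    linarith
  · exact h2 (hS.block i) ε β ϱ g (u (hS.block i)) hSc hf.ϱ_le (hpk _)
      (fun i hi => hf.localized i (Finset.mem_filter.1 hi).2) (hf.sol _) i
      (Finset.mem_filter.2 ⟨hS.mem_block i, hi⟩) _ (by linarith [hns (hS.block i)])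

/-- The interactions between different blocks are small. -/
lemma exists_cross_bound {b Λ τs C₀ : ℝ} (hb : 1 ≤ b) (hΛ : 0 ≤ Λ) (hτs : 0 ≤ τs)
    (hC₀ : 0 ≤ C₀) :
    ∃ C : ℝ, 0 ≤ C ∧ ∀ q : A.Term, Cross S q →
      ∀ ε β ϱ (g : A.I → L1 d J) (u : Fin K → ℝ → L1 d J), Scale C₀ ε β ϱ →
      A.IsFamily S T b Λ τs ε β ϱ g u → ∀ τ ∈ Set.Icc 0 τs,
      ‖∫ s in (0 : ℝ)..τ, q.val (s / ϱ) (hS.comps fun p => u p s)‖ ≤ C * errScale ε β ϱ := by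
  obtain ⟨n, hn, h1⟩ := hS.exists_block_estimates hb hΛ hτs hC₀
  obtain ⟨C₁, hC₁, h2⟩ := exists_nonresonant_bound hb hΛ hτs (Finset.univ : Finset A.I)
  have hlog : 0 ≤ (Real.log 2)⁻¹ := inv_nonneg.2 (Real.log_nonneg (by norm_num))
  have hbn : 1 ≤ b + n := by linarith
  have hq : ∀ q : A.Term, ∃ C : ℝ, 0 ≤ C ∧ (Cross S q →
      ∀ ε β ϱ (g : A.I → L1 d J) (u : Fin K → ℝ → L1 d J), Scale C₀ ε β ϱ →
      A.IsFamily S T b Λ τs ε β ϱ g u → ∀ τ ∈ Set.Icc 0 τs,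
      ‖∫ s in (0 : ℝ)..τ, q.val (s / ϱ) (hS.comps fun p => u p s)‖ ≤ C * errScale ε β ϱ) := by
    intro q
    by_cases hc : Cross S q
    swap
    · exact ⟨0, le_rfl, fun h => absurd h hc⟩
    by_cases hr : q.Resonant
    · obtain ⟨a, a', haa, hv, ha, ha'⟩ := hS.exists_slots hc hr
      obtain ⟨C, hC, h3⟩ := q.phaseMono.collision hbn hC₀ hτs haa hv
      refine ⟨C, hC.le, fun _ ε β ϱ g u hSc hf τ hτ => ?_⟩
      obtain ⟨-, h4, h5⟩ := h1 ε β ϱ g u hSc hf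
      have hcw := hS.continuous_comps fun p => (hf.sol p).continuous
      have hcq : Continuous fun s => fun j => hS.comps (fun p => u p s) (q.2.1 j) :=
        continuous_pi fun j => continuous_pi_iff.1 hcw (q.2.1 j)
      have hloc : ∀ a, (q.2.1 a).1.2 ∈ T → IsLocalizedPath
          (atoms (q.phaseMono.c a) (widthScale ε β) (gradScale ε β)) τs (errScale ε β ϱ) (b + n)
          (fun s => hS.comps (fun p => u p s) (q.2.1 a)) := by
        intro a ha
        obtain ⟨h, b', k1, k2, k3, k4⟩ := h5 _ ha
        rw [Term.phaseMono_c]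
        refine ⟨h, b', k1, fun τ hτ => (k2 τ hτ).trans ?_, k3.trans (by linarith),
          fun s hs => (k4 s hs).trans (by linarith)⟩
        exact mul_le_mul_of_nonneg_right (by linarith) hSc.err_pos.le
      have h6 := h3 ε β ϱ hSc (fun s j => hS.comps (fun p => u p s) (q.2.1 j)) hcq
        (fun s j => (norm_comp_le _ _).trans (((hf.sol _).bound s).trans (by linarith)))
        (fun s hs j => by
          rw [Term.phaseMono_c]
          refine (h4 _ s hs).trans (mul_le_mul_of_nonneg_right (by linarith) hSc.width_pos.le))
        (hloc a ha) (hloc a' ha')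
      have hcv : Continuous fun s => q.val (s / ϱ) (hS.comps fun p => u p s) :=
        q.continuous_val hcw ϱ
      refine (intervalIntegral.norm_integral_le_integral_norm hτ.1).trans (le_trans ?_ h6)
      exact intervalIntegral.integral_mono_interval le_rfl hτ.1 hτ.2
        (Filter.Eventually.of_forall fun s => norm_nonneg _) (hcv.norm.intervalIntegrable _ _)
    · refine ⟨C₁ * ((Real.log 2)⁻¹ + τs * (Fintype.card A.I * n * (C₀ * (Real.log 2)⁻¹))),
        by positivity, fun _ ε β ϱ g u hSc hf τ hτ => ?_⟩
      obtain ⟨-, h4, -⟩ := h1 ε β ϱ g u hSc hf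
      have hcw := hS.continuous_comps fun p => (hf.sol p).continuous
      have h5 := h2 q (mem_terms.2 fun j => Finset.mem_univ _) hr ϱ hSc.ϱ_pos
        (fun s => hS.comps fun p => u p s) hcw
        (fun s i => (norm_comp_le _ _).trans ((hf.sol _).bound s))
        (fun s s' i => by
          rw [comps, comps, comp, comp, ← map_sub]
          exact (norm_Q_le _ _).trans ((hf.sol _).lip s s')) τ hτ
      refine h5.trans ?_
      rw [mul_assoc]
      refine mul_le_mul_of_nonneg_left ?_ hC₁
      have h6 : ∫ s in (0 : ℝ)..τ, spread Finset.univ (hS.comps fun p => u p s) ≤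
          ∫ s in (0 : ℝ)..τ, Fintype.card A.I * (n * widthScale ε β) := by
        refine intervalIntegral.integral_mono_on hτ.1
          ((continuous_spread _ hcw).intervalIntegrable _ _)
          (continuous_const.intervalIntegrable _ _) fun s hs => ?_
        refine (Finset.sum_le_sum fun i _ => h4 i s ⟨hs.1, hs.2.trans hτ.2⟩).trans (le_of_eq ?_)
        rw [Finset.sum_const, nsmul_eq_mul, Finset.card_univ]
      rw [intervalIntegral.integral_const, sub_zero, smul_eq_mul] at h6
      have h7 : τ * (Fintype.card A.I * (n * widthScale ε β)) ≤
          τs * (Fintype.card A.I * (n * (C₀ * (Real.log 2)⁻¹ * errScale ε β ϱ))) := by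
        have h8 := hSc.width_le_err
        have h9 := hSc.width_pos
        have := hτ.2
        gcongr
      have h8 := hSc.ϱ_le_err
      linarith
  choose C hC h3 using hq
  refine ⟨∑ q, C q, Finset.sum_nonneg fun q _ => hC q, fun q hq ε β ϱ g u hSc hf τ hτ =>
    (h3 q hq ε β ϱ g u hSc hf τ hτ).trans (mul_le_mul_of_nonneg_right
      (Finset.single_le_sum (fun q _ => hC q) (Finset.mem_univ q)) hSc.err_pos.le)⟩

lemma rhs_sum_comps (t : ℝ) (u : Fin K → L1 d J) :
    open Classical in
    A.sys.rhs t (∑ i, hS.comps u i) - ∑ p, ∑ q ∈ terms (blk A (S p)), q.val t (comp (u p)) =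
      ∑ q : A.Term, if Cross S q then q.val t (hS.comps u) else 0 := by
  classical
  have h1 : terms (Finset.univ : Finset A.I) = Finset.univ :=
    Finset.eq_univ_of_forall fun q => mem_terms.2 fun j => Finset.mem_univ _
  have h2 : ∑ p, ∑ q ∈ terms (blk A (S p)), q.val t (comp (u p)) =
      ∑ q : A.Term, ∑ p, if q ∈ terms (blk A (S p)) then q.val t (comp (u p)) else 0 := by
    rw [Finset.sum_comm]
    refine Finset.sum_congr rfl fun p _ => ?_
    rw [← Finset.sum_filter, Finset.filter_mem_eq_inter, Finset.univ_inter]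
  rw [rhs_sum Finset.univ (w := hS.comps u) (fun i => isFiltered_Q i _), h1, h2, ← Finset.sum_sub_distrib]
  exact Finset.sum_congr rfl fun q _ => hS.val_sub_sum q t u

set_option maxHeartbeats 1000000 in
lemma exists_defect_bound {b Λ τs C₀ : ℝ} (hb : 1 ≤ b) (hΛ : 0 ≤ Λ) (hτs : 0 ≤ τs)
    (hC₀ : 0 ≤ C₀) :
    ∃ C : ℝ, 0 ≤ C ∧ ∀ ε β ϱ (g : A.I → L1 d J) (u : Fin K → ℝ → L1 d J), Scale C₀ ε β ϱ →
      A.IsFamily S T b Λ τs ε β ϱ g u → ∀ τ ∈ Set.Icc 0 τs,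
      ‖∫ s in (0 : ℝ)..τ, (A.sys.rhs (s / ϱ) (∑ p, u p s) - ∑ p, A.sys.rhs (s / ϱ) (u p s))‖ ≤
        C * errScale ε β ϱ := by
  classical
  have hb0 : 0 ≤ b := zero_le_one.trans hb
  obtain ⟨n, hn, h1⟩ := hS.exists_block_estimates hb hΛ hτs hC₀
  obtain ⟨C₁, hC₁, h2⟩ := hS.exists_cross_bound hb hΛ hτs hC₀
  choose C₂ hC₂ h3 using fun p => exists_rhs_sub_bound (blk A (S p)) hb0
  obtain ⟨C₃, hC₃, -, h4⟩ := A.adm.exists_rhs_bound ((K + Fintype.card A.I) * b) (by positivity)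
  have hlog : 0 ≤ (Real.log 2)⁻¹ := inv_nonneg.2 (Real.log_nonneg (by norm_num))
  have hC₂s : 0 ≤ ∑ p, C₂ p := Finset.sum_nonneg fun p _ => hC₂ p
  set D := (C₃ * K + ∑ p, C₂ p) * n with hD
  have hD0 : 0 ≤ D := by positivity
  refine ⟨τs * (D * (C₀ * (Real.log 2)⁻¹)) + Fintype.card A.Term * C₁, by positivity,
    fun ε β ϱ g u hSc hf τ hτ => ?_⟩
  obtain ⟨h5, -, -⟩ := h1 ε β ϱ g u hSc hf
  have hw := hSc.width_pos.le
  have hη := hSc.err_pos.le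
  have huc := fun p => (hf.sol p).continuous
  have hub := fun p => (hf.sol p).bound
  have hcw := hS.continuous_comps huc
  set f : ℝ → L1 d J := fun s => A.sys.rhs (s / ϱ) (∑ p, u p s) -
    ∑ p, A.sys.rhs (s / ϱ) (u p s) with hfdef
  set x : ℝ → L1 d J := fun s =>
    ∑ q : A.Term, if Cross S q then q.val (s / ϱ) (hS.comps fun p => u p s) else 0 with hx
  have hfc : Continuous f :=
    (A.adm.continuous_rhs_comp ϱ (continuous_finsetSum _ fun p _ => huc p)).sub
      (continuous_finsetSum _ fun p _ => A.adm.continuous_rhs_comp ϱ (huc p))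
  have hxq : ∀ q : A.Term, Continuous fun s =>
      if Cross S q then q.val (s / ϱ) (hS.comps fun p => u p s) else 0 := by
    intro q
    by_cases h : Cross S q
    · simp only [if_pos h]
      exact q.continuous_val hcw ϱ
    · simp only [if_neg h]
      exact continuous_const
  have hxc : Continuous x := continuous_finsetSum _ fun q _ => hxq q
  have hd : ∀ s ∈ Set.Icc 0 τs, ‖f s - x s‖ ≤ D * widthScale ε β := by
    intro s hs
    have e : f s - x s = (A.sys.rhs (s / ϱ) (∑ p, u p s) -
        A.sys.rhs (s / ϱ) (∑ i, hS.comps (fun p => u p s) i)) -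
        ∑ p, (A.sys.rhs (s / ϱ) (u p s) -
          ∑ q ∈ terms (blk A (S p)), q.val (s / ϱ) (comp (u p s))) := by
      rw [Finset.sum_sub_distrib, hx]
      simp only
      rw [← hS.rhs_sum_comps, hfdef]
      simp only
      abel
    have hn1 : ‖∑ p, u p s‖ ≤ (K + Fintype.card A.I) * b := by
      refine (norm_sum_le _ _).trans ((Finset.sum_le_sum fun p _ => hub p s).trans ?_)
      rw [Finset.sum_const, nsmul_eq_mul, Finset.card_univ, Fintype.card_fin]
      have : 0 ≤ (Fintype.card A.I : ℝ) * b := by positivity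
      linarith
    have hn2 : ‖∑ i, hS.comps (fun p => u p s) i‖ ≤ (K + Fintype.card A.I) * b := by
      refine (norm_sum_le _ _).trans ((Finset.sum_le_sum fun i _ =>
        (norm_comp_le _ _).trans (hub _ s)).trans ?_)
      rw [Finset.sum_const, nsmul_eq_mul, Finset.card_univ]
      have : 0 ≤ (K : ℝ) * b := by positivity
      linarith
    have k1 : ‖A.sys.rhs (s / ϱ) (∑ p, u p s) -
        A.sys.rhs (s / ϱ) (∑ i, hS.comps (fun p => u p s) i)‖ ≤
        C₃ * (K * (n * widthScale ε β)) := by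
      refine (h4 _ _ _ hn1 hn2).trans (mul_le_mul_of_nonneg_left ?_ hC₃)
      rw [hS.sum_sub_sum_comps]
      refine (norm_sum_le _ _).trans ((Finset.sum_le_sum fun p _ => h5 p s hs).trans
        (le_of_eq ?_))
      rw [Finset.sum_const, nsmul_eq_mul, Finset.card_univ, Fintype.card_fin]
    have k2 : ‖∑ p, (A.sys.rhs (s / ϱ) (u p s) -
          ∑ q ∈ terms (blk A (S p)), q.val (s / ϱ) (comp (u p s)))‖ ≤
        (∑ p, C₂ p) * (n * widthScale ε β) := by
      rw [Finset.sum_mul]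
      exact norm_sum_le_of_le _ fun p _ => (h3 p _ _ (hub p s)).trans
        (mul_le_mul_of_nonneg_left (h5 p s hs) (hC₂ p))
    rw [e]
    refine (norm_sub_le _ _).trans ((add_le_add k1 k2).trans (le_of_eq ?_))
    rw [hD]
    ring
  have hsplit : ∫ s in (0 : ℝ)..τ, f s = (∫ s in (0 : ℝ)..τ, (f s - x s)) +
      ∫ s in (0 : ℝ)..τ, x s := by
    rw [intervalIntegral.integral_sub (hfc.intervalIntegrable _ _) (hxc.intervalIntegrable _ _),
      sub_add_cancel]
  have k3 : ‖∫ s in (0 : ℝ)..τ, (f s - x s)‖ ≤ τs * (D * (C₀ * (Real.log 2)⁻¹ *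
      errScale ε β ϱ)) := by
    have h6 := intervalIntegral.norm_integral_le_of_norm_le_const (a := 0) (b := τ)
      (C := D * widthScale ε β) (f := fun s => f s - x s) fun s hs => by
        rw [Set.uIoc_of_le hτ.1] at hs
        exact hd s ⟨hs.1.le, hs.2.trans hτ.2⟩
    rw [sub_zero, abs_of_nonneg hτ.1, mul_comm (D * widthScale ε β) τ] at h6
    refine h6.trans ?_
    exact mul_le_mul hτ.2 (mul_le_mul_of_nonneg_left hSc.width_le_err hD0) (by positivity) hτs
  have k4 : ‖∫ s in (0 : ℝ)..τ, x s‖ ≤ Fintype.card A.Term * (C₁ * errScale ε β ϱ) := by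
    rw [hx, intervalIntegral.integral_finsetSum fun q _ => (hxq q).intervalIntegrable _ _]
    refine (norm_sum_le _ _).trans ((Finset.sum_le_sum (g := fun _ => C₁ * errScale ε β ϱ)
      fun q _ => ?_).trans (le_of_eq ?_))
    · by_cases h : Cross S q
      · simp only [if_pos h]
        exact h2 q h ε β ϱ g u hSc hf τ hτ
      · simp only [if_neg h]
        rw [intervalIntegral.integral_zero, norm_zero]
        positivity
    · rw [Finset.sum_const, nsmul_eq_mul, Finset.card_univ]
  rw [hsplit]
  refine (norm_add_le _ _).trans ((add_le_add k3 k4).trans (le_of_eq (by ring)))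

/-- The superposition principle for exact wave packets. -/
lemma exists_superposition {b Λ τs C₀ : ℝ} (hb : 1 ≤ b) (hΛ : 0 ≤ Λ) (hτs : 0 ≤ τs)
    (hC₀ : 0 ≤ C₀) :
    ∃ C : ℝ, 0 ≤ C ∧ ∀ ε β ϱ (g : A.I → L1 d J) (U : ℝ → L1 d J) (u : Fin K → ℝ → L1 d J),
      Scale C₀ ε β ϱ → A.IsFamily S T b Λ τs ε β ϱ g u →
      A.sys.IsGlobalSol ϱ τs b Λ (∑ i, g i) U → ∀ τ ∈ Set.Icc 0 τs,
      ‖U τ - ∑ p, u p τ‖ ≤ C * errScale ε β ϱ := by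
  obtain ⟨C₁, hC₁, h1⟩ := hS.exists_defect_bound hb hΛ hτs hC₀
  obtain ⟨C₃, hC₃, -, h4⟩ := A.adm.exists_rhs_bound ((K + 1) * b) (by positivity)
  refine ⟨C₁ * Real.exp (C₃ * τs), by positivity, fun ε β ϱ g U u hSc hf hU τ hτ => ?_⟩
  have hη := hSc.err_pos.le
  have huc := fun p => (hf.sol p).continuous
  have hvc : Continuous fun s => ∑ p, u p s := continuous_finsetSum _ fun p _ => huc p
  have hb0 : 0 ≤ b := zero_le_one.trans hb
  have hcU := A.adm.continuous_rhs_comp ϱ hU.continuous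
  have hcv := A.adm.continuous_rhs_comp ϱ hvc
  have hcu := fun p => A.adm.continuous_rhs_comp ϱ (huc p)
  have h5 := A.adm.norm_sub_le_of_approx (ϱ := ϱ) (T := τs) (δ := C₁ * errScale ε β ϱ) hC₃ h4
    hU.continuous hvc (fun s => (hU.bound s).trans (by
      have : 0 ≤ (K : ℝ) * b := by positivity
      linarith))
    (fun s => (norm_sum_le _ _).trans ((Finset.sum_le_sum fun p _ => (hf.sol p).bound s).trans (by
      rw [Finset.sum_const, nsmul_eq_mul, Finset.card_univ, Fintype.card_fin]
      linarith)))
    (fun σ hσ => by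
      have e : U σ - ∑ p, u p σ - ∫ s in (0 : ℝ)..σ,
          (A.sys.rhs (s / ϱ) (U s) - A.sys.rhs (s / ϱ) (∑ p, u p s)) =
          ∫ s in (0 : ℝ)..σ, (A.sys.rhs (s / ϱ) (∑ p, u p s) -
            ∑ p, A.sys.rhs (s / ϱ) (u p s)) := by
        rw [intervalIntegral.integral_sub (hcU.intervalIntegrable _ _)
          (hcv.intervalIntegrable _ _),
          intervalIntegral.integral_sub (hcv.intervalIntegrable _ _)
          ((continuous_finsetSum _ fun p _ => hcu p).intervalIntegrable _ _),
          intervalIntegral.integral_finsetSum fun p _ => (hcu p).intervalIntegrable _ _,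
          hU.eq σ hσ, Finset.sum_congr rfl fun p _ => (hf.sol p).eq σ hσ,
          Finset.sum_add_distrib, hS.sum_blk]
        abel
      rw [e]
      exact h1 ε β ϱ g u hSc hf σ hσ) hτ
  refine h5.trans ?_
  have h6 : Real.exp (C₃ * τ) ≤ Real.exp (C₃ * τs) :=
    Real.exp_le_exp.2 (mul_le_mul_of_nonneg_left hτ.2 hC₃)
  calc _ ≤ C₁ * errScale ε β ϱ * Real.exp (C₃ * τs) :=
        mul_le_mul_of_nonneg_left h6 (by positivity)
    _ = _ := by ring

end IsSplit

end Frame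

end Wavepacket

namespace Wavepacket

variable {d J m : ℕ}

open WaveSystem

/-! ### Wavepackets and their exact components -/

section Packet

variable {sys : WaveSystem d J} {Ψ : X d → ℝ} {ε s : ℝ} {σ : NK d J}

lemma bandProj_eq_of_cut {ζ : ℤˣ} {n : Fin J} {k : X d} {z : ℝ} {x : V J}
    (h : x = z • sys.bandProj ζ n k x) : sys.bandProj ζ n k x = x := by
  conv_lhs => rw [h]
  rw [(sys.bandProj ζ n k).map_smul_of_tower, bandProj_idem, ← h]

lemma wnorm_le_of_cut (hΨ : IsCutoff Ψ) {a : ℝ} (ha : 0 < a) {c : X d} {f : L1 d J}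
    {P : X d → V J →L[ℂ] V J}
    (h : ∀ᵐ k, f k = Ψ ((a / 2)⁻¹ • (k - c)) • P k (f k)) : wnorm c f ≤ a * ‖f‖ := by
  rw [wnorm, L1.norm_eq_integral_norm, ← integral_const_mul]
  refine integral_mono_ae (integrable_dist1_mul c f) ((integrable_coe f).norm.const_mul a) ?_
  filter_upwards [h] with k hk
  by_cases h1 : 1 ≤ ‖(a / 2)⁻¹ • (k - c)‖
  · rw [hΨ.eq_zero _ h1, zero_smul] at hk
    simp [hk]
  · push Not at h1
    refine mul_le_mul_of_nonneg_right ((min_le_left _ _).trans ?_) (norm_nonneg _)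
    have ha2 : 0 < a / 2 := by positivity
    rw [norm_smul, norm_inv, Real.norm_of_nonneg ha2.le, inv_mul_lt_iff₀ ha2, mul_one] at h1
    linarith

lemma WaveSystem.Admissible.norm_le_norm_add (hsys : sys.Admissible) {n : Fin J} {f : ℤˣ → L1 d J}
    (hf : ∀ ζ, ∀ᵐ k, sys.bandProj ζ n k (f ζ k) = f ζ k) (ζ : ℤˣ) :
    ‖f ζ‖ ≤ ‖f (-1) + f 1‖ := by
  rw [L1.norm_eq_integral_norm, L1.norm_eq_integral_norm]
  refine integral_mono_ae (integrable_coe _).norm (integrable_coe _).norm ?_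
  filter_upwards [hf 1, hf (-1), hsys.ae_off, Lp.coeFn_add (f (-1)) (f 1)] with k h1 h2 h3 h4
  have h5 : f ζ k = sys.bandProj ζ n k ((f (-1) + f 1 : L1 d J) k) := by
    rw [h4, Pi.add_apply, map_add]
    rcases Int.units_eq_one_or ζ with rfl | rfl
    · rw [← h2, hsys.bandProj_comp h3 (i := (1, n)) (j := (-1, n)) (by simp), zero_add, h1]
    · rw [h2, ← h1, hsys.bandProj_comp h3 (i := (-1, n)) (j := (1, n)) (by simp), add_zero]
  rw [h5]
  exact (ContinuousLinearMap.le_of_opNorm_le _ (norm_bandProj_le _ _ _) _).trans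
    (le_of_eq (one_mul _))

/-- Bounds for a wavepacket and for its components. -/
structure IsExact (sys : WaveSystem d J) (ε s b : ℝ) (σ : NK d J) (β : ℝ) (h : L1 d J)
    (hc : ℤˣ → L1 d J) : Prop where
  norm_sub : ‖h - (hc (-1) + hc 1)‖ ≤ b * β ^ s
  bound : ∀ ζ, ‖hc ζ‖ ≤ b
  width : ∀ ζ, wnorm (sgn ζ • σ.2) (hc ζ) ≤ b * widthScale ε β
  proj : ∀ ζ, ∀ᵐ k, sys.bandProj ζ σ.1 k (hc ζ k) = hc ζ k

lemma eventually_small {β₀ : ℝ} (h : 0 < β₀) : ∀ᶠ β in 𝓝[>] (0 : ℝ), β ∈ Set.Ioo 0 β₀ :=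
  Ioo_mem_nhdsGT h

lemma WaveSystem.Admissible.exists_isExact (hsys : sys.Admissible) (hΨ : IsCutoff Ψ) (hs : 0 < s)
    {h : ℝ → X d → L1 d J} {hc : ℤˣ → ℝ → X d → L1 d J}
    (hw : sys.IsWavepacketWith Ψ ε s σ h hc) :
    ∃ b : ℝ, 1 ≤ b ∧ ∀ b' ≥ b, ∀ᶠ β in 𝓝[>] (0 : ℝ), ∀ r,
      IsExact sys ε s b' σ β (h β r) fun ζ => hc ζ β r := by
  obtain ⟨β₀, hβ₀, ⟨C, hC⟩, hcut, ⟨C', hC'⟩⟩ := hw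
  refine ⟨1 + |C| + |C'|, by linarith [abs_nonneg C, abs_nonneg C'], fun b hb => ?_⟩
  filter_upwards [eventually_small hβ₀, eventually_small one_pos] with β hβ hβ1 r
  have hβ0 : 0 < β := hβ.1
  have hβs : β ^ s ≤ 1 := Real.rpow_le_one hβ0.le hβ1.2.le hs.le
  have hβs0 : 0 ≤ β ^ s := Real.rpow_nonneg hβ0.le _
  have ha : 0 < β ^ (1 - ε) := Real.rpow_pos_of_pos hβ0 _
  have h1 := abs_nonneg C
  have h2 := abs_nonneg C'
  have hproj : ∀ ζ, ∀ᵐ k, sys.bandProj ζ σ.1 k (hc ζ β r k) = hc ζ β r k := fun ζ => by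
    filter_upwards [hcut β hβ r ζ] with k hk
    exact bandProj_eq_of_cut hk
  have hsub := hC' β hβ r
  have hsub' : ‖h β r - (hc (-1) β r + hc 1 β r)‖ ≤ |C'| * β ^ s :=
    hsub.trans (mul_le_mul_of_nonneg_right (le_abs_self _) hβs0)
  have hbd : ∀ ζ, ‖hc ζ β r‖ ≤ b := by
    intro ζ
    refine (hsys.norm_le_norm_add (f := fun ζ => hc ζ β r) hproj ζ).trans ?_
    have h3 := norm_sub_norm_le (hc (-1) β r + hc 1 β r) (h β r)
    rw [norm_sub_rev] at h3
    have h4 := (hC β hβ r).trans (le_abs_self _)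
    have h5 := mul_le_of_le_one_right h2 hβs
    change ‖hc (-1) β r + hc 1 β r‖ ≤ _
    linarith
  refine ⟨hsub'.trans (mul_le_mul_of_nonneg_right (by linarith) hβs0), hbd, fun ζ => ?_, hproj⟩
  refine (wnorm_le_of_cut hΨ ha (hcut β hβ r ζ)).trans ?_
  rw [mul_comm]
  exact mul_le_mul_of_nonneg_right (hbd ζ) ha.le

lemma atomNorm_le_of_weakGradient {c r : X d} {b η β : ℝ} (hb : 0 < b) (hη : 0 ≤ η)
    {f : L1 d J} (h1 : ‖f‖ ≤ b) (h2 : wnorm c f ≤ b * widthScale ε β)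
    {G : X d → (X d →L[ℝ] V J)}
    (hG : HasIntegrableWeakGradient
      (fun k => Complex.exp (Complex.I * ((inner ℝ r k : ℝ) : ℂ)) • f k) G)
    (hGb : ∫ k, ‖G k‖ ≤ b * gradScale ε β) :
    atomNorm (atoms c (widthScale ε β) (gradScale ε β)) η f ≤ b := by
  refine atomNorm_atoms_le hη hb h1 h2 r fun y => ?_
  refine (norm_translate_sub_le_of_weakGradient ?_ hG y).trans
    (mul_le_mul_of_nonneg_left hGb (norm_nonneg _))
  filter_upwards [mul_coe (isBddMeas_modul r) f] with k hk
  rw [hk, modul_apply, cis, mul_comm Complex.I]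

/-- The components of a wavepacket, with bounds that hold for small `β`, and with localization if
the wavepacket is particle-like. -/
lemma WaveSystem.Admissible.exists_components (hsys : sys.Admissible) (hΨ : IsCutoff Ψ) (hs : 0 < s)
    {h : ℝ → X d → L1 d J} {T : Set (NK d J)} (hw : sys.IsWavepacket Ψ ε s σ h)
    (hT : σ ∈ T → sys.IsParticleLike Ψ ε s σ h) :
    ∃ (hc : ℤˣ → ℝ → X d → L1 d J) (b : ℝ), 1 ≤ b ∧ ∀ b' ≥ b, ∀ᶠ β in 𝓝[>] (0 : ℝ), ∀ r,
      IsExact sys ε s b' σ β (h β r) (fun ζ => hc ζ β r) ∧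
      (σ ∈ T → ∀ ζ η, 0 ≤ η →
        atomNorm (atoms (sgn ζ • σ.2) (widthScale ε β) (gradScale ε β)) η (hc ζ β r) ≤ b') := by
  by_cases hσ : σ ∈ T
  · obtain ⟨hc, hw, β₀, hβ₀, C₁, hC₁⟩ := hT hσ
    obtain ⟨b, hb, h1⟩ := hsys.exists_isExact hΨ hs hw
    refine ⟨hc, b + |C₁|, by linarith [abs_nonneg C₁], fun b' hb' => ?_⟩
    have h0 := abs_nonneg C₁
    filter_upwards [h1 b' (by linarith), eventually_small hβ₀] with β hβ hβ1 r
    refine ⟨hβ r, fun _ ζ η hη => ?_⟩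
    obtain ⟨G, hG, hGb⟩ := hC₁ β hβ1 r ζ
    refine atomNorm_le_of_weakGradient (by linarith) hη ((hβ r).bound ζ) ((hβ r).width ζ) hG
      (hGb.trans ?_)
    exact mul_le_mul_of_nonneg_right (by linarith [le_abs_self C₁])
      (Real.rpow_nonneg hβ1.1.le _)
  · obtain ⟨hc, hw⟩ := hw
    obtain ⟨b, hb, h1⟩ := hsys.exists_isExact hΨ hs hw
    refine ⟨hc, b, hb, fun b' hb' => ?_⟩
    filter_upwards [h1 b' hb'] with β hβ r
    exact ⟨hβ r, fun h => absurd h hσ⟩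

end Packet

/-! ### Solutions -/

section Solution

variable {sys : WaveSystem d J}

lemma WaveSystem.IsGlobalSol.mono {ϱ T B B' C : ℝ} {h : L1 d J} {u : ℝ → L1 d J}
    (hu : sys.IsGlobalSol ϱ T B C h u) (hB : B ≤ B') : sys.IsGlobalSol ϱ T B' C h u :=
  ⟨hu.continuous, fun τ => (hu.bound τ).trans hB, hu.eq, hu.lip⟩

/-- `C` and `τs` are a bound for the nonlinearity on the ball of the radius `4R` and a time on
which the equation is solvable for data of norm at most `2R`. -/
structure IsTime (sys : WaveSystem d J) (R C τs : ℝ) : Prop where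
  R_pos : 0 < R
  C_nonneg : 0 ≤ C
  time_pos : 0 < τs
  mul_le : C * τs ≤ R
  bound : ∀ t, ∀ u : L1 d J, ‖u‖ ≤ 2 * (2 * R) → ‖sys.rhs t u‖ ≤ C
  lip : ∀ t, ∀ u v : L1 d J, ‖u‖ ≤ 2 * (2 * R) → ‖v‖ ≤ 2 * (2 * R) →
    ‖sys.rhs t u - sys.rhs t v‖ ≤ C * ‖u - v‖

lemma WaveSystem.Admissible.exists_isTime (hsys : sys.Admissible) {R : ℝ} (hR : 0 < R) :
    ∃ C τs, IsTime sys R C τs := by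
  obtain ⟨C, hC, h1, h2⟩ := hsys.exists_rhs_bound (2 * (2 * R)) (by positivity)
  refine ⟨C, R / (C + 1), hR, hC, by positivity, ?_, h1, h2⟩
  rw [mul_div_assoc', div_le_iff₀ (by positivity)]
  nlinarith

namespace IsTime

variable {R C τs ϱ : ℝ} (ht : IsTime sys R C τs)

include ht

lemma exists_isSolution (hsys : sys.Admissible) {h : L1 d J} (hh : ‖h‖ ≤ R) :
    ∃ u, sys.IsSolution ϱ τs R h u := by
  have hR := ht.R_pos
  exact hsys.exists_isSolution hR ht.time_pos ht.C_nonneg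
    (fun t u hu => ht.bound t u (by linarith))
    (fun t u v hu hv => ht.lip t u v (by linarith) (by linarith)) ht.mul_le h hh

lemma exists_isGlobalSol (hsys : sys.Admissible) {h : L1 d J} {u : ℝ → L1 d J}
    (hu : sys.IsSolution ϱ τs R h u) :
    ∃ v, sys.IsGlobalSol ϱ τs (2 * R) C h v ∧ Set.EqOn u v (Set.Icc 0 τs) := by
  have hR := ht.R_pos
  exact hsys.exists_isGlobalSol ht.time_pos.le (fun t u hu => ht.bound t u (by linarith)) hu

lemma exists_isGlobalSol_of_norm_le (hsys : sys.Admissible) (ϱ : ℝ) {h : L1 d J}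
    (hh : ‖h‖ ≤ 2 * R) : ∃ v, sys.IsGlobalSol ϱ τs (2 * (2 * R)) C h v := by
  have hR := ht.R_pos
  obtain ⟨u, hu⟩ := hsys.exists_isSolution (ϱ := ϱ) (R := 2 * R) (by positivity) ht.time_pos
    ht.C_nonneg ht.bound ht.lip (by linarith [ht.mul_le]) h hh
  obtain ⟨v, hv, -⟩ := hsys.exists_isGlobalSol ht.time_pos.le ht.bound hu
  exact ⟨v, hv⟩

lemma eqOn (hsys : sys.Admissible) {h : L1 d J} {u u' : ℝ → L1 d J}
    (hu : sys.IsSolution ϱ τs R h u) (hu' : sys.IsSolution ϱ τs R h u') :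
    Set.EqOn u u' (Set.Icc 0 τs) := by
  have hR := ht.R_pos
  obtain ⟨v, hv, e⟩ := ht.exists_isGlobalSol hsys hu
  obtain ⟨v', hv', e'⟩ := ht.exists_isGlobalSol hsys hu'
  intro τ hτ
  have h1 := hsys.stability ht.C_nonneg ht.lip hv hv' (by linarith) (by linarith) hτ
  rw [sub_self, norm_zero, zero_mul] at h1
  rw [e hτ, e' hτ]
  exact sub_eq_zero.1 (norm_le_zero_iff.1 h1)

lemma isSolution_solution (hsys : sys.Admissible) {h : L1 d J} (hh : ‖h‖ ≤ R) :
    sys.IsSolution ϱ τs R h (sys.solution ϱ τs R h) := by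
  have hex : ∃ u, sys.IsSolution ϱ τs R h u := ht.exists_isSolution hsys hh
  rw [solution, dif_pos hex]
  exact hex.choose_spec

/-- Solutions depend continuously on the data. -/
lemma norm_solution_sub_le (hsys : sys.Admissible) {h h' : L1 d J} (hh : ‖h‖ ≤ R)
    {v : ℝ → L1 d J} (hv : sys.IsGlobalSol ϱ τs (2 * (2 * R)) C h' v) {τ : ℝ}
    (hτ : τ ∈ Set.Icc 0 τs) :
    ‖sys.solution ϱ τs R h τ - v τ‖ ≤ ‖h - h'‖ * Real.exp (C * τs) := by
  have hR := ht.R_pos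
  obtain ⟨w, hw, e⟩ := ht.exists_isGlobalSol hsys (ht.isSolution_solution hsys hh)
  rw [e hτ]
  refine (hsys.stability ht.C_nonneg ht.lip hw hv (by linarith) le_rfl hτ).trans ?_
  exact mul_le_mul_of_nonneg_left
    (Real.exp_le_exp.2 (mul_le_mul_of_nonneg_left hτ.2 ht.C_nonneg)) (norm_nonneg _)

end IsTime

end Solution

end Wavepacket

namespace Wavepacket

variable {d J m : ℕ}

open WaveSystem

lemma Scale.ϱ_le_width {C₀ ε β ϱ : ℝ} (S : Scale C₀ ε β ϱ) (h : errScale ε β ϱ ≤ 1) :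
    ϱ ≤ 2 * widthScale ε β := by
  have h1 : ϱ * gradScale ε β ≤ 2 := by
    refine S.grad_le_err.trans ?_
    have h2 : (Real.log 2)⁻¹ ≤ 2 := by
      rw [inv_le_comm₀ Scale.log_two_pos two_pos]
      linarith [Real.log_two_gt_d9]
    exact (mul_le_mul h2 h S.err_pos.le two_pos.le).trans (by norm_num)
  have h3 := mul_le_mul_of_nonneg_left S.one_le_width_mul_grad S.ϱ_pos.le
  calc ϱ ≤ ϱ * gradScale ε β * widthScale ε β := by linarith
    _ ≤ _ := mul_le_mul_of_nonneg_right h1 S.width_pos.le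

lemma eventually_rpow_le {s c : ℝ} (hs : 0 < s) (hc : 0 < c) (a : ℝ) :
    ∀ᶠ β in 𝓝[>] (0 : ℝ), a * β ^ s ≤ c := by
  have h : Filter.Tendsto (fun β : ℝ => a * β ^ s) (𝓝[>] 0) (𝓝 (a * 0 ^ s)) :=
    ((Real.continuousAt_rpow_const 0 s (Or.inr hs.le)).tendsto.mono_left
      nhdsWithin_le_nhds).const_mul a
  rw [Real.zero_rpow hs.ne', mul_zero] at h
  filter_upwards [h.eventually (gt_mem_nhds hc)] with β hβ
  exact hβ.le

namespace Frame

variable {A : Frame d J} {K : ℕ} {S : Fin K → Finset (NK d J)} {T : Set (NK d J)}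

lemma sum_blk_eq {E : Type*} [AddCommMonoid E] {B : Finset (NK d J)} (hB : B ⊆ A.S)
    (f : ℤˣ → NK d J → E) :
    ∑ i ∈ blk A B, f i.1.1 i.1.2 = ∑ σ ∈ B, (f (-1) σ + f 1 σ) := by
  have h1 : ∑ i ∈ blk A B, f i.1.1 i.1.2 =
      ∑ x ∈ (Finset.univ : Finset ℤˣ) ×ˢ B, f x.1 x.2 := by
    refine Finset.sum_nbij (fun i => i.1) (fun i hi => ?_) (fun i _ i' _ h => Subtype.ext h)
      (fun x hx => ?_) fun _ _ => rfl
    · exact Finset.mem_product.2 ⟨Finset.mem_univ _, mem_blk.1 hi⟩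
    · have hx2 := (Finset.mem_product.1 hx).2
      exact ⟨⟨x, mem_idx.2 (hB hx2)⟩, mem_blk.2 hx2, rfl⟩
  rw [h1, Finset.sum_product_right]
  refine Finset.sum_congr rfl fun σ _ => ?_
  rw [UnitsInt.univ, Finset.sum_pair (by decide), add_comm]

namespace IsSplit

variable (hS : A.IsSplit S T)

include hS

lemma card_le (p : Fin K) : (S p).card ≤ A.S.card := Finset.card_le_card (hS.subset p)

set_option maxHeartbeats 1000000 in
/-- The superposition principle for small `β`, and for a small error. -/
lemma exists_superposition_of_small {R C τs : ℝ} (ht : IsTime A.sys R C τs) {ε s : ℝ}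
    (hs : 0 < s) {Ψ : X d → ℝ} (hΨ : IsCutoff Ψ) {h : NK d J → ℝ → X d → L1 d J}
    (hw : ∀ σ ∈ total S, A.sys.IsWavepacket Ψ ε s σ (h σ))
    (hT : ∀ σ ∈ T, A.sys.IsParticleLike Ψ ε s σ (h σ)) {C₀ : ℝ} (hC₀ : 0 ≤ C₀) :
    ∃ D : ℝ, 0 ≤ D ∧ ∀ᶠ β in 𝓝[>] (0 : ℝ), ∀ ϱ, Scale C₀ ε β ϱ → errScale ε β ϱ ≤ 1 →
      ∀ r : NK d J → X d, ‖∑ p, blockData h (S p) β r‖ ≤ R →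
      (∀ p, ‖blockData h (S p) β r‖ ≤ R) → ∀ τ ∈ Set.Icc 0 τs,
      ‖A.sys.solution ϱ τs R (∑ p, blockData h (S p) β r) τ -
        ∑ p, A.sys.solution ϱ τs R (blockData h (S p) β r) τ‖ ≤
        D * (errScale ε β ϱ + β ^ s) := by
  have hc' : ∀ σ : NK d J, ∃ (hc : ℤˣ → ℝ → X d → L1 d J) (b : ℝ), 1 ≤ b ∧ (σ ∈ A.S →
      ∀ b' ≥ b, ∀ᶠ β in 𝓝[>] (0 : ℝ), ∀ r,
      IsExact A.sys ε s b' σ β (h σ β r) (fun ζ => hc ζ β r) ∧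
      (σ ∈ T → ∀ ζ η, 0 ≤ η →
        atomNorm (atoms (sgn ζ • σ.2) (widthScale ε β) (gradScale ε β)) η (hc ζ β r) ≤ b')) := by
    intro σ
    by_cases hσ : σ ∈ A.S
    · have hσ' : σ ∈ total S := by rw [← hS.total_eq]; exact hσ
      obtain ⟨hc, b, h1, h2⟩ := A.adm.exists_components hΨ hs (hw σ hσ') (hT σ)
      exact ⟨hc, b, h1, fun _ => h2⟩
    · exact ⟨0, 1, le_rfl, fun h => absurd h hσ⟩
  choose hc b hb1 hP using hc'
  have hR := ht.R_pos
  have hbs : 0 ≤ ∑ σ ∈ A.S, b σ := Finset.sum_nonneg fun σ _ => zero_le_one.trans (hb1 σ)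
  set b' := ∑ σ ∈ A.S, b σ + 2 * (2 * R) + 2 with hb'
  have hb'1 : 1 ≤ b' := by linarith
  have hbb : ∀ σ ∈ A.S, b σ ≤ b' := fun σ hσ => by
    have := Finset.single_le_sum (f := b) (fun σ _ => zero_le_one.trans (hb1 σ)) hσ
    linarith
  obtain ⟨D, hD, hsup⟩ := hS.exists_superposition hb'1 ht.C_nonneg ht.time_pos.le hC₀
  set M : ℝ := (K + 1) * (A.S.card * b') with hM
  have hM0 : 0 ≤ M := by positivity
  set E := Real.exp (C * τs) with hE
  have hE0 : 0 ≤ E := (Real.exp_pos _).le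
  refine ⟨D + (K + 1) * M * E, by positivity, ?_⟩
  have hev : ∀ᶠ β in 𝓝[>] (0 : ℝ), ∀ σ ∈ A.S, ∀ r,
      IsExact A.sys ε s b' σ β (h σ β r) (fun ζ => hc σ ζ β r) ∧
      (σ ∈ T → ∀ ζ η, 0 ≤ η →
        atomNorm (atoms (sgn ζ • σ.2) (widthScale ε β) (gradScale ε β)) η (hc σ ζ β r) ≤ b') :=
    (Filter.eventually_all_finset A.S).2 fun σ hσ => hP σ hσ b' (hbb σ hσ)
  filter_upwards [hev, eventually_rpow_le hs hR M] with β hβ hβM ϱ hSc hη1 r hn1 hn2 τ hτ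
  have hη := hSc.err_pos.le
  have hβs : 0 ≤ β ^ s := Real.rpow_nonneg hSc.β_pos.le _
  set g : A.I → L1 d J := fun i => hc i.1.2 i.1.1 β (r i.1.2) with hg
  have hmem : ∀ i : A.I, i.1.2 ∈ A.S := fun i => mem_idx.1 i.2
  have hblk : ∀ p, ‖blockData h (S p) β r - ∑ i ∈ blk A (S p), g i‖ ≤
      A.S.card * b' * β ^ s := by
    intro p
    rw [sum_blk_eq (hS.subset p) fun ζ σ => hc σ ζ β (r σ), blockData,
      ← Finset.sum_sub_distrib]
    refine (norm_sum_le _ _).trans ((Finset.sum_le_sum fun σ hσ =>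
      (hβ σ (hS.subset p hσ) (r σ)).1.norm_sub).trans ?_)
    rw [Finset.sum_const, nsmul_eq_mul, mul_assoc]
    exact mul_le_mul_of_nonneg_right (by exact_mod_cast hS.card_le p) (by positivity)
  have hAβ : 0 ≤ A.S.card * b' * β ^ s := by positivity
  have hblkM : ∀ p, ‖blockData h (S p) β r - ∑ i ∈ blk A (S p), g i‖ ≤ M * β ^ s := by
    intro p
    refine (hblk p).trans ?_
    have : 0 ≤ K * (A.S.card * b' * β ^ s) := by positivity
    rw [hM]
    linarith
  have htot : ‖∑ p, blockData h (S p) β r - ∑ i, g i‖ ≤ M * β ^ s := by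
    rw [← hS.sum_blk, ← Finset.sum_sub_distrib]
    refine (norm_sum_le _ _).trans ((Finset.sum_le_sum fun p _ => hblk p).trans ?_)
    rw [Finset.sum_const, nsmul_eq_mul, Finset.card_univ, Fintype.card_fin, hM]
    linarith
  have hsol : ∀ {f f' : L1 d J}, ‖f‖ ≤ R → ‖f - f'‖ ≤ M * β ^ s →
      ∃ v, A.sys.IsGlobalSol ϱ τs (2 * (2 * R)) C f' v := by
    intro f f' hf hff
    refine ht.exists_isGlobalSol_of_norm_le A.adm ϱ ?_
    have h3 := norm_sub_norm_le f' f
    rw [norm_sub_rev] at h3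
    linarith
  obtain ⟨U, hU⟩ := hsol hn1 htot
  choose u hu using fun p => hsol (hn2 p) (hblkM p)
  have hle : 2 * (2 * R) ≤ b' := by linarith
  have hfam : A.IsFamily S T b' C τs ε β ϱ g u := by
    refine ⟨(hSc.ϱ_le_width hη1).trans (mul_le_mul_of_nonneg_right (by linarith)
      hSc.width_pos.le), ⟨fun i _ => ?_, fun i _ => ?_, fun i _ => ?_⟩, fun i hi => ?_,
      fun p => (hu p).mono hle⟩
    · exact (hβ _ (hmem i) _).1.bound _
    · exact (hβ _ (hmem i) _).1.width _
    · exact (hβ _ (hmem i) _).1.proj _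
    · exact (hβ _ (hmem i) _).2 hi _ _ hη
  have k1 := hsup ε β ϱ g U u hSc hfam (hU.mono hle) τ hτ
  have k2 : ‖A.sys.solution ϱ τs R (∑ p, blockData h (S p) β r) τ - U τ‖ ≤ M * β ^ s * E :=
    (ht.norm_solution_sub_le A.adm hn1 hU hτ).trans (mul_le_mul_of_nonneg_right htot hE0)
  have k3 : ‖∑ p, u p τ - ∑ p, A.sys.solution ϱ τs R (blockData h (S p) β r) τ‖ ≤
      K * (M * β ^ s * E) := by
    rw [← Finset.sum_sub_distrib]
    refine (norm_sum_le _ _).trans ((Finset.sum_le_sum (g := fun _ => M * β ^ s * E)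
      fun p _ => ?_).trans (le_of_eq ?_))
    · rw [norm_sub_rev]
      exact (ht.norm_solution_sub_le A.adm (hn2 p) (hu p) hτ).trans
        (mul_le_mul_of_nonneg_right (hblkM p) hE0)
    · rw [Finset.sum_const, nsmul_eq_mul, Finset.card_univ, Fintype.card_fin]
  have e : A.sys.solution ϱ τs R (∑ p, blockData h (S p) β r) τ -
      ∑ p, A.sys.solution ϱ τs R (blockData h (S p) β r) τ =
      (A.sys.solution ϱ τs R (∑ p, blockData h (S p) β r) τ - U τ) + (U τ - ∑ p, u p τ) +
      (∑ p, u p τ - ∑ p, A.sys.solution ϱ τs R (blockData h (S p) β r) τ) := by abel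
  rw [e]
  refine (norm_add₃_le.trans (add_le_add (add_le_add k2 k1) k3)).trans ?_
  have h4 : 0 ≤ D * β ^ s + (K + 1) * M * E * errScale ε β ϱ := by positivity
  linarith

/-- The superposition principle. -/
lemma exists_solution_bound {R C τs : ℝ} (ht : IsTime A.sys R C τs) {ε s : ℝ}
    (hs : 0 < s) {Ψ : X d → ℝ} (hΨ : IsCutoff Ψ) {h : NK d J → ℝ → X d → L1 d J}
    (hw : ∀ σ ∈ total S, A.sys.IsWavepacket Ψ ε s σ (h σ))
    (hT : ∀ σ ∈ T, A.sys.IsParticleLike Ψ ε s σ (h σ)) {C₀ : ℝ} (hC₀ : 0 ≤ C₀) :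
    ∃ D : ℝ, 0 ≤ D ∧ ∀ β ϱ, Scale C₀ ε β ϱ →
      ∀ r : NK d J → X d, ‖∑ p, blockData h (S p) β r‖ ≤ R →
      (∀ p, ‖blockData h (S p) β r‖ ≤ R) → ∀ τ ∈ Set.Icc 0 τs,
      ‖A.sys.solution ϱ τs R (∑ p, blockData h (S p) β r) τ -
        ∑ p, A.sys.solution ϱ τs R (blockData h (S p) β r) τ‖ ≤
        D * (errScale ε β ϱ + β ^ s) := by
  obtain ⟨D, hD, hev⟩ := hS.exists_superposition_of_small ht hs hΨ hw hT hC₀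
  obtain ⟨β₁, hβ₁, hsub⟩ := mem_nhdsGT_iff_exists_Ioo_subset.1 hev
  have hβ₁' : 0 < β₁ := hβ₁
  have hR := ht.R_pos
  set N : ℝ := (K + 1) * (2 * R) with hN
  have hN0 : 0 ≤ N := by positivity
  have hβs1 : 0 < β₁ ^ s := Real.rpow_pos_of_pos hβ₁' s
  refine ⟨D + N + N / β₁ ^ s, by positivity, fun β ϱ hSc r hn1 hn2 τ hτ => ?_⟩
  have hη := hSc.err_pos.le
  have hβs : 0 ≤ β ^ s := Real.rpow_nonneg hSc.β_pos.le _
  have htriv : ‖A.sys.solution ϱ τs R (∑ p, blockData h (S p) β r) τ -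
        ∑ p, A.sys.solution ϱ τs R (blockData h (S p) β r) τ‖ ≤ N := by
    have k1 := (ht.isSolution_solution (ϱ := ϱ) A.adm hn1).2.1 τ hτ
    have k2 : ‖∑ p, A.sys.solution ϱ τs R (blockData h (S p) β r) τ‖ ≤ K * (2 * R) := by
      refine (norm_sum_le _ _).trans ((Finset.sum_le_sum fun p _ =>
        (ht.isSolution_solution (ϱ := ϱ) A.adm (hn2 p)).2.1 τ hτ).trans (le_of_eq ?_))
      rw [Finset.sum_const, nsmul_eq_mul, Finset.card_univ, Fintype.card_fin]
    refine (norm_sub_le _ _).trans ((add_le_add k1 k2).trans (le_of_eq ?_))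
    rw [hN]
    ring
  have h0 : 0 ≤ N / β₁ ^ s := by positivity
  have hsum : 0 ≤ errScale ε β ϱ + β ^ s := add_nonneg hη hβs
  rcases lt_or_ge β β₁ with hβ | hβ
  · rcases le_or_gt (errScale ε β ϱ) 1 with h1 | h1
    · refine (hsub ⟨hSc.β_pos, hβ⟩ ϱ hSc h1 r hn1 hn2 τ hτ).trans ?_
      exact mul_le_mul_of_nonneg_right (by linarith) hsum
    · refine htriv.trans ?_
      calc N = N * 1 := (mul_one N).symm
        _ ≤ (D + N + N / β₁ ^ s) * (errScale ε β ϱ + β ^ s) :=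
          mul_le_mul (by linarith) (by linarith) zero_le_one (by positivity)
  · refine htriv.trans ?_
    have h2 : β₁ ^ s ≤ β ^ s := Real.rpow_le_rpow hβ₁'.le hβ hs.le
    calc N = N / β₁ ^ s * β₁ ^ s := (div_mul_cancel₀ N hβs1.ne').symm
      _ ≤ (D + N + N / β₁ ^ s) * (errScale ε β ϱ + β ^ s) :=
        mul_le_mul (by linarith) (by linarith) hβs1.le (by positivity)

end IsSplit

end Frame

lemma errScale_eq (ε ϱ : ℝ) {β : ℝ} (hβ : 0 < β) :
    errScale ε β ϱ = ϱ / β ^ (1 + ε) * |Real.log β| := by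
  rw [errScale, gradScale, show -1 - ε = -(1 + ε) by ring, Real.rpow_neg hβ.le, div_eq_mul_inv]

end Wavepacket

end

open Wavepacket Wavepacket.WaveSystem in
theorem mainTheorem5 {d J : ℕ} (sys : WaveSystem d J) (hsys : sys.Admissible)
    (R : ℝ) (hR : 0 < R) :
    ∃ τs > (0 : ℝ),
      -- the solution operator is well defined for data of norm at most `R`
      (∀ ϱ > (0 : ℝ), ∀ h : L1 d J, ‖h‖ ≤ R →
        (∃ u, sys.IsSolution ϱ τs R h u) ∧
        ∀ u u', sys.IsSolution ϱ τs R h u → sys.IsSolution ϱ τs R h u' →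
          Set.EqOn u u' (Set.Icc 0 τs)) ∧
      -- the approximate superposition principle
      ∀ (ε s : ℝ), 0 < ε → ε < 1 → 0 < s → ∀ Ψ : X d → ℝ, IsCutoff Ψ →
      ∀ (K : ℕ) (S : Fin K → Finset (NK d J)) (T : Set (NK d J)),
        (∀ p q, p ≠ q → Disjoint (S p) (S q)) →
        sys.AvoidsBandCrossing (total S) →
        sys.IsResonanceInvariant (total S) →
        T ⊆ total S →
        sys.IsLocalizationClosed (total S) T →
        sys.IsPartiallyGVM S T →
      ∀ h : NK d J → ℝ → X d → L1 d J,
        (∀ σ ∈ total S, sys.IsWavepacket Ψ ε s σ (h σ)) →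
        (∀ σ ∈ T, sys.IsParticleLike Ψ ε s σ (h σ)) →
      ∀ C₀ : ℝ, ∃ C : ℝ, ∀ β ϱ : ℝ, 0 < β → β ≤ 1 / 2 → 0 < ϱ → ϱ ≤ 1 / 2 → β ^ 2 / ϱ ≤ C₀ →
      ∀ r : NK d J → X d,
        ‖∑ p, blockData h (S p) β r‖ ≤ R →
        (∀ p, ‖blockData h (S p) β r‖ ≤ R) →
      ∀ τ ∈ Set.Icc 0 τs,
        ‖sys.solution ϱ τs R (∑ p, blockData h (S p) β r) τ
            - ∑ p, sys.solution ϱ τs R (blockData h (S p) β r) τ‖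
          ≤ C * (ϱ / β ^ (1 + ε) * |Real.log β| + β ^ s) ∧
        (1 - ε ≤ s →
          ‖sys.solution ϱ τs R (∑ p, blockData h (S p) β r) τ
              - ∑ p, sys.solution ϱ τs R (blockData h (S p) β r) τ‖
            ≤ C * (ϱ / β ^ (1 + ε) * |Real.log β|)) := by
  classical
  obtain ⟨C, τs, ht⟩ := hsys.exists_isTime hR
  refine ⟨τs, ht.time_pos, fun ϱ _ h hh => ⟨ht.exists_isSolution hsys hh,
    fun u u' hu hu' => ht.eqOn hsys hu hu'⟩, ?_⟩
  intro ε s hε _ hs Ψ hΨ K S T hdisj hav _ _ hloc hgvm h hw hT C₀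
  have htot : ((Finset.univ.biUnion S : Finset (NK d J)) : Set (NK d J)) = total S := by
    ext σ
    simp [total]
  obtain ⟨ρ, hρ⟩ := hsys.exists_isRadius (S := Finset.univ.biUnion S) (by rw [htot]; exact hav)
  have hS : (⟨sys, hsys, Finset.univ.biUnion S, ρ, hρ⟩ : Frame d J).IsSplit S T :=
    ⟨htot, hdisj, hloc, hgvm⟩
  obtain ⟨D, hD, hb⟩ := hS.exists_solution_bound ht hs hΨ hw hT (abs_nonneg C₀)
  set L := |C₀| * (Real.log 2)⁻¹ with hL
  have hL0 : 0 ≤ L := mul_nonneg (abs_nonneg _) (inv_nonneg.2 Scale.log_two_pos.le)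
  refine ⟨D * (1 + L), fun β ϱ hβ hβ2 hϱ _ hβϱ r hn1 hn2 τ hτ => ?_⟩
  have hSc : Scale |C₀| ε β ϱ := by
    refine ⟨hε, hβ, hβ2, hϱ, ?_⟩
    rw [div_le_iff₀ hϱ] at hβϱ
    exact hβϱ.trans (mul_le_mul_of_nonneg_right (le_abs_self C₀) hϱ.le)
  have hη := hSc.err_pos.le
  have hβs : 0 ≤ β ^ s := Real.rpow_nonneg hβ.le s
  have hb' := hb β ϱ hSc r hn1 hn2 τ hτ
  rw [← errScale_eq ε ϱ hβ]
  refine ⟨hb'.trans (mul_le_mul_of_nonneg_right ?_ (add_nonneg hη hβs)), fun hεs => hb'.trans ?_⟩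
  · nlinarith [mul_nonneg hD hL0]
  · have h1 : β ^ s ≤ widthScale ε β :=
      Real.rpow_le_rpow_of_exponent_ge hβ (by linarith) hεs
    have h2 := h1.trans hSc.width_le_err
    rw [mul_assoc]
    refine mul_le_mul_of_nonneg_left ?_ hD
    linarith
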